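/- **Setting.** For a spherically symmetric, compactly supported potential $w:\mathbb R^3\to\mathbb R$, define the scattering length $$SL[w]=\inf_\phi\Big\{\frac1{4\pi}\int_{\mathbb R^3}|\nabla\phi|^2+\tfrac12 w|\phi|^2\,dx\;:\;\lim_{|x|\to\infty}\phi(x)=1\Big\}\in[-\infty,\infty],$$ the infimum being over weakly differentiable complex-valued $\phi$ of finite energy. For a pair potential $v$ and $a>0$ put $v^a(x)=a^{-2}v(x/a)$. Let $E(N,\Lambda)$ be the ground state energy (the infimum of the quadratic form over normalized symmetric wave functions) of $$H_N=\sum_{i=1}^N-\Delta_i+\sum_{1\le i<j\le N}v^a(x_i-x_j)$$ for $N$ bosons in a cubic box of volume $\Lambda=L^3$ with periodic boundary conditions, where $x_i-x_j$ is understood on the torus. **Theorem.** There are functions $c_1,c_2:(0,\infty)\to(1,\infty)$ such that the following holds. Let $v=v_++v_-$, where $v_\pm:\mathbb R^3\to\mathbb R$ are measurable and spherically symmetric, $v_+\ge 0$ ($v_-$ need not be negative), and $v_-$ has compact support, and assume the normalization $SL[v]=1$ (so that $SL[v^a]=a$). Then there are a constant $C$ depending only on $v_+,v_-$ and, for each $t>0$,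 a constant $\delta(t)>0$ depending only on $v_+,v_-$ and $t$, such that: whenever $R_0,r_1,\lambda_+,\lambda_-,t>0$ satisfy - $v(x)=0$ for $|x|>R_0$, $\;v_-\ge-\lambda_-$ everywhere, $\;v_+(x)\ge\lambda_+$ for $|x|\le r_1$, - $SL\big[c_1(R_0/r_1)\,(v+t\,v_-)\big]\ge 0$ and $\lambda_+\ge(1+t^{-1})\,c_2(R_0/r_1)\,\lambda_-$, then for all $a,\rho>0$ with $\frac{4\pi}3a^3\rho<\delta(t)$, in the thermodynamic limit $N\to\infty$, $N/\Lambda\to\rho$ (along every choice of box volumes $\Lambda=\Lambda_N$ with this property), $$\liminf_{N\to\infty}\frac{E(N,\Lambda)}{4\pi a\rho N}\ \ge\ 1-C\,(a^3\rho)^{1/17}.$$ -/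

import Mathlib

open MeasureTheory Filter Topology
open scoped ContDiff

/-- Euclidean three-space. -/
abbrev R3 : Type := EuclideanSpace ℝ (Fin 3)

/-- The configuration space `(ℝ³)^N` of `N` particles, with Lebesgue measure. -/
abbrev Config (N : ℕ) : Type := Fin N → R3

/-- `w` is spherically symmetric. -/
def IsRadial (w : R3 → ℝ) : Prop :=
  ∀ x y : R3, ‖x‖ = ‖y‖ → w x = w y

/-- `g` is the weak (distributional) derivative of `f` in the direction `e`: both are locally
integrable and `∫ (∂ₑ η) f = - ∫ η g` for every smooth compactly supported `η`. -/
structure HasWeakDirDeriv {X : Type*} [NormedAddCommGroup X] [NormedSpace ℝ X]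
    [MeasureSpace X] (f g : X → ℂ) (e : X) : Prop where
  locallyIntegrable : LocallyIntegrable f volume
  locallyIntegrable_deriv : LocallyIntegrable g volume
  integral_eq : ∀ η : X → ℝ, ContDiff ℝ ∞ η → HasCompactSupport η →
    ∫ x, (fderiv ℝ η x e) • f x = - ∫ x, η x • g x

/-- The `k`-th unit vector of `ℝ³`. -/
noncomputable def unitVec (k : Fin 3) : R3 := EuclideanSpace.single k 1

/-- The unit vector of `(ℝ³)^N` that moves particle `i` in the coordinate direction `k`. -/
noncomputable def particleUnitVec {N : ℕ} (i : Fin N) (k : Fin 3) : Config N :=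
  Pi.single i (unitVec k)

/-! ### Scattering length -/

/-- `φ`, with weak gradient `G`, is a trial function for the scattering length of `w`: its energy
is finite and `φ(x) → 1` as `|x| → ∞`. -/
structure IsScatteringTrial (w : R3 → ℝ) (φ : R3 → ℂ) (G : Fin 3 → R3 → ℂ) : Prop where
  weakGradient : ∀ k, HasWeakDirDeriv φ (G k) (unitVec k)
  integrable_gradient : ∀ k, Integrable (fun x => ‖G k x‖ ^ 2) volume
  integrable_potential : Integrable (fun x => w x * ‖φ x‖ ^ 2) volume
  tendsto_one : Tendsto φ (cocompact R3) (𝓝 1)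

/-- The energy `∫ |∇φ|² + ½ w |φ|²`, with `G` the gradient of `φ`. -/
noncomputable def scatteringEnergy (w : R3 → ℝ) (φ : R3 → ℂ) (G : Fin 3 → R3 → ℂ) : ℝ :=
  ∫ x, ((∑ k, ‖G k x‖ ^ 2) + 1 / 2 * w x * ‖φ x‖ ^ 2)

/-- The scattering length of `w`: the minimal energy, divided by `4π`, of functions
that tend to `1` at infinity (possibly `-∞`). -/
noncomputable def scatteringLength (w : R3 → ℝ) : EReal :=
  ⨅ (φ : R3 → ℂ) (G : Fin 3 → R3 → ℂ) (_ : IsScatteringTrial w φ G),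
    ((1 / (4 * Real.pi) * scatteringEnergy w φ G : ℝ) : EReal)

/-! ### The Bose gas on the torus of side length `L` -/

/-- The scaled potential `vᵃ(x) = a⁻² v(x / a)`. -/
noncomputable def scaledPotential (a : ℝ) (v : R3 → ℝ) : R3 → ℝ :=
  fun x => (a ^ 2)⁻¹ * v (a⁻¹ • x)

/-- The representative of `x - y` modulo `L ℤ³` all of whose coordinates have absolute value at
most `L / 2` (for `L > 0`); its norm is the distance of `x` and `y` on the torus. -/
noncomputable def torusDiff (L : ℝ) (x y : R3) : R3 :=
  WithLp.toLp 2 (fun k => (x k - y k) - L * (round ((x k - y k) / L) : ℝ))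

/-- The box `([0, L)³)^N`. -/
def torusBox (N : ℕ) (L : ℝ) : Set (Config N) :=
  {x | ∀ i k, x i k ∈ Set.Ico 0 L}

/-- The total interaction `∑_{i<j} w(xᵢ - xⱼ)` on the torus. -/
noncomputable def totalInteraction (w : R3 → ℝ) (N : ℕ) (L : ℝ) (x : Config N) : ℝ :=
  ∑ i, ∑ j ∈ Finset.Ioi i, w (torusDiff L (x i) (x j))

/-- `ψ`, with weak gradient `G`, is a normalized bosonic wave function in the form domain
of `H_N = ∑ᵢ -Δᵢ + ∑_{i<j} w(xᵢ - xⱼ)` with periodic boundary conditions: it is (the periodic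
extension of) a symmetric function in the periodic Sobolev space `H¹`, with finite
potential energy. -/
structure IsBoseTrial (w : R3 → ℝ) (N : ℕ) (L : ℝ) (ψ : Config N → ℂ)
    (G : Fin N → Fin 3 → Config N → ℂ) : Prop where
  periodic : ∀ (i : Fin N) (k : Fin 3) (x : Config N),
    ψ (x + L • particleUnitVec i k) = ψ x
  symmetric : ∀ (σ : Equiv.Perm (Fin N)) (x : Config N), ψ (fun i => x (σ i)) = ψ x
  weakGradient : ∀ i k, HasWeakDirDeriv ψ (G i k) (particleUnitVec i k)
  integrable_sq : IntegrableOn (fun x => ‖ψ x‖ ^ 2) (torusBox N L) volume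
  integrable_gradient : ∀ i k, IntegrableOn (fun x => ‖G i k x‖ ^ 2) (torusBox N L) volume
  integrable_potential :
    IntegrableOn (fun x => totalInteraction w N L x * ‖ψ x‖ ^ 2) (torusBox N L) volume
  normalized : ∫ x in torusBox N L, ‖ψ x‖ ^ 2 = 1

/-- The energy `⟨ψ, H_N ψ⟩`, with `G` the gradient of `ψ`. -/
noncomputable def boseEnergy (w : R3 → ℝ) (N : ℕ) (L : ℝ) (ψ : Config N → ℂ)
    (G : Fin N → Fin 3 → Config N → ℂ) : ℝ :=
  ∫ x in torusBox N L,
    ((∑ i, ∑ k, ‖G i k x‖ ^ 2) + totalInteraction w N L x * ‖ψ x‖ ^ 2)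

/-- The ground state energy of `N` bosons with pair interaction `w` on the torus of side
length `L`. -/
noncomputable def groundStateEnergy (w : R3 → ℝ) (N : ℕ) (L : ℝ) : EReal :=
  ⨅ (ψ : Config N → ℂ) (G : Fin N → Fin 3 → Config N → ℂ) (_ : IsBoseTrial w N L ψ G),
    ((boseEnergy w N L ψ G : ℝ) : EReal)

/-!
# A lower bound for the ground state energy of a dilute Bose gas

The interaction `v = vp + vm` need not be positive, so that Dyson's method has to be combined with a
mechanism that prevents the particles from forming clusters.

*One pair.* Radial trial functions turn a lower bound on the scattering length of `w` into the
one-dimensional inequality `∫ |f'|² r² + ½ ∫ w |f|² r² ≥ SL[w] |f(s)|²` for every `s` beyond the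
range (`IsCoreRadial.energy`). It is used for `v`, where `SL = 1`, and for `c (v + t vm)`, where
`SL ≥ 0`. A convex combination of both, integrated over the shell `R₀ < |y| ≤ R`, bounds the soft
potential `shellPot`, which has integral `4π`, by the kinetic energy in the ball of radius `R` and by
the interaction, and it saves the fraction `(1 - θ) t / (1 + t)` of `vp` (`IsAdmissible.dyson`). For
`θ = 0` only the fraction `1 / c` of the kinetic energy in a ball slightly larger than `R₀` is
spent. Wave functions are only weakly differentiable, so the inequality is transferred to the
relative position of two particles by means of a fundamental theorem of calculus along dilations
(`weak_flow_ftc`, `IsTorusState.pair`).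

*Many pairs.* The torus is divided into boxes of side `ℓ`, and each particle is assigned to a group
of at most `m` particles of its box. The pair inequality for `i` moving around `j` is used with `θ`
close to `1` if `j` is far from the rest of the group and the box is not crowded, with `θ = 1 / 4` if
the box is crowded, and with `θ = 0` for other pairs unless many particles are close to `j`. These
conditions do not depend on the position of `i`. The balls of the first two kinds overlap at most
once, those of the third kind at most `n₀` times, and `c` is large compared with `n₀`; hence the
kinetic energy suffices, and a fraction `ε` of it remains (`Layout.kinetic_budget`). The pairs with
many neighbours, for which no inequality is used, contribute at least `-lamM / 2` each. By a count
over cells of side about `r₁ / 2` their number is bounded by that of the pairs at distance at most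
`r₁` for which a part of `vp ≥ lamP` has been saved (`Layout.potential_budget`).

*The soft energy.* In each box, the remaining kinetic energy together with the Poincaré inequality
allows the wave function to be replaced by one that is constant in the variables of a group
(`groupPot_bound`), which yields `4π n (n - 1) / ℓ³` for a group of `n` particles up to small errors.
A sum over groups and boxes, with `n² ≥ 2 k n - k²` for the mean number `k` of particles in a box,
gives the energy `4π k N / ℓ³` (`IsTorusState.energy_ge`). With `e = (a³ρ)^(1/17)`, in units of `a`,
the choice `R = e⁻⁵`, `ℓ ≈ e⁻⁶`, `k ≈ e⁻¹` makes all relative errors of order `e`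
(`errors_le`, `boseEnergy_ge`).
-/


/-! ### Polar coordinates -/

/-- The unit sphere of `ℝ³`. -/
abbrev UnitSphere : Type := Metric.sphere (0 : R3) 1

/-- The surface measure on the unit sphere. -/
noncomputable def sphereMeasure : Measure UnitSphere := (volume : Measure R3).toSphere

/-- The measure `r² dr` on `(0, ∞)`, as a measure on `ℝ`. -/
noncomputable def radialMeasure : Measure ℝ :=
  (volume.restrict (Set.Ioi 0)).withDensity (fun r => ENNReal.ofReal (r ^ 2))

instance : IsFiniteMeasure sphereMeasure := by unfold sphereMeasure; infer_instance

instance : SigmaFinite radialMeasure := by unfold radialMeasure; infer_instance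

/-- Polar coordinates `(o, r) ↦ r o`, with the measures `do` and `r² dr`. -/
lemma measurePreserving_polar :
    MeasurePreserving (fun p : UnitSphere × ℝ => p.2 • (p.1 : R3))
      (sphereMeasure.prod radialMeasure) volume := by
  have h0 := (volume : Measure R3).measurePreserving_homeomorphUnitSphereProd
  have hd : Module.finrank ℝ R3 - 1 = 2 := by simp
  rw [hd] at h0
  have h1 : MeasurePreserving (Subtype.val : Set.Ioi (0:ℝ) → ℝ) (Measure.volumeIoiPow 2)
      radialMeasure := by
    refine ⟨measurable_subtype_coe, ?_⟩
    ext s hs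
    rw [Measure.map_apply measurable_subtype_coe hs, Measure.volumeIoiPow,
      withDensity_apply _ (measurable_subtype_coe hs), radialMeasure, withDensity_apply _ hs,
      Measure.restrict_restrict hs]
    have := setLIntegral_subtype (μ := volume) (measurableSet_Ioi (a := (0:ℝ))) (Subtype.val ⁻¹' s)
      (fun r => ENNReal.ofReal (r ^ 2))
    rw [this]
    congr 2
    ext x; simp [and_comm]
  have h2 := (MeasurePreserving.id sphereMeasure).prod h1
  have h3 : MeasurePreserving (Subtype.val : ({0}ᶜ : Set R3) → R3)
      (Measure.comap Subtype.val volume) volume := by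
    refine ⟨measurable_subtype_coe, ?_⟩
    rw [map_comap_subtype_coe (measurableSet_singleton _).compl]
    exact Measure.restrict_eq_self_of_ae_mem (by simp [ae_iff])
  have h4 : MeasurePreserving (homeomorphUnitSphereProd R3).toMeasurableEquiv
      (Measure.comap Subtype.val volume) (sphereMeasure.prod (Measure.volumeIoiPow 2)) := h0
  refine ⟨by fun_prop, ?_⟩
  rw [← h2.map_eq, ← h4.map_eq, Measure.map_map h2.measurable h4.measurable,
    Measure.map_map (by fun_prop) (h2.measurable.comp h4.measurable)]
  refine Eq.trans ?_ h3.map_eq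
  congr 1
  ext1 x
  have := (homeomorphUnitSphereProd R3).symm_apply_apply x
  have hx : ‖(x : R3)‖ ≠ 0 := norm_ne_zero_iff.2 x.2
  simp [hx, smul_smul]

lemma integral_radialMeasure {E : Type*} [NormedAddCommGroup E] [NormedSpace ℝ E] (f : ℝ → E) :
    ∫ r, f r ∂radialMeasure = ∫ r in Set.Ioi 0, (r ^ 2) • f r := by
  rw [radialMeasure, integral_withDensity_eq_integral_toReal_smul (by fun_prop) (by simp)]
  congr 1; ext r; rw [ENNReal.toReal_ofReal (sq_nonneg r)]

lemma integrable_radialMeasure_iff {E : Type*} [NormedAddCommGroup E] [NormedSpace ℝ E]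
    (f : ℝ → E) :
    Integrable f radialMeasure ↔ IntegrableOn (fun r => (r ^ 2) • f r) (Set.Ioi 0) := by
  rw [radialMeasure, integrable_withDensity_iff_integrable_smul' (by fun_prop) (by simp)]
  unfold IntegrableOn
  congr! 3 with r
  rw [ENNReal.toReal_ofReal (sq_nonneg r)]

lemma ae_radialMeasure_iff {p : ℝ → Prop} :
    (∀ᵐ r ∂radialMeasure, p r) ↔ ∀ᵐ r, 0 < r → p r := by
  rw [radialMeasure, ae_withDensity_iff (by fun_prop), ae_restrict_iff' measurableSet_Ioi]
  refine eventually_congr (Eventually.of_forall fun r => ?_)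
  refine imp_congr_right fun hr => ?_
  have : (0:ℝ) < r := hr
  simp [this.ne']

lemma ae_polar {p : R3 → Prop} (h : ∀ᵐ x, p x) :
    ∀ᵐ o : UnitSphere ∂sphereMeasure, ∀ᵐ r ∂radialMeasure, p (r • (o : R3)) :=
  Measure.ae_ae_of_ae_prod (measurePreserving_polar.quasiMeasurePreserving.ae h)

lemma integrable_polar {E : Type*} [NormedAddCommGroup E] {f : R3 → E} (hf : Integrable f) :
    Integrable (fun p : UnitSphere × ℝ => f (p.2 • (p.1 : R3)))
      (sphereMeasure.prod radialMeasure) :=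
  (measurePreserving_polar.integrable_comp hf.1).2 hf

lemma integral_polar {E : Type*} [NormedAddCommGroup E] [NormedSpace ℝ E]
    {f : R3 → E} (hf : Integrable f) :
    ∫ x, f x = ∫ o, ∫ r, f (r • (o : R3)) ∂radialMeasure ∂sphereMeasure := by
  rw [← integral_prod _ (integrable_polar hf), ← measurePreserving_polar.map_eq,
    integral_map measurePreserving_polar.measurable.aemeasurable]
  rw [measurePreserving_polar.map_eq]; exact hf.1

lemma norm_polar (o : UnitSphere) {r : ℝ} (hr : 0 < r) : ‖r • (o : R3)‖ = r := by
  simp [norm_smul, abs_of_pos hr]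

lemma sphereMeasure_real_univ : sphereMeasure.real Set.univ = 4 * Real.pi := by
  rw [sphereMeasure, Measure.toSphere_real_apply_univ, measureReal_def,
    EuclideanSpace.volume_ball_fin_three]
  simp
  rw [ENNReal.toReal_ofReal (by positivity)]
  ring

lemma integrable_comp_norm_iff {E : Type*} [NormedAddCommGroup E] [NormedSpace ℝ E] (f : ℝ → E) :
    Integrable (fun x : R3 => f ‖x‖) ↔ IntegrableOn (fun r => (r ^ 2) • f r) (Set.Ioi 0) := by
  have := integrable_fun_norm_addHaar (volume : Measure R3) (f := f)
  simpa using this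

lemma integral_comp_norm {E : Type*} [NormedAddCommGroup E] [NormedSpace ℝ E]
    (f : ℝ → E) :
    ∫ x : R3, f ‖x‖ = (4 * Real.pi) • ∫ r in Set.Ioi 0, (r ^ 2) • f r := by
  have := integral_fun_norm_addHaar (volume : Measure R3) f
  rw [this, ← sphereMeasure_real_univ, sphereMeasure, Measure.toSphere_real_apply_univ]
  simp only [finrank_euclideanSpace, Fintype.card_fin, Nat.add_one_sub_one]
  rw [mul_smul, ← Nat.cast_smul_eq_nsmul ℝ]

/-! ### Radial functions and their weak gradients -/

/-- The function `r ↦ ∫_r^∞ g`. -/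
noncomputable def tailIntegral (g : ℝ → ℂ) (r : ℝ) : ℂ := ∫ u in Set.Ioi r, g u

/-- The Fubini kernel behind `∫ F(x) ∫_{|x|}^∞ g = ∫ g(r) ∫_{|x| < r} F`: since `g` has bounded
support, integrability with respect to `r² dr` suffices near the origin. -/
lemma integrable_tail_kernel {g : ℝ → ℂ} (hg : Measurable g) (hi : Integrable g radialMeasure)
    {s : ℝ} (hs : ∀ u, s < u → g u = 0) :
    Integrable (Set.indicator {p : R3 × ℝ | ‖p.1‖ < p.2} (fun p => g p.2))
      ((volume : Measure R3).prod (volume.restrict (Set.Ioi 0))) := by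
  have hm : MeasurableSet {p : R3 × ℝ | ‖p.1‖ < p.2} :=
    measurableSet_lt (by fun_prop) (by fun_prop)
  have hmeas : Measurable (Set.indicator {p : R3 × ℝ | ‖p.1‖ < p.2} (fun p => g p.2)) :=
    Measurable.indicator (by fun_prop) hm
  have key : ∀ u : ℝ, (fun x : R3 => Set.indicator {p : R3 × ℝ | ‖p.1‖ < p.2} (fun p => g p.2)
      (x, u)) = Set.indicator (Metric.ball 0 u) (fun _ => g u) := by
    intro u; ext x
    by_cases hx : ‖x‖ < u <;> simp [hx]
  rw [integrable_prod_iff' hmeas.aestronglyMeasurable]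
  constructor
  · refine Eventually.of_forall fun u => ?_
    rw [key, integrable_indicator_iff measurableSet_ball]
    exact integrableOn_const measure_ball_lt_top.ne
  · have h2 : ∀ u ∈ Set.Ioi (0:ℝ), ∫ x : R3, ‖Set.indicator {p : R3 × ℝ | ‖p.1‖ < p.2}
        (fun p => g p.2) (x, u)‖ = (4 * Real.pi / 3 * u) * ‖(u ^ 2) • g u‖ := by
      intro u hu
      have hu' : (0:ℝ) < u := hu
      have : (fun x : R3 => ‖Set.indicator {p : R3 × ℝ | ‖p.1‖ < p.2}
        (fun p => g p.2) (x, u)‖) = Set.indicator (Metric.ball 0 u) (fun _ => ‖g u‖) := by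
        ext x; rw [congrFun (key u) x, norm_indicator_eq_indicator_norm]
      rw [this, integral_indicator measurableSet_ball]
      simp only [integral_const, smul_eq_mul, measureReal_restrict_apply_univ, norm_smul, norm_pow,
        Real.norm_eq_abs, abs_of_pos hu']
      rw [measureReal_def, EuclideanSpace.volume_ball_fin_three]
      rw [ENNReal.toReal_mul, ENNReal.toReal_pow, ENNReal.toReal_ofReal hu'.le,
        ENNReal.toReal_ofReal (by positivity)]
      ring
    rw [integrable_congr ((ae_restrict_iff' measurableSet_Ioi).2 (Eventually.of_forall h2))]
    rw [integrable_radialMeasure_iff] at hi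
    refine Integrable.mono' ((hi.norm).const_mul (4 * Real.pi / 3 * |s|)) (by fun_prop) ?_
    refine (ae_restrict_iff' measurableSet_Ioi).2 (Eventually.of_forall fun u hu => ?_)
    have hu' : (0:ℝ) < u := hu
    by_cases hus : s < u
    · simp [hs u hus]
    · push Not at hus
      rw [norm_mul, norm_norm, Real.norm_eq_abs, abs_of_pos (by positivity)]
      have : u ≤ |s| := hus.trans (le_abs_self s)
      gcongr

lemma tail_kernel_section (g : ℝ → ℂ) (x : R3) :
    ∫ u in Set.Ioi (0:ℝ), Set.indicator {p : R3 × ℝ | ‖p.1‖ < p.2} (fun p => g p.2) (x, u)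
      = tailIntegral g ‖x‖ := by
  have : (fun u : ℝ => Set.indicator {p : R3 × ℝ | ‖p.1‖ < p.2} (fun p => g p.2) (x, u))
      = Set.indicator (Set.Ioi ‖x‖) g := by
    ext u; simp [Set.indicator_apply]
  rw [this, setIntegral_indicator measurableSet_Ioi, tailIntegral]
  congr 2
  ext u; simp only [Set.mem_inter_iff, Set.mem_Ioi, and_iff_right_iff_imp]
  exact fun h => (norm_nonneg x).trans_lt h

lemma integrable_tailIntegral {g : ℝ → ℂ} (hg : Measurable g) (hi : Integrable g radialMeasure)
    {s : ℝ} (hs : ∀ u, s < u → g u = 0) : Integrable (fun x : R3 => tailIntegral g ‖x‖) := by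
  have := (integrable_tail_kernel hg hi hs).integral_prod_left
  simpa only [tail_kernel_section] using this

lemma integral_smul_tailIntegral {g : ℝ → ℂ} (hg : Measurable g) (hi : Integrable g radialMeasure)
    {s : ℝ} (hs : ∀ u, s < u → g u = 0) {h : R3 → ℝ} (hh : Continuous h) {C : ℝ}
    (hC : ∀ x, ‖h x‖ ≤ C) :
    Integrable (fun u => (∫ x in Metric.ball 0 u, h x) • g u) (volume.restrict (Set.Ioi 0)) ∧
    ∫ x : R3, h x • tailIntegral g ‖x‖
      = ∫ u in Set.Ioi (0:ℝ), (∫ x in Metric.ball 0 u, h x) • g u := by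
  have h1 := integrable_tail_kernel hg hi hs
  have h2 : Integrable (fun p : R3 × ℝ => h p.1 • Set.indicator {p : R3 × ℝ | ‖p.1‖ < p.2}
      (fun p => g p.2) p) ((volume : Measure R3).prod (volume.restrict (Set.Ioi 0))) :=
    h1.bdd_smul C (hh.comp continuous_fst).aestronglyMeasurable
      (Eventually.of_forall fun p => hC p.1)
  have key : ∀ u : ℝ, ∫ x : R3, h x • Set.indicator {p : R3 × ℝ | ‖p.1‖ < p.2} (fun p => g p.2)
      (x, u) = (∫ x in Metric.ball 0 u, h x) • g u := by
    intro u
    rw [← integral_indicator measurableSet_ball, ← integral_smul_const]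
    congr 1; ext x
    by_cases hx : ‖x‖ < u <;> simp [hx]
  constructor
  · have := h2.integral_prod_right
    simpa only [key] using this
  · have := integral_integral_swap (f := fun (x : R3) (u : ℝ) => h x •
      Set.indicator {p : R3 × ℝ | ‖p.1‖ < p.2} (fun p => g p.2) (x, u)) h2
    simp only [key] at this
    rw [← this]
    congr 1; ext x
    rw [integral_smul, tail_kernel_section]

lemma integrable_radial_gradient {g : ℝ → ℂ} (hi : Integrable g radialMeasure)
    (k : Fin 3) : Integrable (fun x : R3 => ((x k / ‖x‖ : ℝ)) • g ‖x‖) := by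
  have h0 : Integrable (fun x : R3 => g ‖x‖) := by
    rw [integrable_comp_norm_iff, ← integrable_radialMeasure_iff]; exact hi
  refine h0.bdd_smul (φ := fun x : R3 => (x k / ‖x‖ : ℝ)) 1 ?_ ?_
  · exact Measurable.aestronglyMeasurable (by fun_prop)
  · refine Eventually.of_forall fun x => ?_
    rw [norm_div, norm_norm]
    exact div_le_one_of_le₀ (PiLp.norm_apply_le x k) (norm_nonneg x)

/-- The flux of `η` times the `k`-th unit vector through the sphere of radius `u`. -/
noncomputable def sphereFlux (η : R3 → ℝ) (k : Fin 3) (u : ℝ) : ℝ :=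
  u ^ 2 * ∫ o : UnitSphere, η (u • (o : R3)) * (o : R3) k ∂sphereMeasure

lemma integral_smul_radial_gradient {g : ℝ → ℂ}
    (hi : Integrable g radialMeasure) (k : Fin 3) {η : R3 → ℝ} (hη : Continuous η) {C : ℝ}
    (hC : ∀ x, ‖η x‖ ≤ C) :
    Integrable (fun u => sphereFlux η k u • g u) (volume.restrict (Set.Ioi 0)) ∧
    ∫ x : R3, η x • ((x k / ‖x‖ : ℝ)) • g ‖x‖
      = ∫ u in Set.Ioi (0:ℝ), sphereFlux η k u • g u := by
  have h1 : Integrable (fun x : R3 => η x • ((x k / ‖x‖ : ℝ)) • g ‖x‖) :=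
    (integrable_radial_gradient hi k).bdd_smul C hη.aestronglyMeasurable
      (Eventually.of_forall hC)
  have h2 := integrable_polar h1
  have key : ∀ᵐ r ∂radialMeasure, (∫ o : UnitSphere, η (r • (o : R3)) • (((r • (o : R3)) k /
      ‖r • (o : R3)‖ : ℝ)) • g ‖r • (o : R3)‖ ∂sphereMeasure) =
      (∫ o : UnitSphere, η (r • (o : R3)) * (o : R3) k ∂sphereMeasure) • g r := by
    rw [ae_radialMeasure_iff]
    refine Eventually.of_forall fun r hr => ?_
    rw [← integral_smul_const]
    congr 1; ext o
    rw [norm_polar o hr, smul_smul]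
    simp [hr.ne']
  constructor
  · have h3 := h2.integral_prod_right
    rw [integrable_congr key, integrable_radialMeasure_iff] at h3
    simpa only [sphereFlux, smul_smul] using! h3
  · rw [integral_polar h1, integral_integral_swap h2, integral_congr_ae key,
      integral_radialMeasure]
    simp only [sphereFlux, smul_smul]

lemma hasFDerivAt_norm_R3 {x : R3} (hx : x ≠ 0) :
    HasFDerivAt (fun y : R3 => ‖y‖) (‖x‖⁻¹ • innerSL ℝ x) x := by
  have h := ((hasStrictFDerivAt_norm_sq x).hasFDerivAt).sqrt (by simpa using hx)
  simp only [Real.sqrt_sq (norm_nonneg _)] at h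
  convert! h using 1
  ext y
  simp
  field_simp

/-- The divergence theorem on balls, for almost every radius. -/
lemma integral_ball_fderiv_eq_sphereFlux {η : R3 → ℝ} (hη : ContDiff ℝ ∞ η)
    (hc : HasCompactSupport η) (k : Fin 3) :
    ∀ᵐ u : ℝ, u ∈ Set.Ioi (0:ℝ) →
      (∫ x in Metric.ball 0 u, fderiv ℝ η x (unitVec k)) = sphereFlux η k u := by
  have hdc : Continuous (fun x => fderiv ℝ η x (unitVec k)) :=
    (hη.continuous_fderiv (by simp)).clm_apply continuous_const
  have hds : HasCompactSupport (fun x => fderiv ℝ η x (unitVec k)) := hc.fderiv_apply ℝ _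
  obtain ⟨C, hC⟩ := hds.exists_bound_of_continuous hdc
  obtain ⟨D, hD⟩ := hc.exists_bound_of_continuous hη.continuous
  have hCi : Integrable (fun x => fderiv ℝ η x (unitVec k)) := hdc.integrable_of_hasCompactSupport hds
  suffices h : ∀ᵐ u : ℝ, u ∈ Set.Ioi (0:ℝ) →
      (∫ x in Metric.ball 0 u, fderiv ℝ η x (unitVec k)) - sphereFlux η k u = 0 by
    filter_upwards [h] with u hu h0 using sub_eq_zero.1 (hu h0)
  -- facts about test functions on the half line
  have test : ∀ ζ : ℝ → ℝ, ContDiff ℝ ∞ ζ → HasCompactSupport ζ → tsupport ζ ⊆ Set.Ioi 0 →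
      Measurable (fun u => (ζ u : ℂ)) ∧ Integrable (fun u => (ζ u : ℂ)) radialMeasure ∧
      ∃ s : ℝ, ∀ u, s < u → (ζ u : ℂ) = 0 := by
    intro ζ hζ hζc _
    have hcont := hζ.continuous
    refine ⟨by fun_prop, ?_, ?_⟩
    · rw [integrable_radialMeasure_iff]
      refine Integrable.integrableOn ?_
      refine Continuous.integrable_of_hasCompactSupport (by fun_prop) ?_
      refine HasCompactSupport.smul_left (f := fun u : ℝ => u ^ 2) ?_
      exact hζc.comp_left (g := fun x : ℝ => (x : ℂ)) (by simp)
    · obtain ⟨s, hs⟩ := hζc.isCompact.bddAbove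
      refine ⟨s, fun u hu => ?_⟩
      have : u ∉ tsupport ζ := fun h => absurd (hs h) (not_le.2 hu)
      simp [image_eq_zero_of_notMem_tsupport this]
  refine isOpen_Ioi.ae_eq_zero_of_integral_contDiff_smul_eq_zero ?_ ?_
  · intro x hx
    have hx' : (0:ℝ) < x := hx
    refine ⟨Set.Ioc 0 (x + 1), mem_nhdsWithin.2 ⟨Set.Iio (x + 1), isOpen_Iio, by simp, ?_⟩, ?_⟩
    · rintro y ⟨h1, h2⟩; exact ⟨h2, le_of_lt h1⟩
    have hm : Measurable (Set.indicator (Set.Ioc 0 (x + 1)) (fun _ => (1:ℂ))) :=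
      measurable_const.indicator measurableSet_Ioc
    have hi : Integrable (Set.indicator (Set.Ioc 0 (x + 1)) (fun _ => (1:ℂ))) radialMeasure := by
      rw [integrable_radialMeasure_iff]
      have : (fun r : ℝ => r ^ 2 • Set.indicator (Set.Ioc 0 (x + 1)) (fun _ => (1:ℂ)) r) =
          Set.indicator (Set.Ioc 0 (x + 1)) (fun r => r ^ 2 • (1:ℂ)) := by
        ext r; by_cases hr : r ∈ Set.Ioc 0 (x + 1) <;> simp [hr]
      rw [this]
      refine Integrable.integrableOn ?_
      rw [integrable_indicator_iff measurableSet_Ioc]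
      exact (Continuous.integrableOn_Icc (by fun_prop)).mono_set Set.Ioc_subset_Icc_self
    have hs : ∀ u, x + 1 < u → Set.indicator (Set.Ioc 0 (x + 1)) (fun _ => (1:ℂ)) u = 0 := by
      intro u hu
      exact Set.indicator_of_notMem (fun h => absurd h.2 (not_le.2 hu)) _
    have e1 := (integral_smul_tailIntegral hm hi hs hdc hC).1
    have e2 := (integral_smul_radial_gradient hi k hη.continuous hD).1
    have e3 := (e1.sub e2).re.mono_measure
      (Measure.restrict_mono (μ := volume) (Set.Ioc_subset_Ioi_self : Set.Ioc (0:ℝ) (x + 1) ⊆ Set.Ioi 0)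
        le_rfl)
    refine e3.congr ((ae_restrict_iff' measurableSet_Ioc).2 (Eventually.of_forall fun u hu => ?_))
    simp [hu.1, hu.2]
  · intro ζ hζ hζc hζs
    obtain ⟨hm, hi, s, hs⟩ := test ζ hζ hζc hζs
    have e1 := integral_smul_tailIntegral hm hi hs hdc hC
    have e2 := integral_smul_radial_gradient hi k hη.continuous hD
    have hcont : Continuous (fun u => (ζ u : ℂ)) := Complex.continuous_ofReal.comp hζ.continuous
    have hint : Integrable (fun u => (ζ u : ℂ)) :=
      hcont.integrable_of_hasCompactSupport (hζc.comp_left (g := fun x : ℝ => (x : ℂ)) (by simp))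
    -- the primitive is differentiable
    have hZ : ∀ r, HasDerivAt (tailIntegral (fun u => (ζ u : ℂ))) (-(ζ r : ℂ)) r := by
      intro r
      have : tailIntegral (fun u => (ζ u : ℂ)) = fun r => (∫ u in Set.Ioi 0, (ζ u : ℂ)) -
          ∫ u in (0:ℝ)..r, (ζ u : ℂ) := by
        ext r
        rw [tailIntegral, eq_sub_iff_add_eq', 
          intervalIntegral.integral_interval_add_Ioi hint.integrableOn hint.integrableOn]
      rw [this]
      simpa using! (hasDerivAt_const r _).sub (intervalIntegral.integral_hasDerivAt_right
        (hcont.intervalIntegrable 0 r) (hcont.stronglyMeasurableAtFilter _ _) hcont.continuousAt)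
    have hd : ∀ x : R3, HasFDerivAt (fun x : R3 => tailIntegral (fun u => (ζ u : ℂ)) ‖x‖)
        ((-(ζ ‖x‖ : ℂ)) • (Complex.ofRealCLM.comp (‖x‖⁻¹ • innerSL ℝ x))) x := by
      intro x
      rcases eq_or_ne x 0 with rfl | hx
      · have h0 : (0:ℝ) ∉ tsupport ζ := fun h => by simpa using hζs h
        have h1 : ∀ᶠ u in 𝓝 (0:ℝ), ζ u = 0 := notMem_tsupport_iff_eventuallyEq.1 h0
        obtain ⟨d, hd, hd'⟩ := Metric.eventually_nhds_iff.1 h1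
        have h2 : (fun x : R3 => tailIntegral (fun u => (ζ u : ℂ)) ‖x‖) =ᶠ[𝓝 0]
            fun _ => tailIntegral (fun u => (ζ u : ℂ)) 0 := by
          filter_upwards [Metric.ball_mem_nhds (0:R3) hd] with y hy
          have hy' : ‖y‖ < d := by simpa using hy
          rw [tailIntegral, tailIntegral, ← sub_eq_zero, ← neg_eq_zero, neg_sub,
            intervalIntegral.integral_Ioi_sub_Ioi hint.integrableOn (norm_nonneg y)]
          rw [intervalIntegral.integral_of_le (norm_nonneg y)]
          refine setIntegral_eq_zero_of_forall_eq_zero fun u hu => ?_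
          simp only [Complex.ofReal_eq_zero]
          apply hd'
          simpa [abs_of_pos hu.1] using hu.2.trans_lt hy'
        have h3 := (hasFDerivAt_const (𝕜 := ℝ) (tailIntegral (fun u => (ζ u : ℂ)) 0)
          (0:R3)).congr_of_eventuallyEq h2
        convert! h3 using 1
        ext y
        simp
      · have := (hZ ‖x‖).hasFDerivAt.comp x (hasFDerivAt_norm_R3 hx)
        convert! this using 1
        ext y
        simp
        ring
    have hfd : ∀ x : R3, fderiv ℝ (fun x : R3 => tailIntegral (fun u => (ζ u : ℂ)) ‖x‖) x
        (unitVec k) = -((x k / ‖x‖ : ℝ) • (ζ ‖x‖ : ℂ)) := by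
      intro x
      rw [(hd x).fderiv]
      simp [unitVec, EuclideanSpace.inner_single_right]
      ring
    have ibp := integral_smul_fderiv_eq_neg_fderiv_smul_of_integrable (μ := (volume : Measure R3))
      (𝕜 := ℝ) (f := η) (g := fun x : R3 => tailIntegral (fun u => (ζ u : ℂ)) ‖x‖) (v := unitVec k)
      ?_ ?_ ?_ (fun x _ => (hη.differentiable (by simp)).differentiableAt) (fun x _ => (hd x).differentiableAt)
    · simp only [hfd] at ibp
      simp only [smul_neg, integral_neg, neg_inj] at ibp
      rw [e1.2, e2.2] at ibp
      have e3 := integral_sub e1.1 e2.1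
      rw [ibp, sub_self] at e3
      simp only [← sub_smul] at e3
      have e4 : ∫ x in Set.Ioi (0:ℝ), (ζ x • ((∫ y in Metric.ball 0 x, fderiv ℝ η y (unitVec k)) - sphereFlux η k x) : ℝ) = 0 := by
        apply Complex.ofReal_injective
        rw [← integral_complex_ofReal, Complex.ofReal_zero, ← e3]
        congr 1; ext u
        simp [mul_comm]
      rw [← e4, setIntegral_eq_integral_of_forall_compl_eq_zero]
      intro u hu
      have : u ∉ tsupport ζ := fun h => hu (hζs h)
      simp [image_eq_zero_of_notMem_tsupport this]
    · exact (integrable_tailIntegral hm hi hs).bdd_smul (φ := fun x => fderiv ℝ η x (unitVec k)) C hdc.aestronglyMeasurable (Eventually.of_forall hC)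
    · simp only [hfd]
      exact (integrable_radial_gradient hi k).neg.bdd_smul (φ := η) D hη.continuous.aestronglyMeasurable (Eventually.of_forall hD)
    · exact (integrable_tailIntegral hm hi hs).bdd_smul (φ := η) D hη.continuous.aestronglyMeasurable (Eventually.of_forall hD)

/-- The radial functions `β - ∫_{|x|}^∞ g` have the weak gradient `g(|x|) x / |x|`; no continuity of
`g`, and no condition at the origin other than integrability, is needed. -/
lemma hasWeakDirDeriv_radial {g : ℝ → ℂ} (hg : Measurable g) (hi : Integrable g radialMeasure)
    {s : ℝ} (hs : ∀ u, s < u → g u = 0) (β : ℂ) (k : Fin 3) :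
    HasWeakDirDeriv (fun x : R3 => β - tailIntegral g ‖x‖)
      (fun x => ((x k / ‖x‖ : ℝ)) • g ‖x‖) (unitVec k) where
  locallyIntegrable := by
    have h1 : LocallyIntegrable (fun _ : R3 => β) := (continuous_const).locallyIntegrable
    exact h1.sub (integrable_tailIntegral hg hi hs).locallyIntegrable
  locallyIntegrable_deriv := (integrable_radial_gradient hi k).locallyIntegrable
  integral_eq η hη hc := by
    have hdc : Continuous (fun x => fderiv ℝ η x (unitVec k)) :=
      (hη.continuous_fderiv (by simp)).clm_apply continuous_const
    have hds : HasCompactSupport (fun x => fderiv ℝ η x (unitVec k)) := hc.fderiv_apply ℝ _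
    obtain ⟨C, hC⟩ := hds.exists_bound_of_continuous hdc
    obtain ⟨D, hD⟩ := hc.exists_bound_of_continuous hη.continuous
    have hCi : Integrable (fun x => fderiv ℝ η x (unitVec k)) :=
      hdc.integrable_of_hasCompactSupport hds
    have e1 := integral_smul_tailIntegral hg hi hs hdc hC
    have e2 := integral_smul_radial_gradient hi k hη.continuous hD
    have e0 : ∫ x, fderiv ℝ η x (unitVec k) = 0 := by
      have := integral_mul_fderiv_eq_neg_fderiv_mul_of_integrable (μ := (volume : Measure R3))
        (𝕜 := ℝ) (f := fun _ => (1:ℝ)) (g := η) (v := unitVec k) (by simp) (by simpa using hCi)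
        (by simpa using hη.continuous.integrable_of_hasCompactSupport hc)
        (fun x _ => by fun_prop) (fun x _ => (hη.differentiable (by simp)).differentiableAt)
      simpa using this
    simp only [smul_sub]
    have hti : Integrable (fun x : R3 => fderiv ℝ η x (unitVec k) • tailIntegral g ‖x‖) :=
      (integrable_tailIntegral hg hi hs).bdd_smul (φ := fun x => fderiv ℝ η x (unitVec k)) C
        hdc.aestronglyMeasurable (Eventually.of_forall hC)
    rw [integral_sub (hCi.smul_const β) hti, integral_smul_const, e0, zero_smul, zero_sub, e1.2, e2.2]
    congr 1
    refine setIntegral_congr_ae measurableSet_Ioi ?_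
    filter_upwards [integral_ball_fderiv_eq_sphereFlux hη hc k] with u hu h0
    rw [hu h0]

/-! ### Scattering length and radial profiles -/

/-- The profile of a spherically symmetric function. -/
noncomputable def radialProfile (w : R3 → ℝ) (r : ℝ) : ℝ := w (r • unitVec 0)

lemma norm_unitVec (k : Fin 3) : ‖unitVec k‖ = 1 := by simp [unitVec]

lemma IsRadial.eq_profile {w : R3 → ℝ} (hw : IsRadial w) (x : R3) :
    w x = radialProfile w ‖x‖ := by
  apply hw; simp [norm_smul, norm_unitVec]

lemma integrable_of_sq_radial {g : ℝ → ℂ} (hg : Measurable g)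
    (h2 : Integrable (fun r => ‖g r‖ ^ 2) radialMeasure) {s : ℝ} (hs : ∀ u, s < u → g u = 0) :
    Integrable g radialMeasure := by
  have h1 : Integrable (Set.indicator (Set.Iic s) (fun _ => (1:ℝ))) radialMeasure := by
    rw [integrable_radialMeasure_iff]
    have : (fun r : ℝ => r ^ 2 • Set.indicator (Set.Iic s) (fun _ => (1:ℝ)) r) =
        Set.indicator (Set.Iic s) (fun r => r ^ 2 • (1:ℝ)) := by
      ext r; by_cases hr : r ∈ Set.Iic s <;> simp [hr]
    rw [this, integrableOn_indicator_iff measurableSet_Iic, Set.inter_comm, Set.Ioi_inter_Iic]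
    exact (Continuous.integrableOn_Icc (by fun_prop)).mono_set Set.Ioc_subset_Icc_self
  refine Integrable.mono' (h1.add h2) hg.aestronglyMeasurable (Eventually.of_forall fun r => ?_)
  by_cases hr : s < r
  · simp [hs r hr, Set.indicator_nonneg]
  · simp only [Pi.add_apply, Set.indicator_apply, Set.mem_Iic, not_lt.1 hr, if_true]
    nlinarith [sq_nonneg (‖g r‖ - 1)]

lemma sum_sq_radial_gradient {x : R3} (hx : x ≠ 0) (z : ℂ) :
    ∑ k, ‖((x k / ‖x‖ : ℝ)) • z‖ ^ 2 = ‖z‖ ^ 2 := by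
  simp only [norm_smul, norm_div, norm_norm, mul_pow, div_pow]
  rw [← Finset.sum_mul, ← Finset.sum_div, ← EuclideanSpace.norm_sq_eq, div_self (by simpa using hx),
    one_mul]

/-- A spherically symmetric potential that is nonpositive and integrable outside the ball of
radius `R₀`. -/
structure IsCoreRadial (w : R3 → ℝ) (R₀ : ℝ) : Prop where
  radial : IsRadial w
  measurable : Measurable w
  pos : 0 < R₀
  nonpos : ∀ x, R₀ < ‖x‖ → w x ≤ 0
  integrable : IntegrableOn w {x | R₀ < ‖x‖}

lemma ae_pos_radialMeasure : ∀ᵐ r ∂radialMeasure, 0 < r :=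
  ae_radialMeasure_iff.2 (Eventually.of_forall fun _ => id)

lemma measurable_tailIntegral {g : ℝ → ℂ} (hg : Measurable g) : Measurable (tailIntegral g) := by
  have h : StronglyMeasurable (fun p : ℝ × ℝ => Set.indicator {p : ℝ × ℝ | p.1 < p.2}
      (fun p => g p.2) p) :=
    (Measurable.indicator (by fun_prop)
      (measurableSet_lt measurable_fst measurable_snd)).stronglyMeasurable
  have h2 := (h.integral_prod_right' (ν := volume)).measurable
  convert! h2 using 1
  ext r
  rw [tailIntegral, ← integral_indicator measurableSet_Ioi]
  rfl

lemma integrable_outside {g : ℝ → ℂ} (hi : Integrable g radialMeasure) {R : ℝ} (hR : 0 < R) :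
    IntegrableOn g (Set.Ioi R) := by
  rw [integrable_radialMeasure_iff] at hi
  have h1 : IntegrableOn (fun r : ℝ => r ^ 2 • g r) (Set.Ioi R) :=
    hi.mono_set (Set.Ioi_subset_Ioi hR.le)
  have h2 : IntegrableOn (fun r : ℝ => (r ^ 2)⁻¹ • (r ^ 2 • g r)) (Set.Ioi R) := by
    refine h1.bdd_smul (φ := fun r : ℝ => (r ^ 2)⁻¹) ((R ^ 2)⁻¹)
      (Measurable.aestronglyMeasurable (by fun_prop)) ?_
    refine (ae_restrict_iff' measurableSet_Ioi).2 (Eventually.of_forall fun r hr => ?_)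
    have : R < r := hr
    rw [norm_inv, norm_pow, Real.norm_eq_abs, sq_abs]
    gcongr
  refine h2.congr_fun (fun r hr => ?_) measurableSet_Ioi
  have : r ≠ 0 := (hR.trans hr).ne'
  simp only [smul_smul]
  rw [inv_mul_cancel₀ (by positivity), one_smul]

lemma IsCoreRadial.integrable_potential {w : R3 → ℝ} {R₀ : ℝ} (hw : IsCoreRadial w R₀)
    {g : ℝ → ℂ} (hg : Measurable g)
    (h2 : Integrable (fun r => ‖g r‖ ^ 2) radialMeasure) {s : ℝ} (hs : ∀ u, s < u → g u = 0)
    (β : ℂ) (hpot : IntegrableOn (fun r => radialProfile w r * ‖β - tailIntegral g r‖ ^ 2)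
      (Set.Ioc 0 R₀) radialMeasure) :
    Integrable (fun r => radialProfile w r * ‖β - tailIntegral g r‖ ^ 2) radialMeasure := by
  have hi := integrable_of_sq_radial hg h2 hs
  have ho := integrable_outside hi hw.pos
  have hwi : IntegrableOn (radialProfile w) (Set.Ioi R₀) radialMeasure := by
    have hm : MeasurableSet {x : R3 | R₀ < ‖x‖} := measurableSet_lt (by fun_prop) (by fun_prop)
    have h3 := hw.integrable
    rw [← integrable_indicator_iff hm] at h3
    rw [← integrable_indicator_iff measurableSet_Ioi, integrable_radialMeasure_iff,
      ← integrable_comp_norm_iff]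
    refine h3.congr (Eventually.of_forall fun x => ?_)
    simp [Set.indicator_apply, hw.radial.eq_profile x]
  rw [← integrableOn_univ, ← Set.union_compl_self (Set.Ioc 0 R₀), integrableOn_union]
  refine ⟨hpot, ?_⟩
  have h3 : IntegrableOn (fun r => radialProfile w r * ‖β - tailIntegral g r‖ ^ 2)
      (Set.Ioi R₀) radialMeasure := by
    refine hwi.mul_bdd (c := (‖β‖ + ∫ u in Set.Ioi R₀, ‖g u‖) ^ 2) ?_ ?_
    · have := measurable_tailIntegral hg
      exact Measurable.aestronglyMeasurable (by fun_prop)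
    · refine (ae_restrict_iff' measurableSet_Ioi).2 (Eventually.of_forall fun r hr => ?_)
      rw [norm_pow, norm_norm]
      gcongr
      refine (norm_sub_le _ _).trans (add_le_add_right ?_ _)
      refine (norm_integral_le_integral_norm _).trans ?_
      exact setIntegral_mono_set ho.norm (Eventually.of_forall fun _ => norm_nonneg _)
        (Set.Ioi_subset_Ioi (le_of_lt hr)).eventuallyLE
  refine h3.mono_set_ae ?_
  filter_upwards [ae_pos_radialMeasure] with r hr hr'
  by_contra h
  exact hr' ⟨hr, not_lt.1 h⟩

/-- The scattering energy of a profile with value `1` beyond `s`: the profile is itself a trial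
function, once the part of the potential beyond the core is dropped. -/
lemma IsCoreRadial.energy_one {w : R3 → ℝ} {R₀ : ℝ} (hw : IsCoreRadial w R₀) {α : ℝ}
    (hα : (α : EReal) ≤ scatteringLength w) {g : ℝ → ℂ} (hg : Measurable g)
    (h2 : Integrable (fun r => ‖g r‖ ^ 2) radialMeasure) {s : ℝ} (hs : ∀ u, s < u → g u = 0)
    (hpot : IntegrableOn (fun r => radialProfile w r * ‖1 - tailIntegral g r‖ ^ 2)
      (Set.Ioc 0 R₀) radialMeasure) :
    α ≤ ∫ r, ‖g r‖ ^ 2 ∂radialMeasure +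
      1 / 2 * ∫ r in Set.Ioc 0 R₀, radialProfile w r * ‖1 - tailIntegral g r‖ ^ 2
        ∂radialMeasure := by
  have hi := integrable_of_sq_radial hg h2 hs
  have hp := hw.integrable_potential hg h2 hs 1 hpot
  have hx0 : ∀ᵐ x : R3, x ≠ 0 := by simp [ae_iff]
  have htrial : IsScatteringTrial w (fun x : R3 => 1 - tailIntegral g ‖x‖)
      (fun k x => ((x k / ‖x‖ : ℝ)) • g ‖x‖) := by
    refine ⟨fun k => hasWeakDirDeriv_radial hg hi hs 1 k, fun k => ?_, ?_, ?_⟩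
    · have : Integrable (fun x : R3 => ‖g ‖x‖‖ ^ 2) := by
        rw [integrable_comp_norm_iff (fun r => ‖g r‖ ^ 2), ← integrable_radialMeasure_iff]
        exact h2
      refine this.mono' (by fun_prop) ?_
      filter_upwards [hx0] with x hx
      rw [norm_pow, norm_norm, ← sum_sq_radial_gradient hx (g ‖x‖)]
      exact Finset.single_le_sum (f := fun k => ‖((x k / ‖x‖ : ℝ)) • g ‖x‖‖ ^ 2)
        (fun _ _ => by positivity) (Finset.mem_univ k)
    · simp only [hw.radial.eq_profile]
      rw [integrable_comp_norm_iff (fun r => radialProfile w r * ‖1 - tailIntegral g r‖ ^ 2),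
        ← integrable_radialMeasure_iff]
      exact hp
    · have : (fun x : R3 => 1 - tailIntegral g ‖x‖) =ᶠ[cocompact R3] fun _ => 1 := by
        filter_upwards [(tendsto_norm_cocompact_atTop (E := R3)).eventually_ge_atTop s] with x hx
        rw [tailIntegral, setIntegral_eq_zero_of_forall_eq_zero, sub_zero]
        exact fun u hu => hs u (hx.trans_lt hu)
      exact tendsto_const_nhds.congr' this.symm
  have h1 : (α : EReal) ≤ ((1 / (4 * Real.pi) * scatteringEnergy w _ _ : ℝ) : EReal) :=
    hα.trans (iInf_le_of_le _ (iInf_le_of_le _ (iInf_le _ htrial)))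
  rw [EReal.coe_le_coe_iff] at h1
  have h3 : scatteringEnergy w (fun x : R3 => 1 - tailIntegral g ‖x‖)
      (fun k x => ((x k / ‖x‖ : ℝ)) • g ‖x‖) = (4 * Real.pi) * ∫ r, (‖g r‖ ^ 2 +
        1 / 2 * (radialProfile w r * ‖1 - tailIntegral g r‖ ^ 2)) ∂radialMeasure := by
    rw [integral_radialMeasure, ← smul_eq_mul (4 * Real.pi), ← integral_comp_norm, scatteringEnergy]
    refine integral_congr_ae ?_
    filter_upwards [hx0] with x hx
    rw [sum_sq_radial_gradient hx, hw.radial.eq_profile x, mul_assoc]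
  rw [h3, ← mul_assoc, one_div, inv_mul_cancel₀ (by positivity), one_mul,
    integral_add h2 (hp.const_mul _), integral_const_mul] at h1
  refine h1.trans (add_le_add_right (mul_le_mul_of_nonneg_left ?_ (by norm_num)) _)
  rw [← integral_add_compl (measurableSet_Ioc (a := (0:ℝ)) (b := R₀)) hp]
  refine add_le_of_nonpos_right (integral_nonpos_of_ae ?_)
  rw [Filter.EventuallyLE, ae_restrict_iff' measurableSet_Ioc.compl]
  filter_upwards [ae_pos_radialMeasure] with r hr hr'
  have : R₀ < r := by
    by_contra h; exact hr' ⟨hr, not_lt.1 h⟩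
  refine mul_nonpos_of_nonpos_of_nonneg ?_ (by positivity)
  apply hw.nonpos
  rw [norm_smul, norm_unitVec, mul_one, Real.norm_eq_abs, abs_of_pos hr]; exact this


/-- A lower bound on the scattering length controls the radial energy of any profile
`r ↦ β - ∫_r^∞ g` in terms of its value `β` far away. -/
lemma IsCoreRadial.energy {w : R3 → ℝ} {R₀ : ℝ} (hw : IsCoreRadial w R₀) {α : ℝ}
    (hα : (α : EReal) ≤ scatteringLength w) {g : ℝ → ℂ} (hg : Measurable g)
    (h2 : Integrable (fun r => ‖g r‖ ^ 2) radialMeasure) {s : ℝ} (hs : ∀ u, s < u → g u = 0)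
    (β : ℂ)
    (hpot : IntegrableOn (fun r => radialProfile w r * ‖β - tailIntegral g r‖ ^ 2)
      (Set.Ioc 0 R₀) radialMeasure) :
    α * ‖β‖ ^ 2 ≤ ∫ r, ‖g r‖ ^ 2 ∂radialMeasure +
      1 / 2 * ∫ r in Set.Ioc 0 R₀, radialProfile w r * ‖β - tailIntegral g r‖ ^ 2
        ∂radialMeasure := by
  -- by scaling, the claim holds for `β ≠ 0`
  have main : ∀ (g : ℝ → ℂ) (s : ℝ) (β : ℂ), Measurable g →
      Integrable (fun r => ‖g r‖ ^ 2) radialMeasure → (∀ u, s < u → g u = 0) →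
      IntegrableOn (fun r => radialProfile w r * ‖β - tailIntegral g r‖ ^ 2)
      (Set.Ioc 0 R₀) radialMeasure → β ≠ 0 →
      α * ‖β‖ ^ 2 ≤ ∫ r, ‖g r‖ ^ 2 ∂radialMeasure +
      1 / 2 * ∫ r in Set.Ioc 0 R₀, radialProfile w r * ‖β - tailIntegral g r‖ ^ 2
        ∂radialMeasure := by
    intro g s β hg h2 hs hpot hβ
    have hβ' : (0:ℝ) < ‖β‖ ^ 2 := by positivity
    have e1 : ∀ r, ‖β⁻¹ * g r‖ ^ 2 = (‖β‖ ^ 2)⁻¹ * ‖g r‖ ^ 2 := by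
      intro r; rw [norm_mul, mul_pow, norm_inv, inv_pow]
    have e2 : ∀ r, radialProfile w r * ‖1 - tailIntegral (fun u => β⁻¹ * g u) r‖ ^ 2 =
        (‖β‖ ^ 2)⁻¹ * (radialProfile w r * ‖β - tailIntegral g r‖ ^ 2) := by
      intro r
      have : 1 - tailIntegral (fun u => β⁻¹ * g u) r = β⁻¹ * (β - tailIntegral g r) := by
        rw [tailIntegral, integral_const_mul, mul_sub, inv_mul_cancel₀ hβ]; rfl
      rw [this, norm_mul, mul_pow, norm_inv, inv_pow]; ring
    have := hw.energy_one hα (g := fun u => β⁻¹ * g u) (by fun_prop)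
      (by simp only [e1]; exact h2.const_mul _) (s := s) (fun u hu => by simp [hs u hu])
      (by simp only [e2]; exact hpot.const_mul _)
    simp only [e1, e2, integral_const_mul] at this
    have h5 := mul_le_mul_of_nonneg_left this hβ'.le
    rw [mul_add, ← mul_assoc, mul_inv_cancel₀ hβ'.ne', one_mul, mul_left_comm (‖β‖ ^ 2) (1 / 2 : ℝ),
      ← mul_assoc (‖β‖ ^ 2), mul_inv_cancel₀ hβ'.ne', one_mul, mul_comm] at h5
    exact h5
  rcases eq_or_ne β 0 with rfl | hβ
  swap
  · exact main g s β hg h2 hs hpot hβ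
  -- for `β = 0`, raise the profile to a small value `d` on the shell `(S, S + 1]`
  set E := ∫ r, ‖g r‖ ^ 2 ∂radialMeasure +
      1 / 2 * ∫ r in Set.Ioc 0 R₀, radialProfile w r * ‖0 - tailIntegral g r‖ ^ 2 ∂radialMeasure
    with hE
  set S := max s R₀ with hS
  set b : ℝ → ℂ := Set.indicator (Set.Ioc S (S + 1)) (fun _ => 1) with hb
  have hbm : Measurable b := measurable_const.indicator measurableSet_Ioc
  have hS0 : 0 < S := hw.pos.trans_le (le_max_right _ _)
  have hbi : Integrable (fun r => ‖b r‖ ^ 2) radialMeasure := by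
    rw [integrable_radialMeasure_iff]
    have : (fun r : ℝ => r ^ 2 • ‖b r‖ ^ 2) =
        Set.indicator (Set.Ioc S (S + 1)) (fun r => r ^ 2) := by
      ext r; by_cases hr : r ∈ Set.Ioc S (S + 1) <;> simp [hb, hr]
    rw [this]
    refine Integrable.integrableOn ?_
    rw [integrable_indicator_iff measurableSet_Ioc]
    exact (Continuous.integrableOn_Icc (by fun_prop)).mono_set Set.Ioc_subset_Icc_self
  have hgb : ∀ r, ∀ d : ℝ, ‖g r + d * b r‖ ^ 2 = ‖g r‖ ^ 2 + d ^ 2 * ‖b r‖ ^ 2 := by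
    intro r d
    by_cases hr : r ∈ Set.Ioc S (S + 1)
    · rw [hs r ((le_max_left _ _).trans_lt hr.1)]
      simp [mul_pow]
    · simp [hb, hr]
  have htail : ∀ d : ℝ, ∀ r ∈ Set.Ioc 0 R₀,
      (d : ℂ) - tailIntegral (fun u => g u + d * b u) r = 0 - tailIntegral g r := by
    intro d r hr
    have h3 := integrable_outside (integrable_of_sq_radial hg h2 hs) hr.1
    have hbi' : Integrable b := by
      rw [hb, integrable_indicator_iff measurableSet_Ioc]
      exact integrableOn_const (by simp)
    rw [tailIntegral, integral_add h3 (hbi'.integrableOn.const_mul _), integral_const_mul]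
    have : ∫ u in Set.Ioi r, b u = 1 := by
      rw [hb, setIntegral_indicator measurableSet_Ioc, Set.inter_eq_right.2]
      · simp
      · intro u hu; exact (hr.2.trans (le_max_right _ _)).trans_lt hu.1
    rw [this, tailIntegral]; ring
  have key : ∀ d : ℝ, 0 < d → α * d ^ 2 ≤ E + d ^ 2 * ∫ r, ‖b r‖ ^ 2 ∂radialMeasure := by
    intro d hd
    have h3 : Set.EqOn (fun r => radialProfile w r *
        ‖(d : ℂ) - tailIntegral (fun u => g u + d * b u) r‖ ^ 2)
        (fun r => radialProfile w r * ‖0 - tailIntegral g r‖ ^ 2) (Set.Ioc 0 R₀) := by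
      intro r hr; simp only; rw [htail d r hr]
    have := main (fun u => g u + d * b u) (S + 1) d (by fun_prop)
      (by simp only [hgb]; exact h2.add (hbi.const_mul _)) (fun u hu => by
        rw [hs u (by linarith [le_max_left s R₀]), hb, Set.indicator_of_notMem (fun h =>
          absurd h.2 (not_le.2 hu))]; simp)
      (hpot.congr_fun h3.symm measurableSet_Ioc) (by simpa using hd.ne')
    rw [setIntegral_congr_fun measurableSet_Ioc h3] at this
    simp only [hgb] at this
    rw [integral_add h2 (hbi.const_mul _), integral_const_mul] at this
    simp only [Complex.norm_real, Real.norm_eq_abs, sq_abs] at this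
    linarith
  have lim : Tendsto (fun d : ℝ => E + d ^ 2 * ∫ r, ‖b r‖ ^ 2 ∂radialMeasure - α * d ^ 2)
      (𝓝[>] 0) (𝓝 E) := by
    have : Continuous (fun d : ℝ => E + d ^ 2 * ∫ r, ‖b r‖ ^ 2 ∂radialMeasure - α * d ^ 2) := by
      fun_prop
    simpa using (this.tendsto 0).mono_left nhdsWithin_le_nhds
  have := ge_of_tendsto lim (eventually_nhdsWithin_of_forall fun d hd => sub_nonneg.2 (key d hd))
  simpa using this

/-! ### Dyson's inequality in a ball -/

lemma tailIntegral_indicator (g : ℝ → ℂ) {r s : ℝ} (hr : 0 < r) (hrs : r ≤ s) :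
    tailIntegral (Set.indicator (Set.Ioc 0 s) g) r = ∫ u in r..s, g u := by
  rw [tailIntegral, setIntegral_indicator measurableSet_Ioc, intervalIntegral.integral_of_le hrs]
  congr 2
  ext u; simp only [Set.mem_inter_iff, Set.mem_Ioi, Set.mem_Ioc]
  exact ⟨fun h => ⟨h.1, h.2.2⟩, fun h => ⟨h.1, hr.trans h.1, h.2⟩⟩

/-- The radial energy on `(0, R]` is bounded below by the value of the profile at almost every
`s ∈ (R₀, R]`: freeze the profile beyond `s` and use it as a trial function. -/
lemma IsCoreRadial.energy_le_of_ae {w : R3 → ℝ} {R₀ : ℝ} (hw : IsCoreRadial w R₀) {α : ℝ}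
    (hα : (α : EReal) ≤ scatteringLength w) {R : ℝ} {f g : ℝ → ℂ}
    (hg : Measurable g)
    (hfg : ∀ᵐ s : ℝ, 0 < s → ∀ᵐ r : ℝ, 0 < r → f r - f s = ∫ u in s..r, g u)
    (h2 : IntegrableOn (fun r => ‖g r‖ ^ 2) (Set.Ioc 0 R) radialMeasure)
    (hpot : IntegrableOn (fun r => radialProfile w r * ‖f r‖ ^ 2) (Set.Ioc 0 R₀) radialMeasure) :
    ∀ᵐ s ∂radialMeasure.restrict (Set.Ioc R₀ R), α * ‖f s‖ ^ 2 ≤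
      ∫ r in Set.Ioc 0 R, ‖g r‖ ^ 2 ∂radialMeasure +
      1 / 2 * ∫ r in Set.Ioc 0 R₀, radialProfile w r * ‖f r‖ ^ 2 ∂radialMeasure := by
  rw [ae_restrict_iff' measurableSet_Ioc, ae_radialMeasure_iff]
  filter_upwards [hfg] with s hs hs0 hsR
  have e1 : ∀ r, ‖Set.indicator (Set.Ioc 0 s) g r‖ ^ 2 =
      Set.indicator (Set.Ioc 0 s) (fun r => ‖g r‖ ^ 2) r := by
    intro r; by_cases hr : r ∈ Set.Ioc 0 s <;> simp [hr]
  have e2 : ∀ᵐ r ∂radialMeasure.restrict (Set.Ioc 0 R₀), radialProfile w r * ‖f r‖ ^ 2 =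
      radialProfile w r * ‖f s - tailIntegral (Set.indicator (Set.Ioc 0 s) g) r‖ ^ 2 := by
    rw [ae_restrict_iff' measurableSet_Ioc, ae_radialMeasure_iff]
    filter_upwards [hs hs0] with r hr hr0 hrR
    rw [tailIntegral_indicator g hr0 (hrR.2.trans hsR.1.le), intervalIntegral.integral_symm, ← hr hr0]
    simp
  have h3 := hw.energy hα (g := Set.indicator (Set.Ioc 0 s) g) (hg.indicator measurableSet_Ioc)
    (by simp only [e1]; rw [integrable_indicator_iff measurableSet_Ioc]
        exact h2.mono_set (Set.Ioc_subset_Ioc_right hsR.2)) (s := s)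
    (fun u hu => Set.indicator_of_notMem (fun h => absurd h.2 (not_le.2 hu)) _) (f s)
    (hpot.congr e2)
  rw [← integral_congr_ae e2] at h3
  simp only [e1] at h3
  rw [integral_indicator measurableSet_Ioc] at h3
  refine h3.trans (add_le_add_left ?_ _)
  exact setIntegral_mono_set h2 (Eventually.of_forall fun _ => by positivity)
    (Set.Ioc_subset_Ioc_right hsR.2).eventuallyLE

/-- `φ` is absolutely continuous along almost every ray, with gradient `Γ`. -/
def IsRadiallyAC (φ : R3 → ℂ) (Γ : Fin 3 → R3 → ℂ) : Prop :=
  ∀ᵐ y : R3, ∀ᵐ c : ℝ, 0 < c →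
    φ (c • y) - φ y = ∫ u in (1:ℝ)..c, ∑ k, (y k : ℂ) * Γ k (u • y)

lemma ae_mul_left {p : ℝ → Prop} (h : ∀ᵐ c : ℝ, p c) {a : ℝ} (ha : a ≠ 0) :
    ∀ᵐ c : ℝ, p (a * c) := by
  rw [ae_iff] at h ⊢
  have := Real.volume_preimage_mul_left ha {c | ¬ p c}
  rw [h, mul_zero] at this
  exact this

lemma IsRadiallyAC.ae_ray {φ : R3 → ℂ} {Γ : Fin 3 → R3 → ℂ} (h : IsRadiallyAC φ Γ) :
    ∀ᵐ o : UnitSphere ∂sphereMeasure, ∀ᵐ s : ℝ, 0 < s → ∀ᵐ r : ℝ, 0 < r →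
      φ (r • (o : R3)) - φ (s • (o : R3)) =
        ∫ u in s..r, ∑ k, ((o : R3) k : ℂ) * Γ k (u • (o : R3)) := by
  filter_upwards [ae_polar h] with o ho
  rw [ae_radialMeasure_iff] at ho
  filter_upwards [ho] with s hs hs0
  filter_upwards [ae_mul_left (hs hs0) (inv_ne_zero hs0.ne')] with r hr hr0
  have h1 := hr (by positivity)
  have h2 : (s⁻¹ * r) • s • (o : R3) = r • (o : R3) := by
    rw [smul_smul]; congr 1; field_simp
  rw [h2] at h1
  rw [h1]
  have h3 := intervalIntegral.smul_integral_comp_mul_right (a := 1) (b := s⁻¹ * r)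
    (fun u => ∑ k, ((o : R3) k : ℂ) * Γ k (u • (o : R3))) s
  rw [one_mul, show s⁻¹ * r * s = r by field_simp] at h3
  rw [← h3, ← intervalIntegral.integral_smul]
  congr 1; ext u
  rw [Finset.smul_sum]
  refine Finset.sum_congr rfl fun k _ => ?_
  rw [smul_smul]
  simp only [PiLp.smul_apply, smul_eq_mul, Complex.real_smul, Complex.ofReal_mul]
  ring

lemma norm_sq_radial_le (o : UnitSphere) (z : Fin 3 → ℂ) :
    ‖∑ k, ((o : R3) k : ℂ) * z k‖ ^ 2 ≤ ∑ k, ‖z k‖ ^ 2 := by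
  have h1 : ‖∑ k, ((o : R3) k : ℂ) * z k‖ ≤ ∑ k, |(o : R3) k| * ‖z k‖ := by
    refine (norm_sum_le _ _).trans (le_of_eq ?_)
    simp
  have h2 : ∑ k, |(o : R3) k| ^ 2 = 1 := by
    have h3 : ‖(o : R3)‖ = 1 := by simp
    have := EuclideanSpace.norm_sq_eq (o : R3)
    rw [h3] at this
    simpa using this.symm
  calc ‖∑ k, ((o : R3) k : ℂ) * z k‖ ^ 2 ≤ (∑ k, |(o : R3) k| * ‖z k‖) ^ 2 := by gcongr
    _ ≤ (∑ k, |(o : R3) k| ^ 2) * ∑ k, ‖z k‖ ^ 2 := Finset.sum_mul_sq_le_sq_mul_sq _ _ _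
    _ = _ := by rw [h2, one_mul]

/-- Integration over a radial shell in polar coordinates. -/
lemma setIntegral_shell {F : R3 → ℝ} {a b : ℝ}
    (hF : IntegrableOn F {x | ‖x‖ ∈ Set.Ioc a b}) :
    ∫ x in {x : R3 | ‖x‖ ∈ Set.Ioc a b}, F x =
      ∫ o : UnitSphere, ∫ r in Set.Ioc a b, F (r • (o : R3)) ∂radialMeasure ∂sphereMeasure ∧
    Integrable (fun o : UnitSphere => ∫ r in Set.Ioc a b, F (r • (o : R3)) ∂radialMeasure)
      sphereMeasure ∧
    ∀ᵐ o : UnitSphere ∂sphereMeasure,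
      IntegrableOn (fun r => F (r • (o : R3))) (Set.Ioc a b) radialMeasure := by
  have hm : MeasurableSet {x : R3 | ‖x‖ ∈ Set.Ioc a b} := measurable_norm measurableSet_Ioc
  rw [← integrable_indicator_iff hm] at hF
  have key : ∀ o : UnitSphere, (fun r : ℝ => Set.indicator {x : R3 | ‖x‖ ∈ Set.Ioc a b} F
      (r • (o : R3))) =ᵐ[radialMeasure]
      Set.indicator (Set.Ioc a b) (fun r => F (r • (o : R3))) := by
    intro o
    filter_upwards [ae_pos_radialMeasure] with r hr
    simp only [Set.indicator_apply, Set.mem_ofPred_eq, norm_polar o hr]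
  have key2 : ∀ o : UnitSphere, ∫ r, Set.indicator {x : R3 | ‖x‖ ∈ Set.Ioc a b} F
      (r • (o : R3)) ∂radialMeasure = ∫ r in Set.Ioc a b, F (r • (o : R3)) ∂radialMeasure := by
    intro o
    rw [integral_congr_ae (key o), integral_indicator measurableSet_Ioc]
  refine ⟨?_, ?_, ?_⟩
  · rw [← integral_indicator hm, integral_polar hF]
    simp only [key2]
  · have := (integrable_polar hF).integral_prod_left
    simpa only [key2] using this
  · filter_upwards [(integrable_polar hF).prod_right_ae] with o ho
    have := (integrable_congr (key o)).1 ho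
    rwa [integrable_indicator_iff measurableSet_Ioc] at this

lemma radialMeasure_real_Ioc {a b : ℝ} (ha : 0 ≤ a) (hab : a ≤ b) :
    radialMeasure.real (Set.Ioc a b) = (b ^ 3 - a ^ 3) / 3 := by
  have h1 : ∫ r in Set.Ioc a b, (1:ℝ) ∂radialMeasure = radialMeasure.real (Set.Ioc a b) := by simp
  rw [← h1, ← integral_indicator measurableSet_Ioc, integral_radialMeasure]
  have : (fun r : ℝ => r ^ 2 • Set.indicator (Set.Ioc a b) (fun _ => (1:ℝ)) r) =
      Set.indicator (Set.Ioc a b) (fun r => r ^ 2) := by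
    ext r; by_cases hr : r ∈ Set.Ioc a b <;> simp [hr]
  rw [this, setIntegral_indicator measurableSet_Ioc, show Set.Ioi 0 ∩ Set.Ioc a b = Set.Ioc a b from
    Set.inter_eq_right.2 fun x (hx : x ∈ Set.Ioc a b) => ha.trans_lt hx.1,
    ← intervalIntegral.integral_of_le hab, integral_pow]
  norm_num

/-- Dyson's inequality: the energy in a ball of radius `R` dominates the soft potential
`3 / (R³ - R₀³)` on the shell `R₀ < |y| ≤ R`, with coupling a lower bound on the scattering
length. -/
theorem IsCoreRadial.dyson {w : R3 → ℝ} {R₀ : ℝ} (hw : IsCoreRadial w R₀) {α : ℝ}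
    (hα : (α : EReal) ≤ scatteringLength w) {R : ℝ} (hR : R₀ < R) {φ : R3 → ℂ}
    {Γ : Fin 3 → R3 → ℂ} (hΓm : ∀ k, Measurable (Γ k)) (hAC : IsRadiallyAC φ Γ)
    (hΓ : ∀ k, IntegrableOn (fun x => ‖Γ k x‖ ^ 2) {x | ‖x‖ ∈ Set.Ioc 0 R})
    (hφ : IntegrableOn (fun x => ‖φ x‖ ^ 2) {x | ‖x‖ ∈ Set.Ioc R₀ R})
    (hpot : IntegrableOn (fun x => w x * ‖φ x‖ ^ 2) {x | ‖x‖ ∈ Set.Ioc 0 R₀}) :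
    α * (3 / (R ^ 3 - R₀ ^ 3) * ∫ x in {x : R3 | ‖x‖ ∈ Set.Ioc R₀ R}, ‖φ x‖ ^ 2) ≤
      (∫ x in {x : R3 | ‖x‖ ∈ Set.Ioc 0 R}, ∑ k, ‖Γ k x‖ ^ 2) +
      1 / 2 * ∫ x in {x : R3 | ‖x‖ ∈ Set.Ioc 0 R₀}, w x * ‖φ x‖ ^ 2 := by
  have hΓs : IntegrableOn (fun x => ∑ k, ‖Γ k x‖ ^ 2) {x : R3 | ‖x‖ ∈ Set.Ioc 0 R} :=
    integrable_finsetSum _ fun k _ => hΓ k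
  obtain ⟨a1, a2, a3⟩ := setIntegral_shell hΓs
  obtain ⟨b1, b2, b3⟩ := setIntegral_shell hφ
  obtain ⟨c1, c2, c3⟩ := setIntegral_shell hpot
  rw [a1, b1, c1]
  have hV : 0 < (R ^ 3 - R₀ ^ 3) / 3 := by
    have := pow_lt_pow_left₀ hR hw.pos.le (n := 3) (by norm_num)
    linarith
  rw [← integral_const_mul, ← integral_const_mul, ← integral_const_mul,
    ← integral_add a2 (c2.const_mul _)]
  refine integral_mono_ae ((b2.const_mul _).const_mul _) (a2.add (c2.const_mul _)) ?_
  filter_upwards [a3, b3, c3, hAC.ae_ray] with o ha hb hc ho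
  have hgm : Measurable (fun u : ℝ => ∑ k, ((o : R3) k : ℂ) * Γ k (u • (o : R3))) := by
    refine Finset.measurable_sum _ fun k _ => ?_
    exact measurable_const.mul ((hΓm k).comp (by fun_prop))
  have hg2 : IntegrableOn (fun u : ℝ => ‖∑ k, ((o : R3) k : ℂ) * Γ k (u • (o : R3))‖ ^ 2)
      (Set.Ioc 0 R) radialMeasure := by
    refine Integrable.mono' ha (hgm.norm.pow_const 2).aestronglyMeasurable
      (Eventually.of_forall fun u => ?_)
    rw [norm_pow, norm_norm]
    exact norm_sq_radial_le o fun k => Γ k (u • (o : R3))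
  have hwp : ∀ᵐ r ∂radialMeasure.restrict (Set.Ioc 0 R₀), w (r • (o : R3)) * ‖φ (r • (o : R3))‖ ^ 2
      = radialProfile w r * ‖φ (r • (o : R3))‖ ^ 2 := by
    rw [ae_restrict_iff' measurableSet_Ioc]
    refine Eventually.of_forall fun r hr => ?_
    rw [hw.radial.eq_profile, norm_polar o hr.1]
  have h1 := hw.energy_le_of_ae hα hgm ho hg2 ((integrable_congr hwp).1 hc)
  rw [← integral_congr_ae hwp] at h1
  have hfin : IsFiniteMeasure (radialMeasure.restrict (Set.Ioc R₀ R)) := by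
    refine ⟨?_⟩
    rw [Measure.restrict_apply_univ]
    by_contra h
    have h5 := radialMeasure_real_Ioc hw.pos.le hR.le
    rw [measureReal_def, not_lt_top_iff.1 h] at h5
    simp at h5; linarith
  have h2 := integral_mono_ae (hb.const_mul α) (integrable_const _) h1
  rw [integral_const_mul, integral_const, measureReal_restrict_apply_univ,
    radialMeasure_real_Ioc hw.pos.le hR.le, smul_eq_mul] at h2
  have h3 : ∫ u in Set.Ioc 0 R, ‖∑ k, ((o : R3) k : ℂ) * Γ k (u • (o : R3))‖ ^ 2 ∂radialMeasure
      ≤ ∫ u in Set.Ioc 0 R, ∑ k, ‖Γ k (u • (o : R3))‖ ^ 2 ∂radialMeasure :=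
    integral_mono hg2 ha fun u => norm_sq_radial_le o fun k => Γ k (u • (o : R3))
  rw [show 3 / (R ^ 3 - R₀ ^ 3) = ((R ^ 3 - R₀ ^ 3) / 3)⁻¹ by rw [inv_div], mul_left_comm,
    inv_mul_le_iff₀ hV]
  refine h2.trans ?_
  gcongr

/-! ### The fundamental theorem of calculus along one-particle flows -/

section Flow
variable {N : ℕ}

/-- The embedding of `ℝ³` as the coordinates of particle `i`. -/
noncomputable def particleIncl (i : Fin N) : R3 →L[ℝ] Config N :=
  ContinuousLinearMap.single ℝ (fun _ => R3) i

/-- The flow `x ↦ x + u ιᵢ(A x + b)` that moves particle `i` only. -/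
noncomputable def flow (i : Fin N) (A : Config N →L[ℝ] R3) (b : R3) (u : ℝ) (x : Config N) :
    Config N := x + u • particleIncl i (A x + b)

lemma continuous_flow (i : Fin N) (A : Config N →L[ℝ] R3) (b : R3) :
    Continuous (fun p : ℝ × Config N => flow i A b p.1 p.2) := by
  unfold flow; fun_prop

/-- The inverse of `flow`, if `A ιᵢ = γ`. -/
noncomputable def flowInv (i : Fin N) (A : Config N →L[ℝ] R3) (b : R3) (γ u : ℝ) (y : Config N) :
    Config N := y - (u / (1 + γ * u)) • particleIncl i (A y + b)

lemma particleUnitVec_eq (i : Fin N) (k : Fin 3) :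
    particleUnitVec i k = particleIncl i (unitVec k) := rfl

lemma R3_eq_sum (z : R3) : z = ∑ k, z k • unitVec k := by
  ext k
  simp [unitVec, Pi.single_apply]

section
variable {i : Fin N} {A : Config N →L[ℝ] R3} {γ : ℝ} {b : R3}

lemma flowInv_flow (hA : ∀ z, A (particleIncl i z) = γ • z) (b : R3)
    {u : ℝ} (hu : 0 < 1 + γ * u) (x : Config N) :
    flowInv i A b γ u (flow i A b u x) = x := by
  have h : A (flow i A b u x) + b = (1 + γ * u) • (A x + b) := by
    simp only [flow, map_add, map_smul, hA]
    module
  rw [flowInv, h, flow, map_smul, smul_smul, div_mul_cancel₀ _ hu.ne', add_sub_cancel_right]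

lemma flow_flowInv (hA : ∀ z, A (particleIncl i z) = γ • z) (b : R3)
    {u : ℝ} (hu : 0 < 1 + γ * u) (y : Config N) :
    flow i A b u (flowInv i A b γ u y) = y := by
  have h : A (flowInv i A b γ u y) + b = (1 + γ * u)⁻¹ • (A y + b) := by
    simp only [flowInv, map_sub, map_smul, hA, map_add]
    have : (1 + γ * u)⁻¹ = 1 - u / (1 + γ * u) * γ := by field_simp; ring
    rw [this]
    module
  rw [flow, h, flowInv, map_smul, smul_smul, div_eq_mul_inv, sub_add_cancel]

lemma A_flow (hA : ∀ z, A (particleIncl i z) = γ • z) (b : R3)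
    (u : ℝ) (x : Config N) : A (flow i A b u x) + b = (1 + γ * u) • (A x + b) := by
  simp only [flow, map_add, map_smul, hA]
  module

/-- Minus the derivative in `u` of `(1 + γ u)⁻³ η (flowInv u y)`. -/
noncomputable def flowDiv (i : Fin N) (A : Config N →L[ℝ] R3) (b : R3) (γ : ℝ) (η : Config N → ℝ)
    (u : ℝ) (y : Config N) : ℝ :=
  ((1 + γ * u) ^ 4)⁻¹ * (3 * γ * η (flowInv i A b γ u y) + (1 + γ * u)⁻¹ *
    fderiv ℝ η (flowInv i A b γ u y) (particleIncl i (A y + b)))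

lemma hasDerivAt_flow_test {η : Config N → ℝ} (hη : ContDiff ℝ ∞ η) {u : ℝ}
    (hu : 0 < 1 + γ * u) (y : Config N) :
    HasDerivAt (fun u => ((1 + γ * u) ^ 3)⁻¹ * η (flowInv i A b γ u y))
      (-flowDiv i A b γ η u y) u := by
  have h0 : HasDerivAt (fun u : ℝ => 1 + γ * u) γ u := by
    simpa using ((hasDerivAt_id u).const_mul γ).const_add 1
  have h1 : HasDerivAt (fun u : ℝ => u / (1 + γ * u)) (((1 + γ * u) ^ 2)⁻¹) u := by
    convert! (hasDerivAt_id u).div h0 hu.ne' using 1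
    simp only [id]; field_simp; ring
  have h2 : HasDerivAt (fun u => flowInv i A b γ u y)
      (-(((1 + γ * u) ^ 2)⁻¹ • particleIncl i (A y + b))) u :=
    (h1.smul_const _).const_sub y
  have h3 := ((hη.differentiable (by simp)).differentiableAt (x := flowInv i A b γ u y)).hasFDerivAt.comp_hasDerivAt u h2
  have h4 := ((h0.pow 3).inv (pow_pos hu 3).ne').mul h3
  convert! h4 using 1
  simp only [flowDiv, map_neg, map_smul, Function.comp, smul_eq_mul, Pi.pow_apply, Pi.inv_apply]
  generalize fderiv ℝ η (flowInv i A b γ u y) (particleIncl i (A y + b)) = D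
  generalize η (flowInv i A b γ u y) = E
  have hu' := hu.ne'
  generalize 1 + γ * u = J at *
  push_cast
  field_simp
  ring

lemma contDiff_flowInv (u : ℝ) : ContDiff ℝ ∞ (flowInv i A b γ u) := by
  unfold flowInv; fun_prop

lemma sum_fderiv_flow_test (hA : ∀ z, A (particleIncl i z) = γ • z)
    {η : Config N → ℝ} (hη : ContDiff ℝ ∞ η) {u : ℝ}
    (hu : 0 < 1 + γ * u) (y : Config N) :
    ∑ k, fderiv ℝ (fun y => ((1 + γ * u) ^ 4)⁻¹ * ((A y + b) k * η (flowInv i A b γ u y))) y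
      (particleUnitVec i k) = flowDiv i A b γ η u y := by
  have hS : HasFDerivAt (flowInv i A b γ u) (ContinuousLinearMap.id ℝ _ - (u / (1 + γ * u)) •
      (particleIncl i).comp A) y := by
    have h1 : HasFDerivAt (fun y => A y + b) A y := A.hasFDerivAt.add_const b
    have h2 := (particleIncl i).hasFDerivAt.comp y h1
    exact (hasFDerivAt_id y).sub (h2.const_smul (u / (1 + γ * u)))
  have hηS := ((hη.differentiable (by simp)).differentiableAt (x := flowInv i A b γ u y)).hasFDerivAt.comp y hS
  have hk : ∀ k : Fin 3, HasFDerivAt (fun y => (A y + b) k) ((EuclideanSpace.proj k).comp A) y := by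
    intro k
    have h1 : HasFDerivAt (fun y => A y + b) A y := A.hasFDerivAt.add_const b
    exact (EuclideanSpace.proj (𝕜 := ℝ) k : R3 →L[ℝ] ℝ).hasFDerivAt.comp y h1
  have hq : ∀ k : Fin 3, fderiv ℝ (fun y => ((1 + γ * u) ^ 4)⁻¹ * ((A y + b) k *
      η (flowInv i A b γ u y))) y (particleUnitVec i k) = ((1 + γ * u) ^ 4)⁻¹ *
      ((A y + b) k * ((1 + γ * u)⁻¹ * fderiv ℝ η (flowInv i A b γ u y) (particleUnitVec i k))
        + γ * η (flowInv i A b γ u y)) := by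
    intro k
    have h3 := ((hk k).mul hηS).const_mul (((1 + γ * u) ^ 4)⁻¹)
    have h4 : fderiv ℝ (fun y => ((1 + γ * u) ^ 4)⁻¹ * ((A y + b) k *
      η (flowInv i A b γ u y))) y = _ := h3.fderiv
    have e : (1 + γ * u)⁻¹ = 1 - u / (1 + γ * u) * γ := by field_simp; ring
    rw [h4, particleUnitVec_eq, e]
    have e1 : (EuclideanSpace.proj k : R3 →L[ℝ] ℝ) (unitVec k) = 1 := by simp [unitVec]
    simp only [smul_add, Function.comp, add_apply, smul_apply,
      ContinuousLinearMap.comp_apply, sub_apply, ContinuousLinearMap.id_apply,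
      hA, map_sub, map_smul, e1, smul_eq_mul]
    ring
  simp only [hq]
  rw [← Finset.mul_sum, Finset.sum_add_distrib, flowDiv]
  have h5 : fderiv ℝ η (flowInv i A b γ u y) (particleIncl i (A y + b))
      = ∑ k, (A y + b) k * fderiv ℝ η (flowInv i A b γ u y) (particleUnitVec i k) := by
    conv_lhs => rw [R3_eq_sum (A y + b)]
    simp only [map_sum, map_smul, smul_eq_mul, particleUnitVec_eq]
  rw [h5, Finset.mul_sum]
  simp only [Finset.sum_const, Finset.card_univ, Fintype.card_fin, nsmul_eq_mul]
  refine congrArg _ ((add_comm _ _).trans (congrArg₂ _ ?_ ?_))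
  · push_cast; ring
  · exact Finset.sum_congr rfl fun k _ => mul_left_comm _ _ _

end

lemma flow_map_integrable {i : Fin N} {A : Config N →L[ℝ] R3} {b : R3} {u J : ℝ}
    (hJ : Measure.map (flow i A b u) volume = ENNReal.ofReal J • (volume : Measure (Config N)))
    {E : Type*} [NormedAddCommGroup E] {F : Config N → E} (hF : Integrable F) :
    Integrable (fun x => F (flow i A b u x)) := by
  have : Integrable F (Measure.map (flow i A b u) volume) := by
    rw [hJ]; exact hF.smul_measure (by simp)
  exact this.comp_measurable (by unfold flow; fun_prop)

lemma flow_map_integral {i : Fin N} {A : Config N →L[ℝ] R3} {b : R3} {u J : ℝ} (hJ0 : 0 ≤ J)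
    (hJ : Measure.map (flow i A b u) volume = ENNReal.ofReal J • (volume : Measure (Config N)))
    {E : Type*} [NormedAddCommGroup E] [NormedSpace ℝ E] {F : Config N → E}
    (hF : AEStronglyMeasurable F) : ∫ x, F (flow i A b u x) = J • ∫ y, F y := by
  rw [← integral_map (f := F) (by unfold flow; fun_prop) ?_, hJ, integral_smul_measure,
    ENNReal.toReal_ofReal hJ0]
  rw [hJ]; exact hF.mono_ac Measure.smul_absolutelyContinuous

lemma measurable_flow (i : Fin N) (A : Config N →L[ℝ] R3) (b : R3) :
    Measurable (fun p : ℝ × Config N => flow i A b p.1 p.2) := (continuous_flow i A b).measurable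

lemma measurable_flowInv (i : Fin N) (A : Config N →L[ℝ] R3) (b : R3) (γ : ℝ) :
    Measurable (fun p : ℝ × Config N => flowInv i A b γ p.1 p.2) := by
  unfold flowInv; fun_prop

lemma measurable_flowDiv (i : Fin N) (A : Config N →L[ℝ] R3) (b : R3) (γ : ℝ)
    {η : Config N → ℝ} (hη : ContDiff ℝ ∞ η) :
    Measurable (fun p : ℝ × Config N => flowDiv i A b γ η p.1 p.2) := by
  have h1 := measurable_flowInv i A b γ
  have h2 : Measurable (fun p : ℝ × Config N => fderiv ℝ η (flowInv i A b γ p.1 p.2)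
      (particleIncl i (A p.2 + b))) := by
    have h3 : Continuous (fun q : Config N × Config N => fderiv ℝ η q.1 q.2) :=
      ((hη.continuous_fderiv (by simp)).comp continuous_fst).clm_apply continuous_snd
    exact h3.measurable.comp (h1.prodMk (by fun_prop))
  have h3 := hη.continuous.measurable.comp h1
  unfold flowDiv
  exact Measurable.mul (by fun_prop) ((measurable_const.mul h3).add (Measurable.mul (by fun_prop) h2))

lemma continuousOn_flowDiv (i : Fin N) (A : Config N →L[ℝ] R3) (b : R3) (γ : ℝ)
    {η : Config N → ℝ} (hη : ContDiff ℝ ∞ η) :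
    ContinuousOn (fun p : ℝ × Config N => flowDiv i A b γ η p.1 p.2)
      {p | 0 < 1 + γ * p.1} := by
  have h0 : ∀ p ∈ {p : ℝ × Config N | 0 < 1 + γ * p.1}, 1 + γ * p.1 ≠ 0 := fun p hp => ne_of_gt hp
  have h1 : ContinuousOn (fun p : ℝ × Config N => flowInv i A b γ p.1 p.2)
      {p | 0 < 1 + γ * p.1} := by
    unfold flowInv
    refine ContinuousOn.sub (by fun_prop) (ContinuousOn.smul (ContinuousOn.div (by fun_prop)
      (by fun_prop) h0) (by fun_prop))
  have h2 : ContinuousOn (fun p : ℝ × Config N => fderiv ℝ η (flowInv i A b γ p.1 p.2)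
      (particleIncl i (A p.2 + b))) {p | 0 < 1 + γ * p.1} :=
    ((hη.continuous_fderiv (by simp)).comp_continuousOn h1).clm_apply (by fun_prop)
  have h3 := hη.continuous.comp_continuousOn h1
  unfold flowDiv
  refine ContinuousOn.mul (ContinuousOn.inv₀ (by fun_prop) fun p hp => pow_ne_zero _ (h0 p hp))
    ((continuousOn_const.mul h3).add (ContinuousOn.mul (ContinuousOn.inv₀ (by fun_prop) h0) h2))

/-- The weak derivative integrates to differences along the flow. -/
theorem weak_flow_ftc {i : Fin N} {A : Config N →L[ℝ] R3} {γ : ℝ} {b : R3}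
    (hA : ∀ z, A (particleIncl i z) = γ • z)
    (hJ : ∀ u, 0 < 1 + γ * u → Measure.map (flow i A b u) volume =
      ENNReal.ofReal ((1 + γ * u) ^ 3)⁻¹ • (volume : Measure (Config N)))
    {ψ : Config N → ℂ} {G : Fin 3 → Config N → ℂ} (hψm : Measurable ψ) (hGm : ∀ k, Measurable (G k))
    (hG : ∀ k, HasWeakDirDeriv ψ (G k) (particleUnitVec i k))
    {T : ℝ} (hT : 0 < 1 + γ * T) :
    ∀ᵐ x, ψ (flow i A b T x) - ψ x =
      ∫ u in (0:ℝ)..T, ∑ k, ((A x + b) k : ℂ) * G k (flow i A b u x) := by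
  have hpos : ∀ u ∈ Set.uIcc 0 T, 0 < 1 + γ * u := by
    intro u hu
    have : Convex ℝ {u : ℝ | 0 < 1 + γ * u} := by
      intro x hx y hy a b ha hb hab
      simp only [Set.mem_ofPred_eq, smul_eq_mul] at *
      have : 1 + γ * (a * x + b * y) = a * (1 + γ * x) + b * (1 + γ * y) := by
        linear_combination -hab
      rw [this]
      rcases ha.eq_or_lt with rfl | ha
      · have : b = 1 := by linarith
        subst this; simpa using hy
      · positivity
    exact this.ordConnected.uIcc_subset (by simp) (by simpa using hT) hu
  have hsub : Set.uIoc 0 T ⊆ Set.uIcc 0 T := Set.uIoc_subset_uIcc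
  have : IsFiniteMeasure (volume.restrict (Set.uIoc 0 T)) :=
    ⟨by rw [Measure.restrict_apply_univ, Set.uIoc]; simp⟩
  have hJ0 : ∀ u, 0 < 1 + γ * u → 0 ≤ ((1 + γ * u) ^ 3)⁻¹ := fun u hu => by positivity
  -- the flow of a compact set stays in a compact set
  have hcomp : ∀ K : Set (Config N), IsCompact K → IsCompact
      ((fun p : ℝ × Config N => flow i A b p.1 p.2) '' (Set.uIcc 0 T ×ˢ K)) := fun K hK =>
    (isCompact_uIcc.prod hK).image (continuous_flow i A b)
  -- integrability of the right-hand side on compact sets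
  have hK : ∀ K : Set (Config N), IsCompact K → ∀ k, Integrable (fun p : ℝ × Config N =>
      Set.indicator K (fun x => G k (flow i A b p.1 x)) p.2)
      ((volume.restrict (Set.uIoc 0 T)).prod volume) := by
    intro K hK k
    set K₂ := (fun p : ℝ × Config N => flow i A b p.1 p.2) '' (Set.uIcc 0 T ×ˢ K) with hK₂
    have hF : Integrable (Set.indicator K₂ (G k)) :=
      ((hG k).locallyIntegrable_deriv.integrableOn_isCompact (hcomp K hK)).integrable_indicator
        (hcomp K hK).measurableSet
    have heq : ∀ u ∈ Set.uIoc 0 T, (fun x => Set.indicator K (fun x => G k (flow i A b u x)) x) =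
        Set.indicator K (fun x => Set.indicator K₂ (G k) (flow i A b u x)) := by
      intro u hu
      refine Set.indicator_congr fun x hx => ?_
      rw [Set.indicator_of_mem]
      exact ⟨(u, x), ⟨hsub hu, hx⟩, rfl⟩
    have hmeas : Measurable (fun p : ℝ × Config N =>
        Set.indicator K (fun x => G k (flow i A b p.1 x)) p.2) := by
      have : (fun p : ℝ × Config N => Set.indicator K (fun x => G k (flow i A b p.1 x)) p.2) =
          Set.indicator (Prod.snd ⁻¹' K) (fun p => G k (flow i A b p.1 p.2)) := rfl
      rw [this]
      exact ((hGm k).comp (measurable_flow i A b)).indicator (measurable_snd hK.measurableSet)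
    rw [integrable_prod_iff hmeas.aestronglyMeasurable]
    constructor
    · rw [ae_restrict_iff' measurableSet_uIoc]
      refine Eventually.of_forall fun u hu => ?_
      change Integrable (fun x => Set.indicator K (fun x => G k (flow i A b u x)) x) _
      rw [heq u hu]
      exact (flow_map_integrable (hJ u (hpos u (hsub hu))) hF).indicator hK.measurableSet
    · have hc : ContinuousOn (fun u : ℝ => ((1 + γ * u) ^ 3)⁻¹ *
          ∫ y, ‖Set.indicator K₂ (G k) y‖) (Set.uIcc 0 T) :=
        (ContinuousOn.inv₀ (by fun_prop) fun u hu => pow_ne_zero _ (hpos u hu).ne').mul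
          continuousOn_const
      refine Integrable.mono' ((hc.integrableOn_compact isCompact_uIcc).mono_set hsub)
        hmeas.stronglyMeasurable.norm.integral_prod_right'.aestronglyMeasurable ?_
      rw [ae_restrict_iff' measurableSet_uIoc]
      refine Eventually.of_forall fun u hu => ?_
      have h1 := flow_map_integral (hJ0 u (hpos u (hsub hu))) (hJ u (hpos u (hsub hu))) hF.norm.1
      rw [← smul_eq_mul, ← h1, Real.norm_of_nonneg (integral_nonneg fun _ => norm_nonneg _)]
      refine integral_mono_of_nonneg (Eventually.of_forall fun _ => norm_nonneg _)
        (flow_map_integrable (hJ u (hpos u (hsub hu))) hF.norm) (Eventually.of_forall fun x => ?_)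
      have h2 := congrFun (heq u hu) x
      simp only at h2 ⊢
      rw [h2]
      exact norm_indicator_le_norm_self _ _
  -- the derivative of the test function is bounded with compact support
  have hD : ∀ η : Config N → ℝ, ContDiff ℝ ∞ η → HasCompactSupport η →
      Integrable (fun p : ℝ × Config N => flowDiv i A b γ η p.1 p.2 • ψ p.2)
      ((volume.restrict (Set.uIoc 0 T)).prod volume) := by
    intro η hη hηc
    set K₂ := (fun p : ℝ × Config N => flow i A b p.1 p.2) '' (Set.uIcc 0 T ×ˢ tsupport η) with hK₂
    have hK₂c := hcomp _ hηc.isCompact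
    obtain ⟨C, hC⟩ := (isCompact_uIcc.prod hK₂c).exists_bound_of_continuousOn
      ((continuousOn_flowDiv i A b γ hη).mono fun p hp => hpos p.1 hp.1)
    have hF : Integrable (Set.indicator K₂ ψ) :=
      ((hG 0).locallyIntegrable.integrableOn_isCompact hK₂c).integrable_indicator
        hK₂c.measurableSet
    refine Integrable.mono' ((hF.norm.const_mul C).comp_snd (volume.restrict (Set.uIoc 0 T)))
      (((measurable_flowDiv i A b γ hη).smul (hψm.comp measurable_snd)).aestronglyMeasurable) ?_
    have hae : ∀ᵐ p ∂(volume.restrict (Set.uIoc 0 T)).prod (volume : Measure (Config N)),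
        p.1 ∈ Set.uIoc 0 T :=
      Measure.quasiMeasurePreserving_fst.ae (ae_restrict_mem measurableSet_uIoc)
    filter_upwards [hae] with p hp
    by_cases hp2 : p.2 ∈ K₂
    · rw [norm_smul, Set.indicator_of_mem hp2]
      exact mul_le_mul_of_nonneg_right (hC p ⟨hsub hp, hp2⟩) (norm_nonneg _)
    · have h3 : flowInv i A b γ p.1 p.2 ∉ tsupport η := by
        intro h
        exact hp2 ⟨(p.1, flowInv i A b γ p.1 p.2), ⟨hsub hp, h⟩,
          flow_flowInv hA b (hpos _ (hsub hp)) p.2⟩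
      have h4 : flowDiv i A b γ η p.1 p.2 = 0 := by
        have h5 : fderiv ℝ η (flowInv i A b γ p.1 p.2) = 0 := by
          by_contra h6
          exact h3 (support_fderiv_subset ℝ h6)
        rw [flowDiv, image_eq_zero_of_notMem_tsupport h3, h5]; simp
      rw [h4, Set.indicator_of_notMem hp2]; simp
  have hKsum : ∀ K : Set (Config N), IsCompact K → Integrable (fun p : ℝ × Config N =>
      Set.indicator K (fun x => ∑ k, ((A x + b) k : ℂ) * G k (flow i A b p.1 x)) p.2)
      ((volume.restrict (Set.uIoc 0 T)).prod volume) := by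
    intro K hKc
    have h1 : ∀ k : Fin 3, Integrable (fun p : ℝ × Config N =>
      (Set.indicator K (fun x => ((A x + b) k : ℂ)) p.2) *
        Set.indicator K (fun x => G k (flow i A b p.1 x)) p.2)
        ((volume.restrict (Set.uIoc 0 T)).prod volume) := by
      intro k
      have hcont : Continuous (fun x => ((A x + b) k : ℂ)) := by fun_prop
      obtain ⟨C, hC⟩ := hKc.exists_bound_of_continuousOn hcont.continuousOn
      refine (hK K hKc k).bdd_mul (c := max C 0) ?_ (Eventually.of_forall fun p => ?_)
      · exact ((hcont.measurable.indicator hKc.measurableSet).comp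
          measurable_snd).aestronglyMeasurable
      · by_cases hp : p.2 ∈ K
        · rw [Set.indicator_of_mem hp]; exact (hC _ hp).trans (le_max_left _ _)
        · rw [Set.indicator_of_notMem hp]; simp
    refine (integrable_finsetSum Finset.univ fun k _ => h1 k).congr (Eventually.of_forall fun p => ?_)
    by_cases hp : p.2 ∈ K <;> simp [hp]
  have hsgn : ∀ f : ℝ → ℂ, ∫ u in (0:ℝ)..T, f u = (if 0 ≤ T then (1:ℝ) else -1) •
      ∫ u in Set.uIoc 0 T, f u := fun f => intervalIntegral.intervalIntegral_eq_integral_uIoc _ _ _ _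
  refine ae_eq_of_integral_contDiff_smul_eq ?_ ?_ ?_
  · refine LocallyIntegrable.sub ?_ (hG 0).locallyIntegrable
    rw [locallyIntegrable_iff]
    intro K hKc
    have hK₂c := hcomp K hKc
    have hF := ((hG 0).locallyIntegrable.integrableOn_isCompact hK₂c).integrable_indicator
        hK₂c.measurableSet
    refine (flow_map_integrable (hJ T hT) hF).integrableOn.congr_fun (fun x hx => ?_)
      hKc.measurableSet
    exact Set.indicator_of_mem (s := (fun p : ℝ × Config N => flow i A b p.1 p.2) ''
      (Set.uIcc 0 T ×ˢ K)) ⟨(T, x), ⟨Set.right_mem_uIcc, hx⟩, rfl⟩ ψ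
  · rw [locallyIntegrable_iff]
    intro K hKc
    simp only [hsgn]
    have hh : IntegrableOn (fun x => ∫ u in Set.uIoc 0 T, ∑ k, ((A x + b) k : ℂ) *
        G k (flow i A b u x)) K := by
      rw [← integrable_indicator_iff hKc.measurableSet]
      refine (hKsum K hKc).integral_prod_right.congr (Eventually.of_forall fun x => ?_)
      by_cases hx : x ∈ K <;> simp [hx]
    exact hh.fun_smul (if 0 ≤ T then (1:ℝ) else -1)
  · intro η hη hηc
    have hηK := hηc.isCompact
    -- left-hand side
    have hηS : ∀ u, 0 < 1 + γ * u → HasCompactSupport (fun y => η (flowInv i A b γ u y)) := by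
      intro u hu
      refine HasCompactSupport.of_support_subset_isCompact
        (hηK.image (f := flow i A b u) (by unfold flow; fun_prop)) ?_
      intro y hy
      exact ⟨flowInv i A b γ u y, subset_tsupport _ hy, flow_flowInv hA b hu y⟩
    have hηSi : ∀ u, 0 < 1 + γ * u → Integrable (fun y => η (flowInv i A b γ u y) • ψ y) := by
      intro u hu
      exact (hG 0).locallyIntegrable.integrable_smul_left_of_hasCompactSupport
        (hη.continuous.comp (contDiff_flowInv (b := b) u).continuous) (hηS u hu)
    have e0 : ∀ u, 0 < 1 + γ * u → ∫ x, η x • ψ (flow i A b u x) =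
        ((1 + γ * u) ^ 3)⁻¹ • ∫ y, η (flowInv i A b γ u y) • ψ y := by
      intro u hu
      rw [← flow_map_integral (hJ0 u hu) (hJ u hu) (hηSi u hu).1]
      simp only [flowInv_flow hA b hu]
    have hm0 : (0:ℝ) < 1 + γ * 0 := by simp
    have hηψ : Integrable (fun x => η x • ψ x) :=
      (hG 0).locallyIntegrable.integrable_smul_left_of_hasCompactSupport hη.continuous hηc
    have hηψT : Integrable (fun x => η x • ψ (flow i A b T x)) := by
      have := flow_map_integrable (hJ T hT) (hηSi T hT)
      simpa only [flowInv_flow hA b hT] using this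
    have ftc : ∀ y, ((1 + γ * T) ^ 3)⁻¹ * η (flowInv i A b γ T y) - η y =
        ∫ u in (0:ℝ)..T, -flowDiv i A b γ η u y := by
      intro y
      rw [intervalIntegral.integral_eq_sub_of_hasDerivAt
        (f := fun u => ((1 + γ * u) ^ 3)⁻¹ * η (flowInv i A b γ u y))
        (fun u hu => hasDerivAt_flow_test hη (hpos u hu) y)]
      · simp [flowInv]
      · refine ContinuousOn.intervalIntegrable (ContinuousOn.neg ?_)
        exact (continuousOn_flowDiv i A b γ hη).comp (f := fun u => (u, y)) (by fun_prop)
          (fun u hu => hpos u hu)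
    have lhs : ∫ x, η x • (ψ (flow i A b T x) - ψ x) = (if 0 ≤ T then (1:ℝ) else -1) •
        ∫ u in Set.uIoc 0 T, ∫ y, -(flowDiv i A b γ η u y • ψ y) := by
      simp only [smul_sub]
      have hI : Integrable (fun y => ((1 + γ * T) ^ 3)⁻¹ • η (flowInv i A b γ T y) • ψ y) :=
        (hηSi T hT).fun_smul _
      rw [integral_sub hηψT hηψ, e0 T hT, ← integral_smul, ← integral_sub hI hηψ]
      rw [integral_integral_swap (f := fun u y => -(flowDiv i A b γ η u y • ψ y)) (hD η hη hηc).neg,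
        ← integral_smul]
      congr 1; ext y
      rw [smul_smul, ← sub_smul, ftc, ← hsgn, ← intervalIntegral.integral_smul_const]
      simp only [neg_smul]
    rw [lhs]
    have rhs : ∫ x, η x • ∫ u in (0:ℝ)..T, ∑ k, ((A x + b) k : ℂ) * G k (flow i A b u x) =
        (if 0 ≤ T then (1:ℝ) else -1) • ∫ u in Set.uIoc 0 T, ∫ x, η x •
          ∑ k, ((A x + b) k : ℂ) * G k (flow i A b u x) := by
      simp only [hsgn]
      have hint : Integrable (fun p : ℝ × Config N => η p.2 • ∑ k, ((A p.2 + b) k : ℂ) *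
          G k (flow i A b p.1 p.2)) ((volume.restrict (Set.uIoc 0 T)).prod volume) := by
        obtain ⟨C, hC⟩ := hηc.exists_bound_of_continuous hη.continuous
        refine ((hKsum _ hηK).bdd_smul (φ := fun p : ℝ × Config N => η p.2) C
          (hη.continuous.comp continuous_snd).aestronglyMeasurable
          (Eventually.of_forall fun p => hC p.2)).congr (Eventually.of_forall fun p => ?_)
        by_cases hp : p.2 ∈ tsupport η
        · simp [hp]
        · simp [image_eq_zero_of_notMem_tsupport hp]
      rw [integral_integral_swap (f := fun u x => η x • ∑ k, ((A x + b) k : ℂ) *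
        G k (flow i A b u x)) hint, ← integral_smul]
      congr 1; ext x
      rw [integral_smul, smul_comm]
    rw [rhs]
    congr 1
    refine setIntegral_congr_fun measurableSet_uIoc fun u hu => ?_
    have hu0 := hpos u (hsub hu)
    simp only
    have hq : ∀ k, ContDiff ℝ ∞ (fun y => ((1 + γ * u) ^ 4)⁻¹ * ((A y + b) k *
        η (flowInv i A b γ u y))) := by
      intro k
      have h1 := hη.comp (contDiff_flowInv (i := i) (A := A) (b := b) (γ := γ) u)
      have h2 : ContDiff ℝ ∞ (fun y => (A y + b) k) := by fun_prop
      exact contDiff_const.mul (h2.mul h1)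
    have hqc : ∀ k, HasCompactSupport (fun y => ((1 + γ * u) ^ 4)⁻¹ * ((A y + b) k *
        η (flowInv i A b γ u y))) := fun k => ((hηS u hu0).mul_left).mul_left
    have hqi : ∀ k, Integrable (fun y => (((1 + γ * u) ^ 4)⁻¹ * ((A y + b) k *
        η (flowInv i A b γ u y))) • G k y) := fun k =>
      (hG k).locallyIntegrable_deriv.integrable_smul_left_of_hasCompactSupport (hq k).continuous (hqc k)
    have hqd : ∀ k, Integrable (fun y => (fderiv ℝ (fun y => ((1 + γ * u) ^ 4)⁻¹ * ((A y + b) k *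
        η (flowInv i A b γ u y))) y (particleUnitVec i k)) • ψ y) := fun k =>
      (hG k).locallyIntegrable.integrable_smul_left_of_hasCompactSupport
        (((hq k).continuous_fderiv (by simp)).clm_apply continuous_const) ((hqc k).fderiv_apply ℝ _)
    rw [integral_neg]
    simp only [← sum_fderiv_flow_test hA hη hu0, Finset.sum_smul]
    rw [integral_finsetSum _ fun k _ => hqd k, ← Finset.sum_neg_distrib]
    have h7 : ∀ k, -∫ y, (fderiv ℝ (fun y => ((1 + γ * u) ^ 4)⁻¹ * ((A y + b) k *
        η (flowInv i A b γ u y))) y (particleUnitVec i k)) • ψ y =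
        ∫ y, (((1 + γ * u) ^ 4)⁻¹ * ((A y + b) k * η (flowInv i A b γ u y))) • G k y := by
      intro k
      rw [(hG k).integral_eq _ (hq k) (hqc k), neg_neg]
    simp only [h7]
    rw [← integral_finsetSum _ fun k _ => hqi k]
    have hS := integrable_finsetSum Finset.univ fun k _ => hqi k
    have h8 : ∫ x, (1 + γ * u) ^ 3 • ∑ k, (((1 + γ * u) ^ 4)⁻¹ * ((A (flow i A b u x) + b) k *
        η (flowInv i A b γ u (flow i A b u x)))) • G k (flow i A b u x) =
        ∫ y, ∑ k, (((1 + γ * u) ^ 4)⁻¹ * ((A y + b) k * η (flowInv i A b γ u y))) • G k y := by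
      rw [integral_smul, flow_map_integral (hJ0 u hu0) (hJ u hu0) hS.1, smul_smul,
        mul_inv_cancel₀ (by positivity), one_smul]
    rw [← h8]
    congr 1; ext x
    rw [flowInv_flow hA b hu0, A_flow hA b, Finset.smul_sum, Finset.smul_sum]
    refine Finset.sum_congr rfl fun k _ => ?_
    have hu1 : ((1 + γ * u : ℝ) : ℂ) ≠ 0 := by exact_mod_cast hu0.ne'
    simp only [PiLp.smul_apply, smul_eq_mul, Complex.real_smul]
    push_cast at hu1 ⊢
    field_simp
end Flow

section Instances
variable {N : ℕ}

lemma flow_translation (i : Fin N) (h : R3) (u : ℝ) (x : Config N) :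
    flow i 0 h u x = x + u • particleIncl i h := by simp [flow]

lemma weak_translation_ftc {i : Fin N} {ψ : Config N → ℂ} {G : Fin 3 → Config N → ℂ}
    (hψm : Measurable ψ) (hGm : ∀ k, Measurable (G k))
    (hG : ∀ k, HasWeakDirDeriv ψ (G k) (particleUnitVec i k)) (h : R3) :
    ∀ᵐ x, ψ (x + particleIncl i h) - ψ x =
      ∫ u in (0:ℝ)..1, ∑ k, (h k : ℂ) * G k (x + u • particleIncl i h) := by
  have := weak_flow_ftc (i := i) (A := 0) (γ := 0) (b := h) (by simp) ?_ hψm hGm hG (T := 1) (by simp)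
  · simpa [flow_translation] using this
  · intro u _
    have : flow i 0 h u = fun x => x + u • particleIncl i h := by ext1 x; exact flow_translation i h u x
    rw [this, map_add_right_eq_self]
    simp

/-- The difference `x ↦ xᵢ - xⱼ`. -/
noncomputable def pairDiff (i j : Fin N) : Config N →L[ℝ] R3 :=
  (ContinuousLinearMap.proj i : Config N →L[ℝ] R3) - ContinuousLinearMap.proj j

lemma pairDiff_incl {i j : Fin N} (hij : i ≠ j) (z : R3) :
    pairDiff i j (particleIncl i z) = (1:ℝ) • z := by
  simp [pairDiff, particleIncl, Pi.single_eq_of_ne hij.symm]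

lemma flow_dilation_update {i j : Fin N} (hij : i ≠ j) (x : Config N) (y : R3) (u : ℝ) :
    flow i (pairDiff i j) 0 u (Function.update x i (x j + y)) =
      Function.update x i (x j + (1 + u) • y) := by
  have h1 : pairDiff i j (Function.update x i (x j + y)) = y := by
    simp [pairDiff, hij.symm]
  rw [flow, h1]
  ext1 k
  rcases eq_or_ne k i with rfl | hk
  · simp [particleIncl]; module
  · simp [particleIncl, hk]

lemma det_dilation {i j : Fin N} (hij : i ≠ j) (u : ℝ) :
    LinearMap.det (LinearMap.id + u • ((particleIncl i).comp (pairDiff i j) :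
      Config N →L[ℝ] Config N).toLinearMap) = (1 + u) ^ 3 := by
  set T := LinearMap.id + u • ((particleIncl i).comp (pairDiff i j) :
      Config N →L[ℝ] Config N).toLinearMap with hT
  set E : Config N →ₗ[ℝ] Config N := ((particleIncl i).comp (ContinuousLinearMap.proj j) :
      Config N →L[ℝ] Config N).toLinearMap with hE
  set D : Config N →ₗ[ℝ] Config N := LinearMap.pi (fun k =>
    ((if k = i then (1 + u) else 1 : ℝ) • (LinearMap.id : R3 →ₗ[ℝ] R3)).comp (LinearMap.proj k)) with hD
  have h1 : T.comp (LinearMap.id + E) = (LinearMap.id + E).comp D := by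
    refine LinearMap.ext fun x => ?_
    ext1 k
    rcases eq_or_ne k i with rfl | hk
    · simp [hT, hE, hD, pairDiff, particleIncl, hij.symm]; module
    · simp [hT, hE, hD, pairDiff, particleIncl, hk]
  have h2 : (LinearMap.id + E).comp (LinearMap.id - E) = LinearMap.id := by
    refine LinearMap.ext fun x => ?_
    ext1 k
    rcases eq_or_ne k i with rfl | hk
    · simp [hE, particleIncl, hij.symm]
    · simp [hE, particleIncl, hk]
  have h3 := congrArg LinearMap.det h1
  have h4 := congrArg LinearMap.det h2
  rw [LinearMap.det_comp] at h3 h4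
  rw [LinearMap.det_id] at h4
  rw [LinearMap.det_comp, mul_comm] at h3
  have h5 := mul_left_cancel₀ (left_ne_zero_of_mul_eq_one h4) h3
  rw [h5, hD, LinearMap.det_pi]
  simp only [LinearMap.det_smul, LinearMap.det_id, mul_one, finrank_euclideanSpace, Fintype.card_fin]
  rw [Finset.prod_eq_single i] <;> simp +contextual

lemma ae_update {i : Fin N} {p : Config N → Prop} (h : ∀ᵐ x, p x) :
    ∀ᵐ x, ∀ᵐ z : R3, p (Function.update x i z) := by
  obtain ⟨n, rfl⟩ : ∃ n, N = n + 1 := ⟨N - 1, by have := i.2; omega⟩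
  have e := volume_preserving_piFinSuccAbove (fun _ : Fin (n + 1) => R3) i
  have h1 := (MeasurePreserving.symm _ e).quasiMeasurePreserving.ae h
  have h2 : ∀ᵐ q : (Fin n → R3) × R3, p ((MeasurableEquiv.piFinSuccAbove
      (fun _ : Fin (n + 1) => R3) i).symm (q.2, q.1)) :=
    (Measure.measurePreserving_swap.quasiMeasurePreserving).ae h1
  have h3 := Measure.ae_ae_of_ae_prod h2
  have h4 := (Measure.quasiMeasurePreserving_snd.comp e.quasiMeasurePreserving).ae h3
  filter_upwards [h4] with x hx
  filter_upwards [hx] with z hz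
  convert! hz using 1
  ext1 k
  refine Fin.succAboveCases i ?_ (fun m => ?_) k <;>
  simp [MeasurableEquiv.piFinSuccAbove, Fin.insertNthEquiv, Fin.removeNth]

/-- As a function of the position of particle `i`, almost every section of `ψ` is absolutely
continuous along almost all rays that issue from particle `j`: apply `weak_flow_ftc` to the dilations of `x_i`
about `x_j`. -/
lemma ae_isRadiallyAC {i j : Fin N} (hij : i ≠ j) {ψ : Config N → ℂ} {G : Fin 3 → Config N → ℂ}
    (hψm : Measurable ψ) (hGm : ∀ k, Measurable (G k))
    (hG : ∀ k, HasWeakDirDeriv ψ (G k) (particleUnitVec i k)) :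
    ∀ᵐ x : Config N, IsRadiallyAC (fun y => ψ (Function.update x i (x j + y)))
      (fun k y => G k (Function.update x i (x j + y))) := by
  set A := pairDiff i j
  have hJ : ∀ u, 0 < 1 + (1:ℝ) * u → Measure.map (flow i A 0 u) volume =
      ENNReal.ofReal ((1 + 1 * u) ^ 3)⁻¹ • (volume : Measure (Config N)) := by
    intro u hu
    rw [one_mul] at hu ⊢
    have hdet := det_dilation hij u
    have h1 := Measure.map_linearMap_addHaar_eq_smul_addHaar (volume : Measure (Config N))
      (f := LinearMap.id + u • ((particleIncl i).comp (pairDiff i j) :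
      Config N →L[ℝ] Config N).toLinearMap) (by rw [hdet]; positivity)
    rw [hdet, abs_of_pos (by positivity)] at h1
    rw [← h1]
    congr 1
    ext1 x
    simp [flow, A]
  have h1 : ∀ c : ℝ, 0 < c → ∀ᵐ x, ψ (flow i A 0 (c - 1) x) - ψ x =
      ∫ u in (0:ℝ)..(c - 1), ∑ k, ((A x + 0) k : ℂ) * G k (flow i A 0 u x) := fun c hc =>
    weak_flow_ftc (pairDiff_incl hij) hJ hψm hGm hG (T := c - 1) (by linarith)
  have h2 : ∀ᵐ x, ∀ᵐ c : ℝ, 0 < c → ψ (flow i A 0 (c - 1) x) - ψ x =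
      ∫ u in (0:ℝ)..(c - 1), ∑ k, ((A x + 0) k : ℂ) * G k (flow i A 0 u x) := by
    rw [Measure.ae_ae_comm]
    · refine Eventually.of_forall fun c => ?_
      by_cases hc : 0 < c
      · filter_upwards [h1 c hc] with x hx _ using hx
      · exact Eventually.of_forall fun x h => absurd h hc
    · have hflow := measurable_flow i A 0
      have m1 : Measurable (fun q : Config N × ℝ => ψ (flow i A 0 (q.2 - 1) q.1) - ψ q.1) :=
        (hψm.comp (hflow.comp ((measurable_snd.sub_const 1).prodMk measurable_fst))).sub
          (hψm.comp measurable_fst)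
      have m0 : Measurable (fun q : (Config N × ℝ) × ℝ =>
          ∑ k, ((A q.1.1 + 0) k : ℂ) * G k (flow i A 0 q.2 q.1.1)) := by
        refine Finset.measurable_sum _ fun k _ => Measurable.mul ?_ ?_
        · fun_prop
        · exact (hGm k).comp (hflow.comp (measurable_snd.prodMk (measurable_fst.comp measurable_fst)))
      have m2 : Measurable (fun q : Config N × ℝ =>
          ∫ u in (0:ℝ)..(q.2 - 1), ∑ k, ((A q.1 + 0) k : ℂ) * G k (flow i A 0 u q.1)) := by
        have s1 : MeasurableSet {q : (Config N × ℝ) × ℝ | q.2 ∈ Set.Ioc 0 (q.1.2 - 1)} :=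
          (measurableSet_lt measurable_const measurable_snd).inter
            (measurableSet_le measurable_snd (by fun_prop))
        have s2 : MeasurableSet {q : (Config N × ℝ) × ℝ | q.2 ∈ Set.Ioc (q.1.2 - 1) 0} :=
          (measurableSet_lt (by fun_prop) measurable_snd).inter
            (measurableSet_le measurable_snd measurable_const)
        have t1 := ((m0.indicator s1).stronglyMeasurable.integral_prod_right' (ν := volume)).measurable
        have t2 := ((m0.indicator s2).stronglyMeasurable.integral_prod_right' (ν := volume)).measurable
        convert! t1.sub t2 using 1
        ext1 q
        rw [intervalIntegral, ← integral_indicator measurableSet_Ioc,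
          ← integral_indicator measurableSet_Ioc]
        rfl
      have := (measurableSet_lt (measurable_const (a := (0:ℝ))) (measurable_snd (α := Config N))).compl.union
        (measurableSet_eq_fun m1 m2)
      convert! this using 1
      ext q
      simp [imp_iff_not_or]
  filter_upwards [ae_update (i := i) h2] with x hx
  have hx2 := (measurePreserving_add_left (volume : Measure R3) (x j)).quasiMeasurePreserving.ae hx
  filter_upwards [hx2] with y hy
  filter_upwards [hy] with c hc hc0
  have h3 := hc hc0
  have h4 : A (Function.update x i (x j + y)) = y := by simp [A, pairDiff, hij.symm]
  have h6 : ∀ u, flow i A 0 u (Function.update x i (x j + y)) =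
      Function.update x i (x j + (1 + u) • y) := fun u => flow_dilation_update hij x y u
  simp only [h6, h4, add_sub_cancel] at h3
  rw [h3, add_zero]
  have h5 := intervalIntegral.integral_comp_add_left (a := 0) (b := c - 1) (fun u =>
    ∑ k, (y k : ℂ) * G k (Function.update x i (x j + u • y))) 1
  rw [h5]
  simp
end Instances

/-! ### The pair inequality in a ball -/

/-- The hypotheses on the potential `vp + vm` that enter the lower bound: range `R₀`, scattering
length at least `1`, and stability of `c (vp + (1 + t) vm)`. -/
structure IsAdmissible (vp vm : R3 → ℝ) (R₀ t c lamM : ℝ) : Prop where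
  core : IsCoreRadial (fun x => vp x + vm x) R₀
  coreStable : IsCoreRadial (fun x => c * ((vp x + vm x) + t * vm x)) R₀
  measurable_pos : Measurable vp
  measurable_neg : Measurable vm
  one_le_scatteringLength : 1 ≤ scatteringLength (fun x => vp x + vm x)
  zero_le_scatteringLength : 0 ≤ scatteringLength (fun x => c * ((vp x + vm x) + t * vm x))
  eq_zero : ∀ x, R₀ < ‖x‖ → vp x + vm x = 0
  nonneg : ∀ x, 0 ≤ vp x
  lower : ∀ x, -lamM ≤ vm x
  t_pos : 0 < t
  c_pos : 1 ≤ c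
  lamM_pos : 0 < lamM

/-- The soft potential that replaces the interaction: constant on the shell `R₀ < |y| ≤ R`, with
total integral `4π`. -/
noncomputable def shellPot (R₀ R : ℝ) (y : R3) : ℝ :=
  Set.indicator {y : R3 | ‖y‖ ∈ Set.Ioc R₀ R} (fun _ => 3 / (R ^ 3 - R₀ ^ 3)) y

/-- The indicator function of the punctured ball of radius `R`. -/
noncomputable def ballInd (R : ℝ) (y : R3) : ℝ :=
  Set.indicator {y : R3 | ‖y‖ ∈ Set.Ioc 0 R} (fun _ => 1) y

/-- Half the interaction, minus a part of `vp` that is saved for the control of clusters. -/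
noncomputable def pairPot (vp vm : R3 → ℝ) (R₀ t θ : ℝ) (y : R3) : ℝ :=
  Set.indicator (Metric.closedBall 0 R₀)
    (fun y => 1 / 2 * (vp y + vm y) - 1 / 2 * (1 - θ) * (t / (1 + t)) * vp y) y

lemma measurableSet_shell (a b : ℝ) : MeasurableSet {y : R3 | ‖y‖ ∈ Set.Ioc a b} :=
  measurable_norm measurableSet_Ioc

section Mixed
variable {vp vm : R3 → ℝ} {R₀ t c lamM : ℝ}

lemma IsAdmissible.integrable_pos (hv : IsAdmissible vp vm R₀ t c lamM) {X : Type*}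
    [MeasurableSpace X] {μ : Measure X} {d : X → R3} (hd : Measurable d) {f : X → ℝ}
    (hfm : Measurable f) (hf0 : ∀ x, 0 ≤ f x) (hf : Integrable f μ)
    (hpot : Integrable (fun x => (vp (d x) + vm (d x)) * f x) μ) :
    Integrable (fun x => vp (d x) * f x) μ := by
  have hp := hv.measurable_pos
  refine Integrable.mono' (hpot.add (hf.const_mul lamM)) (by fun_prop)
    (Eventually.of_forall fun x => ?_)
  rw [Real.norm_of_nonneg (mul_nonneg (hv.nonneg _) (hf0 x))]
  have := hv.lower (d x)
  have h0 := hf0 x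
  simp only [Pi.add_apply]
  nlinarith

/-- Dyson's inequality in a ball: the kinetic energy in the ball and the interaction dominate the
soft shell potential. The fraction `θ` is bounded with the scattering length of `vp + vm`, the
fraction `1 - θ` with the stability of `c (vp + (1 + t) vm)`, at the price of a factor `1 / c` in
the kinetic energy. -/
theorem IsAdmissible.dyson (hv : IsAdmissible vp vm R₀ t c lamM) {θ : ℝ} (h0 : 0 ≤ θ) (h1 : θ ≤ 1)
    {R : ℝ} (hR : R₀ < R) {φ : R3 → ℂ}
    {Γ : Fin 3 → R3 → ℂ} (hφm : Measurable φ) (hΓm : ∀ k, Measurable (Γ k))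
    (hAC : IsRadiallyAC φ Γ)
    (hΓ : ∀ k, IntegrableOn (fun x => ‖Γ k x‖ ^ 2) {x | ‖x‖ ∈ Set.Ioc 0 R})
    (hφ : IntegrableOn (fun x => ‖φ x‖ ^ 2) {x | ‖x‖ ∈ Set.Ioc 0 R})
    (hpot : IntegrableOn (fun x => (vp x + vm x) * ‖φ x‖ ^ 2) {x | ‖x‖ ∈ Set.Ioc 0 R₀}) :
    θ * ∫ x, shellPot R₀ R x * ‖φ x‖ ^ 2 ≤
      (θ + (1 - θ) / c) * (∫ x, ballInd R x * ∑ k, ‖Γ k x‖ ^ 2) +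
      ∫ x, pairPot vp vm R₀ t θ x * ‖φ x‖ ^ 2 := by
  have hφ1 : IntegrableOn (fun x => ‖φ x‖ ^ 2) {x | ‖x‖ ∈ Set.Ioc R₀ R} :=
    hφ.mono_set fun x hx => ⟨hv.core.pos.trans hx.1, hx.2⟩
  have hφ0 : IntegrableOn (fun x => ‖φ x‖ ^ 2) {x | ‖x‖ ∈ Set.Ioc 0 R₀} :=
    hφ.mono_set fun x hx => ⟨hx.1, hx.2.trans hR.le⟩
  have hvp : IntegrableOn (fun x => vp x * ‖φ x‖ ^ 2) {x | ‖x‖ ∈ Set.Ioc 0 R₀} :=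
    hv.integrable_pos measurable_id (by fun_prop) (fun x => by positivity) hφ0 hpot
  have hvm : IntegrableOn (fun x => vm x * ‖φ x‖ ^ 2) {x | ‖x‖ ∈ Set.Ioc 0 R₀} := by
    refine (Integrable.sub hpot hvp).congr (Eventually.of_forall fun x => ?_)
    simp only [Pi.sub_apply]; ring
  have e1 := hv.core.dyson (α := 1) hv.one_le_scatteringLength hR hΓm hAC hΓ hφ1 hpot
  have hst : IntegrableOn (fun x => c * ((vp x + vm x) + t * vm x) * ‖φ x‖ ^ 2)
      {x | ‖x‖ ∈ Set.Ioc 0 R₀} := by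
    refine ((Integrable.add hpot (hvm.const_mul t)).const_mul c).congr
      (Eventually.of_forall fun x => ?_)
    simp only [Pi.add_apply]; ring
  have e2 := hv.coreStable.dyson (α := 0) hv.zero_le_scatteringLength hR hΓm hAC hΓ hφ1 hst
  have e3 : ∫ x in {x | ‖x‖ ∈ Set.Ioc 0 R₀}, c * ((vp x + vm x) + t * vm x) * ‖φ x‖ ^ 2 =
      c * ((1 + t) * ((∫ x in {x | ‖x‖ ∈ Set.Ioc 0 R₀}, (vp x + vm x) * ‖φ x‖ ^ 2) -
        t / (1 + t) * ∫ x in {x | ‖x‖ ∈ Set.Ioc 0 R₀}, vp x * ‖φ x‖ ^ 2)) := by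
    rw [← integral_const_mul (t / (1 + t)), ← integral_sub hpot (hvp.const_mul _),
      ← integral_const_mul, ← integral_const_mul]
    congr 1; ext x
    have := hv.t_pos
    field_simp
    ring
  have f1 : ∫ x, shellPot R₀ R x * ‖φ x‖ ^ 2 = 3 / (R ^ 3 - R₀ ^ 3) *
      ∫ x in {x : R3 | ‖x‖ ∈ Set.Ioc R₀ R}, ‖φ x‖ ^ 2 := by
    rw [← integral_const_mul, ← integral_indicator (measurableSet_shell _ _)]
    congr 1; ext x
    simp [shellPot, Set.indicator_apply]
  have f2 : ∫ x, ballInd R x * ∑ k, ‖Γ k x‖ ^ 2 =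
      ∫ x in {x : R3 | ‖x‖ ∈ Set.Ioc 0 R}, ∑ k, ‖Γ k x‖ ^ 2 := by
    rw [← integral_indicator (measurableSet_shell _ _)]
    congr 1; ext x
    simp [ballInd, Set.indicator_apply]
  have f3 : ∫ x, pairPot vp vm R₀ t θ x * ‖φ x‖ ^ 2 =
      1 / 2 * (∫ x in {x | ‖x‖ ∈ Set.Ioc 0 R₀}, (vp x + vm x) * ‖φ x‖ ^ 2) -
      1 / 2 * (1 - θ) * (t / (1 + t)) * ∫ x in {x | ‖x‖ ∈ Set.Ioc 0 R₀}, vp x * ‖φ x‖ ^ 2 := by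
    rw [← integral_const_mul, ← integral_const_mul, ← integral_sub (hpot.const_mul _)
      (hvp.const_mul _), ← integral_indicator (measurableSet_shell _ _)]
    refine integral_congr_ae ?_
    filter_upwards [compl_mem_ae_iff.2 (measure_singleton (0 : R3))] with x hx
    have hx' : 0 < ‖x‖ := norm_pos_iff.2 hx
    by_cases h : ‖x‖ ≤ R₀
    · rw [pairPot, Set.indicator_of_mem (mem_closedBall_zero_iff.2 h),
        Set.indicator_of_mem (show x ∈ {x : R3 | ‖x‖ ∈ Set.Ioc 0 R₀} from ⟨hx', h⟩)]
      ring
    · rw [pairPot, Set.indicator_of_notMem (fun h' => h (mem_closedBall_zero_iff.1 h')),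
        Set.indicator_of_notMem (fun h' : x ∈ {x : R3 | ‖x‖ ∈ Set.Ioc 0 R₀} => h h'.2), zero_mul]
  rw [f1, f2, f3]
  rw [e3] at e2
  have hK : 0 ≤ ∫ x in {x : R3 | ‖x‖ ∈ Set.Ioc 0 R}, ∑ k, ‖Γ k x‖ ^ 2 :=
    integral_nonneg fun x => by positivity
  generalize (∫ x in {x : R3 | ‖x‖ ∈ Set.Ioc 0 R}, ∑ k, ‖Γ k x‖ ^ 2) = K at *
  generalize (∫ x in {x | ‖x‖ ∈ Set.Ioc 0 R₀}, (vp x + vm x) * ‖φ x‖ ^ 2) = V at *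
  generalize (∫ x in {x | ‖x‖ ∈ Set.Ioc 0 R₀}, vp x * ‖φ x‖ ^ 2) = P at *
  generalize 3 / (R ^ 3 - R₀ ^ 3) * (∫ x in {x : R3 | ‖x‖ ∈ Set.Ioc R₀ R}, ‖φ x‖ ^ 2) = S at *
  have ht := hv.t_pos
  have hc : 0 < c := by linarith [hv.c_pos]
  have e4 : 0 ≤ K / c + 1 / 2 * (V - t / (1 + t) * P) := by
    have h5 : 0 ≤ K / (c * (1 + t)) + 1 / 2 * (V - t / (1 + t) * P) := by
      have : K / (c * (1 + t)) + 1 / 2 * (V - t / (1 + t) * P) =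
        (c * (1 + t))⁻¹ * (K + 1 / 2 * (c * ((1 + t) * (V - t / (1 + t) * P)))) := by
        field_simp
      rw [this]
      have : 0 ≤ K + 1 / 2 * (c * ((1 + t) * (V - t / (1 + t) * P))) := by linarith
      positivity
    have h6 : K / (c * (1 + t)) ≤ K / c := by
      apply div_le_div_of_nonneg_left hK hc
      nlinarith
    linarith
  have e5 : θ * S ≤ θ * (K + 1 / 2 * V) := mul_le_mul_of_nonneg_left (by linarith) h0
  have e6 := mul_nonneg (sub_nonneg.2 h1) e4
  have : (1 - θ) * (K / c + 1 / 2 * (V - t / (1 + t) * P)) = (1 - θ) / c * K +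
    (1 - θ) * (1 / 2 * (V - t / (1 + t) * P)) := by ring
  rw [this] at e6
  linarith
end Mixed

/-! ### Product measures on boxes, and cells of the torus -/

/-- The half-open cube with corner `c` and side `ℓ`. -/
def cube (c : R3) (ℓ : ℝ) : Set R3 := {y | ∀ k, y k ∈ Set.Ico (c k) (c k + ℓ)}

lemma cube_eq_preimage (c : R3) (ℓ : ℝ) : cube c ℓ = (WithLp.ofLp : R3 → (Fin 3 → ℝ)) ⁻¹'
    (Set.pi Set.univ fun k => Set.Ico (c k) (c k + ℓ)) := by
  ext y; simp [cube]

lemma measurableSet_cube (c : R3) (ℓ : ℝ) : MeasurableSet (cube c ℓ) := by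
  rw [cube_eq_preimage]
  exact (PiLp.volume_preserving_ofLp (Fin 3)).measurable
    (MeasurableSet.univ_pi fun _ => measurableSet_Ico)

lemma volume_cube (c : R3) (ℓ : ℝ) : volume (cube c ℓ) = ENNReal.ofReal ℓ ^ 3 := by
  rw [cube_eq_preimage, (PiLp.volume_preserving_ofLp (Fin 3)).measure_preimage
    (MeasurableSet.univ_pi fun _ => measurableSet_Ico).nullMeasurableSet, volume_pi_pi]
  simp

lemma torusBox_eq_pi (N : ℕ) (L : ℝ) : torusBox N L = Set.pi Set.univ fun _ => cube 0 L := by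
  ext x; simp [torusBox, cube]

/-- Resampling one coordinate of a product of probability measures preserves the product. -/
lemma measurePreserving_resample {ι α : Type*} [Fintype ι] [DecidableEq ι] [MeasurableSpace α]
    (μ : ι → Measure α) [∀ i, IsProbabilityMeasure (μ i)] (i : ι) :
    MeasurePreserving (fun p : (ι → α) × α => Function.update p.1 i p.2)
      ((Measure.pi μ).prod (μ i)) (Measure.pi μ) := by
  have hm : Measurable (fun p : (ι → α) × α => Function.update p.1 i p.2) :=
    measurable_pi_iff.2 fun k => by
      by_cases h : k = i
      · subst h; simpa using measurable_snd
      · simp only [Function.update_of_ne h]; fun_prop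
  refine ⟨hm, (Measure.pi_eq fun s hs => ?_).symm⟩
  rw [Measure.map_apply hm (MeasurableSet.univ_pi hs)]
  have : (fun p : (ι → α) × α => Function.update p.1 i p.2) ⁻¹' Set.univ.pi s =
      (Set.univ.pi (Function.update s i Set.univ)) ×ˢ s i := by
    ext p
    simp only [Set.mem_preimage, Set.mem_pi, Set.mem_univ, true_imp_iff, Set.mem_prod]
    constructor
    · intro h
      refine ⟨fun k => ?_, by simpa using h i⟩
      by_cases hk : k = i
      · subst hk; simp
      · simpa [hk] using h k
    · rintro ⟨h, h'⟩ k
      by_cases hk : k = i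
      · subst hk; simpa using h'
      · simpa [hk] using h k
  rw [this, Measure.prod_prod, Measure.pi_pi, ← Finset.mul_prod_erase _ _ (Finset.mem_univ i),
    ← Finset.mul_prod_erase _ (fun k => μ k (s k)) (Finset.mem_univ i)]
  simp only [Function.update_self, measure_univ, one_mul]
  rw [mul_comm]
  congr 1
  exact Finset.prod_congr rfl fun k hk => by simp [Finset.ne_of_mem_erase hk]

section BoxProb
variable {N : ℕ}

/-- The law of independent particles, the `i`-th one uniformly distributed in `Q i`. -/
noncomputable def boxProb (Q : Fin N → Set R3) : Measure (Config N) :=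
  Measure.pi fun i => ProbabilityTheory.cond volume (Q i)

/-- Boxes of finite positive volume. -/
def IsBox (Q : Fin N → Set R3) : Prop :=
  ∀ i, MeasurableSet (Q i) ∧ volume (Q i) ≠ 0 ∧ volume (Q i) ≠ ⊤

lemma isBox_cube (c : Fin N → R3) {ℓ : ℝ} (hℓ : 0 < ℓ) : IsBox fun i => cube (c i) ℓ := by
  intro i
  refine ⟨measurableSet_cube _ _, ?_, ?_⟩ <;> simp only [volume_cube]
  · simpa using hℓ
  · exact ENNReal.pow_ne_top ENNReal.ofReal_ne_top

lemma IsBox.isProbabilityMeasure {Q : Fin N → Set R3} (hQ : IsBox Q) (i : Fin N) :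
    IsProbabilityMeasure (ProbabilityTheory.cond (volume : Measure R3) (Q i)) :=
  ProbabilityTheory.cond_isProbabilityMeasure_of_finite (hQ i).2.1 (hQ i).2.2

lemma boxProb_eq {Q : Fin N → Set R3} (hQ : IsBox Q) :
    boxProb Q = (∏ i, (volume (Q i))⁻¹) • (volume : Measure (Config N)).restrict
      (Set.pi Set.univ Q) := by
  have := hQ.isProbabilityMeasure
  refine Measure.pi_eq fun s hs => ?_
  rw [Measure.smul_apply, volume_pi, Measure.restrict_pi_pi, Measure.pi_pi, smul_eq_mul,
    ← Finset.prod_mul_distrib]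
  refine Finset.prod_congr rfl fun i _ => ?_
  rw [ProbabilityTheory.cond_apply (hQ i).1, Measure.restrict_apply (hs i), Set.inter_comm]

/-- The volume of a box, as a real number. -/
noncomputable def boxVol (Q : Fin N → Set R3) : ℝ := ∏ i, (volume (Q i)).toReal

lemma IsBox.boxVol_pos {Q : Fin N → Set R3} (hQ : IsBox Q) : 0 < boxVol Q :=
  Finset.prod_pos fun i _ => ENNReal.toReal_pos (hQ i).2.1 (hQ i).2.2

lemma IsBox.integrable_iff {Q : Fin N → Set R3} (hQ : IsBox Q) {E : Type*} [NormedAddCommGroup E]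
    {F : Config N → E} : Integrable F (boxProb Q) ↔ IntegrableOn F (Set.pi Set.univ Q) := by
  rw [boxProb_eq hQ, integrable_smul_measure]
  · rfl
  · exact Finset.prod_ne_zero_iff.2 fun i _ => ENNReal.inv_ne_zero.2 (hQ i).2.2
  · exact ENNReal.prod_ne_top fun i _ => ENNReal.inv_ne_top.2 (hQ i).2.1

lemma IsBox.setIntegral_eq {Q : Fin N → Set R3} (hQ : IsBox Q) {E : Type*} [NormedAddCommGroup E]
    [NormedSpace ℝ E] (F : Config N → E) :
    ∫ x in Set.pi Set.univ Q, F x = boxVol Q • ∫ x, F x ∂(boxProb Q) := by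
  rw [boxProb_eq hQ, integral_smul_measure, smul_smul, boxVol, ENNReal.toReal_prod,
    ← Finset.prod_mul_distrib, Finset.prod_eq_one, one_smul]
  intro i _
  rw [ENNReal.toReal_inv, mul_inv_cancel₀ (ENNReal.toReal_pos (hQ i).2.1 (hQ i).2.2).ne']

lemma IsBox.boxProb_absolutelyContinuous {Q : Fin N → Set R3} (hQ : IsBox Q) :
    boxProb Q ≪ (volume : Measure (Config N)) := by
  rw [boxProb_eq hQ]
  exact (Measure.smul_absolutelyContinuous).trans Measure.restrict_le_self.absolutelyContinuous
end BoxProb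

/-- `f` is periodic under the lattice `L ℤ³`. -/
def IsPeriodic {E : Type*} (L : ℝ) (f : R3 → E) : Prop := ∀ k y, f (y + L • unitVec k) = f y

/-- The basis `L e₁, L e₂, L e₃` of `ℝ³`. -/
noncomputable def latticeBasis {L : ℝ} (hL : 0 < L) : Module.Basis (Fin 3) ℝ R3 :=
  (EuclideanSpace.basisFun (Fin 3) ℝ).toBasis.unitsSMul fun _ => Units.mk0 L hL.ne'

lemma latticeBasis_apply {L : ℝ} (hL : 0 < L) (k : Fin 3) :
    latticeBasis hL k = L • unitVec k := by
  simp [latticeBasis, unitVec, Module.Basis.unitsSMul_apply, Units.smul_def]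

open Pointwise in
lemma cube_eq_vadd {L : ℝ} (hL : 0 < L) (c : R3) :
    cube c L = c +ᵥ ZSpan.fundamentalDomain (latticeBasis hL) := by
  ext y
  rw [Set.mem_vadd_set_iff_neg_vadd_mem, ZSpan.mem_fundamentalDomain]
  refine forall_congr' fun k => ?_
  simp only [latticeBasis, Module.Basis.repr_unitsSMul, Set.mem_Ico, vadd_eq_add, Units.smul_def,
    OrthonormalBasis.coe_toBasis_repr_apply, EuclideanSpace.basisFun_repr, PiLp.add_apply,
    PiLp.neg_apply, smul_eq_mul, Units.val_inv_eq_inv_val, Units.val_mk0]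
  rw [inv_mul_lt_one₀ hL, mul_nonneg_iff_of_pos_left (inv_pos.2 hL)]
  constructor <;> rintro ⟨h1, h2⟩ <;> constructor <;> linarith

lemma IsPeriodic.add_mem {E : Type*} {L : ℝ} (hL : 0 < L) {f : R3 → E} (hf : IsPeriodic L f)
    (g : (Submodule.span ℤ (Set.range (latticeBasis hL))).toAddSubgroup) (y : R3) : f (g +ᵥ y) = f y := by
  obtain ⟨g, hg⟩ := g
  change f (g + y) = f y
  induction hg using Submodule.span_induction generalizing y with
  | mem x hx =>
    obtain ⟨k, rfl⟩ := hx
    rw [latticeBasis_apply, add_comm, hf]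
  | zero => simp
  | add a b _ _ ha hb => rw [add_assoc, ha, hb]
  | smul n a _ ha =>
    induction n using Int.induction_on generalizing y with
    | zero => simp
    | succ n ih => rw [add_smul, add_assoc, ih, one_smul, ha]
    | pred n ih =>
      rw [sub_smul, ← ha, one_smul, ← add_assoc, add_sub_cancel, ih]

lemma isAddFundamentalDomain_cube {L : ℝ} (hL : 0 < L) (c : R3) :
    IsAddFundamentalDomain ((Submodule.span ℤ (Set.range (latticeBasis hL))).toAddSubgroup) (cube c L)
      (volume : Measure R3) := by
  rw [cube_eq_vadd hL]
  exact (ZSpan.isAddFundamentalDomain' (latticeBasis hL) volume).vadd_of_comm c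

lemma IsPeriodic.integrableOn_cube_iff {E : Type*} [NormedAddCommGroup E] {L : ℝ} (hL : 0 < L)
    {f : R3 → E} (hf : IsPeriodic L f) (b c : R3) :
    IntegrableOn f (cube b L) ↔ IntegrableOn f (cube c L) := by
  have : Countable (Submodule.span ℤ (Set.range (latticeBasis hL))).toAddSubgroup :=
    inferInstanceAs (Countable (Submodule.span ℤ (Set.range (latticeBasis hL))))
  exact (isAddFundamentalDomain_cube hL b).integrableOn_iff (isAddFundamentalDomain_cube hL c)
    (hf.add_mem hL)

lemma IsPeriodic.setIntegral_cube_eq {E : Type*} [NormedAddCommGroup E] [NormedSpace ℝ E] {L : ℝ}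
    (hL : 0 < L) {f : R3 → E} (hf : IsPeriodic L f) (b c : R3) :
    ∫ y in cube b L, f y = ∫ y in cube c L, f y := by
  have : Countable (Submodule.span ℤ (Set.range (latticeBasis hL))).toAddSubgroup :=
    inferInstanceAs (Countable (Submodule.span ℤ (Set.range (latticeBasis hL))))
  exact (isAddFundamentalDomain_cube hL b).setIntegral_eq (isAddFundamentalDomain_cube hL c)
    (hf.add_mem hL)

/-! ### Periodic representatives -/

section Periodic
variable {N : ℕ}

/-- The lattice vector with components `L n`. -/
noncomputable def latticeShift (L : ℝ) (n : Fin N → Fin 3 → ℤ) : Config N :=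
  fun i => WithLp.toLp 2 fun k => L * n i k

/-- The representative of `x` modulo the lattice in the box `([0, L)³)^N`. -/
noncomputable def reduce (L : ℝ) (x : Config N) : Config N :=
  fun i => WithLp.toLp 2 fun k => L * Int.fract (x i k / L)

lemma reduce_eq {L : ℝ} (hL : 0 < L) (x : Config N) :
    reduce L x = x + latticeShift L fun i k => -⌊x i k / L⌋ := by
  ext i k
  simp only [reduce, latticeShift, Pi.add_apply, PiLp.add_apply, Int.fract]
  push_cast
  field_simp
  ring

lemma measurable_reduce (L : ℝ) : Measurable (reduce L : Config N → Config N) := by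
  refine measurable_pi_iff.2 fun i => (PiLp.volume_preserving_toLp (Fin 3)).measurable.comp
    (measurable_pi_iff.2 fun k => ?_)
  have : Measurable fun x : Config N => x i k := by fun_prop
  exact (measurable_fract.comp (this.div_const L)).const_mul L

lemma reduce_add {L : ℝ} (hL : 0 < L) (i : Fin N) (k : Fin 3) (x : Config N) :
    reduce L (x + L • particleUnitVec i k) = reduce L x := by
  ext j m
  simp only [reduce, Pi.add_apply, PiLp.add_apply, Pi.smul_apply, PiLp.smul_apply, smul_eq_mul]
  congr 1
  rw [add_div, mul_div_cancel_left₀ _ hL.ne']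
  have : ∃ n : ℤ, (particleUnitVec i k : Config N) j m = n := by
    by_cases h : j = i
    · subst h
      by_cases h' : m = k
      · exact ⟨1, by simp [particleUnitVec, unitVec, h']⟩
      · exact ⟨0, by simp [particleUnitVec, unitVec, h']⟩
    · exact ⟨0, by simp [particleUnitVec, Pi.single_eq_of_ne h]⟩
  obtain ⟨n, hn⟩ := this
  rw [hn, Int.fract_add_intCast]

lemma ae_add {p : Config N → Prop} (h : ∀ᵐ x, p x) (v : Config N) : ∀ᵐ x, p (x + v) :=
  (measurePreserving_add_right (volume : Measure (Config N)) v).quasiMeasurePreserving.ae h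

lemma ae_latticeShift {f : Config N → ℂ} {L : ℝ}
    (hp : ∀ i k, ∀ᵐ x, f (x + L • particleUnitVec i k) = f x) (n : Fin N → Fin 3 → ℤ) :
    ∀ᵐ x, f (x + latticeShift L n) = f x := by
  let S : AddSubgroup (Config N) :=
    { carrier := {v | ∀ᵐ x, f (x + v) = f x}
      zero_mem' := by simp
      add_mem' := by
        intro a b ha hb
        change ∀ᵐ x, f (x + (a + b)) = f x
        filter_upwards [ae_add hb a, ha] with x h1 h2
        rw [← add_assoc, h1, h2]
      neg_mem' := by
        intro a ha
        change ∀ᵐ x, f (x + -a) = f x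
        filter_upwards [ae_add ha (-a)] with x h1
        rw [← h1, neg_add_cancel_right] }
  have : latticeShift L n = ∑ i, ∑ k, n i k • (L • (particleUnitVec i k : Config N)) := by
    ext j m
    simp only [latticeShift, Finset.sum_apply, WithLp.ofLp_sum, Pi.smul_apply, PiLp.smul_apply]
    rw [Finset.sum_eq_single j, Finset.sum_eq_single m]
    · simp [particleUnitVec, unitVec, mul_comm]
    · intro b _ hb; simp [particleUnitVec, unitVec, hb.symm]
    · simp
    · intro b _ hb; simp [particleUnitVec, Pi.single_eq_of_ne hb.symm]
    · simp
  change latticeShift L n ∈ S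
  rw [this]
  exact sum_mem fun i _ => sum_mem fun k _ => zsmul_mem (hp i k) _

/-- A function that is periodic up to null sets has a measurable, exactly periodic
representative. -/
lemma exists_periodic_version {f : Config N → ℂ} (hf : AEStronglyMeasurable f volume) {L : ℝ}
    (hL : 0 < L) (hp : ∀ i k, ∀ᵐ x, f (x + L • particleUnitVec i k) = f x) :
    ∃ g : Config N → ℂ, Measurable g ∧ (∀ i k x, g (x + L • particleUnitVec i k) = g x) ∧
      f =ᵐ[volume] g := by
  refine ⟨hf.mk f ∘ reduce L, hf.stronglyMeasurable_mk.measurable.comp (measurable_reduce L),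
    fun i k x => by simp only [Function.comp, reduce_add hL], ?_⟩
  have h1 : ∀ᵐ x, ∀ n, f (x + latticeShift L n) = f x := ae_all_iff.2 (ae_latticeShift hp)
  have h2 : ∀ᵐ x, ∀ n : Fin N → Fin 3 → ℤ,
      f (x + latticeShift L n) = hf.mk f (x + latticeShift L n) :=
    ae_all_iff.2 fun n => ae_add hf.ae_eq_mk _
  filter_upwards [h1, h2] with x hx1 hx2
  rw [Function.comp, reduce_eq hL, ← hx2, hx1]

lemma HasWeakDirDeriv.congr_ae {f f' g g' : Config N → ℂ} {e : Config N}
    (h : HasWeakDirDeriv f g e) (hf : f =ᵐ[volume] f') (hg : g =ᵐ[volume] g') :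
    HasWeakDirDeriv f' g' e := by
  refine ⟨h.locallyIntegrable.congr hf, h.locallyIntegrable_deriv.congr hg, fun η h1 h2 => ?_⟩
  have := h.integral_eq η h1 h2
  rw [integral_congr_ae (g := fun x => (fderiv ℝ η x e) • f' x)
    (by filter_upwards [hf] with x hx; rw [hx]),
    integral_congr_ae (f := fun x => η x • g x) (g := fun x => η x • g' x)
    (by filter_upwards [hg] with x hx; rw [hx])] at this
  exact this

/-- A weak derivative of a periodic function is periodic, up to a null set. -/
lemma HasWeakDirDeriv.ae_periodic {f g : Config N → ℂ} {e v : Config N}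
    (h : HasWeakDirDeriv f g e) (hf : ∀ x, f (x + v) = f x) : ∀ᵐ x, g (x + v) = g x := by
  have hm := measurePreserving_add_right (volume : Measure (Config N)) v
  have hloc : LocallyIntegrable (fun x => g (x + v)) volume := by
    intro x
    obtain ⟨u, hu, hi⟩ := h.locallyIntegrable_deriv (x + v)
    refine ⟨(fun y => y + v) ⁻¹' u, (continuous_add_const v).continuousAt hu, ?_⟩
    exact (hm.integrableOn_comp_preimage (measurableEmbedding_addRight v)).2 hi
  refine ae_eq_of_integral_contDiff_smul_eq hloc h.locallyIntegrable_deriv fun η h1 h2 => ?_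
  have h1' : ContDiff ℝ ∞ fun x => η (x - v) := h1.comp (contDiff_id.sub contDiff_const)
  have h2' : HasCompactSupport fun x => η (x - v) := by
    simpa [sub_eq_add_neg, Function.comp_def] using
      h2.comp_homeomorph (Homeomorph.addRight (-v))
  have e1 := h.integral_eq _ h1' h2'
  have e2 := h.integral_eq _ h1 h2
  have e3 : ∫ x, η x • g (x + v) = ∫ x, η (x - v) • g x := by
    rw [← integral_add_right_eq_self (fun x => η (x - v) • g x) v]
    simp
  have e4 : ∫ x, (fderiv ℝ (fun x => η (x - v)) x e) • f x = ∫ x, (fderiv ℝ η x e) • f x := by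
    rw [← integral_add_right_eq_self (fun x => (fderiv ℝ (fun x => η (x - v)) x e) • f x) v]
    congr 1; ext x
    rw [fderiv_comp_sub, hf, add_sub_cancel_right]
  rw [e3]
  rw [e4, e2] at e1
  exact (neg_inj.1 e1).symm
end Periodic

/-! ### Pair estimate on the torus -/

section Cell
variable {vp vm : R3 → ℝ} {R₀ t c lamM : ℝ}

/-- The centered cell of the torus of side length `L`. -/
noncomputable def cell (L : ℝ) : Set R3 := cube (WithLp.toLp 2 fun _ => -(L / 2)) L

lemma mem_cell_of_norm_lt {L : ℝ} {y : R3} (h : ‖y‖ < L / 2) : y ∈ cell L := by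
  intro k
  have h1 : |y k| ≤ ‖y‖ := by simpa using PiLp.norm_apply_le y k
  have h2 := abs_lt.1 (h1.trans_lt h)
  exact ⟨h2.1.le, by have := h2.2; simp only; linarith⟩

lemma torusDiff_of_mem_cell {L : ℝ} (hL : 0 < L) {x y : R3} (h : y ∈ cell L) :
    torusDiff L (x + y) x = y := by
  ext k
  have h1 : round (y k / L) = 0 := by
    rw [round_eq_zero_iff]
    have h2 := h k
    simp only [Set.mem_Ico] at h2
    constructor
    · rw [le_div_iff₀ hL]; linarith [h2.1]
    · rw [div_lt_iff₀ hL]; linarith [h2.2]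
  simp [torusDiff, h1]

lemma torusDiff_add_left {L : ℝ} (hL : 0 < L) (x y : R3) (k : Fin 3) :
    torusDiff L (x + L • unitVec k) y = torusDiff L x y := by
  ext m
  simp only [torusDiff, PiLp.add_apply, PiLp.smul_apply, smul_eq_mul]
  obtain ⟨n, hn⟩ : ∃ n : ℤ, (unitVec k) m = n := by
    by_cases h' : m = k
    · exact ⟨1, by simp [unitVec, h']⟩
    · exact ⟨0, by simp [unitVec, h']⟩
  have : (x m + L * (unitVec k) m - y m) / L = (x m - y m) / L + n := by
    rw [hn]; field_simp; ring
  rw [this, round_add_intCast, hn]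
  push_cast
  ring

lemma measurable_torusDiff (L : ℝ) : Measurable fun p : R3 × R3 => torusDiff L p.1 p.2 := by
  refine (PiLp.volume_preserving_toLp (Fin 3)).measurable.comp
    (measurable_pi_iff.2 fun k => ?_)
  have h : Measurable fun p : R3 × R3 => p.1 k - p.2 k := by fun_prop
  have h1 : Measurable (round : ℝ → ℤ) := by
    have : (round : ℝ → ℤ) = fun x => ⌊x + 1 / 2⌋ := by ext x; exact round_eq x
    rw [this]; exact Int.measurable_floor.comp (measurable_id.add_const _)
  exact h.sub (((measurable_of_countable (fun n : ℤ => (n : ℝ))).comp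
    (h1.comp (h.div_const L))).const_mul L)

/-- Dyson's inequality with all integrals over the centered cell, which contains the ball of
radius `R`. -/
lemma IsAdmissible.dyson_cell (hv : IsAdmissible vp vm R₀ t c lamM) {θ : ℝ} (h0 : 0 ≤ θ)
    (h1 : θ ≤ 1) {R L : ℝ} (hR : R₀ < R) (hRL : 2 * R < L) {φ : R3 → ℂ}
    {Γ : Fin 3 → R3 → ℂ} (hφm : Measurable φ) (hΓm : ∀ k, Measurable (Γ k))
    (hAC : IsRadiallyAC φ Γ)
    (hΓ : ∀ k, IntegrableOn (fun x => ‖Γ k x‖ ^ 2) (cell L))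
    (hφ : IntegrableOn (fun x => ‖φ x‖ ^ 2) (cell L))
    (hpot : IntegrableOn (fun x => (vp x + vm x) * ‖φ x‖ ^ 2) (cell L)) :
    0 ≤ ∫ y in cell L, ((θ + (1 - θ) / c) * (ballInd R y * ∑ k, ‖Γ k y‖ ^ 2) +
      pairPot vp vm R₀ t θ y * ‖φ y‖ ^ 2 - θ * (shellPot R₀ R y * ‖φ y‖ ^ 2)) := by
  have hsub : ∀ a b : ℝ, b ≤ R → {x : R3 | ‖x‖ ∈ Set.Ioc a b} ⊆ cell L := fun a b hb x hx =>
    mem_cell_of_norm_lt (by have := hx.2; linarith)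
  have d := hv.dyson h0 h1 hR hφm hΓm hAC (fun k => (hΓ k).mono_set (hsub 0 R le_rfl))
    (hφ.mono_set (hsub 0 R le_rfl)) (hpot.mono_set (hsub 0 R₀ hR.le))
  have hsub' : Metric.closedBall (0 : R3) R₀ ⊆ cell L := fun x hx =>
    mem_cell_of_norm_lt (by have := mem_closedBall_zero_iff.1 hx; linarith)
  have hpot' := hpot.mono_set hsub'
  have hvp : IntegrableOn (fun x => vp x * ‖φ x‖ ^ 2) (Metric.closedBall 0 R₀) :=
    hv.integrable_pos measurable_id (by fun_prop) (fun x => by positivity)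
      (hφ.mono_set hsub') hpot'
  have i1 : Integrable (fun y => ballInd R y * ∑ k, ‖Γ k y‖ ^ 2) := by
    have : IntegrableOn (fun y => ∑ k, ‖Γ k y‖ ^ 2) {x | ‖x‖ ∈ Set.Ioc 0 R} :=
      integrable_finsetSum _ fun k _ => (hΓ k).mono_set (hsub 0 R le_rfl)
    refine (this.integrable_indicator (measurableSet_shell _ _)).congr
      (Eventually.of_forall fun y => ?_)
    simp only [ballInd, Set.indicator_apply]; split_ifs <;> simp
  have i2 : Integrable (fun y => pairPot vp vm R₀ t θ y * ‖φ y‖ ^ 2) := by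
    have h : IntegrableOn _ (Metric.closedBall (0 : R3) R₀) := Integrable.sub
      (hpot'.const_mul (1 / 2)) (hvp.const_mul (1 / 2 * (1 - θ) * (t / (1 + t))))
    refine (h.integrable_indicator Metric.isClosed_closedBall.measurableSet).congr
      (Eventually.of_forall fun y => ?_)
    by_cases hy : y ∈ Metric.closedBall (0 : R3) R₀
    · simp only [pairPot, Set.indicator_of_mem hy, Pi.sub_apply]; ring
    · simp only [pairPot, Set.indicator_of_notMem hy, zero_mul]
  have i3 : Integrable (fun y => shellPot R₀ R y * ‖φ y‖ ^ 2) := by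
    have h : IntegrableOn _ {x : R3 | ‖x‖ ∈ Set.Ioc R₀ R} :=
      (hφ.mono_set (hsub R₀ R le_rfl)).const_mul (3 / (R ^ 3 - R₀ ^ 3))
    refine (h.integrable_indicator (measurableSet_shell _ _)).congr
      (Eventually.of_forall fun y => ?_)
    simp only [shellPot, Set.indicator_apply]; split_ifs <;> ring
  have i4 : Integrable (fun y => (θ + (1 - θ) / c) * (ballInd R y * ∑ k, ‖Γ k y‖ ^ 2) +
      pairPot vp vm R₀ t θ y * ‖φ y‖ ^ 2) := (i1.const_mul _).add i2
  rw [setIntegral_eq_integral_of_forall_compl_eq_zero, integral_sub i4 (i3.const_mul _), integral_add (i1.const_mul _) i2, integral_const_mul, integral_const_mul]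
  · linarith
  · intro y hy
    have hy1 : ¬ ‖y‖ ≤ R := fun h => hy (mem_cell_of_norm_lt (by linarith))
    have hy2 : ¬ ‖y‖ ≤ R₀ := fun h => hy1 (h.trans hR.le)
    simp [ballInd, pairPot, shellPot, hy1, hy2]
end Cell

/-- A measurable, exactly periodic wave function with its weak gradient, of finite energy for
the pair interaction `w`. -/
structure IsTorusState (w : R3 → ℝ) (N : ℕ) (L : ℝ) (ψ : Config N → ℂ)
    (G : Fin N → Fin 3 → Config N → ℂ) : Prop where
  measurable : Measurable ψ
  measurable_deriv : ∀ i k, Measurable (G i k)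
  periodic : ∀ i k x, ψ (x + L • particleUnitVec i k) = ψ x
  periodic_deriv : ∀ j m i k x, G j m (x + L • particleUnitVec i k) = G j m x
  weakGradient : ∀ i k, HasWeakDirDeriv ψ (G i k) (particleUnitVec i k)
  integrable_sq : IntegrableOn (fun x => ‖ψ x‖ ^ 2) (torusBox N L) volume
  integrable_gradient : ∀ i k, IntegrableOn (fun x => ‖G i k x‖ ^ 2) (torusBox N L) volume
  integrable_potential : ∀ i j, i ≠ j →
    IntegrableOn (fun x => w (torusDiff L (x i) (x j)) * ‖ψ x‖ ^ 2) (torusBox N L) volume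

section Pair
variable {N : ℕ}

lemma update_add_particleUnitVec (x : Config N) (i : Fin N) (y : R3) (L : ℝ) (k : Fin 3) :
    Function.update x i (y + L • unitVec k) =
      Function.update x i y + L • particleUnitVec i k := by
  ext1 j
  by_cases h : j = i
  · subst h; simp [particleUnitVec]
  · simp [particleUnitVec, h]

lemma isBox_torus {L : ℝ} (hL : 0 < L) : IsBox fun _ : Fin N => cube 0 L :=
  isBox_cube (fun _ => 0) hL

variable {Q : Fin N → Set R3}

lemma IsBox.resample (hQ : IsBox Q) (i : Fin N) :
    MeasurePreserving (fun p : Config N × R3 => Function.update p.1 i p.2)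
      ((boxProb Q).prod (ProbabilityTheory.cond volume (Q i))) (boxProb Q) := by
  have := hQ.isProbabilityMeasure
  exact measurePreserving_resample _ i

lemma IsBox.isProbabilityMeasure_boxProb (hQ : IsBox Q) : IsProbabilityMeasure (boxProb Q) := by
  have := hQ.isProbabilityMeasure
  unfold boxProb
  infer_instance

lemma IsBox.integrable_cond_iff (hQ : IsBox Q) (i : Fin N) {E : Type*} [NormedAddCommGroup E]
    {f : R3 → E} : Integrable f (ProbabilityTheory.cond volume (Q i)) ↔ IntegrableOn f (Q i) := by
  rw [ProbabilityTheory.cond, integrable_smul_measure (ENNReal.inv_ne_zero.2 (hQ i).2.2)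
    (ENNReal.inv_ne_top.2 (hQ i).2.1)]
  rfl

lemma IsBox.integral_resample (hQ : IsBox Q) (i : Fin N) {E : Type*} [NormedAddCommGroup E]
    [NormedSpace ℝ E] {F : Config N → E} (hF : Integrable F (boxProb Q)) :
    ∫ x, F x ∂(boxProb Q) =
      ∫ x, ∫ y, F (Function.update x i y) ∂(ProbabilityTheory.cond volume (Q i)) ∂(boxProb Q) := by
  have := hQ.isProbabilityMeasure i
  have := hQ.isProbabilityMeasure_boxProb
  have h1 := (hQ.resample i)
  have h2 : Integrable (fun p : Config N × R3 => F (Function.update p.1 i p.2))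
      ((boxProb Q).prod (ProbabilityTheory.cond volume (Q i))) :=
    h1.integrable_comp_of_integrable hF
  rw [← integral_prod _ h2]
  conv_lhs => rw [← h1.map_eq]
  rw [integral_map h1.measurable.aemeasurable]
  rw [h1.map_eq]; exact hF.aestronglyMeasurable

lemma IsBox.ae_integrable_resample (hQ : IsBox Q) (i : Fin N) {E : Type*} [NormedAddCommGroup E]
    {F : Config N → E} (hF : Integrable F (boxProb Q)) :
    ∀ᵐ x ∂(boxProb Q), Integrable (fun y => F (Function.update x i y))
      (ProbabilityTheory.cond volume (Q i)) := by
  have := hQ.isProbabilityMeasure i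
  have := hQ.isProbabilityMeasure_boxProb
  have h2 : Integrable (fun p : Config N × R3 => F (Function.update p.1 i p.2))
      ((boxProb Q).prod (ProbabilityTheory.cond volume (Q i))) :=
    (hQ.resample i).integrable_comp_of_integrable hF
  exact h2.prod_right_ae

lemma isPeriodic_update {E : Type*} {H : Config N → E} {L : ℝ} {i : Fin N}
    (hp : ∀ k x, H (x + L • particleUnitVec i k) = H x) (x : Config N) :
    IsPeriodic L fun y => H (Function.update x i y) := fun k y => by
  simp only [update_add_particleUnitVec, hp]

lemma cube_eq_cell_preimage {L : ℝ} (z : R3) :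
    cell L = (fun y => z + y) ⁻¹' cube (z + WithLp.toLp 2 fun _ => -(L / 2)) L := by
  ext y
  simp only [cell, cube, Set.mem_preimage, Set.mem_ofPred_eq, PiLp.add_apply, Set.mem_Ico]
  refine forall_congr' fun k => ?_
  constructor <;> rintro ⟨h1, h2⟩ <;> constructor <;> linarith

lemma ae_integrableOn_cell {E : Type*} [NormedAddCommGroup E] {H : Config N → E} {L : ℝ}
    (hL : 0 < L) {i j : Fin N} (hp : ∀ k x, H (x + L • particleUnitVec i k) = H x)
    (hH : IntegrableOn H (torusBox N L)) :
    ∀ᵐ x ∂(boxProb fun _ : Fin N => cube 0 L),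
      IntegrableOn (fun y => H (Function.update x i (x j + y))) (cell L) := by
  have hQ := isBox_torus (N := N) hL
  rw [torusBox_eq_pi, ← hQ.integrable_iff] at hH
  filter_upwards [hQ.ae_integrable_resample i hH] with x hx
  rw [hQ.integrable_cond_iff i, (isPeriodic_update hp x).integrableOn_cube_iff hL 0
    (x j + WithLp.toLp 2 fun _ => -(L / 2))] at hx
  rw [cube_eq_cell_preimage (x j)]
  exact ((measurePreserving_add_left (volume : Measure R3) (x j)).integrableOn_comp_preimage
    (measurableEmbedding_addLeft (x j))).2 hx

lemma integral_torus_nonneg {H : Config N → ℝ} {L : ℝ}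
    (hL : 0 < L) {i j : Fin N} (hp : ∀ k x, H (x + L • particleUnitVec i k) = H x)
    (hH : IntegrableOn H (torusBox N L))
    (h0 : ∀ᵐ x ∂(boxProb fun _ : Fin N => cube 0 L),
      0 ≤ ∫ y in cell L, H (Function.update x i (x j + y))) :
    0 ≤ ∫ x in torusBox N L, H x := by
  have hQ := isBox_torus (N := N) hL
  rw [torusBox_eq_pi, ← hQ.integrable_iff] at hH
  rw [torusBox_eq_pi, hQ.setIntegral_eq, hQ.integral_resample i hH]
  refine mul_nonneg hQ.boxVol_pos.le (integral_nonneg_of_ae ?_)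
  filter_upwards [h0] with x hx
  rw [ProbabilityTheory.cond, integral_smul_measure]
  refine mul_nonneg ENNReal.toReal_nonneg ?_
  rw [(isPeriodic_update hp x).setIntegral_cube_eq hL 0 (x j + WithLp.toLp 2 fun _ => -(L / 2))]
  rw [cube_eq_cell_preimage (x j), (measurePreserving_add_left (volume : Measure R3)
    (x j)).setIntegral_preimage_emb (measurableEmbedding_addLeft (x j))
    (fun y => H (Function.update x i y))] at hx
  exact hx

lemma exists_bound_indicator (s : Set R3) (a : ℝ) (y : R3) :
    ‖s.indicator (fun _ => a) y‖ ≤ ‖a‖ := norm_indicator_le_norm_self (f := fun _ => a) y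

/-- The pair estimate, integrated over the configurations of the torus. -/
theorem IsTorusState.pair {vp vm : R3 → ℝ} {R₀ t c lamM : ℝ}
    (hv : IsAdmissible vp vm R₀ t c lamM) {L : ℝ} {ψ : Config N → ℂ}
    {G : Fin N → Fin 3 → Config N → ℂ} (hs : IsTorusState (fun x => vp x + vm x) N L ψ G)
    {i j : Fin N} (hij : i ≠ j) {χ : Config N → ℝ} (hχm : Measurable χ)
    (hχ0 : ∀ x, 0 ≤ χ x) (hχ1 : ∀ x, χ x ≤ 1) (hχ : ∀ x y, χ (Function.update x i y) = χ x)
    {θ R : ℝ} (h0 : 0 ≤ θ) (h1 : θ ≤ 1) (hR : R₀ < R) (hRL : 2 * R < L) :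
    IntegrableOn (fun x => χ x * ((θ + (1 - θ) / c) *
      (ballInd R (torusDiff L (x i) (x j)) * ∑ k, ‖G i k x‖ ^ 2) +
      pairPot vp vm R₀ t θ (torusDiff L (x i) (x j)) * ‖ψ x‖ ^ 2 -
      θ * (shellPot R₀ R (torusDiff L (x i) (x j)) * ‖ψ x‖ ^ 2))) (torusBox N L) ∧
    0 ≤ ∫ x in torusBox N L, χ x * ((θ + (1 - θ) / c) *
      (ballInd R (torusDiff L (x i) (x j)) * ∑ k, ‖G i k x‖ ^ 2) +
      pairPot vp vm R₀ t θ (torusDiff L (x i) (x j)) * ‖ψ x‖ ^ 2 -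
      θ * (shellPot R₀ R (torusDiff L (x i) (x j)) * ‖ψ x‖ ^ 2)) := by
  have hL : 0 < L := by linarith [hv.core.pos]
  have hδ : Measurable fun x : Config N => torusDiff L (x i) (x j) :=
    (measurable_torusDiff L).comp (by fun_prop : Measurable fun x : Config N => (x i, x j))
  have hψm := hs.measurable
  have hGm := hs.measurable_deriv
  have hvp : IntegrableOn (fun x => vp (torusDiff L (x i) (x j)) * ‖ψ x‖ ^ 2) (torusBox N L) :=
    hv.integrable_pos hδ (by fun_prop) (fun x => by positivity) hs.integrable_sq
      (hs.integrable_potential i j hij)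
  have b1 : Measurable (ballInd R) := measurable_const.indicator (measurableSet_shell _ _)
  have b3 : Measurable (shellPot R₀ R) := measurable_const.indicator (measurableSet_shell _ _)
  have i1 : IntegrableOn (fun x => ballInd R (torusDiff L (x i) (x j)) * ∑ k, ‖G i k x‖ ^ 2)
      (torusBox N L) :=
    Integrable.bdd_mul (c := ‖(1 : ℝ)‖) (integrable_finsetSum _ fun k _ => hs.integrable_gradient i k)
      (b1.comp hδ).aestronglyMeasurable (Eventually.of_forall fun x => exists_bound_indicator _ _ _)
  have i3 : IntegrableOn (fun x => shellPot R₀ R (torusDiff L (x i) (x j)) * ‖ψ x‖ ^ 2)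
      (torusBox N L) :=
    Integrable.bdd_mul (c := ‖3 / (R ^ 3 - R₀ ^ 3)‖) hs.integrable_sq
      (b3.comp hδ).aestronglyMeasurable (Eventually.of_forall fun x => exists_bound_indicator _ _ _)
  have i2 : IntegrableOn (fun x => pairPot vp vm R₀ t θ (torusDiff L (x i) (x j)) * ‖ψ x‖ ^ 2)
      (torusBox N L) := by
    refine (Integrable.indicator (Integrable.sub ((hs.integrable_potential i j hij).const_mul (1 / 2))
      (hvp.const_mul (1 / 2 * (1 - θ) * (t / (1 + t))))) (hδ (Metric.isClosed_closedBall (x := 0) (ε := R₀)).measurableSet)).congr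
      (Eventually.of_forall fun x => ?_)
    change _ = pairPot vp vm R₀ t θ (torusDiff L (x i) (x j)) * ‖ψ x‖ ^ 2
    by_cases h : torusDiff L (x i) (x j) ∈ Metric.closedBall (0 : R3) R₀
    · rw [Set.indicator_of_mem (show x ∈ (fun x : Config N =>
        torusDiff L (x i) (x j)) ⁻¹' Metric.closedBall (0 : R3) R₀ from h), pairPot, Set.indicator_of_mem h]
      simp only [Pi.sub_apply]; ring
    · rw [Set.indicator_of_notMem (show x ∉ (fun x : Config N =>
        torusDiff L (x i) (x j)) ⁻¹' Metric.closedBall (0 : R3) R₀ from h), pairPot, Set.indicator_of_notMem h,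
        zero_mul]
  have hint : IntegrableOn (fun x => χ x * ((θ + (1 - θ) / c) *
      (ballInd R (torusDiff L (x i) (x j)) * ∑ k, ‖G i k x‖ ^ 2) +
      pairPot vp vm R₀ t θ (torusDiff L (x i) (x j)) * ‖ψ x‖ ^ 2 -
      θ * (shellPot R₀ R (torusDiff L (x i) (x j)) * ‖ψ x‖ ^ 2))) (torusBox N L) := by
    refine Integrable.bdd_mul (c := 1) (Integrable.sub (Integrable.add (i1.const_mul _) i2)
      (i3.const_mul _)) hχm.aestronglyMeasurable (Eventually.of_forall fun x => ?_)
    rw [Real.norm_of_nonneg (hχ0 x)]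
    exact hχ1 x
  have pδ : ∀ k x, torusDiff L ((x + L • particleUnitVec i k) i) ((x + L • particleUnitVec i k) j) =
      torusDiff L (x i) (x j) := by
    intro k x
    have e1 : (x + L • particleUnitVec i k : Config N) i = x i + L • unitVec k := by
      simp [particleUnitVec]
    have e2 : (x + L • particleUnitVec i k : Config N) j = x j := by
      simp [particleUnitVec, Pi.single_eq_of_ne hij.symm]
    rw [e1, e2, torusDiff_add_left hL]
  have pχ : ∀ k x, χ (x + L • particleUnitVec i k) = χ x := by
    intro k x
    have := update_add_particleUnitVec x i (x i) L k
    rw [Function.update_eq_self] at this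
    rw [← this, hχ]
  refine ⟨hint, integral_torus_nonneg hL (i := i) (j := j) (fun k x => ?_) hint ?_⟩
  · simp only [pδ, pχ, hs.periodic, hs.periodic_deriv]
  have a1 := ae_integrableOn_cell (j := j) hL (H := fun x => ‖ψ x‖ ^ 2) (i := i)
    (fun k x => by simp only [hs.periodic]) hs.integrable_sq
  have a2 := ae_all_iff.2 fun m => ae_integrableOn_cell (j := j) hL (H := fun x => ‖G i m x‖ ^ 2)
    (i := i) (fun k x => by simp only [hs.periodic_deriv]) (hs.integrable_gradient i m)
  have a3 := ae_integrableOn_cell (j := j) hL (H := fun x => (vp (torusDiff L (x i) (x j)) +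
    vm (torusDiff L (x i) (x j))) * ‖ψ x‖ ^ 2) (i := i)
    (fun k x => by simp only [hs.periodic, pδ]) (hs.integrable_potential i j hij)
  have a4 := (isBox_torus hL).boxProb_absolutelyContinuous.ae_le
    (ae_isRadiallyAC hij hψm (fun k => hGm i k) fun k => hs.weakGradient i k)
  filter_upwards [a1, a2, a3, a4] with x h1' h2 h3 h4
  have hu : Measurable fun y : R3 => Function.update x i (x j + y) :=
    (measurable_update x).comp (measurable_const_add _)
  have eδ : ∀ y ∈ cell L, torusDiff L (Function.update x i (x j + y) i)
      (Function.update x i (x j + y) j) = y := by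
    intro y hy
    rw [Function.update_self, Function.update_of_ne hij.symm, torusDiff_of_mem_cell hL hy]
  have h3' : IntegrableOn (fun y => (vp y + vm y) * ‖ψ (Function.update x i (x j + y))‖ ^ 2)
      (cell L) := by
    refine h3.congr_fun (fun y hy => ?_) (measurableSet_cube _ _)
    simp only [eδ y hy]
  have key := hv.dyson_cell h0 h1 hR hRL (hψm.comp hu) (fun k => (hGm i k).comp hu) h4
    h2 h1' h3'
  rw [setIntegral_congr_fun (g := fun y => χ x * ((θ + (1 - θ) / c) *
      (ballInd R y * ∑ k, ‖G i k (Function.update x i (x j + y))‖ ^ 2) +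
      pairPot vp vm R₀ t θ y * ‖ψ (Function.update x i (x j + y))‖ ^ 2 -
      θ * (shellPot R₀ R y * ‖ψ (Function.update x i (x j + y))‖ ^ 2)))
      (show MeasurableSet (cell L) from measurableSet_cube _ _)
      (fun y hy => by simp only [eδ y hy, hχ]), integral_const_mul]
  exact mul_nonneg (hχ0 x) key
end Pair

/-! ### Averages over one particle and the Poincaré inequality in a box -/

section OneVariable
variable {α : Type*} [MeasurableSpace α] {ν : Measure α} [IsProbabilityMeasure ν]

lemma enorm_integral_sq_le {g : α → ℂ} (hg : Measurable g) :
    ‖∫ y, g y ∂ν‖ₑ ^ 2 ≤ ∫⁻ y, ‖g y‖ₑ ^ 2 ∂ν := by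
  have h1 : ‖∫ y, g y ∂ν‖ₑ ≤ ∫⁻ y, ‖g y‖ₑ ∂ν := enorm_integral_le_lintegral_enorm _
  have h2 := ENNReal.lintegral_mul_le_Lp_mul_Lq ν Real.HolderConjugate.two_two
    hg.enorm.aemeasurable (g := fun _ => 1) aemeasurable_const
  simp only [Pi.mul_apply, mul_one, ENNReal.one_rpow, lintegral_const, measure_univ] at h2
  calc ‖∫ y, g y ∂ν‖ₑ ^ 2 ≤ ((∫⁻ y, ‖g y‖ₑ ^ (2:ℝ) ∂ν) ^ (1 / (2:ℝ))) ^ 2 := by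
        gcongr; exact h1.trans h2
    _ = ∫⁻ y, ‖g y‖ₑ ^ (2:ℝ) ∂ν := by
        rw [← ENNReal.rpow_natCast, ← ENNReal.rpow_mul]; norm_num
    _ = _ := by simp only [← ENNReal.rpow_natCast, Nat.cast_ofNat]

lemma integrable_of_sq {f : α → ℂ} (hf : Measurable f) (h : Integrable (fun y => ‖f y‖ ^ 2) ν) :
    Integrable f ν := by
  refine Integrable.mono' (h.add (integrable_const (1 : ℝ))) hf.aestronglyMeasurable
    (Eventually.of_forall fun y => ?_)
  simp only [Pi.add_apply]
  nlinarith [sq_nonneg (‖f y‖ - 1), norm_nonneg (f y)]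

lemma integrable_sq_sub {β : Type*} [MeasurableSpace β] {μ : Measure β} {f h : β → ℂ}
    (hf : Measurable f) (hh : Measurable h)
    (hf2 : Integrable (fun y => ‖f y‖ ^ 2) μ) (hh2 : Integrable (fun y => ‖h y‖ ^ 2) μ) :
    Integrable (fun y => ‖f y - h y‖ ^ 2) μ := by
  refine Integrable.mono' ((hf2.add hh2).const_mul 2) (by fun_prop)
    (Eventually.of_forall fun y => ?_)
  rw [Real.norm_of_nonneg (by positivity)]
  simp only [Pi.add_apply]
  have := norm_sub_le (f y) (h y)
  nlinarith [sq_nonneg (‖f y‖ - ‖h y‖), norm_nonneg (f y - h y)]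

/-- The mean is the best constant approximation, with the exact defect. -/
lemma integral_norm_sub_sq {f : α → ℂ} (hf : Measurable f)
    (h : Integrable (fun y => ‖f y‖ ^ 2) ν) (c : ℂ) :
    ∫ y, ‖f y - c‖ ^ 2 ∂ν = (∫ y, ‖f y - ∫ z, f z ∂ν‖ ^ 2 ∂ν) + ‖(∫ z, f z ∂ν) - c‖ ^ 2 := by
  set m := ∫ z, f z ∂ν with hm
  have hi := integrable_of_sq hf h
  have e : ∀ y, ‖f y - c‖ ^ 2 = ‖f y - m‖ ^ 2 + (‖m - c‖ ^ 2 +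
      2 * ((starRingEnd ℂ) (m - c) * (f y - m)).re) := by
    intro y
    simp only [← Complex.normSq_eq_norm_sq]
    have : f y - c = (f y - m) + (m - c) := by ring
    rw [this, Complex.normSq_add]
    rw [mul_comm (f y - m)]
    ring
  have i1 : Integrable (fun y => ‖f y - m‖ ^ 2) ν :=
    integrable_sq_sub hf measurable_const h (integrable_const (‖m‖ ^ 2))
  have i2 : Integrable (fun y => (starRingEnd ℂ) (m - c) * (f y - m)) ν :=
    (hi.sub (integrable_const m)).const_mul _
  have i2r : Integrable (fun y => ((starRingEnd ℂ) (m - c) * (f y - m)).re) ν := i2.re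
  have i3 : Integrable (fun y => ‖m - c‖ ^ 2 + 2 * ((starRingEnd ℂ) (m - c) * (f y - m)).re) ν :=
    (integrable_const _).add (i2r.const_mul 2)
  simp_rw [e]
  rw [integral_add i1 i3, integral_add (integrable_const _) (i2r.const_mul 2),
    integral_const_mul]
  have : ∫ y, ((starRingEnd ℂ) (m - c) * (f y - m)).re ∂ν = 0 := by
    have h1 := integral_re i2
    simp only [RCLike.re_eq_complex_re] at h1
    rw [h1, integral_const_mul, integral_sub hi (integrable_const m), ← hm]
    simp
  rw [this]
  simp

lemma norm_integral_sq_le {f : α → ℂ} (hf : Measurable f)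
    (h : Integrable (fun y => ‖f y‖ ^ 2) ν) : ‖∫ y, f y ∂ν‖ ^ 2 ≤ ∫ y, ‖f y‖ ^ 2 ∂ν := by
  have h1 := integral_norm_sub_sq hf h 0
  simp only [sub_zero] at h1
  rw [h1]
  have : 0 ≤ ∫ y, ‖f y - ∫ z, f z ∂ν‖ ^ 2 ∂ν := integral_nonneg fun y => by positivity
  linarith

lemma integral_norm_sub_mean_sq_le {f h : α → ℂ} (hf : Measurable f) (hh : Measurable h)
    (hf2 : Integrable (fun y => ‖f y‖ ^ 2) ν) (hh2 : Integrable (fun y => ‖h y‖ ^ 2) ν) :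
    ∫ y, ‖f y - ∫ z, h z ∂ν‖ ^ 2 ∂ν ≤
      (∫ y, ‖f y - ∫ z, f z ∂ν‖ ^ 2 ∂ν) + ∫ y, ‖f y - h y‖ ^ 2 ∂ν := by
  rw [integral_norm_sub_sq hf hf2]
  have := norm_integral_sq_le (ν := ν) (hf.sub hh) (integrable_sq_sub hf hh hf2 hh2)
  simp only [Pi.sub_apply] at this
  rw [integral_sub (integrable_of_sq hf hf2) (integrable_of_sq hh hh2)] at this
  gcongr
end OneVariable

section Average
variable {N : ℕ} {Q : Fin N → Set R3}

/-- The average of `f` over the position of particle `i` in `Q i`. -/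
noncomputable def avg (Q : Fin N → Set R3) (i : Fin N) (f : Config N → ℂ) (x : Config N) : ℂ :=
  ∫ y, f (Function.update x i y) ∂(ProbabilityTheory.cond volume (Q i))

lemma measurable_update_pair (i : Fin N) :
    Measurable fun p : Config N × R3 => Function.update p.1 i p.2 :=
  measurable_pi_iff.2 fun k => by
    by_cases h : k = i
    · subst h; simpa using measurable_snd
    · simp only [Function.update_of_ne h]; fun_prop

lemma measurable_avg (hQ : IsBox Q) (i : Fin N) {f : Config N → ℂ} (hf : Measurable f) :
    Measurable (avg Q i f) := by
  have := hQ.isProbabilityMeasure i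
  exact ((hf.comp (measurable_update_pair i)).stronglyMeasurable.integral_prod_right').measurable

lemma avg_update_self (i : Fin N) (f : Config N → ℂ) (x : Config N) (y : R3) :
    avg Q i f (Function.update x i y) = avg Q i f x := by
  simp [avg]

lemma avg_update_of_indep {i j : Fin N} {f : Config N → ℂ}
    (h : ∀ x y, f (Function.update x j y) = f x) (x : Config N) (y : R3) :
    avg Q i f (Function.update x j y) = avg Q i f x := by
  by_cases hij : j = i
  · subst hij; exact avg_update_self _ _ _ _
  · simp only [avg]
    congr 1; ext z
    rw [Function.update_comm hij, h]

lemma integrable_avg_sq (hQ : IsBox Q) (i : Fin N) {f : Config N → ℂ} (hf : Measurable f)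
    (h : Integrable (fun x => ‖f x‖ ^ 2) (boxProb Q)) :
    Integrable (fun x => ‖avg Q i f x‖ ^ 2) (boxProb Q) := by
  have := hQ.isProbabilityMeasure i
  have := hQ.isProbabilityMeasure_boxProb
  have h2 : Integrable (fun p : Config N × R3 => ‖f (Function.update p.1 i p.2)‖ ^ 2)
      ((boxProb Q).prod (ProbabilityTheory.cond volume (Q i))) :=
    (hQ.resample i).integrable_comp_of_integrable h
  refine Integrable.mono' h2.integral_prod_left
    ((measurable_avg hQ i hf).norm.pow_const 2).aestronglyMeasurable ?_
  filter_upwards [hQ.ae_integrable_resample i h] with x hx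
  rw [Real.norm_of_nonneg (by positivity)]
  exact norm_integral_sq_le (hf.comp (measurable_update x)) hx

/-- Averaging over one variable contracts, so its distance to `f` splits into the variance of `f` in
that variable and the distance of `f` to `h`. -/
lemma integral_sub_avg_sq_le (hQ : IsBox Q) (i : Fin N) {f h : Config N → ℂ} (hf : Measurable f)
    (hh : Measurable h) (hf2 : Integrable (fun x => ‖f x‖ ^ 2) (boxProb Q))
    (hh2 : Integrable (fun x => ‖h x‖ ^ 2) (boxProb Q)) :
    ∫ x, ‖f x - avg Q i h x‖ ^ 2 ∂(boxProb Q) ≤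
      (∫ x, ‖f x - avg Q i f x‖ ^ 2 ∂(boxProb Q)) + ∫ x, ‖f x - h x‖ ^ 2 ∂(boxProb Q) := by
  have := hQ.isProbabilityMeasure i
  have := hQ.isProbabilityMeasure_boxProb
  have i1 := integrable_sq_sub hf (measurable_avg hQ i hh) hf2 (integrable_avg_sq hQ i hh hh2)
  have i2 := integrable_sq_sub hf (measurable_avg hQ i hf) hf2 (integrable_avg_sq hQ i hf hf2)
  have i3 := integrable_sq_sub hf hh hf2 hh2
  have i4 : Integrable (fun x => ‖f x - avg Q i f x‖ ^ 2 + ‖f x - h x‖ ^ 2) (boxProb Q) :=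
    i2.add i3
  rw [← integral_add i2 i3, hQ.integral_resample i i1, hQ.integral_resample i i4]
  have hr : ∀ {F : Config N → ℝ}, Integrable F (boxProb Q) → Integrable (fun x =>
      ∫ y, F (Function.update x i y) ∂(ProbabilityTheory.cond volume (Q i))) (boxProb Q) :=
    fun {F} hF => Integrable.integral_prod_left
      ((hQ.resample i).integrable_comp_of_integrable hF)
  refine integral_mono_ae (hr i1) (hr i4) ?_
  filter_upwards [hQ.ae_integrable_resample i hf2, hQ.ae_integrable_resample i hh2,
    hQ.ae_integrable_resample i i2, hQ.ae_integrable_resample i i3] with x hx1 hx2 hx3 hx4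
  have e := integral_norm_sub_mean_sq_le (hf.comp (measurable_update x (a := i)))
    (hh.comp (measurable_update x (a := i))) hx1 hx2
  rw [integral_add hx3 hx4]
  simp only [avg_update_self]
  exact e

/-- Averaging over the particles in `s` changes `ψ` by at most the sum of the one-particle
variances. -/
lemma exists_average (hQ : IsBox Q) {ψ : Config N → ℂ} (hψ : Measurable ψ)
    (h2 : Integrable (fun x => ‖ψ x‖ ^ 2) (boxProb Q)) (s : Finset (Fin N)) :
    ∃ ψ₀ : Config N → ℂ, Measurable ψ₀ ∧ Integrable (fun x => ‖ψ₀ x‖ ^ 2) (boxProb Q) ∧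
      (∀ i ∈ s, ∀ x y, ψ₀ (Function.update x i y) = ψ₀ x) ∧
      ∫ x, ‖ψ x - ψ₀ x‖ ^ 2 ∂(boxProb Q) ≤
        ∑ i ∈ s, ∫ x, ‖ψ x - avg Q i ψ x‖ ^ 2 ∂(boxProb Q) := by
  induction s using Finset.induction_on with
  | empty => exact ⟨ψ, hψ, h2, by simp, by simp⟩
  | insert i s his ih =>
    obtain ⟨f, hf, hf2, hfs, hle⟩ := ih
    refine ⟨avg Q i f, measurable_avg hQ i hf, integrable_avg_sq hQ i hf hf2, ?_, ?_⟩
    · intro j hj x y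
      rcases Finset.mem_insert.1 hj with rfl | hj
      · exact avg_update_self _ _ _ _
      · exact avg_update_of_indep (hfs j hj) x y
    · rw [Finset.sum_insert his]
      exact (integral_sub_avg_sq_le hQ i hψ hf h2 hf2).trans (by gcongr)
end Average

section Poincare
variable {N : ℕ}

lemma update_eq_add_particleIncl (x : Config N) (i : Fin N) (h : R3) :
    Function.update x i (x i + h) = x + particleIncl i h := by
  ext1 j
  by_cases hj : j = i
  · subst hj; simp [particleIncl]
  · simp [particleIncl, hj]

lemma smul_particleIncl_apply_self (i : Fin N) (u : ℝ) (h : R3) (x : Config N) :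
    (x + u • particleIncl i h) i = x i + u • h := by
  simp [particleIncl]

lemma add_smul_mem_cube {c y h : R3} {ℓ u : ℝ} (h0 : y ∈ cube c ℓ) (h1 : y + h ∈ cube c ℓ)
    (hu : u ∈ Set.Icc (0:ℝ) 1) : y + u • h ∈ cube c ℓ := by
  intro k
  have a := h0 k
  have b := h1 k
  simp only [Set.mem_Ico, PiLp.add_apply, PiLp.smul_apply, smul_eq_mul] at a b ⊢
  obtain ⟨hu0, hu1⟩ := hu
  constructor
  · nlinarith
  · rcases le_total 0 (h k) with hk | hk <;> nlinarith

lemma enorm_sum_mul_sq_le (h : R3) (z : Fin 3 → ℂ) :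
    ‖∑ k, (h k : ℂ) * z k‖ₑ ^ 2 ≤ ENNReal.ofReal (‖h‖ ^ 2) * ENNReal.ofReal (∑ k, ‖z k‖ ^ 2) := by
  rw [← ENNReal.ofReal_mul (by positivity), ← ofReal_norm, ← ENNReal.ofReal_pow (norm_nonneg _)]
  apply ENNReal.ofReal_le_ofReal
  rw [EuclideanSpace.norm_sq_eq]
  have h1 : ‖∑ k, (h k : ℂ) * z k‖ ≤ ∑ k, ‖h k‖ * ‖z k‖ := (norm_sum_le _ _).trans
    (by simp [Complex.norm_real])
  calc _ ≤ (∑ k, ‖h k‖ * ‖z k‖) ^ 2 := by gcongr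
    _ ≤ _ := Finset.sum_mul_sq_le_sq_mul_sq _ _ _

variable {i : Fin N} {ψ : Config N → ℂ} {G : Fin 3 → Config N → ℂ}

/-- The squared difference of `ψ` under a shift of particle `i` inside a box is controlled by the
gradient. -/
lemma lintegral_translate_le {c : Fin N → R3} {ℓ : ℝ} (hψm : Measurable ψ)
    (hGm : ∀ k, Measurable (G k))
    (hG : ∀ k, HasWeakDirDeriv ψ (G k) (particleUnitVec i k)) (h : R3) :
    ∫⁻ x in Set.pi Set.univ (fun j => cube (c j) ℓ),
      Set.indicator {x : Config N | x i + h ∈ cube (c i) ℓ}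
        (fun x => ‖ψ (x + particleIncl i h) - ψ x‖ₑ ^ 2) x ≤
      ENNReal.ofReal (‖h‖ ^ 2) * ∫⁻ x in Set.pi Set.univ (fun j => cube (c j) ℓ),
        ENNReal.ofReal (∑ k, ‖G k x‖ ^ 2) := by
  set B : Set (Config N) := Set.pi Set.univ (fun j => cube (c j) ℓ) with hB
  have hBm : MeasurableSet B := MeasurableSet.univ_pi fun j => measurableSet_cube _ _
  have hgm : Measurable fun x => ENNReal.ofReal (∑ k, ‖G k x‖ ^ 2) := by fun_prop
  set g : Config N → ENNReal := fun x => ENNReal.ofReal (∑ k, ‖G k x‖ ^ 2) with hg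
  have hs : MeasurableSet {x : Config N | x i + h ∈ cube (c i) ℓ} :=
    (by fun_prop : Measurable fun x : Config N => x i + h) (measurableSet_cube _ _)
  have : IsProbabilityMeasure ((volume : Measure ℝ).restrict (Set.Ioc 0 1)) :=
    ⟨by simp⟩
  have hshift : Measurable fun p : Config N × ℝ => p.1 + p.2 • particleIncl i h := by fun_prop
  have h1 : ∀ᵐ x, x ∈ B → Set.indicator {x : Config N | x i + h ∈ cube (c i) ℓ}
      (fun x => ‖ψ (x + particleIncl i h) - ψ x‖ₑ ^ 2) x ≤
      ∫⁻ u in Set.Ioc (0:ℝ) 1, ENNReal.ofReal (‖h‖ ^ 2) *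
        B.indicator g (x + u • particleIncl i h) := by
    filter_upwards [weak_translation_ftc hψm hGm hG h] with x hx hxB
    by_cases hxs : x i + h ∈ cube (c i) ℓ
    swap
    · rw [Set.indicator_of_notMem (show x ∉ {x : Config N | x i + h ∈ cube (c i) ℓ} from hxs)]
      exact zero_le
    rw [Set.indicator_of_mem (show x ∈ {x : Config N | x i + h ∈ cube (c i) ℓ} from hxs), hx,
      intervalIntegral.integral_of_le zero_le_one]
    refine (enorm_integral_sq_le ?_).trans (setLIntegral_mono' measurableSet_Ioc fun u hu => ?_)
    · refine Finset.measurable_sum _ fun k _ => ((hGm k).comp ?_).const_mul _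
      fun_prop
    · have hmem : x + u • particleIncl i h ∈ B := by
        rw [hB, Set.mem_univ_pi] at hxB ⊢
        intro j
        by_cases hj : j = i
        · subst hj
          rw [smul_particleIncl_apply_self]
          exact add_smul_mem_cube (hxB j) hxs ⟨hu.1.le, hu.2⟩
        · simpa [particleIncl, hj] using hxB j
      rw [Set.indicator_of_mem hmem]
      exact enorm_sum_mul_sq_le h _
  have hgB : Measurable (B.indicator g) := hgm.indicator hBm
  calc _ ≤ ∫⁻ x in B, ∫⁻ u in Set.Ioc (0:ℝ) 1, ENNReal.ofReal (‖h‖ ^ 2) *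
        B.indicator g (x + u • particleIncl i h) := by
        refine lintegral_mono_ae ?_
        rw [ae_restrict_iff' hBm]
        exact h1
    _ ≤ ∫⁻ x, ∫⁻ u in Set.Ioc (0:ℝ) 1, ENNReal.ofReal (‖h‖ ^ 2) *
        B.indicator g (x + u • particleIncl i h) := lintegral_mono' Measure.restrict_le_self le_rfl
    _ = ∫⁻ u in Set.Ioc (0:ℝ) 1, ∫⁻ x, ENNReal.ofReal (‖h‖ ^ 2) *
        B.indicator g (x + u • particleIncl i h) :=
        lintegral_lintegral_swap ((hgB.comp hshift).const_mul _).aemeasurable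
    _ = ∫⁻ u in Set.Ioc (0:ℝ) 1, ENNReal.ofReal (‖h‖ ^ 2) * ∫⁻ x in B, g x := by
        congr 1; ext u
        rw [lintegral_const_mul]
        · rw [lintegral_add_right_eq_self (fun x => B.indicator g x), lintegral_indicator hBm]
        · exact hgB.comp (measurable_add_const _)
    _ = _ := by simp

/-- The Poincaré inequality for one particle in a cube of side `ℓ`. -/
theorem integral_sub_avg_sq_le_gradient {c : Fin N → R3} {ℓ : ℝ} (hℓ : 0 < ℓ) (hψm : Measurable ψ)
    (hGm : ∀ k, Measurable (G k)) (hG : ∀ k, HasWeakDirDeriv ψ (G k) (particleUnitVec i k))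
    (h2 : Integrable (fun x => ‖ψ x‖ ^ 2) (boxProb fun j => cube (c j) ℓ))
    (hG2 : ∀ k, Integrable (fun x => ‖G k x‖ ^ 2) (boxProb fun j => cube (c j) ℓ)) :
    ∫ x, ‖ψ x - avg (fun j => cube (c j) ℓ) i ψ x‖ ^ 2 ∂(boxProb fun j => cube (c j) ℓ) ≤
      24 * ℓ ^ 2 * ∫ x, ∑ k, ‖G k x‖ ^ 2 ∂(boxProb fun j => cube (c j) ℓ) := by
  have hQ := isBox_cube c hℓ
  set Q : Fin N → Set R3 := fun j => cube (c j) ℓ with hQdef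
  set P := boxProb Q with hP
  have := hQ.isProbabilityMeasure i
  have := hQ.isProbabilityMeasure_boxProb
  have hBm : MeasurableSet (Set.pi Set.univ Q) := MeasurableSet.univ_pi fun j => measurableSet_cube _ _
  set g : Config N → ENNReal := fun x => ENNReal.ofReal (∑ k, ‖G k x‖ ^ 2) with hg
  set D : R3 → Config N → ENNReal := fun h x =>
    Set.indicator {x : Config N | x i + h ∈ cube (c i) ℓ}
      (fun x => ‖ψ (x + particleIncl i h) - ψ x‖ₑ ^ 2) x with hD
  have hDm : Measurable fun p : Config N × R3 => D p.2 p.1 := by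
    have e : (fun p : Config N × R3 => D p.2 p.1) =
        Set.indicator {p : Config N × R3 | p.1 i + p.2 ∈ cube (c i) ℓ}
          (fun p => ‖ψ (p.1 + particleIncl i p.2) - ψ p.1‖ₑ ^ 2) := by
      ext p
      rfl
    rw [e]
    refine Measurable.indicator ?_ ((by fun_prop :
      Measurable fun p : Config N × R3 => p.1 i + p.2) (measurableSet_cube _ _))
    have : Measurable fun p : Config N × R3 => p.1 + particleIncl i p.2 := by fun_prop
    exact (((hψm.comp this).sub (hψm.comp measurable_fst)).enorm).pow_const 2
  have htr : ∀ h, ∫⁻ x, D h x ∂P ≤ ENNReal.ofReal (‖h‖ ^ 2) * ∫⁻ x, g x ∂P := by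
    intro h
    rw [hP, boxProb_eq hQ, lintegral_smul_measure, lintegral_smul_measure, smul_eq_mul, smul_eq_mul,
      mul_left_comm]
    gcongr
    exact lintegral_translate_le hψm hGm hG h
  set H : Set R3 := cube (WithLp.toLp 2 fun _ => -ℓ) (2 * ℓ) with hH
  have hin : ∀ᵐ x ∂P, x ∈ Set.pi Set.univ Q := by
    rw [hP, boxProb_eq hQ]
    exact Measure.ae_smul_measure (ae_restrict_mem hBm) _
  have hpt : ∀ᵐ x ∂P, ‖ψ x - avg Q i ψ x‖ₑ ^ 2 ≤ (volume (Q i))⁻¹ * ∫⁻ h in H, D h x := by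
    filter_upwards [hin, hQ.ae_integrable_resample i h2] with x hx hx2
    have hψu : Measurable fun y => ψ (Function.update x i y) := hψm.comp (measurable_update x)
    have e1 : avg Q i ψ x - ψ x = ∫ y, (ψ (Function.update x i y) - ψ x)
        ∂(ProbabilityTheory.cond volume (Q i)) := by
      rw [integral_sub (integrable_of_sq hψu hx2) (integrable_const _)]
      simp [avg]
    rw [enorm_sub_rev, e1]
    refine (enorm_integral_sq_le (hψu.sub_const _)).trans ?_
    rw [ProbabilityTheory.cond, lintegral_smul_measure, smul_eq_mul]
    refine mul_le_mul' le_rfl ?_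
    rw [← lintegral_indicator (hQ i).1, ← lintegral_add_left_eq_self _ (x i),
      ← lintegral_indicator (measurableSet_cube _ _)]
    refine lintegral_mono fun h => ?_
    by_cases hh : x i + h ∈ Q i
    · have hxi := (Set.mem_univ_pi.1 hx) i
      have hhH : h ∈ H := by
        intro k
        have a := hxi k
        have b := hh k
        simp only [Set.mem_Ico, PiLp.add_apply] at a b ⊢
        constructor <;> linarith
      rw [Set.indicator_of_mem hh, Set.indicator_of_mem hhH, update_eq_add_particleIncl]
      simp only [hD]
      rw [Set.indicator_of_mem (show x ∈ {x : Config N | x i + h ∈ cube (c i) ℓ} from hh)]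
    · rw [Set.indicator_of_notMem hh]; exact zero_le
  have hHn : ∀ h ∈ H, ‖h‖ ^ 2 ≤ 3 * ℓ ^ 2 := by
    intro h hh
    rw [EuclideanSpace.norm_sq_eq, Fin.sum_univ_three]
    have : ∀ k, ‖h k‖ ^ 2 ≤ ℓ ^ 2 := by
      intro k
      have a := hh k
      simp only [Set.mem_Ico] at a
      rw [Real.norm_eq_abs, sq_abs]
      nlinarith
    linarith [this 0, this 1, this 2]
  have main : ∫⁻ x, ‖ψ x - avg Q i ψ x‖ₑ ^ 2 ∂P ≤ ENNReal.ofReal (24 * ℓ ^ 2) * ∫⁻ x, g x ∂P := by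
    calc _ ≤ ∫⁻ x, ((volume (Q i))⁻¹ * ∫⁻ h in H, D h x) ∂P := lintegral_mono_ae hpt
      _ = (volume (Q i))⁻¹ * ∫⁻ x, (∫⁻ h in H, D h x) ∂P :=
          lintegral_const_mul _ hDm.lintegral_prod_right'
      _ = (volume (Q i))⁻¹ * ∫⁻ h in H, (∫⁻ x, D h x ∂P) := by
          rw [lintegral_lintegral_swap hDm.aemeasurable]
      _ ≤ (volume (Q i))⁻¹ * ∫⁻ h in H, ENNReal.ofReal (3 * ℓ ^ 2) * ∫⁻ x, g x ∂P := by
          refine mul_le_mul' le_rfl ?_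
          refine setLIntegral_mono' (measurableSet_cube _ _) fun h hh => (htr h).trans ?_
          gcongr
          exact hHn h hh
      _ = _ := by
          rw [setLIntegral_const, volume_cube, volume_cube]
          rw [← ENNReal.ofReal_pow hℓ.le, ← ENNReal.ofReal_inv_of_pos (by positivity),
            ← ENNReal.ofReal_pow (by positivity), mul_comm _ (∫⁻ x, g x ∂P),
            mul_comm _ (∫⁻ x, g x ∂P), mul_left_comm, mul_assoc, ← ENNReal.ofReal_mul (by positivity),
            ← ENNReal.ofReal_mul (by positivity)]
          congr 2
          field_simp
          norm_num
  have hi : Integrable (fun x => ∑ k, ‖G k x‖ ^ 2) P := integrable_finsetSum _ fun k _ => hG2 k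
  rw [integral_eq_lintegral_of_nonneg_ae (Eventually.of_forall fun x => by positivity)
    (show AEStronglyMeasurable (fun x => ‖ψ x - avg Q i ψ x‖ ^ 2) P from
      (((hψm.sub (measurable_avg hQ i hψm)).norm.pow_const 2).aestronglyMeasurable)),
    integral_eq_lintegral_of_nonneg_ae (Eventually.of_forall fun x => by positivity)
    hi.aestronglyMeasurable]
  have hfin : ∫⁻ x, g x ∂P ≠ ⊤ := hi.lintegral_lt_top.ne
  rw [← ENNReal.toReal_ofReal (show 0 ≤ 24 * ℓ ^ 2 by positivity), ← ENNReal.toReal_mul]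
  refine ENNReal.toReal_mono (ENNReal.mul_ne_top ENNReal.ofReal_ne_top hfin) ?_
  simpa only [ENNReal.ofReal_pow (norm_nonneg _), ofReal_norm] using main
end Poincare

/-! ### Groups of particles in one box -/

section Group
variable {N : ℕ}

/-- The points of `cube c ℓ` at distance more than `d` from the boundary. -/
def innerCube (c : R3) (ℓ d : ℝ) : Set R3 := {y | ∀ k, y k ∈ Set.Ioo (c k + d) (c k + ℓ - d)}

lemma innerCube_eq_preimage (c : R3) (ℓ d : ℝ) : innerCube c ℓ d =
    (WithLp.ofLp : R3 → (Fin 3 → ℝ)) ⁻¹'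
      (Set.pi Set.univ fun k => Set.Ioo (c k + d) (c k + ℓ - d)) := by
  ext y; simp [innerCube]

lemma measurableSet_innerCube (c : R3) (ℓ d : ℝ) : MeasurableSet (innerCube c ℓ d) := by
  rw [innerCube_eq_preimage]
  exact (PiLp.volume_preserving_ofLp (Fin 3)).measurable
    (MeasurableSet.univ_pi fun _ => measurableSet_Ioo)

lemma volume_innerCube (c : R3) (ℓ d : ℝ) :
    volume (innerCube c ℓ d) = ENNReal.ofReal (ℓ - 2 * d) ^ 3 := by
  rw [innerCube_eq_preimage, (PiLp.volume_preserving_ofLp (Fin 3)).measure_preimage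
    (MeasurableSet.univ_pi fun _ => measurableSet_Ioo).nullMeasurableSet, volume_pi_pi]
  have (k : Fin 3) : c k + ℓ - d - (c k + d) = ℓ - 2 * d := by ring
  simp [this]

lemma innerCube_subset {c : R3} {ℓ d : ℝ} (hd : 0 ≤ d) : innerCube c ℓ d ⊆ cube c ℓ := fun y hy k =>
  ⟨by linarith [(hy k).1], by linarith [(hy k).2]⟩

lemma mem_cube_of_mem_innerCube {c y z : R3} {ℓ d : ℝ} (hy : y ∈ innerCube c ℓ d)
    (h : ‖z - y‖ ≤ d) : z ∈ cube c ℓ := by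
  intro k
  have h1 : |z k - y k| ≤ ‖z - y‖ := by simpa using PiLp.norm_apply_le (z - y) k
  have h2 := abs_le.1 (h1.trans h)
  have := hy k
  simp only [Set.mem_Ioo] at this
  constructor <;> linarith [h2.1, h2.2, this.1, this.2]

lemma integral_cond_cube (c : R3) {ℓ : ℝ} (hℓ : 0 < ℓ) (f : R3 → ℝ) :
    ∫ y, f y ∂(ProbabilityTheory.cond volume (cube c ℓ)) = (ℓ ^ 3)⁻¹ * ∫ y in cube c ℓ, f y := by
  rw [ProbabilityTheory.cond, integral_smul_measure, volume_cube, smul_eq_mul,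
    ENNReal.toReal_inv, ENNReal.toReal_pow, ENNReal.toReal_ofReal hℓ.le]

lemma measurable_shellPot (R₀ R : ℝ) : Measurable (shellPot R₀ R) :=
  measurable_const.indicator (measurableSet_shell _ _)

lemma volume_closedBall_real (x : R3) {r : ℝ} (hr : 0 ≤ r) :
    (volume : Measure R3).real (Metric.closedBall x r) = 4 * Real.pi / 3 * r ^ 3 := by
  rw [Measure.real, EuclideanSpace.volume_closedBall_fin_three, ENNReal.toReal_mul,
    ENNReal.toReal_pow, ENNReal.toReal_ofReal hr, ENNReal.toReal_ofReal (by positivity)]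
  ring

variable {R₀ R : ℝ}

lemma shell_eq_sdiff : {y : R3 | ‖y‖ ∈ Set.Ioc R₀ R} =
    Metric.closedBall 0 R \ Metric.closedBall 0 R₀ := by
  ext y; simp [and_comm]

lemma integrable_shellPot : Integrable (shellPot R₀ R) := by
  refine (integrableOn_const (by
    rw [shell_eq_sdiff]
    exact ((measure_mono Set.sdiff_subset).trans_lt
      (isCompact_closedBall (0 : R3) R).measure_lt_top).ne) :
    IntegrableOn (fun _ => 3 / (R ^ 3 - R₀ ^ 3)) {y : R3 | ‖y‖ ∈ Set.Ioc R₀ R}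
    volume).integrable_indicator (measurableSet_shell _ _)

lemma cube_sub_pos (h0 : 0 ≤ R₀) (hR : R₀ < R) : 0 < R ^ 3 - R₀ ^ 3 :=
  sub_pos.2 (pow_lt_pow_left₀ hR h0 (by norm_num))

lemma shellPot_nonneg (h0 : 0 ≤ R₀) (hR : R₀ < R) (y : R3) : 0 ≤ shellPot R₀ R y :=
  Set.indicator_nonneg (fun _ _ => div_nonneg (by norm_num) (cube_sub_pos h0 hR).le) _

lemma shellPot_le (h0 : 0 ≤ R₀) (hR : R₀ < R) (y : R3) : shellPot R₀ R y ≤ 3 / (R ^ 3 - R₀ ^ 3) :=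
  Set.indicator_apply_le' (fun _ => le_rfl)
    (fun _ => div_nonneg (by norm_num) (cube_sub_pos h0 hR).le)

lemma integral_shellPot (h0 : 0 ≤ R₀) (hR : R₀ < R) : ∫ y, shellPot R₀ R y = 4 * Real.pi := by
  unfold shellPot
  have := cube_sub_pos h0 hR
  rw [integral_indicator (measurableSet_shell _ _), setIntegral_const, shell_eq_sdiff,
    measureReal_sdiff (Metric.closedBall_subset_closedBall hR.le) Metric.isClosed_closedBall.measurableSet
      ((isCompact_closedBall (0 : R3) R).measure_lt_top.ne),
    volume_closedBall_real _ h0, volume_closedBall_real _ (h0.trans hR.le), smul_eq_mul]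
  field_simp

lemma integral_cond_shellPot_le (h0 : 0 ≤ R₀) (hR : R₀ < R) (c z : R3) {ℓ : ℝ} (hℓ : 0 < ℓ) :
    ∫ y, shellPot R₀ R (y - z) ∂(ProbabilityTheory.cond volume (cube c ℓ)) ≤
      4 * Real.pi / ℓ ^ 3 := by
  rw [integral_cond_cube c hℓ, div_eq_inv_mul]
  gcongr
  rw [← integral_shellPot h0 hR, ← integral_sub_right_eq_self (shellPot R₀ R) z]
  exact setIntegral_le_integral (integrable_shellPot.comp_sub_right z)
    (Eventually.of_forall fun y => shellPot_nonneg h0 hR _)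

lemma integral_cond_shellPot_eq (h0 : 0 ≤ R₀) (hR : R₀ < R) (c : R3) {z : R3} {ℓ : ℝ} (hℓ : 0 < ℓ)
    (hz : z ∈ innerCube c ℓ (2 * R)) :
    ∫ y, shellPot R₀ R (y - z) ∂(ProbabilityTheory.cond volume (cube c ℓ)) =
      4 * Real.pi / ℓ ^ 3 := by
  rw [integral_cond_cube c hℓ, div_eq_inv_mul]
  congr 1
  rw [← integral_shellPot h0 hR, ← integral_sub_right_eq_self (shellPot R₀ R) z]
  refine setIntegral_eq_integral_of_forall_compl_eq_zero fun y hy => ?_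
  by_contra hne
  have h1 := Set.mem_of_indicator_ne_zero hne
  simp only [Set.mem_ofPred_eq, Set.mem_Ioc] at h1
  exact hy (mem_cube_of_mem_innerCube hz (by linarith))

open Classical in
/-- The soft pair potential between `i` and `j`, kept only if `xⱼ` is far from the boundary of
the box and from all other particles of the group `s`. -/
noncomputable def pairTerm (s : Finset (Fin N)) (c₀ : R3) (ℓ R₀ R : ℝ) (i j : Fin N)
    (x : Config N) : ℝ :=
  if x j ∈ innerCube c₀ ℓ (2 * R) ∧ ∀ k ∈ s, k ≠ i → k ≠ j → 2 * R < ‖x k - x j‖ then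
    shellPot R₀ R (x i - x j) else 0

/-- The soft interaction within the group `s`. -/
noncomputable def groupPot (s : Finset (Fin N)) (c₀ : R3) (ℓ R₀ R : ℝ) (x : Config N) : ℝ :=
  ∑ i ∈ s, ∑ j ∈ s.erase i, pairTerm s c₀ ℓ R₀ R i j x

variable {s : Finset (Fin N)} {c₀ : R3} {ℓ : ℝ}

lemma pairTerm_nonneg (h0 : 0 ≤ R₀) (hR : R₀ < R) (i j : Fin N) (x : Config N) :
    0 ≤ pairTerm s c₀ ℓ R₀ R i j x := by
  unfold pairTerm
  split_ifs
  · exact shellPot_nonneg h0 hR _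
  · rfl

lemma pairTerm_le (h0 : 0 ≤ R₀) (hR : R₀ < R) (i j : Fin N) (x : Config N) :
    pairTerm s c₀ ℓ R₀ R i j x ≤ 3 / (R ^ 3 - R₀ ^ 3) := by
  unfold pairTerm
  split_ifs
  · exact shellPot_le h0 hR _
  · exact div_nonneg (by norm_num) (cube_sub_pos h0 hR).le

lemma of_pairTerm_ne_zero {i j : Fin N} {x : Config N}
    (h : pairTerm s c₀ ℓ R₀ R i j x ≠ 0) :
    (∀ k ∈ s, k ≠ i → k ≠ j → 2 * R < ‖x k - x j‖) ∧ ‖x i - x j‖ ≤ R := by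
  unfold pairTerm at h
  split_ifs at h with h1
  · exact ⟨h1.2, (Set.mem_of_indicator_ne_zero h).2⟩
  · exact absurd rfl h

lemma measurable_pairTerm (i j : Fin N) : Measurable (pairTerm s c₀ ℓ R₀ R i j) := by
  refine Measurable.ite ?_ ((measurable_shellPot R₀ R).comp (by fun_prop)) measurable_const
  have h1 : MeasurableSet {x : Config N | x j ∈ innerCube c₀ ℓ (2 * R)} :=
    measurable_pi_apply j (measurableSet_innerCube _ _ _)
  have h2 : MeasurableSet {x : Config N | ∀ k ∈ s, k ≠ i → k ≠ j → 2 * R < ‖x k - x j‖} := by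
    have : {x : Config N | ∀ k ∈ s, k ≠ i → k ≠ j → 2 * R < ‖x k - x j‖} =
        ⋂ k : Fin N, ⋂ (_ : k ∈ s), ⋂ (_ : k ≠ i), ⋂ (_ : k ≠ j),
          {x : Config N | 2 * R < ‖x k - x j‖} := by
      ext x; simp
    rw [this]
    exact MeasurableSet.iInter fun k => MeasurableSet.iInter fun _ => MeasurableSet.iInter fun _ =>
      MeasurableSet.iInter fun _ => measurableSet_lt measurable_const (by fun_prop)
  exact h1.inter h2

lemma measurable_groupPot : Measurable (groupPot s c₀ ℓ R₀ R) :=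
  Finset.measurable_sum _ fun i _ => Finset.measurable_sum _ fun j _ => measurable_pairTerm i j

lemma groupPot_nonneg (h0 : 0 ≤ R₀) (hR : R₀ < R) (x : Config N) :
    0 ≤ groupPot s c₀ ℓ R₀ R x :=
  Finset.sum_nonneg fun _ _ => Finset.sum_nonneg fun _ _ => pairTerm_nonneg h0 hR _ _ _

/-- At most one `j` interacts with a given particle `i`. -/
lemma groupPot_le (h0 : 0 ≤ R₀) (hR : R₀ < R) (x : Config N) :
    groupPot s c₀ ℓ R₀ R x ≤ 3 * s.card / (R ^ 3 - R₀ ^ 3) := by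
  have : ∀ i ∈ s, ∑ j ∈ s.erase i, pairTerm s c₀ ℓ R₀ R i j x ≤ 3 / (R ^ 3 - R₀ ^ 3) := by
    intro i _
    by_cases h : ∀ j ∈ s.erase i, pairTerm s c₀ ℓ R₀ R i j x = 0
    · rw [Finset.sum_eq_zero h]
      exact div_nonneg (by norm_num) (cube_sub_pos h0 hR).le
    push Not at h
    obtain ⟨j, hj, hne⟩ := h
    rw [Finset.sum_eq_single_of_mem j hj]
    · exact pairTerm_le h0 hR _ _ _
    · intro m hm hmj
      by_contra hm0
      obtain ⟨hfar, d1⟩ := of_pairTerm_ne_zero hne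
      have d2 := (of_pairTerm_ne_zero hm0).2
      have := hfar m (Finset.mem_of_mem_erase hm) (Finset.ne_of_mem_erase hm) hmj
      have e : x m - x j = (x i - x j) - (x i - x m) := by abel
      rw [e] at this
      linarith [norm_sub_le (x i - x j) (x i - x m)]
  calc groupPot s c₀ ℓ R₀ R x ≤ ∑ i ∈ s, 3 / (R ^ 3 - R₀ ^ 3) := Finset.sum_le_sum this
    _ = _ := by rw [Finset.sum_const, nsmul_eq_mul]; ring

lemma IsBox.integral_mul_indep {Q : Fin N → Set R3} (hQ : IsBox Q) (i : Fin N) {K g : Config N → ℝ}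
    (h : Integrable (fun x => K x * g x) (boxProb Q))
    (hg : ∀ x y, g (Function.update x i y) = g x) :
    ∫ x, K x * g x ∂(boxProb Q) = ∫ x, (∫ y, K (Function.update x i y)
      ∂(ProbabilityTheory.cond volume (Q i))) * g x ∂(boxProb Q) := by
  rw [hQ.integral_resample i h]
  simp only [hg, integral_mul_const]
end Group

section GroupBound
variable {N : ℕ} {R₀ R ℓ : ℝ} {c : Fin N → R3} {s : Finset (Fin N)} {c₀ : R3} {g : Config N → ℝ}

lemma integrable_bdd_mul {P : Measure (Config N)} {K g : Config N → ℝ} (hK : Measurable K) {b : ℝ}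
    (hK0 : ∀ x, 0 ≤ K x) (hKb : ∀ x, K x ≤ b) (hg : Integrable g P) :
    Integrable (fun x => K x * g x) P :=
  Integrable.bdd_mul (c := b) hg hK.aestronglyMeasurable (Eventually.of_forall fun x => by
    rw [Real.norm_of_nonneg (hK0 x)]; exact hKb x)

/-- The mean of the soft interaction of `i` with a particle `j` away from the boundary. -/
lemma integral_inner_shell (h0 : 0 ≤ R₀) (hR : R₀ < R) (hℓ : 4 * R ≤ ℓ) {i j : Fin N} (hij : i ≠ j)
    (hci : c i = c₀) (hcj : c j = c₀) (hg0 : ∀ x, 0 ≤ g x)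
    (hg : Integrable g (boxProb fun m => cube (c m) ℓ))
    (hgi : ∀ x y, g (Function.update x i y) = g x) (hgj : ∀ x y, g (Function.update x j y) = g x) :
    4 * Real.pi / ℓ ^ 3 * (1 - 12 * R / ℓ) * ∫ x, g x ∂(boxProb fun m => cube (c m) ℓ) ≤
    ∫ x, ((innerCube c₀ ℓ (2 * R)).indicator (fun _ => (1 : ℝ)) (x j) *
      shellPot R₀ R (x i - x j)) * g x ∂(boxProb fun m => cube (c m) ℓ) := by
  have hR0 : 0 < R := h0.trans_lt hR
  have hℓ0 : 0 < ℓ := by linarith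
  have hQ := isBox_cube c hℓ0
  have hIm : Measurable ((innerCube c₀ ℓ (2 * R)).indicator (fun _ => (1 : ℝ))) :=
    measurable_const.indicator (measurableSet_innerCube _ _ _)
  set I := (innerCube c₀ ℓ (2 * R)).indicator (fun _ => (1 : ℝ)) with hI
  have hI0 : ∀ y, 0 ≤ I y := fun y => Set.indicator_nonneg (fun _ _ => zero_le_one) _
  have hI1 : ∀ y, I y ≤ 1 := fun y => Set.indicator_apply_le' (fun _ => le_rfl) fun _ => zero_le_one
  rw [hQ.integral_mul_indep i ?_ hgi]
  swap
  · refine integrable_bdd_mul (b := 1 * (3 / (R ^ 3 - R₀ ^ 3)))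
      ((hIm.comp (measurable_pi_apply j)).mul ((measurable_shellPot R₀ R).comp (by fun_prop)))
      (fun x => mul_nonneg (hI0 _) (shellPot_nonneg h0 hR _))
      (fun x => mul_le_mul (hI1 _) (shellPot_le h0 hR _) (shellPot_nonneg h0 hR _) zero_le_one) hg
  have e1 : ∀ x : Config N, ∫ y, I (Function.update x i y j) *
      shellPot R₀ R (Function.update x i y i - Function.update x i y j)
      ∂(ProbabilityTheory.cond volume (cube (c i) ℓ)) = I (x j) * (4 * Real.pi / ℓ ^ 3) := by
    intro x
    simp only [Function.update_of_ne hij.symm, Function.update_self, integral_const_mul]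
    by_cases hx : x j ∈ innerCube c₀ ℓ (2 * R)
    · rw [hci, integral_cond_shellPot_eq h0 hR c₀ hℓ0 hx]
    · rw [hI, Set.indicator_of_notMem hx, zero_mul, zero_mul]
  simp only [e1]
  rw [hQ.integral_mul_indep j ?_ hgj]
  swap
  · exact integrable_bdd_mul (b := 1 * (4 * Real.pi / ℓ ^ 3))
      ((hIm.comp (measurable_pi_apply j)).mul_const _)
      (fun x => mul_nonneg (hI0 _) (by positivity))
      (fun x => mul_le_mul (hI1 _) le_rfl (by positivity) zero_le_one) hg
  have e2 : ∫ y, I y ∂(ProbabilityTheory.cond volume (cube (c j) ℓ)) = (1 - 4 * R / ℓ) ^ 3 := by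
    rw [integral_cond_cube _ hℓ0, hI, setIntegral_indicator (measurableSet_innerCube _ _ _),
      hcj, Set.inter_eq_right.2 (innerCube_subset (by linarith)), setIntegral_const, Measure.real,
      volume_innerCube, ENNReal.toReal_pow, ENNReal.toReal_ofReal (by linarith)]
    simp only [smul_eq_mul, mul_one]
    field_simp
    ring
  have e3 : 1 - 12 * R / ℓ ≤ (1 - 4 * R / ℓ) ^ 3 := by
    have h1 : 4 * R / ℓ ≤ 1 := (div_le_one hℓ0).2 hℓ
    have := one_add_mul_le_pow (a := -(4 * R / ℓ)) (by linarith) 3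
    have h2 : 12 * R / ℓ = 3 * (4 * R / ℓ) := by ring
    push_cast at this
    rw [h2]
    linarith
  simp only [Function.update_self, integral_mul_const, e2, integral_const_mul]
  rw [mul_comm ((1 - 4 * R / ℓ) ^ 3)]
  exact mul_le_mul_of_nonneg_right (mul_le_mul_of_nonneg_left e3 (by positivity))
    (integral_nonneg hg0)

/-- The mean of the soft interaction that is lost because a third particle `k` is close. -/
lemma integral_near_shell (h0 : 0 ≤ R₀) (hR : R₀ < R) (hℓ : 0 < ℓ) {i j k : Fin N}
    (hij : i ≠ j) (hki : k ≠ i) (hkj : k ≠ j) (hg0 : ∀ x, 0 ≤ g x)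
    (hg : Integrable g (boxProb fun m => cube (c m) ℓ))
    (hgi : ∀ x y, g (Function.update x i y) = g x) (hgk : ∀ x y, g (Function.update x k y) = g x) :
    ∫ x, ((Metric.closedBall 0 (2 * R)).indicator (fun _ => (1 : ℝ)) (x k - x j) *
      shellPot R₀ R (x i - x j)) * g x ∂(boxProb fun m => cube (c m) ℓ) ≤
    4 * Real.pi / ℓ ^ 3 * (32 * Real.pi / 3 * R ^ 3 / ℓ ^ 3) *
      ∫ x, g x ∂(boxProb fun m => cube (c m) ℓ) := by
  have hR0 : 0 < R := h0.trans_lt hR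
  have hQ := isBox_cube c hℓ
  have hIm : Measurable ((Metric.closedBall (0 : R3) (2 * R)).indicator (fun _ => (1 : ℝ))) :=
    measurable_const.indicator Metric.isClosed_closedBall.measurableSet
  set I := (Metric.closedBall (0 : R3) (2 * R)).indicator (fun _ => (1 : ℝ)) with hI
  have hI0 : ∀ y, 0 ≤ I y := fun y => Set.indicator_nonneg (fun _ _ => zero_le_one) _
  have hI1 : ∀ y, I y ≤ 1 := fun y => Set.indicator_apply_le' (fun _ => le_rfl) fun _ => zero_le_one
  have hIc : Measurable fun x : Config N => I (x k - x j) :=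
    hIm.comp (by fun_prop : Measurable fun x : Config N => x k - x j)
  have i1 : Integrable (fun x => (I (x k - x j) * shellPot R₀ R (x i - x j)) * g x)
      (boxProb fun m => cube (c m) ℓ) :=
    integrable_bdd_mul (b := 1 * (3 / (R ^ 3 - R₀ ^ 3)))
      (hIc.mul ((measurable_shellPot R₀ R).comp (by fun_prop)))
      (fun x => mul_nonneg (hI0 _) (shellPot_nonneg h0 hR _))
      (fun x => mul_le_mul (hI1 _) (shellPot_le h0 hR _) (shellPot_nonneg h0 hR _) zero_le_one) hg
  have i2 : Integrable (fun x => (I (x k - x j) * (4 * Real.pi / ℓ ^ 3)) * g x)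
      (boxProb fun m => cube (c m) ℓ) :=
    integrable_bdd_mul (b := 1 * (4 * Real.pi / ℓ ^ 3)) (hIc.mul_const _)
      (fun x => mul_nonneg (hI0 _) (by positivity))
      (fun x => mul_le_mul (hI1 _) le_rfl (by positivity) zero_le_one) hg
  have e1 : ∀ x : Config N, ∫ y, I (Function.update x i y k - Function.update x i y j) *
      shellPot R₀ R (Function.update x i y i - Function.update x i y j)
      ∂(ProbabilityTheory.cond volume (cube (c i) ℓ)) ≤ I (x k - x j) * (4 * Real.pi / ℓ ^ 3) := by
    intro x
    simp only [Function.update_of_ne hij.symm, Function.update_of_ne hki, Function.update_self,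
      integral_const_mul]
    exact mul_le_mul_of_nonneg_left (integral_cond_shellPot_le h0 hR _ _ hℓ) (hI0 _)
  have e1' : ∀ x : Config N, 0 ≤ ∫ y, I (Function.update x i y k - Function.update x i y j) *
      shellPot R₀ R (Function.update x i y i - Function.update x i y j)
      ∂(ProbabilityTheory.cond volume (cube (c i) ℓ)) := fun x =>
    integral_nonneg fun y => mul_nonneg (hI0 _) (shellPot_nonneg h0 hR _)
  have e2 : ∀ x : Config N, ∫ y, I (Function.update x k y k - Function.update x k y j) *
      (4 * Real.pi / ℓ ^ 3) ∂(ProbabilityTheory.cond volume (cube (c k) ℓ)) ≤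
      4 * Real.pi / ℓ ^ 3 * (32 * Real.pi / 3 * R ^ 3 / ℓ ^ 3) := by
    intro x
    simp only [Function.update_of_ne hkj.symm, Function.update_self, integral_mul_const]
    rw [mul_comm]
    refine mul_le_mul_of_nonneg_left ?_ (by positivity)
    rw [integral_cond_cube _ hℓ, div_eq_inv_mul]
    refine mul_le_mul_of_nonneg_left ?_ (by positivity)
    have hint : Integrable I := by
      rw [hI]
      exact (integrableOn_const (isCompact_closedBall (0 : R3) (2 * R)).measure_lt_top.ne :
        IntegrableOn (fun _ => (1 : ℝ)) (Metric.closedBall (0 : R3) (2 * R))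
        volume).integrable_indicator Metric.isClosed_closedBall.measurableSet
    refine (setIntegral_le_integral (hint.comp_sub_right (x j))
      (Eventually.of_forall fun y => hI0 _)).trans ?_
    rw [integral_sub_right_eq_self I (x j), hI,
      integral_indicator Metric.isClosed_closedBall.measurableSet, setIntegral_const,
      volume_closedBall_real _ (by linarith)]
    simp only [smul_eq_mul, mul_one]
    apply le_of_eq
    ring
  have e2' : ∀ x : Config N, 0 ≤ ∫ y, I (Function.update x k y k - Function.update x k y j) *
      (4 * Real.pi / ℓ ^ 3) ∂(ProbabilityTheory.cond volume (cube (c k) ℓ)) := fun x =>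
    integral_nonneg fun y => mul_nonneg (hI0 _) (by positivity)
  calc _ = _ := hQ.integral_mul_indep i i1 hgi
    _ ≤ ∫ x, (I (x k - x j) * (4 * Real.pi / ℓ ^ 3)) * g x ∂(boxProb fun m => cube (c m) ℓ) := by
        refine integral_mono_of_nonneg (Eventually.of_forall fun x => mul_nonneg (e1' x) (hg0 x)) i2
          (Eventually.of_forall fun x => mul_le_mul_of_nonneg_right (e1 x) (hg0 x))
    _ = _ := hQ.integral_mul_indep k i2 hgk
    _ ≤ ∫ x, 4 * Real.pi / ℓ ^ 3 * (32 * Real.pi / 3 * R ^ 3 / ℓ ^ 3) * g x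
        ∂(boxProb fun m => cube (c m) ℓ) := by
        refine integral_mono_of_nonneg (Eventually.of_forall fun x => mul_nonneg (e2' x) (hg0 x))
          (hg.const_mul _)
          (Eventually.of_forall fun x => mul_le_mul_of_nonneg_right (e2 x) (hg0 x))
    _ = _ := integral_const_mul _ _

/-- The relative error in the mean of the soft interaction of `n` particles in a box. -/
noncomputable def groupErr (R ℓ : ℝ) (n : ℕ) : ℝ :=
  12 * R / ℓ + n * (32 * Real.pi / 3 * R ^ 3 / ℓ ^ 3)

/-- A union bound over the third particles. -/
lemma pairTerm_ge (h0 : 0 ≤ R₀) (hR : R₀ < R) (i j : Fin N) (x : Config N) :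
    (innerCube c₀ ℓ (2 * R)).indicator (fun _ => (1 : ℝ)) (x j) * shellPot R₀ R (x i - x j) -
      ∑ k ∈ (s.erase i).erase j, (Metric.closedBall 0 (2 * R)).indicator (fun _ => (1 : ℝ))
        (x k - x j) * shellPot R₀ R (x i - x j) ≤ pairTerm s c₀ ℓ R₀ R i j x := by
  have hU := shellPot_nonneg h0 hR (x i - x j)
  have hI0 : ∀ y, 0 ≤ (Metric.closedBall (0 : R3) (2 * R)).indicator (fun _ => (1 : ℝ)) y :=
    fun y => Set.indicator_nonneg (fun _ _ => zero_le_one) _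
  have hS : 0 ≤ ∑ k ∈ (s.erase i).erase j, (Metric.closedBall (0 : R3) (2 * R)).indicator
      (fun _ => (1 : ℝ)) (x k - x j) * shellPot R₀ R (x i - x j) :=
    Finset.sum_nonneg fun k _ => mul_nonneg (hI0 _) hU
  by_cases hin : x j ∈ innerCube c₀ ℓ (2 * R)
  swap
  · rw [Set.indicator_of_notMem hin, zero_mul]
    linarith [pairTerm_nonneg (s := s) (c₀ := c₀) (ℓ := ℓ) h0 hR i j x]
  rw [Set.indicator_of_mem hin, one_mul]
  by_cases hfar : ∀ k ∈ s, k ≠ i → k ≠ j → 2 * R < ‖x k - x j‖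
  · rw [pairTerm, if_pos ⟨hin, hfar⟩]
    linarith
  · rw [pairTerm, if_neg fun h => hfar h.2]
    push Not at hfar
    obtain ⟨k, hk, hki, hkj, hle⟩ := hfar
    have := Finset.single_le_sum (f := fun k => (Metric.closedBall (0 : R3) (2 * R)).indicator
      (fun _ => (1 : ℝ)) (x k - x j) * shellPot R₀ R (x i - x j))
      (fun k _ => mul_nonneg (hI0 _) hU)
      (Finset.mem_erase.2 ⟨hkj, Finset.mem_erase.2 ⟨hki, hk⟩⟩)
    rw [Set.indicator_of_mem (by simpa using hle), one_mul] at this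
    linarith

/-- The mean of the soft interaction, against a density that does not depend on the positions of the
group. -/
lemma integral_groupPot (h0 : 0 ≤ R₀) (hR : R₀ < R) (hℓ : 4 * R ≤ ℓ) (hc : ∀ i ∈ s, c i = c₀)
    (hg0 : ∀ x, 0 ≤ g x) (hg : Integrable g (boxProb fun m => cube (c m) ℓ))
    (hgs : ∀ i ∈ s, ∀ x y, g (Function.update x i y) = g x) :
    4 * Real.pi / ℓ ^ 3 * (s.card * (s.card - 1)) * (1 - groupErr R ℓ s.card) *
      ∫ x, g x ∂(boxProb fun m => cube (c m) ℓ) ≤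
    ∫ x, groupPot s c₀ ℓ R₀ R x * g x ∂(boxProb fun m => cube (c m) ℓ) := by
  have hR0 : 0 < R := h0.trans_lt hR
  have hℓ0 : 0 < ℓ := by linarith
  set P := boxProb fun m => cube (c m) ℓ with hP
  have hG : 0 ≤ ∫ x, g x ∂P := integral_nonneg hg0
  have hpm : ∀ i j, Integrable (fun x => pairTerm s c₀ ℓ R₀ R i j x * g x) P := fun i j =>
    integrable_bdd_mul (measurable_pairTerm i j) (pairTerm_nonneg h0 hR i j)
      (pairTerm_le h0 hR i j) hg
  have hpair : ∀ i ∈ s, ∀ j ∈ s.erase i, 4 * Real.pi / ℓ ^ 3 * (1 - groupErr R ℓ s.card) *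
      ∫ x, g x ∂P ≤ ∫ x, pairTerm s c₀ ℓ R₀ R i j x * g x ∂P := by
    intro i hi j hj
    have hji := Finset.ne_of_mem_erase hj
    have hjs := Finset.mem_of_mem_erase hj
    have a1 := integral_inner_shell h0 hR hℓ hji.symm (hc i hi) (hc j hjs) hg0 hg (hgs i hi) (hgs j hjs)
    have hIm : Measurable ((innerCube c₀ ℓ (2 * R)).indicator (fun _ => (1 : ℝ))) :=
      measurable_const.indicator (measurableSet_innerCube _ _ _)
    have hJm : Measurable ((Metric.closedBall (0 : R3) (2 * R)).indicator (fun _ => (1 : ℝ))) :=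
      measurable_const.indicator Metric.isClosed_closedBall.measurableSet
    have hUm : Measurable fun x : Config N => shellPot R₀ R (x i - x j) :=
      (measurable_shellPot R₀ R).comp (by fun_prop)
    have i1 : Integrable (fun x => ((innerCube c₀ ℓ (2 * R)).indicator (fun _ => (1 : ℝ)) (x j) *
        shellPot R₀ R (x i - x j)) * g x) P :=
      integrable_bdd_mul (b := 1 * (3 / (R ^ 3 - R₀ ^ 3)))
        ((hIm.comp (measurable_pi_apply j)).mul hUm)
        (fun x => mul_nonneg (Set.indicator_nonneg (fun _ _ => zero_le_one) _)
          (shellPot_nonneg h0 hR _))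
        (fun x => mul_le_mul (Set.indicator_apply_le' (fun _ => le_rfl) fun _ => zero_le_one)
          (shellPot_le h0 hR _) (shellPot_nonneg h0 hR _) zero_le_one) hg
    have i2 : ∀ k, Integrable (fun x => ((Metric.closedBall 0 (2 * R)).indicator
        (fun _ => (1 : ℝ)) (x k - x j) * shellPot R₀ R (x i - x j)) * g x) P := fun k =>
      integrable_bdd_mul (b := 1 * (3 / (R ^ 3 - R₀ ^ 3)))
        ((hJm.comp (by fun_prop : Measurable fun x : Config N => x k - x j)).mul hUm)
        (fun x => mul_nonneg (Set.indicator_nonneg (fun _ _ => zero_le_one) _)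
          (shellPot_nonneg h0 hR _))
        (fun x => mul_le_mul (Set.indicator_apply_le' (fun _ => le_rfl) fun _ => zero_le_one)
          (shellPot_le h0 hR _) (shellPot_nonneg h0 hR _) zero_le_one) hg
    have a2 : ∑ k ∈ (s.erase i).erase j, ∫ x, ((Metric.closedBall 0 (2 * R)).indicator
        (fun _ => (1 : ℝ)) (x k - x j) * shellPot R₀ R (x i - x j)) * g x ∂P ≤
        s.card * (4 * Real.pi / ℓ ^ 3 * (32 * Real.pi / 3 * R ^ 3 / ℓ ^ 3) * ∫ x, g x ∂P) := by
      refine (Finset.sum_le_card_nsmul _ _ (4 * Real.pi / ℓ ^ 3 *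
        (32 * Real.pi / 3 * R ^ 3 / ℓ ^ 3) * ∫ x, g x ∂P) fun k hk => ?_).trans ?_
      · obtain ⟨hkj, hk'⟩ := Finset.mem_erase.1 hk
        obtain ⟨hki, hks⟩ := Finset.mem_erase.1 hk'
        exact integral_near_shell h0 hR hℓ0 hji.symm hki hkj hg0 hg (hgs i hi) (hgs k hks)
      · rw [nsmul_eq_mul]
        gcongr
        exact (Finset.erase_subset _ _).trans (Finset.erase_subset _ _)
    have a3 : (∫ x, ((innerCube c₀ ℓ (2 * R)).indicator (fun _ => (1 : ℝ)) (x j) *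
        shellPot R₀ R (x i - x j)) * g x ∂P) - ∑ k ∈ (s.erase i).erase j,
        ∫ x, ((Metric.closedBall 0 (2 * R)).indicator
        (fun _ => (1 : ℝ)) (x k - x j) * shellPot R₀ R (x i - x j)) * g x ∂P ≤
        ∫ x, pairTerm s c₀ ℓ R₀ R i j x * g x ∂P := by
      rw [← integral_finsetSum _ fun k _ => i2 k, ← integral_sub i1
        (integrable_finsetSum _ fun k _ => i2 k)]
      refine integral_mono (i1.sub (integrable_finsetSum _ fun k _ => i2 k)) (hpm i j) fun x => ?_
      have := mul_le_mul_of_nonneg_right (pairTerm_ge (s := s) (c₀ := c₀) (ℓ := ℓ) h0 hR i j x)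
        (hg0 x)
      rwa [sub_mul, Finset.sum_mul] at this
    refine le_trans (le_of_eq ?_) ((sub_le_sub a1 a2).trans a3)
    rw [groupErr]
    ring
  have hsum : ∫ x, groupPot s c₀ ℓ R₀ R x * g x ∂P =
      ∑ i ∈ s, ∑ j ∈ s.erase i, ∫ x, pairTerm s c₀ ℓ R₀ R i j x * g x ∂P := by
    simp only [groupPot, Finset.sum_mul]
    rw [integral_finsetSum _ fun i _ => integrable_finsetSum _ fun j _ => hpm i j]
    exact Finset.sum_congr rfl fun i _ => integral_finsetSum _ fun j _ => hpm i j
  rw [hsum]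
  refine le_trans (le_of_eq ?_) (Finset.sum_le_sum fun i hi => Finset.sum_le_sum fun j hj =>
    hpair i hi j hj)
  have hcard : ∀ i ∈ s, ((s.erase i).card : ℝ) = s.card - 1 := fun i hi => by
    rw [Finset.card_erase_of_mem hi, Nat.cast_sub (Finset.card_pos.2 ⟨i, hi⟩), Nat.cast_one]
  rw [Finset.sum_congr rfl fun i hi => (by rw [Finset.sum_const, nsmul_eq_mul, hcard i hi] :
    ∑ j ∈ s.erase i, 4 * Real.pi / ℓ ^ 3 * (1 - groupErr R ℓ s.card) * ∫ x, g x ∂P =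
      ((s.card : ℝ) - 1) * (4 * Real.pi / ℓ ^ 3 * (1 - groupErr R ℓ s.card) * ∫ x, g x ∂P)),
    Finset.sum_const, nsmul_eq_mul]
  ring

lemma sq_sub_sq_le {η a b d : ℝ} (hη0 : 0 < η) (hη1 : η ≤ 1) (ha : 0 ≤ a) (h : a ≤ b + d) :
    (1 - η) * a ^ 2 - η⁻¹ * d ^ 2 ≤ b ^ 2 := by
  have h3 : a ^ 2 ≤ (b + d) ^ 2 := by gcongr
  have h4 : (1 - η) * a ^ 2 ≤ (1 - η) * (b + d) ^ 2 :=
    mul_le_mul_of_nonneg_left h3 (by linarith)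
  have h5 : b ^ 2 + η⁻¹ * d ^ 2 - (1 - η) * (b + d) ^ 2 =
      η⁻¹ * ((η * b - (1 - η) * d) ^ 2 + (1 - (1 - η) ^ 2 - (1 - η) * η) * d ^ 2) := by
    field_simp
    ring
  have h6 : 0 ≤ η⁻¹ * ((η * b - (1 - η) * d) ^ 2 + (1 - (1 - η) ^ 2 - (1 - η) * η) * d ^ 2) := by
    have : 1 - (1 - η) ^ 2 - (1 - η) * η = η := by ring
    rw [this]
    positivity
  linarith

/-- Lower bound for the soft interaction of a group of particles in a box: replacing `ψ` by its
average over the group costs a fraction of the kinetic energy. -/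
theorem groupPot_bound (h0 : 0 ≤ R₀) (hR : R₀ < R) (hℓ : 4 * R ≤ ℓ) (hc : ∀ i ∈ s, c i = c₀)
    {η : ℝ} (hη0 : 0 < η) (hη1 : η ≤ 1) (herr : groupErr R ℓ s.card ≤ 1) {ψ : Config N → ℂ}
    {G : Fin N → Fin 3 → Config N → ℂ} (hψm : Measurable ψ) (hGm : ∀ i k, Measurable (G i k))
    (hG : ∀ i k, HasWeakDirDeriv ψ (G i k) (particleUnitVec i k))
    (h2 : Integrable (fun x => ‖ψ x‖ ^ 2) (boxProb fun j => cube (c j) ℓ))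
    (hG2 : ∀ i k, Integrable (fun x => ‖G i k x‖ ^ 2) (boxProb fun j => cube (c j) ℓ)) :
    (1 - 2 * η) * (4 * Real.pi / ℓ ^ 3 * (s.card * (s.card - 1)) * (1 - groupErr R ℓ s.card)) *
      ∫ x, ‖ψ x‖ ^ 2 ∂(boxProb fun j => cube (c j) ℓ) ≤
    (∫ x, groupPot s c₀ ℓ R₀ R x * ‖ψ x‖ ^ 2 ∂(boxProb fun j => cube (c j) ℓ)) +
    (3 * s.card / (R ^ 3 - R₀ ^ 3) + 4 * Real.pi / ℓ ^ 3 * (s.card * (s.card - 1))) / η *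
      (24 * ℓ ^ 2) * ∑ i ∈ s, ∫ x, ∑ k, ‖G i k x‖ ^ 2 ∂(boxProb fun j => cube (c j) ℓ) := by
  have hR0 : 0 < R := h0.trans_lt hR
  have hℓ0 : 0 < ℓ := by linarith
  have hQ := isBox_cube c hℓ0
  obtain ⟨ψ₀, hm, h20, hind, hV⟩ := exists_average hQ hψm h2 s
  set P := boxProb fun j => cube (c j) ℓ with hP
  set W := groupPot s c₀ ℓ R₀ R with hW
  have hV' : ∫ x, ‖ψ x - ψ₀ x‖ ^ 2 ∂P ≤ 24 * ℓ ^ 2 * ∑ i ∈ s, ∫ x, ∑ k, ‖G i k x‖ ^ 2 ∂P := by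
    rw [Finset.mul_sum]
    exact hV.trans (Finset.sum_le_sum fun i _ => integral_sub_avg_sq_le_gradient hℓ0 hψm (hGm i)
      (hG i) h2 (hG2 i))
  have hd := integrable_sq_sub hψm hm h2 h20
  have hpt : ∀ x, (1 - η) * ‖ψ₀ x‖ ^ 2 - η⁻¹ * ‖ψ x - ψ₀ x‖ ^ 2 ≤ ‖ψ x‖ ^ 2 := by
    intro x
    have h1 : ‖ψ₀ x‖ ≤ ‖ψ x‖ + ‖ψ x - ψ₀ x‖ := by
      have := norm_sub_norm_le (ψ₀ x) (ψ x)
      rw [norm_sub_rev] at this; linarith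
    exact sq_sub_sq_le hη0 hη1 (norm_nonneg _) h1
  have hWm : Measurable W := measurable_groupPot
  have hW0 : ∀ x, 0 ≤ W x := groupPot_nonneg h0 hR
  have hWb : ∀ x, W x ≤ 3 * s.card / (R ^ 3 - R₀ ^ 3) := groupPot_le h0 hR
  set B := 3 * (s.card : ℝ) / (R ^ 3 - R₀ ^ 3) with hB
  set w₀ := 4 * Real.pi / ℓ ^ 3 * ((s.card : ℝ) * (s.card - 1)) with hw₀
  have hw₀0 : 0 ≤ w₀ := by
    refine mul_nonneg (by positivity) ?_
    rcases Nat.eq_zero_or_pos s.card with h | h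
    · simp [h]
    · have : (1 : ℝ) ≤ s.card := by exact_mod_cast h
      exact mul_nonneg (by linarith) (by linarith)
  have herr0 : 0 ≤ groupErr R ℓ s.card := by
    unfold groupErr; positivity
  set w := w₀ * (1 - groupErr R ℓ s.card) with hw
  have hw0 : 0 ≤ w := mul_nonneg hw₀0 (by linarith)
  have hww : w ≤ w₀ := mul_le_of_le_one_right hw₀0 (by linarith)
  have e1 : w * ∫ x, ‖ψ₀ x‖ ^ 2 ∂P ≤ ∫ x, W x * ‖ψ₀ x‖ ^ 2 ∂P :=
    integral_groupPot h0 hR hℓ hc (fun x => by positivity) h20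
      (fun i hi x y => by simp only [hind i hi])
  have j0 := integrable_bdd_mul hWm hW0 hWb h20
  have jd := integrable_bdd_mul hWm hW0 hWb hd
  have jψ := integrable_bdd_mul hWm hW0 hWb h2
  have e2 : (1 - η) * (∫ x, W x * ‖ψ₀ x‖ ^ 2 ∂P) - η⁻¹ * (∫ x, W x * ‖ψ x - ψ₀ x‖ ^ 2 ∂P) ≤
      ∫ x, W x * ‖ψ x‖ ^ 2 ∂P := by
    rw [← integral_const_mul, ← integral_const_mul, ← integral_sub (j0.const_mul _)
      (jd.const_mul _)]
    refine integral_mono ((j0.const_mul _).sub (jd.const_mul _)) jψ fun x => ?_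
    have := mul_le_mul_of_nonneg_left (hpt x) (hW0 x)
    simp only
    linarith
  have e3 : ∫ x, W x * ‖ψ x - ψ₀ x‖ ^ 2 ∂P ≤ B * ∫ x, ‖ψ x - ψ₀ x‖ ^ 2 ∂P := by
    rw [← integral_const_mul]
    exact integral_mono jd (hd.const_mul _) fun x =>
      mul_le_mul_of_nonneg_right (hWb x) (by positivity)
  have e4 : (1 - η) * (∫ x, ‖ψ x‖ ^ 2 ∂P) - η⁻¹ * (∫ x, ‖ψ x - ψ₀ x‖ ^ 2 ∂P) ≤
      ∫ x, ‖ψ₀ x‖ ^ 2 ∂P := by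
    rw [← integral_const_mul, ← integral_const_mul, ← integral_sub (h2.const_mul _)
      (hd.const_mul _)]
    refine integral_mono ((h2.const_mul _).sub (hd.const_mul _)) h20 fun x => ?_
    refine sq_sub_sq_le hη0 hη1 (norm_nonneg _) ?_
    have := norm_sub_norm_le (ψ x) (ψ₀ x)
    linarith
  have hA : 0 ≤ ∫ x, ‖ψ x‖ ^ 2 ∂P := integral_nonneg fun x => by positivity
  have hVnn : 0 ≤ ∫ x, ‖ψ x - ψ₀ x‖ ^ 2 ∂P := integral_nonneg fun x => by positivity
  have hBnn : 0 ≤ B := (hW0 0).trans (hWb 0)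
  generalize ∫ x, ‖ψ x - ψ₀ x‖ ^ 2 ∂P = V at *
  generalize ∫ x, ‖ψ x‖ ^ 2 ∂P = A at *
  generalize ∫ x, ‖ψ₀ x‖ ^ 2 ∂P = A₀ at *
  generalize ∫ x, W x * ‖ψ x - ψ₀ x‖ ^ 2 ∂P = WV at *
  generalize ∫ x, W x * ‖ψ x‖ ^ 2 ∂P = WA at *
  generalize ∫ x, W x * ‖ψ₀ x‖ ^ 2 ∂P = WA₀ at *
  generalize ∑ i ∈ s, ∫ x, ∑ k, ‖G i k x‖ ^ 2 ∂P = K at *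
  have hηi : 0 < η⁻¹ := inv_pos.2 hη0
  have f1 : (1 - η) * w * ((1 - η) * A - η⁻¹ * V) ≤ (1 - η) * WA₀ := by
    rw [mul_assoc]
    refine mul_le_mul_of_nonneg_left ?_ (by linarith)
    exact (mul_le_mul_of_nonneg_left e4 hw0).trans e1
  have f2 : η⁻¹ * WV ≤ η⁻¹ * (B * V) := mul_le_mul_of_nonneg_left e3 hηi.le
  have f3 : (1 - 2 * η) * w * A ≤ (1 - η) ^ 2 * w * A := by
    have : 0 ≤ η ^ 2 * (w * A) := by positivity
    linarith
  have f4 : (1 - η) * w * (η⁻¹ * V) ≤ w₀ * (η⁻¹ * V) := by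
    refine mul_le_mul_of_nonneg_right ?_ (by positivity)
    have : 0 ≤ η * w := by positivity
    linarith
  have f5 : (B + w₀) / η * V ≤ (B + w₀) / η * (24 * ℓ ^ 2 * K) :=
    mul_le_mul_of_nonneg_left hV' (by positivity)
  have f6 : (B + w₀) / η * V = η⁻¹ * (B * V) + w₀ * (η⁻¹ * V) := by
    rw [div_eq_mul_inv]; ring
  have f7 : (B + w₀) / η * (24 * ℓ ^ 2) * K = (B + w₀) / η * (24 * ℓ ^ 2 * K) := by ring
  rw [f7]
  have f8 : (1 - η) * w * ((1 - η) * A - η⁻¹ * V) =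
      (1 - η) ^ 2 * w * A - (1 - η) * w * (η⁻¹ * V) := by ring
  rw [f8] at f1
  linarith
end GroupBound

/-! ### Distances on the torus, boxes and small cells -/

section TorusMetric
variable {L : ℝ}

lemma norm_le_norm_of_abs_le {x y : R3} (h : ∀ k, |x k| ≤ |y k|) : ‖x‖ ≤ ‖y‖ := by
  rw [EuclideanSpace.norm_eq, EuclideanSpace.norm_eq]
  refine Real.sqrt_le_sqrt (Finset.sum_le_sum fun k _ => ?_)
  exact pow_le_pow_left₀ (norm_nonneg _) (h k) 2

lemma torusDiff_apply (x y : R3) (k : Fin 3) :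
    torusDiff L x y k = (x k - y k) - L * (round ((x k - y k) / L) : ℝ) := rfl

lemma abs_torusDiff_le (hL : 0 < L) (x y : R3) (k : Fin 3) (n : ℤ) :
    |torusDiff L x y k| ≤ |x k - y k - L * n| := by
  have h := round_le ((x k - y k) / L) n
  have e : ∀ m : ℤ, x k - y k - L * m = L * ((x k - y k) / L - m) := fun m => by field_simp
  rw [torusDiff_apply, e, e, abs_mul, abs_mul]
  gcongr

lemma norm_torusDiff_le (hL : 0 < L) (x y : R3) : ‖torusDiff L x y‖ ≤ ‖x - y‖ :=
  norm_le_norm_of_abs_le fun k => by simpa using abs_torusDiff_le hL x y k 0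

lemma norm_torusDiff_comm (hL : 0 < L) (x y : R3) : ‖torusDiff L x y‖ = ‖torusDiff L y x‖ := by
  have h : ∀ x y : R3, ‖torusDiff L x y‖ ≤ ‖torusDiff L y x‖ := fun x y =>
    norm_le_norm_of_abs_le fun k => by
      refine (abs_torusDiff_le hL x y k (-round ((y k - x k) / L))).trans (le_of_eq ?_)
      rw [torusDiff_apply, ← abs_neg]
      congr 1
      push_cast
      ring
  exact le_antisymm (h x y) (h y x)

lemma norm_torusDiff_triangle (hL : 0 < L) (x y z : R3) :
    ‖torusDiff L x z‖ ≤ ‖torusDiff L x y‖ + ‖torusDiff L y z‖ := by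
  refine le_trans (norm_le_norm_of_abs_le fun k => ?_) (norm_add_le _ _)
  refine (abs_torusDiff_le hL x z k (round ((x k - y k) / L) + round ((y k - z k) / L))).trans
    (le_of_eq ?_)
  rw [PiLp.add_apply, torusDiff_apply, torusDiff_apply]
  congr 1
  push_cast
  ring

lemma abs_torusDiff_apply_le_norm (x y : R3) (k : Fin 3) :
    |torusDiff L x y k| ≤ ‖torusDiff L x y‖ := by
  simpa using PiLp.norm_apply_le (torusDiff L x y) k

/-- The index of the box of side `ℓ` that contains `y`. -/
noncomputable def boxOf (ℓ : ℝ) (y : R3) : Fin 3 → ℤ := fun k => ⌊y k / ℓ⌋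

/-- The lower corner of the box with index `b`. -/
noncomputable def corner (ℓ : ℝ) (b : Fin 3 → ℤ) : R3 := WithLp.toLp 2 fun k => b k * ℓ

lemma mem_cube_corner {ℓ : ℝ} (hℓ : 0 < ℓ) {y : R3} {b : Fin 3 → ℤ} :
    y ∈ cube (corner ℓ b) ℓ ↔ boxOf ℓ y = b := by
  rw [funext_iff]
  refine forall_congr' fun k => ?_
  simp only [corner, boxOf, Int.floor_eq_iff, Set.mem_Ico, le_div_iff₀ hℓ, div_lt_iff₀ hℓ, add_mul,
    one_mul]

lemma torusDiff_of_abs_lt (hL : 0 < L) {x y : R3} (h : ∀ k, |x k - y k| < L / 2) :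
    torusDiff L x y = x - y := by
  ext k
  have h1 : round ((x k - y k) / L) = 0 := by
    rw [round_eq_zero_iff]
    have := abs_lt.1 (h k)
    constructor
    · rw [le_div_iff₀ hL]; linarith
    · rw [div_lt_iff₀ hL]; linarith
  rw [torusDiff_apply, h1]
  simp

lemma torusDiff_of_boxOf_eq {ℓ : ℝ} (hℓ : 0 < ℓ) (hL : 2 * ℓ ≤ L) {x y : R3}
    (h : boxOf ℓ x = boxOf ℓ y) : torusDiff L x y = x - y := by
  refine torusDiff_of_abs_lt (by linarith) fun k => ?_
  have h1 := (mem_cube_corner hℓ).2 h k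
  have h2 := (mem_cube_corner hℓ).2 (rfl : boxOf ℓ y = boxOf ℓ y) k
  rw [abs_lt]
  constructor <;> linarith [h1.1, h1.2, h2.1, h2.2]

/-- What is within distance `d` on the torus of a point at distance `d` from the boundary of its box
lies in the same box, the box being far from wrapping around. -/
lemma boxOf_eq_of_near_inner {ℓ d : ℝ} (hℓ : 0 < ℓ) {M : ℕ} (hM : L = M * ℓ) {x y : R3}
    (hx : x ∈ cube 0 L) (hy : y ∈ cube 0 L) {b : Fin 3 → ℤ} (hin : y ∈ innerCube (corner ℓ b) ℓ d)
    (hd : ‖torusDiff L x y‖ ≤ d) : boxOf ℓ x = b := by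
  rw [← mem_cube_corner hℓ]
  intro k
  have h1 := (abs_torusDiff_apply_le_norm x y k).trans hd
  rw [torusDiff_apply] at h1
  set n := round ((x k - y k) / L) with hn
  have h2 := abs_le.1 h1
  have h3 := hin k
  have h4 := hx k
  have h5 := hy k
  have hc : (corner ℓ b) k = b k * ℓ := rfl
  simp only [PiLp.zero_apply, zero_add, Set.mem_Ico, Set.mem_Ioo, hc] at h3 h4 h5 ⊢
  have d0 : 0 ≤ d := (norm_nonneg _).trans hd
  have hLpos : 0 < L := by linarith [h4.1, h4.2]
  have b0 : 0 ≤ b k := by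
    have : (0 : ℝ) < (b k + 1) * ℓ := by linarith [h5.1, h3.2]
    have := pos_of_mul_pos_left this hℓ.le
    have h : (0 : ℤ) < b k + 1 := by exact_mod_cast this
    omega
  have b1 : b k + 1 ≤ M := by
    have : (b k : ℝ) * ℓ < M * ℓ := by rw [← hM]; linarith [h5.2, h3.1]
    have := lt_of_mul_lt_mul_right this hℓ.le
    have h : b k < (M : ℤ) := by exact_mod_cast this
    omega
  have b0' : (0 : ℝ) ≤ b k * ℓ := mul_nonneg (by exact_mod_cast b0) hℓ.le
  have b1' : (b k : ℝ) * ℓ + ℓ ≤ L := by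
    have : ((b k : ℝ) + 1) * ℓ ≤ M * ℓ := by
      gcongr
      exact_mod_cast b1
    rw [hM]; linarith
  have n0 : n = 0 := by
    have p1 : L * (n : ℝ) < L * 1 := by linarith [h2.2, h3.1, h4.2]
    have p2 : L * (-1 : ℝ) < L * n := by linarith [h2.1, h3.2, h4.1]
    have q1 : (n : ℝ) < 1 := lt_of_mul_lt_mul_left p1 hLpos.le
    have q2 : (-1 : ℝ) < n := lt_of_mul_lt_mul_left p2 hLpos.le
    have r1 : n < 1 := by exact_mod_cast q1
    have r2 : -1 < n := by exact_mod_cast q2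
    omega
  rw [n0] at h2
  simp only [Int.cast_zero, mul_zero, sub_zero] at h2
  constructor <;> linarith [h2.1, h2.2, h3.1, h3.2]

/-- The small cell of the torus, of side `L / P`, that contains `y`. -/
noncomputable def cellOf (L : ℝ) (P : ℕ) (y : R3) : Fin 3 → ZMod P := fun k => (⌊y k * P / L⌋ : ℤ)

/-- The cells at distance at most `D` from the cell `a`. -/
noncomputable def cellNbhd {P : ℕ} (D : ℕ) (a : Fin 3 → ZMod P) : Finset (Fin 3 → ZMod P) :=
  (Fintype.piFinset fun _ : Fin 3 => Finset.Icc (-D : ℤ) D).image fun e k => a k + (e k : ZMod P)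

lemma card_cellNbhd_le {P : ℕ} (D : ℕ) (a : Fin 3 → ZMod P) :
    (cellNbhd D a).card ≤ (2 * D + 1) ^ 3 := by
  refine Finset.card_image_le.trans (le_of_eq ?_)
  rw [Fintype.card_piFinset]
  simp only [Int.card_Icc, Finset.prod_const, Finset.card_univ, Fintype.card_fin]
  congr 1
  omega

lemma mem_cellNbhd_comm {P : ℕ} {D : ℕ} {a b : Fin 3 → ZMod P} (h : b ∈ cellNbhd D a) :
    a ∈ cellNbhd D b := by
  simp only [cellNbhd, Finset.mem_image, Fintype.mem_piFinset, Finset.mem_Icc] at h ⊢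
  obtain ⟨e, he, rfl⟩ := h
  refine ⟨-e, fun k => ?_, ?_⟩
  · have := he k
    simp only [Pi.neg_apply]
    omega
  · ext k
    simp

lemma norm_torusDiff_le_of_cellOf_eq (hL : 0 < L) {P : ℕ} (hP : 0 < P) {r : ℝ} (hr : 2 * L ≤ r * P)
    {x y : R3} (hx : x ∈ cube 0 L) (hy : y ∈ cube 0 L) (h : cellOf L P x = cellOf L P y) :
    ‖torusDiff L x y‖ ≤ r := by
  have hP' : (0 : ℝ) < P := by exact_mod_cast hP
  have hr0 : 0 ≤ r := by
    by_contra hneg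
    push Not at hneg
    nlinarith
  refine (norm_torusDiff_le hL x y).trans ?_
  have key : ∀ k, ‖(x - y) k‖ ^ 2 ≤ (r / 2) ^ 2 := by
    intro k
    have hfl : ∀ z : R3, z ∈ cube 0 L → 0 ≤ ⌊z k * P / L⌋ ∧ ⌊z k * P / L⌋ < P := by
      intro z hz
      have := hz k
      simp only [PiLp.zero_apply, zero_add, Set.mem_Ico] at this
      constructor
      · exact Int.floor_nonneg.2 (by have := this.1; positivity)
      · rw [Int.floor_lt, div_lt_iff₀ hL]
        push_cast
        nlinarith [this.2]
    have h1 : ((⌊x k * P / L⌋ : ℤ) : ZMod P) = (⌊y k * P / L⌋ : ℤ) := congrFun h k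
    rw [ZMod.intCast_eq_intCast_iff, Int.ModEq, Int.emod_eq_of_lt (hfl x hx).1 (hfl x hx).2,
      Int.emod_eq_of_lt (hfl y hy).1 (hfl y hy).2] at h1
    have h2 := Int.abs_sub_lt_one_of_floor_eq_floor h1
    have h3 : x k * P / L - y k * P / L = (x k - y k) * (P / L) := by ring
    rw [h3, abs_mul, abs_of_pos (by positivity : (0 : ℝ) < P / L), mul_div_assoc', div_lt_one hL] at h2
    have h4 : |x k - y k| ≤ r / 2 := by
      have : |x k - y k| * P ≤ r / 2 * P := by linarith
      exact le_of_mul_le_mul_right this hP'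
    rw [PiLp.sub_apply, Real.norm_eq_abs]
    gcongr
  have : ‖x - y‖ ^ 2 ≤ r ^ 2 := by
    rw [EuclideanSpace.norm_sq_eq, Fin.sum_univ_three]
    nlinarith [key 0, key 1, key 2]
  exact le_of_sq_le_sq this hr0

lemma cellOf_mem_cellNbhd (hL : 0 < L) {P : ℕ} {d : ℝ} {D : ℕ} (hD : d * P / L + 1 ≤ D)
    {x y : R3} (h : ‖torusDiff L x y‖ ≤ d) : cellOf L P x ∈ cellNbhd D (cellOf L P y) := by
  have hPn : (0 : ℝ) ≤ P := Nat.cast_nonneg P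
  simp only [cellNbhd, Finset.mem_image, Fintype.mem_piFinset, Finset.mem_Icc]
  refine ⟨fun k => ⌊x k * P / L⌋ - ⌊y k * P / L⌋ - round ((x k - y k) / L) * P, fun k => ?_, ?_⟩
  · have h1 := (abs_torusDiff_apply_le_norm x y k).trans h
    rw [torusDiff_apply] at h1
    set n := round ((x k - y k) / L) with hn
    have h2 : |x k * P / L - y k * P / L - n * P| ≤ d * P / L := by
      have : x k * P / L - y k * P / L - n * P = (x k - y k - L * n) * (P / L) := by
        field_simp
      rw [this, abs_mul, abs_of_nonneg (by positivity : (0 : ℝ) ≤ P / L), mul_div_assoc]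
      gcongr
    have h3 := abs_le.1 h2
    have a1 := Int.floor_le (x k * P / L)
    have a2 := Int.lt_floor_add_one (x k * P / L)
    have a3 := Int.floor_le (y k * P / L)
    have a4 := Int.lt_floor_add_one (y k * P / L)
    constructor
    · have : (-(D : ℝ)) ≤ (⌊x k * P / L⌋ - ⌊y k * P / L⌋ - n * P : ℝ) := by linarith [h3.1]
      exact_mod_cast this
    · have : (⌊x k * P / L⌋ - ⌊y k * P / L⌋ - n * P : ℝ) ≤ D := by linarith [h3.2]
      exact_mod_cast this
  · ext k
    simp [cellOf]
end TorusMetric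

/-! ### Clusters -/

section Clusters
open Finset
variable {ι α : Type*} [Fintype ι] [Fintype α] [DecidableEq α]

/-- The number of points in the cell `a`. -/
def occ (cell : ι → α) (a : α) : ℕ := #{i | cell i = a}

lemma sum_occ_eq (cell : ι → α) (f : α → ℕ) : ∑ i, f (cell i) = ∑ a, occ cell a * f a := by
  rw [← Finset.sum_fiberwise univ cell fun i => f (cell i)]
  refine Finset.sum_congr rfl fun a _ => ?_
  rw [Finset.sum_congr rfl (g := fun _ => f a) (fun i hi => by rw [(mem_filter.1 hi).2]), sum_const,
    smul_eq_mul, occ]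

/-- If every point of the second component of a pair in `T` sees at least `4 K` points in at most
`K` nearby cells, then `T` is controlled by the pairs in common cells that hold at least three
points. -/
lemma card_crowded_pairs_le [DecidableEq ι] (cell : ι → α) (nb : α → Finset α) {K : ℕ}
    (hK : ∀ a, #(nb a) ≤ K) (hsymm : ∀ a b, b ∈ nb a → a ∈ nb b) (T : Finset (ι × ι))
    (hT : ∀ p ∈ T, cell p.1 ∈ nb (cell p.2) ∧ 4 * K ≤ #{k | cell k ∈ nb (cell p.2)}) :
    #T ≤ 6 * K * #{p : ι × ι | p.1 ≠ p.2 ∧ cell p.1 = cell p.2 ∧ 3 ≤ occ cell (cell p.2)} := by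
  set f : α → ℕ := fun a => if 3 ≤ occ cell a then occ cell a else 0 with hf
  have hnear : ∀ b, #{k | cell k ∈ nb b} = ∑ a ∈ nb b, occ cell a := by
    intro b
    rw [Finset.card_eq_sum_card_fiberwise (f := cell) (t := nb b) (fun k hk => by simpa using hk)]
    refine Finset.sum_congr rfl fun a ha => ?_
    rw [occ]
    congr 1
    ext k
    simp only [mem_filter, mem_univ, true_and]
    exact ⟨fun h => h.2, fun h => ⟨h ▸ ha, h⟩⟩
  have hcrowd : ∀ b, 4 * K ≤ #{k | cell k ∈ nb b} →
      #{k | cell k ∈ nb b} ≤ 2 * ∑ a ∈ nb b, f a := by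
    intro b hb
    have h1 : ∑ a ∈ nb b, occ cell a ≤ ∑ a ∈ nb b, (2 + f a) := by
      refine Finset.sum_le_sum fun a _ => ?_
      simp only [hf]
      split_ifs <;> omega
    rw [Finset.sum_add_distrib, sum_const, smul_eq_mul] at h1
    have := hK b
    rw [hnear] at hb ⊢
    omega
  have s1 : #T ≤ ∑ j, 2 * ∑ a ∈ nb (cell j), f a := by
    rw [Finset.card_eq_sum_card_fiberwise (f := Prod.snd) (t := univ) (fun _ _ => by simp)]
    refine Finset.sum_le_sum fun j _ => ?_
    by_cases hne : ({p ∈ T | p.2 = j} : Finset (ι × ι)) = ∅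
    · rw [hne]; simp
    obtain ⟨p, hp⟩ := Finset.nonempty_iff_ne_empty.2 hne
    obtain ⟨hpT, rfl⟩ := mem_filter.1 hp
    refine le_trans ?_ (hcrowd _ (hT p hpT).2)
    refine Finset.card_le_card_of_injOn Prod.fst (fun q hq => ?_) (fun q hq q' hq' h => ?_)
    · obtain ⟨hqT, hq2⟩ := mem_filter.1 hq
      have := (hT q hqT).1
      rw [hq2] at this
      simpa using this
    · exact Prod.ext h (((mem_filter.1 hq).2).trans ((mem_filter.1 hq').2).symm)
  have s2 : ∑ j, 2 * ∑ a ∈ nb (cell j), f a = 2 * ∑ b, ∑ a ∈ nb b, occ cell b * f a := by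
    rw [← Finset.mul_sum, sum_occ_eq cell (fun b => ∑ a ∈ nb b, f a)]
    simp only [Finset.mul_sum]
  have s3 : ∑ b, ∑ a ∈ nb b, occ cell b * f a ≤ ∑ b, ∑ a ∈ nb b, (f a ^ 2 + f b ^ 2) := by
    refine Finset.sum_le_sum fun b _ => Finset.sum_le_sum fun a _ => ?_
    by_cases hb : 3 ≤ occ cell b
    · have : f b = occ cell b := by simp [hf, hb]
      rw [← this]
      nlinarith [sq_nonneg ((f a : ℤ) - f b), (by positivity : 0 ≤ f a * f b),
        two_mul_le_add_sq (f b) (f a)]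
    · by_cases ha : 3 ≤ occ cell a
      · have : f a = occ cell a := by simp [hf, ha]
        nlinarith
      · have : f a = 0 := by simp [hf, ha]
        simp [this]
  have s4 : ∑ b, ∑ a ∈ nb b, f b ^ 2 ≤ K * ∑ b, f b ^ 2 := by
    rw [Finset.mul_sum]
    refine Finset.sum_le_sum fun b _ => ?_
    rw [sum_const, smul_eq_mul]
    exact Nat.mul_le_mul_right _ (hK b)
  have s5 : ∑ b, ∑ a ∈ nb b, f a ^ 2 = ∑ b, ∑ a ∈ nb b, f b ^ 2 :=
    Finset.sum_comm' fun x y => by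
      simp only [mem_univ, true_and, and_true]
      exact ⟨hsymm x y, hsymm y x⟩
  have s6 : 2 * ∑ b, f b ^ 2 ≤
      3 * #{p : ι × ι | p.1 ≠ p.2 ∧ cell p.1 = cell p.2 ∧ 3 ≤ occ cell (cell p.2)} := by
    rw [Finset.card_eq_sum_card_fiberwise (f := fun p : ι × ι => cell p.2) (t := univ)
      (fun _ _ => by simp), Finset.mul_sum, Finset.mul_sum]
    refine Finset.sum_le_sum fun a _ => ?_
    by_cases ha : 3 ≤ occ cell a
    swap
    · simp [hf, ha]
    have e : ({p ∈ ({p : ι × ι | p.1 ≠ p.2 ∧ cell p.1 = cell p.2 ∧ 3 ≤ occ cell (cell p.2)} :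
        Finset (ι × ι)) | cell p.2 = a} : Finset (ι × ι)) =
        ({i | cell i = a} : Finset ι).offDiag := by
      ext p
      simp only [mem_filter, mem_univ, true_and, mem_offDiag]
      constructor
      · rintro ⟨⟨h1, h2, h3⟩, h4⟩
        exact ⟨h2.trans h4, h4, h1⟩
      · rintro ⟨h1, h2, h3⟩
        exact ⟨⟨h3, h1.trans h2.symm, by rwa [h2]⟩, h2⟩
    rw [e, Finset.offDiag_card]
    have : f a = occ cell a := by simp [hf, ha]
    rw [this]
    change 2 * occ cell a ^ 2 ≤ 3 * (occ cell a * occ cell a - occ cell a)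
    generalize occ cell a = n at *
    have : n ≤ n * n := by nlinarith
    zify [this]
    nlinarith
  have s7 : ∑ b, ∑ a ∈ nb b, (f a ^ 2 + f b ^ 2) ≤ 2 * (K * ∑ b, f b ^ 2) := by
    simp only [Finset.sum_add_distrib]
    omega
  calc #T ≤ 2 * (2 * (K * ∑ b, f b ^ 2)) := by omega
    _ = 2 * K * (2 * ∑ b, f b ^ 2) := by ring
    _ ≤ 2 * K * (3 * _) := Nat.mul_le_mul_left _ s6
    _ = _ := by ring
end Clusters

/-! ### Groups, isolated pairs and the kinetic energy budget -/

section Grouping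
open Finset
variable {N : ℕ}

/-- Cut a finite set into blocks of `m` elements and one smaller block. Cauchy-Schwarz gives the mean
size of a block. -/
lemma exists_labels (s : Finset (Fin N)) {m : ℕ} (hm : 0 < m) :
    ∃ γ : Fin N → ℕ, (∀ g, #{i ∈ s | γ i = g} ≤ m) ∧ (#s ≤ m → ∀ i ∈ s, γ i = 0) ∧
      (m < #s → #s * m ≤ 2 * ∑ i ∈ s, #{j ∈ s | γ j = γ i}) := by
  classical
  set e := s.equivFin
  set γ : Fin N → ℕ := fun i => if h : i ∈ s then (e ⟨i, h⟩ : ℕ) / m else 0 with hγ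
  refine ⟨γ, fun g => ?_, fun hs i hi => ?_, fun hs => ?_⟩
  · have : #{i ∈ s | γ i = g} ≤ #(range m) := by
      refine Finset.card_le_card_of_injOn
        (fun i => if h : i ∈ s then (e ⟨i, h⟩ : ℕ) % m else 0) (fun i hi => ?_) ?_
      · simp only [coe_range, Set.mem_Iio]
        split_ifs
        · exact Nat.mod_lt _ hm
        · exact hm
      · intro i hi j hj hij
        obtain ⟨his, hig⟩ := mem_filter.1 hi
        obtain ⟨hjs, hjg⟩ := mem_filter.1 hj
        simp only [hγ, his, hjs, dite_true] at hij hig hjg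
        have : (e ⟨i, his⟩ : ℕ) = e ⟨j, hjs⟩ := by
          rw [← Nat.div_add_mod (e ⟨i, his⟩ : ℕ) m, ← Nat.div_add_mod (e ⟨j, hjs⟩ : ℕ) m, hig, hjg,
            hij]
        have := e.injective (Fin.ext this)
        exact congrArg Subtype.val this
    simpa using this
  · simp only [hγ, hi, dite_true]
    exact Nat.div_eq_of_lt ((e ⟨i, hi⟩).2.trans_le hs)
  · have hmaps : ∀ i ∈ s, γ i ∈ range (#s / m + 1) := by
      intro i hi
      simp only [hγ, hi, dite_true, mem_range]
      exact Nat.lt_succ_of_le (Nat.div_le_div_right (e ⟨i, hi⟩).2.le)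
    have h1 : #s = ∑ g ∈ range (#s / m + 1), #{i ∈ s | γ i = g} :=
      Finset.card_eq_sum_card_fiberwise hmaps
    have h2 : ∑ i ∈ s, #{j ∈ s | γ j = γ i} =
        ∑ g ∈ range (#s / m + 1), #{i ∈ s | γ i = g} ^ 2 := by
      rw [← Finset.sum_fiberwise_of_maps_to hmaps]
      refine Finset.sum_congr rfl fun g _ => ?_
      rw [Finset.sum_congr rfl (g := fun _ => #{j ∈ s | γ j = g})
        (fun i hi => by rw [(mem_filter.1 hi).2]), sum_const, smul_eq_mul, sq]
    have h3 := sq_sum_le_card_mul_sum_sq (s := range (#s / m + 1))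
      (f := fun g => #{i ∈ s | γ i = g})
    rw [← h1, ← h2, card_range] at h3
    set S := ∑ i ∈ s, #{j ∈ s | γ j = γ i}
    have h4 : m * (#s / m) ≤ #s := Nat.mul_div_le #s m
    have h5 : #s * (#s * m) ≤ #s * (2 * S) := by
      calc #s * (#s * m) = m * #s ^ 2 := by ring
        _ ≤ m * ((#s / m + 1) * S) := Nat.mul_le_mul_left _ h3
        _ = (m * (#s / m) + m) * S := by ring
        _ ≤ (2 * #s) * S := Nat.mul_le_mul_right _ (by omega)
        _ = #s * (2 * S) := by ring
    exact Nat.le_of_mul_le_mul_left h5 (by omega)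

/-- `grp i` is the group of particle `i`: the groups partition the particles, refine the partition
into boxes given by `σ`, hold at most `m` particles, are whole boxes where possible, and are
otherwise large on average. -/
structure IsGrouping {β : Type*} [DecidableEq β] (m : ℕ) (σ : Fin N → β)
    (grp : Fin N → Finset (Fin N)) : Prop where
  self_mem : ∀ i, i ∈ grp i
  eq_of_mem : ∀ i, ∀ j ∈ grp i, grp j = grp i
  box_eq : ∀ i, ∀ j ∈ grp i, σ j = σ i
  card_le : ∀ i, #(grp i) ≤ m
  eq_box : ∀ i, #{j | σ j = σ i} ≤ m → grp i = ({j | σ j = σ i} : Finset (Fin N))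
  large : ∀ b, m < #{j | σ j = b} → #{j | σ j = b} * m ≤ 2 * ∑ i with σ i = b, #(grp i)

lemma exists_isGrouping {β : Type*} [DecidableEq β] {m : ℕ} (hm : 0 < m) (σ : Fin N → β) :
    ∃ grp, IsGrouping m σ grp := by
  choose γ h1 h2 h3 using fun b => exists_labels ({j | σ j = b} : Finset (Fin N)) hm
  have hg : ∀ i : Fin N, ({j ∈ ({j | σ j = σ i} : Finset (Fin N)) | γ (σ i) j = γ (σ i) i} :
      Finset (Fin N)) = ({j | σ j = σ i ∧ γ (σ i) j = γ (σ i) i} : Finset (Fin N)) := fun i => filter_filter _ _ _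
  refine ⟨fun i => {j | σ j = σ i ∧ γ (σ i) j = γ (σ i) i}, ?_, ?_, ?_, ?_, ?_, ?_⟩
  · simp
  · intro i j hj
    obtain ⟨e1, e2⟩ := (mem_filter.1 hj).2
    rw [e1, e2]
  · intro i j hj
    exact (mem_filter.1 hj).2.1
  · intro i
    rw [← hg]
    exact h1 _ _
  · intro i hi
    ext j
    simp only [mem_filter, mem_univ, true_and]
    refine ⟨fun h => h.1, fun h => ⟨h, ?_⟩⟩
    rw [h2 (σ i) hi j (by simpa using h), h2 (σ i) hi i (by simp)]
  · intro b hb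
    refine (h3 b hb).trans (le_of_eq ?_)
    congr 1
    refine Finset.sum_congr rfl fun i hi => ?_
    have : σ i = b := (mem_filter.1 hi).2
    subst this
    rw [hg]
end Grouping

/-- The length scales and the grouping of particles used on the torus of side `L`: boxes of side
`ℓ = L / M`, groups of at most `m` particles, interaction range `R₀`, soft range `R`, and the
number `n₀` of neighbours that a particle may have outside clusters. -/
structure Layout (N : ℕ) where
  (L ℓ R R₀ : ℝ)
  (M m n₀ : ℕ)
  grp : (Fin N → Fin 3 → ℤ) → Fin N → Finset (Fin N)

/-- The relations between the length scales of a layout, `R₀ ≪ R ≪ ℓ ≪ L`. -/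
structure Layout.IsValid {N : ℕ} (S : Layout N) : Prop where
  ℓ_pos : 0 < S.ℓ
  L_eq : S.L = S.M * S.ℓ
  two_le : 2 ≤ S.M
  R₀_pos : 0 < S.R₀
  two_mul_R₀_le : 2 * S.R₀ ≤ S.R
  four_mul_R_le : 4 * S.R ≤ S.ℓ
  isGrouping : ∀ σ, IsGrouping S.m σ (S.grp σ)

namespace Layout
variable {N : ℕ} (S : Layout N)

/-- The boxes of the particles. -/
noncomputable def boxes (x : Config N) : Fin N → Fin 3 → ℤ := fun i => boxOf S.ℓ (x i)

/-- The boxes of the particles after particle `i` has been moved to particle `j`; this does not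
depend on the position of `i`. -/
noncomputable def movedBoxes (i j : Fin N) (x : Config N) : Fin N → Fin 3 → ℤ :=
  S.boxes (Function.update x i (x j))

/-- The distance of `i` and `j` on the torus. -/
noncomputable def dist (x : Config N) (i j : Fin N) : ℝ := ‖torusDiff S.L (x i) (x j)‖

/-- After moving `i` to `j`, these two are in one group, away from the boundary of the box and from
the other particles of the group. -/
def Isolated (i j : Fin N) (x : Config N) : Prop :=
  j ∈ S.grp (S.movedBoxes i j x) i ∧
  x j ∈ innerCube (corner S.ℓ (S.movedBoxes i j x j)) S.ℓ (2 * S.R) ∧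
  ∀ k ∈ S.grp (S.movedBoxes i j x) i, k ≠ i → k ≠ j → 2 * S.R < ‖x k - x j‖

/-- The box of `j`, with `i` moved there, holds at most `m` particles. -/
def Sparse (i j : Fin N) (x : Config N) : Prop :=
  Finset.card {k | S.movedBoxes i j x k = S.movedBoxes i j x j} ≤ S.m

open Classical in
/-- Apart from `i`, there are fewer than `n₀` particles close to `j`. -/
def Calm (i j : Fin N) (x : Config N) : Prop :=
  Finset.card {k | k ≠ i ∧ k ≠ j ∧ S.dist x k j ≤ 4 * S.R₀} < S.n₀

variable {S} {i j k : Fin N} {x : Config N}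

lemma movedBoxes_update (hij : i ≠ j) (y : R3) :
    S.movedBoxes i j (Function.update x i y) = S.movedBoxes i j x := by
  simp [movedBoxes, Function.update_of_ne hij.symm]

lemma isolated_update (hij : i ≠ j) (y : R3) :
    S.Isolated i j (Function.update x i y) ↔ S.Isolated i j x := by
  simp only [Isolated, movedBoxes_update hij, Function.update_of_ne hij.symm]
  refine and_congr Iff.rfl (and_congr Iff.rfl (forall₃_congr fun k _ hk => ?_))
  rw [Function.update_of_ne hk]

lemma sparse_update (hij : i ≠ j) (y : R3) :
    S.Sparse i j (Function.update x i y) ↔ S.Sparse i j x := by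
  simp only [Sparse, movedBoxes_update hij]

lemma calm_update (hij : i ≠ j) (y : R3) :
    S.Calm i j (Function.update x i y) ↔ S.Calm i j x := by
  unfold Calm
  suffices h : ∀ k, (k ≠ i ∧ k ≠ j ∧ S.dist (Function.update x i y) k j ≤ 4 * S.R₀) ↔
      (k ≠ i ∧ k ≠ j ∧ S.dist x k j ≤ 4 * S.R₀) by simp only [h]
  intro k
  refine and_congr_right fun hk => ?_
  simp only [dist, Function.update_of_ne hij.symm, Function.update_of_ne hk]

lemma measurable_boxes : Measurable (S.boxes : Config N → _) :=
  measurable_pi_iff.2 fun i => measurable_pi_iff.2 fun k =>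
    Int.measurable_floor.comp ((by fun_prop : Measurable fun x : Config N => x i k).div_const _)

lemma measurable_movedBoxes (i j : Fin N) : Measurable (S.movedBoxes i j) :=
  measurable_boxes.comp ((measurable_update_pair i).comp (measurable_id.prodMk (measurable_pi_apply j)))

lemma measurableSet_of_countable {β : Type*} [MeasurableSpace β] [Countable β]
    [MeasurableSingletonClass β] {f : Config N → β} (hf : Measurable f) {p : β → Config N → Prop}
    (hp : ∀ b, MeasurableSet {x | p b x}) : MeasurableSet {x | p (f x) x} := by
  have : {x | p (f x) x} = ⋃ b, f ⁻¹' {b} ∩ {x | p b x} := by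
    ext x; simp
  rw [this]
  exact MeasurableSet.iUnion fun b => (hf (measurableSet_singleton b)).inter (hp b)

lemma measurableSet_isolated (i j : Fin N) : MeasurableSet {x | S.Isolated i j x} := by
  refine measurableSet_of_countable (measurable_movedBoxes i j) (p := fun σ x => j ∈ S.grp σ i ∧
    x j ∈ innerCube (corner S.ℓ (σ j)) S.ℓ (2 * S.R) ∧
    ∀ k ∈ S.grp σ i, k ≠ i → k ≠ j → 2 * S.R < ‖x k - x j‖) fun σ => ?_
  have h1 : MeasurableSet {x : Config N | x j ∈ innerCube (corner S.ℓ (σ j)) S.ℓ (2 * S.R)} :=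
    measurable_pi_apply j (measurableSet_innerCube _ _ _)
  refine (MeasurableSet.const _).inter (h1.inter ?_)
  have : {x : Config N | ∀ k ∈ S.grp σ i, k ≠ i → k ≠ j → 2 * S.R < ‖x k - x j‖} =
      ⋂ k : Fin N, ⋂ (_ : k ∈ S.grp σ i), ⋂ (_ : k ≠ i), ⋂ (_ : k ≠ j),
        {x : Config N | 2 * S.R < ‖x k - x j‖} := by
    ext x; simp
  change MeasurableSet {x : Config N | ∀ k ∈ S.grp σ i, k ≠ i → k ≠ j → 2 * S.R < ‖x k - x j‖}
  rw [this]
  exact MeasurableSet.iInter fun k => MeasurableSet.iInter fun _ =>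
    MeasurableSet.iInter fun _ => MeasurableSet.iInter fun _ =>
      measurableSet_lt measurable_const (by fun_prop)

lemma measurableSet_sparse (i j : Fin N) : MeasurableSet {x | S.Sparse i j x} :=
  measurableSet_of_countable (measurable_movedBoxes i j) (p := fun σ _ =>
    Finset.card {k | σ k = σ j} ≤ S.m) fun _ => MeasurableSet.const _

lemma measurable_dist (k j : Fin N) : Measurable fun x : Config N => S.dist x k j :=
  ((measurable_torusDiff S.L).comp
    (by fun_prop : Measurable fun x : Config N => (x k, x j))).norm

lemma measurableSet_calm (i j : Fin N) : MeasurableSet {x | S.Calm i j x} := by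
  classical
  have hf : Measurable fun x : Config N => fun k : Fin N => S.dist x k j ≤ 4 * S.R₀ :=
    measurable_pi_iff.2 fun k =>
      measurableSet_setOfPred.1 (measurableSet_le (measurable_dist k j) measurable_const)
  refine measurableSet_of_countable hf (p := fun q _ =>
    Finset.card {k | k ≠ i ∧ k ≠ j ∧ q k} < S.n₀) fun q => MeasurableSet.const _

lemma IsValid.L_pos (hS : S.IsValid) : 0 < S.L := by
  rw [hS.L_eq]
  have := hS.ℓ_pos
  have : (2 : ℝ) ≤ S.M := by exact_mod_cast hS.two_le
  positivity

lemma IsValid.two_mul_le (hS : S.IsValid) : 2 * S.ℓ ≤ S.L := by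
  rw [hS.L_eq]
  have := hS.ℓ_pos
  have : (2 : ℝ) ≤ S.M := by exact_mod_cast hS.two_le
  gcongr

lemma IsValid.R_pos (hS : S.IsValid) : 0 < S.R := by
  linarith [hS.R₀_pos, hS.two_mul_R₀_le]

lemma movedBoxes_eq (h : boxOf S.ℓ (x i) = boxOf S.ℓ (x j)) : S.movedBoxes i j x = S.boxes x := by
  ext1 k
  by_cases hk : k = i
  · subst hk; simp [movedBoxes, boxes, h]
  · simp [movedBoxes, boxes, hk]

lemma mem_cube_of_mem_torusBox {L : ℝ} (hx : x ∈ torusBox N L) (i : Fin N) : x i ∈ cube 0 L := by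
  rw [torusBox_eq_pi] at hx
  exact Set.mem_univ_pi.1 hx i

lemma Isolated.boxOf_eq (hS : S.IsValid) (hx : x ∈ torusBox N S.L) (hij : i ≠ j)
    (h : S.Isolated i j x) (hk : S.dist x k j ≤ 2 * S.R) : boxOf S.ℓ (x k) = boxOf S.ℓ (x j) := by
  have := boxOf_eq_of_near_inner hS.ℓ_pos hS.L_eq (mem_cube_of_mem_torusBox hx k)
    (mem_cube_of_mem_torusBox hx j) h.2.1 hk
  rw [this]
  simp [movedBoxes, boxes, Function.update_of_ne hij.symm]

lemma dist_of_boxOf_eq (hS : S.IsValid) (h : boxOf S.ℓ (x i) = boxOf S.ℓ (x j)) :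
    S.dist x i j = ‖x i - x j‖ := by
  rw [dist, torusDiff_of_boxOf_eq hS.ℓ_pos hS.two_mul_le h]

lemma Isolated.movedBoxes_eq (hS : S.IsValid) (hx : x ∈ torusBox N S.L) (hij : i ≠ j)
    (h : S.Isolated i j x) (hd : S.dist x i j ≤ 2 * S.R) : S.movedBoxes i j x = S.boxes x :=
  Layout.movedBoxes_eq (h.boxOf_eq hS hx hij hd)

lemma dist_comm (hS : S.IsValid) (x : Config N) (i j : Fin N) : S.dist x i j = S.dist x j i :=
  norm_torusDiff_comm hS.L_pos _ _

lemma dist_triangle (hS : S.IsValid) (x : Config N) (i j k : Fin N) :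
    S.dist x i k ≤ S.dist x i j + S.dist x j k :=
  norm_torusDiff_triangle hS.L_pos _ _ _

lemma Isolated.unique (hS : S.IsValid) (hx : x ∈ torusBox N S.L) (hij : i ≠ j) (hik : i ≠ k)
    (hj : S.Isolated i j x) (hk : S.Isolated i k x) (hdj : S.dist x i j ≤ S.R)
    (hdk : S.dist x i k ≤ S.R) : j = k := by
  by_contra hjk
  have hR := hS.R_pos
  have ej := hj.movedBoxes_eq hS hx hij (by linarith)
  have ek := hk.movedBoxes_eq hS hx hik (by linarith)
  have hkg : k ∈ S.grp (S.movedBoxes i j x) i := by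
    rw [ej, ← ek]; exact hk.1
  have h1 := hj.2.2 k hkg hik.symm (Ne.symm hjk)
  have b1 := hj.boxOf_eq hS hx hij (k := i) (by linarith)
  have b2 := hk.boxOf_eq hS hx hik (k := i) (by linarith)
  rw [← dist_of_boxOf_eq hS (b2.symm.trans b1)] at h1
  have h2 := dist_triangle hS x k i j
  rw [dist_comm hS x k i] at h2
  linarith

/-- In a sparse box an isolated pair is far from all other particles. -/
lemma Isolated.far (hS : S.IsValid) (hx : x ∈ torusBox N S.L) (hij : i ≠ j)
    (hj : S.Isolated i j x) (hs : S.Sparse i j x) (hki : k ≠ i) (hkj : k ≠ j) :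
    2 * S.R < S.dist x k j := by
  by_contra hcon
  push Not at hcon
  have hb := hj.boxOf_eq hS hx hij hcon
  have hG := hS.isGrouping (S.movedBoxes i j x)
  have h1 : S.movedBoxes i j x j = S.movedBoxes i j x i := hG.box_eq i j hj.1
  have h2 := hG.eq_box i (by rw [← h1]; exact hs)
  have h3 : k ∈ S.grp (S.movedBoxes i j x) i := by
    rw [h2]
    simp only [Finset.mem_filter, Finset.mem_univ, true_and, ← h1]
    simpa [movedBoxes, boxes, Function.update_of_ne hij.symm, Function.update_of_ne hki] using hb
  have h4 := hj.2.2 k h3 hki hkj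
  rw [← dist_of_boxOf_eq hS hb] at h4
  linarith

open Classical in
/-- Few calm balls overlap. -/
lemma card_calm_le (hS : S.IsValid) (x : Config N) (i : Fin N) :
    Finset.card {j | j ≠ i ∧ S.Calm i j x ∧ S.dist x i j ≤ 2 * S.R₀} ≤ S.n₀ := by
  by_cases hne : ({j | j ≠ i ∧ S.Calm i j x ∧ S.dist x i j ≤ 2 * S.R₀} : Finset (Fin N)) = ∅
  · rw [hne]; simp
  obtain ⟨j, hj⟩ := Finset.nonempty_iff_ne_empty.2 hne
  obtain ⟨hji, hc, hd⟩ := (Finset.mem_filter.1 hj).2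
  have : ({j | j ≠ i ∧ S.Calm i j x ∧ S.dist x i j ≤ 2 * S.R₀} : Finset (Fin N)) ⊆
      insert j ({k | k ≠ i ∧ k ≠ j ∧ S.dist x k j ≤ 4 * S.R₀} : Finset (Fin N)) := by
    intro k hk
    obtain ⟨hki, hkc, hkd⟩ := (Finset.mem_filter.1 hk).2
    by_cases hkj : k = j
    · simp [hkj]
    · refine Finset.mem_insert_of_mem (Finset.mem_filter.2 ⟨Finset.mem_univ _, hki, hkj, ?_⟩)
      have := dist_triangle hS x k i j
      rw [dist_comm hS x k i] at this
      linarith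
  refine (Finset.card_le_card this).trans ((Finset.card_insert_le _ _).trans ?_)
  exact hc
end Layout

namespace Layout
variable {N : ℕ} (S : Layout N)

open Classical in
/-- The indicator of isolated pairs in sparse boxes. -/
noncomputable def chiSparse (i j : Fin N) (x : Config N) : ℝ :=
  if S.Isolated i j x ∧ S.Sparse i j x then 1 else 0

open Classical in
/-- The indicator of isolated pairs in crowded boxes. -/
noncomputable def chiDense (i j : Fin N) (x : Config N) : ℝ :=
  if S.Isolated i j x ∧ ¬ S.Sparse i j x then 1 else 0

open Classical in
/-- The indicator of the other pairs outside clusters. -/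
noncomputable def chiCalm (i j : Fin N) (x : Config N) : ℝ :=
  if ¬ S.Isolated i j x ∧ S.Calm i j x then 1 else 0

variable {S} {i j k : Fin N} {x : Config N}

lemma chiSparse_eq_one (h : S.Isolated i j x ∧ S.Sparse i j x) : S.chiSparse i j x = 1 := if_pos h

lemma chiSparse_eq_zero (h : ¬ (S.Isolated i j x ∧ S.Sparse i j x)) : S.chiSparse i j x = 0 :=
  if_neg h

lemma chiDense_eq_one (h : S.Isolated i j x ∧ ¬ S.Sparse i j x) : S.chiDense i j x = 1 := if_pos h

lemma chiDense_eq_zero (h : ¬ (S.Isolated i j x ∧ ¬ S.Sparse i j x)) : S.chiDense i j x = 0 :=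
  if_neg h

lemma chiCalm_eq_one (h : ¬ S.Isolated i j x ∧ S.Calm i j x) : S.chiCalm i j x = 1 := if_pos h

lemma chiCalm_eq_zero (h : ¬ (¬ S.Isolated i j x ∧ S.Calm i j x)) : S.chiCalm i j x = 0 :=
  if_neg h

lemma measurable_chiSparse (i j : Fin N) : Measurable (S.chiSparse i j) :=
  Measurable.ite ((measurableSet_isolated i j).inter (measurableSet_sparse i j)) measurable_const
    measurable_const

lemma measurable_chiDense (i j : Fin N) : Measurable (S.chiDense i j) :=
  Measurable.ite ((measurableSet_isolated i j).inter (measurableSet_sparse i j).compl)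
    measurable_const measurable_const

lemma measurable_chiCalm (i j : Fin N) : Measurable (S.chiCalm i j) :=
  Measurable.ite ((measurableSet_isolated i j).compl.inter (measurableSet_calm i j))
    measurable_const measurable_const

lemma ite_mem_Icc (p : Prop) [Decidable p] : (if p then (1 : ℝ) else 0) ∈ Set.Icc (0 : ℝ) 1 := by
  split_ifs <;> simp

open Classical in
lemma chiSparse_mem_Icc (i j : Fin N) (x : Config N) : S.chiSparse i j x ∈ Set.Icc (0 : ℝ) 1 :=
  ite_mem_Icc _

open Classical in
lemma chiDense_mem_Icc (i j : Fin N) (x : Config N) : S.chiDense i j x ∈ Set.Icc (0 : ℝ) 1 :=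
  ite_mem_Icc _

open Classical in
lemma chiCalm_mem_Icc (i j : Fin N) (x : Config N) : S.chiCalm i j x ∈ Set.Icc (0 : ℝ) 1 :=
  ite_mem_Icc _

open Classical in
lemma chiSparse_update (hij : i ≠ j) (x : Config N) (y : R3) :
    S.chiSparse i j (Function.update x i y) = S.chiSparse i j x :=
  if_congr (and_congr (isolated_update hij y) (sparse_update hij y)) rfl rfl

open Classical in
lemma chiDense_update (hij : i ≠ j) (x : Config N) (y : R3) :
    S.chiDense i j (Function.update x i y) = S.chiDense i j x :=
  if_congr (and_congr (isolated_update hij y) (not_congr (sparse_update hij y))) rfl rfl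

open Classical in
lemma chiCalm_update (hij : i ≠ j) (x : Config N) (y : R3) :
    S.chiCalm i j (Function.update x i y) = S.chiCalm i j x :=
  if_congr (and_congr (not_congr (isolated_update hij y)) (calm_update hij y)) rfl rfl

lemma ballInd_mem_Icc (r : ℝ) (y : R3) : ballInd r y ∈ Set.Icc (0 : ℝ) 1 :=
  ⟨Set.indicator_nonneg (fun _ _ => zero_le_one) _,
    Set.indicator_apply_le' (fun _ => le_rfl) fun _ => zero_le_one⟩

lemma ballInd_eq_zero {r : ℝ} {y : R3} (h : r < ‖y‖) : ballInd r y = 0 :=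
  Set.indicator_of_notMem (fun h' => absurd h'.2 (not_le.2 h)) _

/-- The kinetic energy of each particle suffices for all pair estimates in which it is the moving
particle. -/
lemma kinetic_budget (hS : S.IsValid) (hx : x ∈ torusBox N S.L) {ε c : ℝ} (hε0 : 0 ≤ ε)
    (hε : ε ≤ 1 / 8) (hc : 2 ≤ c) (hcn : 4 * S.n₀ ≤ c) (i : Fin N) :
    ∑ j ∈ Finset.univ.erase i, (S.chiSparse i j x * (((1 - 2 * ε) + (1 - (1 - 2 * ε)) / c) *
        ballInd S.R (torusDiff S.L (x i) (x j))) +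
      S.chiDense i j x * ((1 / 4 + (1 - 1 / 4) / c) * ballInd S.R (torusDiff S.L (x i) (x j))) +
      S.chiCalm i j x * ((0 + (1 - 0) / c) * ballInd (2 * S.R₀) (torusDiff S.L (x i) (x j)))) ≤
    1 - ε := by
  classical
  have hR := hS.R_pos
  have hc0 : 0 < c := by linarith
  have h2R := hS.two_mul_R₀_le
  have hd : ∀ j, ‖torusDiff S.L (x i) (x j)‖ = S.dist x i j := fun j => rfl
  by_cases hex : ∃ j, j ≠ i ∧ S.Isolated i j x ∧ S.Sparse i j x ∧ S.dist x i j ≤ S.R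
  · obtain ⟨j, hji, hI, hs, hdj⟩ := hex
    rw [Finset.sum_eq_single_of_mem j (Finset.mem_erase.2 ⟨hji, Finset.mem_univ _⟩)]
    · rw [chiSparse_eq_one ⟨hI, hs⟩, chiDense_eq_zero (fun h => h.2 hs), chiCalm_eq_zero
          (fun h => h.1 hI)]
      have hb := ballInd_mem_Icc S.R (torusDiff S.L (x i) (x j))
      have h1 : (1 - (1 - 2 * ε)) / c ≤ ε := by
        rw [div_le_iff₀ hc0]; nlinarith
      have h2 : 0 ≤ (1 - (1 - 2 * ε)) / c := div_nonneg (by linarith) hc0.le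
      have h3 : (1 - 2 * ε + (1 - (1 - 2 * ε)) / c) * ballInd S.R (torusDiff S.L (x i) (x j)) ≤
          1 - 2 * ε + (1 - (1 - 2 * ε)) / c := mul_le_of_le_one_right (by linarith) hb.2
      linarith
    · intro k hk hkj
      have hki := Finset.ne_of_mem_erase hk
      have hfar := hI.far hS hx hji.symm hs hki hkj
      have htri := dist_triangle hS x k i j
      rw [dist_comm hS x k i] at htri
      have hdk : S.R < S.dist x i k := by linarith
      rw [ballInd_eq_zero (by rw [hd]; exact hdk),
        ballInd_eq_zero (r := 2 * S.R₀) (by rw [hd]; linarith)]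
      simp
  · have hex' : ∀ j, j ≠ i → S.Isolated i j x → S.dist x i j ≤ S.R → ¬ S.Sparse i j x :=
      fun j h1 h2 h3 h4 => hex ⟨j, h1, h2, h4, h3⟩
    have hκ : 0 ≤ 1 / 4 + (1 - 1 / 4) / c := by positivity
    have hle : ∀ j ∈ Finset.univ.erase i,
        S.chiSparse i j x * (((1 - 2 * ε) + (1 - (1 - 2 * ε)) / c) *
        ballInd S.R (torusDiff S.L (x i) (x j))) +
        S.chiDense i j x * ((1 / 4 + (1 - 1 / 4) / c) * ballInd S.R (torusDiff S.L (x i) (x j))) +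
        S.chiCalm i j x * ((0 + (1 - 0) / c) * ballInd (2 * S.R₀) (torusDiff S.L (x i) (x j))) ≤
        (if S.Isolated i j x ∧ S.dist x i j ≤ S.R then 1 / 4 + (1 - 1 / 4) / c else 0) +
        (if S.Calm i j x ∧ S.dist x i j ≤ 2 * S.R₀ then 1 / c else 0) := by
      intro j hj
      have hji := Finset.ne_of_mem_erase hj
      have e1 : S.chiSparse i j x * (((1 - 2 * ε) + (1 - (1 - 2 * ε)) / c) *
          ballInd S.R (torusDiff S.L (x i) (x j))) = 0 := by
        by_cases h : S.dist x i j ≤ S.R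
        · rw [chiSparse_eq_zero (fun h' => hex' j hji h'.1 h h'.2), zero_mul]
        · rw [ballInd_eq_zero (by rw [hd]; exact not_le.1 h), mul_zero, mul_zero]
      have e2 : S.chiDense i j x * ((1 / 4 + (1 - 1 / 4) / c) *
          ballInd S.R (torusDiff S.L (x i) (x j))) ≤
          (if S.Isolated i j x ∧ S.dist x i j ≤ S.R then 1 / 4 + (1 - 1 / 4) / c else 0) := by
        have hb := ballInd_mem_Icc S.R (torusDiff S.L (x i) (x j))
        split_ifs with h
        · refine (mul_le_of_le_one_left (mul_nonneg hκ hb.1) (ite_mem_Icc _).2).trans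
            (mul_le_of_le_one_right hκ hb.2)
        · by_cases h1 : S.dist x i j ≤ S.R
          · rw [chiDense_eq_zero (fun h' => h ⟨h'.1, h1⟩), zero_mul]
          · rw [ballInd_eq_zero (by rw [hd]; exact not_le.1 h1), mul_zero, mul_zero]
      have e3 : S.chiCalm i j x * ((0 + (1 - 0) / c) *
          ballInd (2 * S.R₀) (torusDiff S.L (x i) (x j))) ≤
          (if S.Calm i j x ∧ S.dist x i j ≤ 2 * S.R₀ then 1 / c else 0) := by
        have hb := ballInd_mem_Icc (2 * S.R₀) (torusDiff S.L (x i) (x j))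
        rw [zero_add, sub_zero]
        split_ifs with h
        · exact (mul_le_of_le_one_left (mul_nonneg (by positivity) hb.1) (ite_mem_Icc _).2).trans
            (mul_le_of_le_one_right (by positivity) hb.2)
        · by_cases h1 : S.dist x i j ≤ 2 * S.R₀
          · rw [chiCalm_eq_zero (fun h' => h ⟨h'.2, h1⟩), zero_mul]
          · rw [ballInd_eq_zero (by rw [hd]; exact not_le.1 h1), mul_zero, mul_zero]
      linarith
    refine (Finset.sum_le_sum hle).trans ?_
    rw [Finset.sum_add_distrib, ← Finset.sum_filter, ← Finset.sum_filter, Finset.sum_const,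
      Finset.sum_const, nsmul_eq_mul, nsmul_eq_mul]
    have c1 : Finset.card {j ∈ Finset.univ.erase i | S.Isolated i j x ∧ S.dist x i j ≤ S.R} ≤ 1 := by
      refine Finset.card_le_one.2 fun a ha b hb => ?_
      obtain ⟨ha1, ha2, ha3⟩ := Finset.mem_filter.1 ha
      obtain ⟨hb1, hb2, hb3⟩ := Finset.mem_filter.1 hb
      exact ha2.unique hS hx (Finset.ne_of_mem_erase ha1).symm (Finset.ne_of_mem_erase hb1).symm
        hb2 ha3 hb3
    have c2 : Finset.card {j ∈ Finset.univ.erase i | S.Calm i j x ∧ S.dist x i j ≤ 2 * S.R₀} ≤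
        S.n₀ := by
      refine (Finset.card_le_card fun j hj => ?_).trans (card_calm_le hS x i)
      obtain ⟨h1, h2, h3⟩ := Finset.mem_filter.1 hj
      exact Finset.mem_filter.2 ⟨Finset.mem_univ _, Finset.ne_of_mem_erase h1, h2, h3⟩
    have c1' : (Finset.card {j ∈ Finset.univ.erase i | S.Isolated i j x ∧ S.dist x i j ≤ S.R} : ℝ) ≤
      1 := by exact_mod_cast c1
    have c2' : (Finset.card {j ∈ Finset.univ.erase i | S.Calm i j x ∧ S.dist x i j ≤ 2 * S.R₀} :
      ℝ) ≤ S.n₀ := by exact_mod_cast c2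
    have h3 : (1 - 1 / 4) / c ≤ 3 / 8 := by
      rw [div_le_iff₀ hc0]; linarith
    have h4 : (S.n₀ : ℝ) * (1 / c) ≤ 1 / 4 := by
      rw [mul_one_div, div_le_iff₀ hc0]; linarith
    have h5 := mul_le_mul_of_nonneg_right c1' hκ
    have h6 := mul_le_mul_of_nonneg_right c2' (by positivity : 0 ≤ 1 / c)
    linarith

lemma sum_erase_ite_eq_card (p : Fin N × Fin N → Prop) [DecidablePred p] (hp : ∀ q, p q → q.1 ≠ q.2)
    (a : ℝ) : ∑ i, ∑ j ∈ Finset.univ.erase i, (if p (i, j) then a else 0) =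
      (Finset.card {q | p q} : ℝ) * a := by
  have h : ∀ i, ∑ j ∈ Finset.univ.erase i, (if p (i, j) then a else 0) =
      ∑ j, if p (i, j) then a else 0 := by
    intro i
    refine Finset.sum_subset (Finset.erase_subset _ _) fun j _ hj => ?_
    have : j = i := by simpa using hj
    subst this
    rw [if_neg (fun h' => hp _ h' rfl)]
  simp only [h]
  rw [← Fintype.sum_prod_type' (fun i j => if p (i, j) then a else 0), ← Finset.sum_filter,
    Finset.sum_const, nsmul_eq_mul]

/-- Where the pair estimate is not used, the repulsion saved inside clusters beats the
attraction. -/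
lemma potential_budget (hS : S.IsValid) (hx : x ∈ torusBox N S.L) {vp vm : R3 → ℝ}
    {t c lamM lamP r₁ : ℝ} (hv : IsAdmissible vp vm S.R₀ t c lamM)
    (hP : ∀ y, ‖y‖ ≤ r₁ → lamP ≤ vp y) (hr : r₁ ≤ S.R₀) {P D : ℕ} (hP0 : 0 < P)
    (hPL : 2 * S.L ≤ r₁ * P) (hD : 4 * S.R₀ * P / S.L + 1 ≤ D)
    (hn : 4 * (2 * D + 1) ^ 3 ≤ S.n₀) (hlam : 8 * (2 * D + 1) ^ 3 * lamM ≤ t / (1 + t) * lamP)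
    {θ : ℝ} (hθ : θ ≤ 1) :
    0 ≤ ∑ i, ∑ j ∈ Finset.univ.erase i,
      (1 / 2 * (vp (torusDiff S.L (x i) (x j)) + vm (torusDiff S.L (x i) (x j))) -
      (S.chiSparse i j x * pairPot vp vm S.R₀ t θ (torusDiff S.L (x i) (x j)) +
       S.chiDense i j x * pairPot vp vm S.R₀ t (1 / 4) (torusDiff S.L (x i) (x j)) +
       S.chiCalm i j x * pairPot vp vm S.R₀ t 0 (torusDiff S.L (x i) (x j)))) := by
  classical
  have : NeZero P := ⟨hP0.ne'⟩
  have hL := hS.L_pos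
  have hR := hS.R_pos
  have h2R := hS.two_mul_R₀_le
  have hR₀ := hS.R₀_pos
  have hlamM := hv.lamM_pos
  have ht := hv.t_pos
  set τ := t / (1 + t) with hτ
  have hτ0 : 0 < τ := by positivity
  have hτ1 : τ ≤ 1 := (div_le_one (by positivity)).2 (by linarith)
  set cell : Fin N → (Fin 3 → ZMod P) := fun k => cellOf S.L P (x k) with hcell
  set K := (2 * D + 1) ^ 3 with hK
  have hlamP : 0 < lamP := by
    have h1 : 0 < 8 * (2 * (D : ℝ) + 1) ^ 3 * lamM := by positivity
    exact pos_of_mul_pos_right (h1.trans_le hlam) hτ0.le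
  let A : Fin N × Fin N → Prop := fun p =>
    p.1 ≠ p.2 ∧ cell p.1 = cell p.2 ∧ 3 ≤ occ cell (cell p.2)
  let B : Fin N × Fin N → Prop := fun p =>
    p.1 ≠ p.2 ∧ ¬ S.Calm p.1 p.2 x ∧ S.dist x p.1 p.2 ≤ S.R₀
  have hcells : ∀ a b, cell a = cell b → S.dist x a b ≤ r₁ := fun a b h =>
    norm_torusDiff_le_of_cellOf_eq hL hP0 hPL (mem_cube_of_mem_torusBox hx a)
      (mem_cube_of_mem_torusBox hx b) h
  -- the third particle of the cell spoils isolation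
  have hA : ∀ i j, A (i, j) → S.dist x i j ≤ r₁ ∧ ¬ (S.Isolated i j x ∧ S.Sparse i j x) := by
    rintro i j ⟨hij, hcl, hocc⟩
    refine ⟨hcells i j hcl, fun h => ?_⟩
    obtain ⟨k, hk, hk'⟩ := Finset.exists_mem_notMem_of_card_lt_card
      ((Finset.card_le_two (a := i) (b := j)).trans_lt (hocc : 3 ≤ Finset.card _))
    simp only [Finset.mem_insert, Finset.mem_singleton, not_or] at hk'
    have h1 := h.1.far hS hx hij h.2 hk'.1 hk'.2
    have h2 := hcells k j (Finset.mem_filter.1 hk).2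
    linarith
  have hterm : ∀ i, ∀ j ∈ Finset.univ.erase i,
      (if A (i, j) then 3 / 8 * τ * lamP else 0) - (if B (i, j) then 1 / 2 * lamM else 0) ≤
      1 / 2 * (vp (torusDiff S.L (x i) (x j)) + vm (torusDiff S.L (x i) (x j))) -
      (S.chiSparse i j x * pairPot vp vm S.R₀ t θ (torusDiff S.L (x i) (x j)) +
       S.chiDense i j x * pairPot vp vm S.R₀ t (1 / 4) (torusDiff S.L (x i) (x j)) +
       S.chiCalm i j x * pairPot vp vm S.R₀ t 0 (torusDiff S.L (x i) (x j))) := by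
    intro i j hj
    have hij := (Finset.ne_of_mem_erase hj).symm
    set y := torusDiff S.L (x i) (x j) with hy
    have hyd : ‖y‖ = S.dist x i j := rfl
    by_cases hd : ‖y‖ ≤ S.R₀
    swap
    · have hpp : ∀ θ, pairPot vp vm S.R₀ t θ y = 0 := fun θ =>
        Set.indicator_of_notMem (fun h => hd (mem_closedBall_zero_iff.1 h)) _
      have hA' : ¬ A (i, j) := fun h => hd (by rw [hyd]; linarith [(hA i j h).1])
      have hB' : ¬ B (i, j) := fun h => hd h.2.2
      rw [if_neg hA', if_neg hB', hpp, hpp, hpp, hv.eq_zero y (not_le.1 hd)]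
      simp
    · have hpp : ∀ θ, pairPot vp vm S.R₀ t θ y =
          1 / 2 * (vp y + vm y) - 1 / 2 * (1 - θ) * τ * vp y := fun θ =>
        Set.indicator_of_mem (mem_closedBall_zero_iff.2 hd) _
      have hvp := hv.nonneg y
      have hvm := hv.lower y
      have hAvp : (if A (i, j) then 3 / 8 * τ * lamP else 0) ≤ 3 / 8 * τ * vp y := by
        split_ifs with h
        · exact mul_le_mul_of_nonneg_left (hP y (hyd ▸ (hA i j h).1)) (by positivity)
        · positivity
      have hB0 : 0 ≤ (if B (i, j) then 1 / 2 * lamM else 0) := by split_ifs <;> positivity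
      have hτv : 0 ≤ τ * vp y := by positivity
      simp only [hpp]
      by_cases hI : S.Isolated i j x
      · rw [chiCalm_eq_zero (fun h => h.1 hI)]
        by_cases hs : S.Sparse i j x
        · rw [chiSparse_eq_one ⟨hI, hs⟩, chiDense_eq_zero (fun h => h.2 hs),
            if_neg (fun h => (hA i j h).2 ⟨hI, hs⟩)]
          have : 0 ≤ (1 - θ) * (τ * vp y) := mul_nonneg (by linarith) hτv
          linarith
        · rw [chiSparse_eq_zero (fun h => hs h.2), chiDense_eq_one ⟨hI, hs⟩]
          linarith
      · rw [chiSparse_eq_zero (fun h => hI h.1), chiDense_eq_zero (fun h => hI h.1)]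
        by_cases hc : S.Calm i j x
        · rw [chiCalm_eq_one ⟨hI, hc⟩]
          linarith
        · rw [chiCalm_eq_zero (fun h => hc h.2), if_pos (show B (i, j) from ⟨hij, hc, hd⟩)]
          have : τ * vp y ≤ vp y := mul_le_of_le_one_left hvp hτ1
          linarith
  refine le_trans ?_ (Finset.sum_le_sum fun i _ => Finset.sum_le_sum (hterm i))
  simp only [Finset.sum_sub_distrib]
  rw [sum_erase_ite_eq_card A (fun q h => h.1), sum_erase_ite_eq_card B (fun q h => h.1)]
  have hcount := card_crowded_pairs_le cell (cellNbhd D) (fun a => card_cellNbhd_le D a)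
    (fun a b h => mem_cellNbhd_comm h) ({q | B q} : Finset (Fin N × Fin N)) (by
      intro q hq
      obtain ⟨h1, h2, h3⟩ := (Finset.mem_filter.1 hq).2
      refine ⟨cellOf_mem_cellNbhd hL hD (h3.trans (by linarith)), ?_⟩
      unfold Calm at h2
      push Not at h2
      refine hn.trans (h2.trans (Finset.card_le_card fun k hk => ?_))
      have := (Finset.mem_filter.1 hk).2.2.2
      exact Finset.mem_filter.2 ⟨Finset.mem_univ _, cellOf_mem_cellNbhd hL hD this⟩)
  have hcount' : (Finset.card {q | B q} : ℝ) ≤ 6 * (2 * D + 1) ^ 3 * Finset.card {q | A q} := by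
    exact_mod_cast hcount
  have hA0 : (0 : ℝ) ≤ Finset.card {q | A q} := Nat.cast_nonneg _
  have f1 := mul_le_mul_of_nonneg_right hcount' (by positivity : 0 ≤ 1 / 2 * lamM)
  have f2 := mul_le_mul_of_nonneg_left hlam (by positivity :
    (0 : ℝ) ≤ 3 / 8 * Finset.card {q | A q})
  linarith

open Classical in
/-- The weight of the soft interaction in the box of particle `i`. -/
noncomputable def weight (S : Layout N) (θ : ℝ) (σ : Fin N → Fin 3 → ℤ) (i : Fin N) : ℝ :=
  if Finset.card {k | σ k = σ i} ≤ S.m then θ else 1 / 4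

/-- In the box configuration `σ` the soft interaction within the groups is part of that left behind by
the pair estimates. -/
lemma weight_mul_pairTerm_le (hS : S.IsValid) {θ : ℝ} (hθ : 0 ≤ θ) {σ : Fin N → Fin 3 → ℤ}
    (hx : S.boxes x = σ) (hj : j ∈ S.grp σ i) :
    S.weight θ σ i * pairTerm (S.grp σ i) (corner S.ℓ (σ i)) S.ℓ S.R₀ S.R i j x ≤
      (θ * S.chiSparse i j x + 1 / 4 * S.chiDense i j x) *
        shellPot S.R₀ S.R (torusDiff S.L (x i) (x j)) := by
  have hR := hS.R_pos
  have hsh : ∀ y, 0 ≤ shellPot S.R₀ S.R y := fun y =>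
    shellPot_nonneg hS.R₀_pos.le (by linarith [hS.two_mul_R₀_le, hS.R₀_pos]) y
  have hσ := (hS.isGrouping σ).box_eq i j hj
  have hbox : boxOf S.ℓ (x i) = boxOf S.ℓ (x j) := by
    have := congrFun hx; simp only [boxes] at this; rw [this, this, hσ]
  have hmv : S.movedBoxes i j x = σ := (Layout.movedBoxes_eq hbox).trans hx
  unfold pairTerm
  split_ifs with h
  · have hI : S.Isolated i j x := by
      unfold Isolated
      rw [hmv, hσ]
      exact ⟨hj, h⟩
    rw [torusDiff_of_boxOf_eq hS.ℓ_pos hS.two_mul_le hbox]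
    refine mul_le_mul_of_nonneg_right ?_ (hsh _)
    have hsp : S.Sparse i j x ↔ Finset.card {k | σ k = σ i} ≤ S.m := by
      unfold Sparse
      rw [hmv, hσ]
    unfold weight
    by_cases hs : S.Sparse i j x
    · rw [if_pos (hsp.1 hs), chiSparse_eq_one ⟨hI, hs⟩, chiDense_eq_zero (fun h => h.2 hs)]; simp
    · rw [if_neg (fun h => hs (hsp.2 h)), chiSparse_eq_zero (fun h => hs h.2),
        chiDense_eq_one ⟨hI, hs⟩]; simp
  · rw [mul_zero]
    refine mul_nonneg (add_nonneg (mul_nonneg hθ (chiSparse_mem_Icc _ _ _).1)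
      (mul_nonneg (by norm_num) (chiDense_mem_Icc _ _ _).1)) (hsh _)
end Layout

/-! ### The energy bounds a soft energy -/

/-- The layout `S` suits the potential `vp + vm`: its kinetic and potential energy budgets are
sufficient. -/
structure Layout.Suits {N : ℕ} (S : Layout N) (vp vm : R3 → ℝ) (t c lamM ε : ℝ) : Prop where
  valid : S.IsValid
  admissible : IsAdmissible vp vm S.R₀ t c lamM
  nonneg : 0 ≤ ε
  le_eighth : ε ≤ 1 / 8
  two_le : 2 ≤ c
  four_mul_le : 4 * S.n₀ ≤ c
  cluster : ∃ (lamP r₁ : ℝ) (P D : ℕ), (∀ y, ‖y‖ ≤ r₁ → lamP ≤ vp y) ∧ r₁ ≤ S.R₀ ∧ 0 < P ∧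
    2 * S.L ≤ r₁ * P ∧ 4 * S.R₀ * P / S.L + 1 ≤ D ∧ 4 * (2 * D + 1) ^ 3 ≤ S.n₀ ∧
    8 * (2 * D + 1) ^ 3 * lamM ≤ t / (1 + t) * lamP

/-- The soft interaction that the pair estimates leave behind. -/
noncomputable def Layout.softPot {N : ℕ} (S : Layout N) (θ : ℝ) (x : Config N) : ℝ :=
  ∑ i, ∑ j ∈ Finset.univ.erase i, (θ * S.chiSparse i j x + 1 / 4 * S.chiDense i j x) *
    shellPot S.R₀ S.R (torusDiff S.L (x i) (x j))

lemma Layout.measurable_softPot {N : ℕ} (S : Layout N) (θ : ℝ) : Measurable (S.softPot θ) := by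
  have h : ∀ i j : Fin N, Measurable fun x : Config N =>
      shellPot S.R₀ S.R (torusDiff S.L (x i) (x j)) := fun i j =>
    (measurable_shellPot _ _).comp ((measurable_torusDiff S.L).comp
      (by fun_prop : Measurable fun x : Config N => (x i, x j)))
  refine Finset.measurable_sum _ fun i _ => Finset.measurable_sum _ fun j _ => ?_
  exact (((Layout.measurable_chiSparse i j).const_mul _).add ((Layout.measurable_chiDense i j).const_mul _)).mul
    (h i j)

lemma Layout.softPot_bounded {N : ℕ} {S : Layout N} (hS : S.IsValid) {θ : ℝ} (h0 : 0 ≤ θ) :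
    (∀ x, 0 ≤ S.softPot θ x) ∧ ∃ b, ∀ x, S.softPot θ x ≤ b := by
  have hR : S.R₀ < S.R := by linarith [hS.two_mul_R₀_le, hS.R₀_pos]
  have hsh := shellPot_nonneg hS.R₀_pos.le hR
  have hsh' := shellPot_le hS.R₀_pos.le hR
  refine ⟨fun x => Finset.sum_nonneg fun i _ => Finset.sum_nonneg fun j _ => mul_nonneg
    (add_nonneg (mul_nonneg h0 (Layout.chiSparse_mem_Icc i j x).1)
      (mul_nonneg (by norm_num) (Layout.chiDense_mem_Icc i j x).1)) (hsh _),
    ∑ i : Fin N, ∑ j ∈ Finset.univ.erase i, (θ * 1 + 1 / 4 * 1) * (3 / (S.R ^ 3 - S.R₀ ^ 3)),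
    fun x => Finset.sum_le_sum fun i _ => Finset.sum_le_sum fun j _ => ?_⟩
  refine mul_le_mul (add_le_add (mul_le_mul_of_nonneg_left (Layout.chiSparse_mem_Icc i j x).2 h0)
    (mul_le_mul_of_nonneg_left (Layout.chiDense_mem_Icc i j x).2 (by norm_num))) (hsh' _) (hsh _)
    (by positivity)

/-- The pair estimates, summed over all pairs: part of the kinetic energy and the interaction bound
the soft interaction. -/
theorem IsTorusState.softEnergy_le {N : ℕ} {S : Layout N} {vp vm : R3 → ℝ} {t c lamM ε : ℝ}
    (hSv : S.Suits vp vm t c lamM ε) {ψ : Config N → ℂ} {G : Fin N → Fin 3 → Config N → ℂ}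
    (hs : IsTorusState (fun x => vp x + vm x) N S.L ψ G) :
    ∫ x in torusBox N S.L, (ε * (∑ i, ∑ k, ‖G i k x‖ ^ 2) +
      S.softPot (1 - 2 * ε) x * ‖ψ x‖ ^ 2) ≤
    ∫ x in torusBox N S.L, ((∑ i, ∑ k, ‖G i k x‖ ^ 2) + ∑ i, ∑ j ∈ Finset.univ.erase i,
      1 / 2 * ((vp (torusDiff S.L (x i) (x j)) + vm (torusDiff S.L (x i) (x j))) * ‖ψ x‖ ^ 2)) := by
  have hS := hSv.valid
  have hv := hSv.admissible
  have hε0 := hSv.nonneg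
  have hε := hSv.le_eighth
  have hRpos := hS.R_pos
  have hR₀ := hS.R₀_pos
  have h2R := hS.two_mul_R₀_le
  have h4R := hS.four_mul_R_le
  have h2ℓ := hS.two_mul_le
  obtain ⟨lamP, r₁, P, D, hP, hr, hP0, hPL, hD, hn, hlam⟩ := hSv.cluster
  have hTm : MeasurableSet (torusBox N S.L) := by
    rw [torusBox_eq_pi]; exact MeasurableSet.univ_pi fun _ => measurableSet_cube _ _
  set θ := 1 - 2 * ε with hθ
  have hS1 := fun (i j : Fin N) (hij : i ≠ j) => hs.pair hv hij (Layout.measurable_chiSparse (S := S) i j)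
    (fun x => (Layout.chiSparse_mem_Icc i j x).1) (fun x => (Layout.chiSparse_mem_Icc i j x).2)
    (Layout.chiSparse_update hij) (θ := θ) (R := S.R) (by linarith) (by linarith) (by linarith)
    (by linarith)
  have hS2 := fun (i j : Fin N) (hij : i ≠ j) => hs.pair hv hij (Layout.measurable_chiDense (S := S) i j)
    (fun x => (Layout.chiDense_mem_Icc i j x).1) (fun x => (Layout.chiDense_mem_Icc i j x).2)
    (Layout.chiDense_update hij) (θ := 1 / 4) (R := S.R) (by norm_num) (by norm_num) (by linarith)
    (by linarith)
  have hS3 := fun (i j : Fin N) (hij : i ≠ j) => hs.pair hv hij (Layout.measurable_chiCalm (S := S) i j)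
    (fun x => (Layout.chiCalm_mem_Icc i j x).1) (fun x => (Layout.chiCalm_mem_Icc i j x).2)
    (Layout.chiCalm_update hij) (θ := 0) (R := 2 * S.R₀) le_rfl (by norm_num) (by linarith)
    (by linarith)
  have hgi : IntegrableOn (fun x => ∑ i, ∑ k, ‖G i k x‖ ^ 2) (torusBox N S.L) :=
    integrable_finsetSum _ fun i _ => integrable_finsetSum _ fun k _ => hs.integrable_gradient i k
  have hvi : IntegrableOn (fun x => ∑ i, ∑ j ∈ Finset.univ.erase i,
      1 / 2 * ((vp (torusDiff S.L (x i) (x j)) + vm (torusDiff S.L (x i) (x j))) * ‖ψ x‖ ^ 2))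
      (torusBox N S.L) :=
    integrable_finsetSum _ fun i _ => integrable_finsetSum _ fun j hj =>
      (hs.integrable_potential i j (Finset.ne_of_mem_erase hj).symm).const_mul _
  obtain ⟨hW0, b, hWb⟩ := Layout.softPot_bounded hS (θ := θ) (by linarith)
  have hWi : IntegrableOn (fun x => S.softPot θ x * ‖ψ x‖ ^ 2) (torusBox N S.L) :=
    integrable_bdd_mul (S.measurable_softPot θ) hW0 hWb hs.integrable_sq
  let F : Fin N → Fin N → Config N → ℝ := fun i j x =>
    S.chiSparse i j x * ((θ + (1 - θ) / c) *
      (ballInd S.R (torusDiff S.L (x i) (x j)) * ∑ k, ‖G i k x‖ ^ 2) +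
      pairPot vp vm S.R₀ t θ (torusDiff S.L (x i) (x j)) * ‖ψ x‖ ^ 2 -
      θ * (shellPot S.R₀ S.R (torusDiff S.L (x i) (x j)) * ‖ψ x‖ ^ 2)) +
    S.chiDense i j x * ((1 / 4 + (1 - 1 / 4) / c) *
      (ballInd S.R (torusDiff S.L (x i) (x j)) * ∑ k, ‖G i k x‖ ^ 2) +
      pairPot vp vm S.R₀ t (1 / 4) (torusDiff S.L (x i) (x j)) * ‖ψ x‖ ^ 2 -
      1 / 4 * (shellPot S.R₀ S.R (torusDiff S.L (x i) (x j)) * ‖ψ x‖ ^ 2)) +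
    S.chiCalm i j x * ((0 + (1 - 0) / c) *
      (ballInd (2 * S.R₀) (torusDiff S.L (x i) (x j)) * ∑ k, ‖G i k x‖ ^ 2) +
      pairPot vp vm S.R₀ t 0 (torusDiff S.L (x i) (x j)) * ‖ψ x‖ ^ 2 -
      0 * (shellPot S.R₀ (2 * S.R₀) (torusDiff S.L (x i) (x j)) * ‖ψ x‖ ^ 2))
  have hFi : ∀ i, ∀ j ∈ Finset.univ.erase i, IntegrableOn (F i j) (torusBox N S.L) := fun i j hj =>
    have hij := (Finset.ne_of_mem_erase hj).symm
    ((hS1 i j hij).1.add (hS2 i j hij).1).add (hS3 i j hij).1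
  have hF0 : ∀ i, ∀ j ∈ Finset.univ.erase i, 0 ≤ ∫ x in torusBox N S.L, F i j x := by
    intro i j hj
    have hij := (Finset.ne_of_mem_erase hj).symm
    have h1 := hS1 i j hij
    have h2 := hS2 i j hij
    have h3 := hS3 i j hij
    have h12 : IntegrableOn _ (torusBox N S.L) := h1.1.add h2.1
    have e : ∫ x in torusBox N S.L, F i j x = _ := integral_add h12 h3.1
    have e' := integral_add h1.1 h2.1
    rw [e, e']
    exact add_nonneg (add_nonneg h1.2 h2.2) h3.2
  have hFsi : IntegrableOn (fun x => ∑ i, ∑ j ∈ Finset.univ.erase i, F i j x) (torusBox N S.L) :=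
    integrable_finsetSum _ fun i _ => integrable_finsetSum _ fun j hj => hFi i j hj
  have hFs : 0 ≤ ∫ x in torusBox N S.L, ∑ i, ∑ j ∈ Finset.univ.erase i, F i j x := by
    rw [integral_finsetSum _ fun i _ => integrable_finsetSum _ fun j hj => hFi i j hj]
    refine Finset.sum_nonneg fun i _ => ?_
    rw [integral_finsetSum _ fun j hj => hFi i j hj]
    exact Finset.sum_nonneg fun j hj => hF0 i j hj
  have hlow : IntegrableOn (fun x => ε * (∑ i, ∑ k, ‖G i k x‖ ^ 2) + S.softPot θ x * ‖ψ x‖ ^ 2)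
      (torusBox N S.L) := (hgi.const_mul ε).add hWi
  have hpt : ∀ x ∈ torusBox N S.L, (ε * (∑ i, ∑ k, ‖G i k x‖ ^ 2) + S.softPot θ x * ‖ψ x‖ ^ 2) +
      ∑ i, ∑ j ∈ Finset.univ.erase i, F i j x ≤ (∑ i, ∑ k, ‖G i k x‖ ^ 2) +
      ∑ i, ∑ j ∈ Finset.univ.erase i,
      1 / 2 * ((vp (torusDiff S.L (x i) (x j)) + vm (torusDiff S.L (x i) (x j))) * ‖ψ x‖ ^ 2) := by
    intro x hx
    have hkin := fun i => mul_le_mul_of_nonneg_right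
      (Layout.kinetic_budget hS hx hε0 hε hSv.two_le hSv.four_mul_le i)
      (by positivity : 0 ≤ ∑ k, ‖G i k x‖ ^ 2)
    have hpot := mul_nonneg (Layout.potential_budget hS hx hv hP hr hP0 hPL hD hn hlam
      (by linarith : θ ≤ 1)) (by positivity : 0 ≤ ‖ψ x‖ ^ 2)
    have hk := Finset.sum_le_sum fun i (_ : i ∈ Finset.univ) => hkin i
    rw [← Finset.mul_sum] at hk
    have key : S.softPot θ x * ‖ψ x‖ ^ 2 + ∑ i, ∑ j ∈ Finset.univ.erase i, F i j x =
        (∑ i, (∑ j ∈ Finset.univ.erase i, (S.chiSparse i j x * ((θ + (1 - θ) / c) *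
          ballInd S.R (torusDiff S.L (x i) (x j))) +
          S.chiDense i j x * ((1 / 4 + (1 - 1 / 4) / c) *
            ballInd S.R (torusDiff S.L (x i) (x j))) +
          S.chiCalm i j x * ((0 + (1 - 0) / c) *
            ballInd (2 * S.R₀) (torusDiff S.L (x i) (x j))))) * ∑ k, ‖G i k x‖ ^ 2) +
        ((∑ i, ∑ j ∈ Finset.univ.erase i,
      1 / 2 * ((vp (torusDiff S.L (x i) (x j)) + vm (torusDiff S.L (x i) (x j))) * ‖ψ x‖ ^ 2)) -
        (∑ i, ∑ j ∈ Finset.univ.erase i,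
          (1 / 2 * (vp (torusDiff S.L (x i) (x j)) + vm (torusDiff S.L (x i) (x j))) -
          (S.chiSparse i j x * pairPot vp vm S.R₀ t θ (torusDiff S.L (x i) (x j)) +
          S.chiDense i j x * pairPot vp vm S.R₀ t (1 / 4) (torusDiff S.L (x i) (x j)) +
          S.chiCalm i j x * pairPot vp vm S.R₀ t 0 (torusDiff S.L (x i) (x j))))) *
          ‖ψ x‖ ^ 2) := by
      simp only [Layout.softPot, Finset.sum_mul, ← Finset.sum_add_distrib, ← Finset.sum_sub_distrib]
      refine Finset.sum_congr rfl fun i _ => ?_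
      refine Finset.sum_congr rfl fun j _ => ?_
      simp only [F]
      ring
    rw [add_assoc, key]
    linarith
  have h1 := setIntegral_mono_on (hlow.add hFsi) (hgi.add hvi) hTm hpt
  have h2 : ∫ x in torusBox N S.L, ((ε * (∑ i, ∑ k, ‖G i k x‖ ^ 2) +
      S.softPot θ x * ‖ψ x‖ ^ 2) + ∑ i, ∑ j ∈ Finset.univ.erase i, F i j x) = _ :=
    integral_add hlow hFsi
  have h3 : ∀ x, ((fun x => ε * (∑ i, ∑ k, ‖G i k x‖ ^ 2) + S.softPot θ x * ‖ψ x‖ ^ 2) +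
      fun x => ∑ i, ∑ j ∈ Finset.univ.erase i, F i j x) x = ((ε * (∑ i, ∑ k, ‖G i k x‖ ^ 2) +
      S.softPot θ x * ‖ψ x‖ ^ 2) + ∑ i, ∑ j ∈ Finset.univ.erase i, F i j x) := fun x => rfl
  simp only [h3, h2] at h1
  refine le_trans ?_ h1
  linarith

/-! ### Localization in boxes and summation over groups -/

section Counting
open Finset
variable {N : ℕ} {β : Type*} [DecidableEq β] {m : ℕ} {σ : Fin N → β}
  {grp : Fin N → Finset (Fin N)}

lemma IsGrouping.filter_eq (h : IsGrouping m σ grp) (i : Fin N) : ({j | grp j = grp i} : Finset _) = grp i := by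
  ext j
  simp only [mem_filter, mem_univ, true_and]
  exact ⟨fun hj => hj ▸ h.self_mem j, fun hj => h.eq_of_mem i j hj⟩

lemma IsGrouping.sum_groups (h : IsGrouping m σ grp) (f : Fin N → Finset (Fin N) → ℝ) :
    ∑ i, f i (grp i) = ∑ s ∈ univ.image grp, ∑ i ∈ s, f i s := by
  rw [← Finset.sum_fiberwise_of_maps_to (s := univ) (t := univ.image grp) (g := grp)
    (fun i _ => mem_image_of_mem _ (mem_univ i))]
  refine Finset.sum_congr rfl fun s hs => ?_
  obtain ⟨i, _, rfl⟩ := mem_image.1 hs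
  rw [h.filter_eq]
  exact Finset.sum_congr rfl fun j hj => by rw [h.eq_of_mem i j hj]

/-- The weighted number of interacting pairs, up to `N`, is bounded below by its value for
equidistributed particles: `n ^ 2` lies above its tangent `2 k n - k ^ 2`, and in crowded boxes
the large groups compensate for the smaller weight. -/
lemma IsGrouping.sum_weight_ge (h : IsGrouping m σ grp) {B : Finset β} (hB : ∀ i, σ i ∈ B) {k θ : ℝ}
    (hk : k * #B = N) (hk0 : 0 ≤ k) (hm : 16 * k + 2 ≤ m) (hθ0 : 0 ≤ θ) (hθ1 : θ ≤ 1) :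
    θ * ((k - 1) * N) ≤
      ∑ i, (if #{j | σ j = σ i} ≤ m then θ else 1 / 4) * ((#(grp i) : ℝ) - 1) := by
  have hN : (N : ℝ) = ∑ b ∈ B, (#{j | σ j = b} : ℝ) := by
    have := Finset.card_eq_sum_card_fiberwise (s := univ) (t := B) (f := σ) (fun i _ => hB i)
    rw [card_univ, Fintype.card_fin] at this
    exact_mod_cast this
  have e : θ * ((k - 1) * N) = ∑ b ∈ B, θ * (2 * k * #{j | σ j = b} - #{j | σ j = b} - k ^ 2) := by
    rw [← Finset.mul_sum, Finset.sum_sub_distrib, Finset.sum_sub_distrib, ← Finset.mul_sum, ← hN,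
      Finset.sum_const, nsmul_eq_mul]
    congr 1
    linear_combination k * hk
  rw [e, ← Finset.sum_fiberwise_of_maps_to (s := univ) (t := B) (g := σ) (fun i _ => hB i)]
  refine Finset.sum_le_sum fun b _ => ?_
  set n := #{j | σ j = b} with hn
  have h1 : ∑ i with σ i = b, (if #{j | σ j = σ i} ≤ m then θ else 1 / 4) * ((#(grp i) : ℝ) - 1) =
      ∑ i with σ i = b, (if n ≤ m then θ else 1 / 4) * ((#(grp i) : ℝ) - 1) := by
    refine Finset.sum_congr rfl fun i hi => ?_
    rw [(mem_filter.1 hi).2]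
  rw [h1, ← Finset.mul_sum, Finset.sum_sub_distrib, Finset.sum_const, nsmul_eq_mul, mul_one, ← hn]
  split_ifs with hnm
  · have h2 : ∑ i with σ i = b, (#(grp i) : ℝ) = n * n := by
      rw [Finset.sum_congr rfl (g := fun _ => (n : ℝ)), Finset.sum_const, nsmul_eq_mul]
      intro i hi
      have hb := (mem_filter.1 hi).2
      rw [h.eq_box i (by rw [hb]; exact hnm), hb]
    rw [h2]
    refine mul_le_mul_of_nonneg_left ?_ hθ0
    nlinarith [sq_nonneg ((n : ℝ) - k)]
  · have h2 : (n : ℝ) * m ≤ 2 * ∑ i with σ i = b, (#(grp i) : ℝ) := by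
      exact_mod_cast h.large b (not_le.1 hnm)
    have hn0 : (0 : ℝ) ≤ n := Nat.cast_nonneg n
    have h3 : θ * (2 * k * n - n - k ^ 2) ≤ 2 * k * n := by
      have : θ * (2 * k * n - n - k ^ 2) ≤ θ * (2 * k * n) := by
        refine mul_le_mul_of_nonneg_left ?_ hθ0
        nlinarith [sq_nonneg k]
      exact this.trans (mul_le_of_le_one_left (by positivity) hθ1)
    have h4 := mul_le_mul_of_nonneg_left hm hn0
    linarith
end Counting

/-- The set of configurations with box indices `σ`. -/
def configBox {N : ℕ} (ℓ : ℝ) (σ : Fin N → Fin 3 → ℤ) : Set (Config N) :=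
  Set.pi Set.univ fun i => cube (corner ℓ (σ i)) ℓ

lemma mem_configBox {N : ℕ} {ℓ : ℝ} (hℓ : 0 < ℓ) {σ : Fin N → Fin 3 → ℤ} {x : Config N} :
    x ∈ configBox ℓ σ ↔ (fun i => boxOf ℓ (x i)) = σ := by
  simp only [configBox, Set.mem_univ_pi, mem_cube_corner hℓ, funext_iff]

lemma measurableSet_configBox {N : ℕ} (ℓ : ℝ) (σ : Fin N → Fin 3 → ℤ) :
    MeasurableSet (configBox ℓ σ) :=
  MeasurableSet.univ_pi fun _ => measurableSet_cube _ _

/-- The indices of the boxes of the torus. -/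
noncomputable def boxIndices (M : ℕ) : Finset (Fin 3 → ℤ) := Fintype.piFinset fun _ => Finset.Ico 0 (M : ℤ)

lemma card_boxIndices (M : ℕ) : (boxIndices M).card = M ^ 3 := by
  simp [boxIndices, Fintype.card_piFinset]

lemma torusBox_eq_biUnion {N : ℕ} {L ℓ : ℝ} {M : ℕ} (hℓ : 0 < ℓ) (hL : L = M * ℓ) :
    torusBox N L = ⋃ σ ∈ Fintype.piFinset fun _ : Fin N => boxIndices M, configBox ℓ σ := by
  have h : ∀ x : Config N, x ∈ torusBox N L ↔ (fun i => boxOf ℓ (x i)) ∈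
      Fintype.piFinset fun _ : Fin N => boxIndices M := by
    intro x
    simp only [torusBox, boxIndices, Fintype.mem_piFinset, Finset.mem_Ico, boxOf]
    refine forall_congr' fun i => forall_congr' fun k => ?_
    rw [Set.mem_Ico, Int.floor_nonneg, Int.floor_lt, hL, div_lt_iff₀ hℓ, Int.cast_natCast]
    refine and_congr_left fun _ => ?_
    rw [le_div_iff₀ hℓ, zero_mul]
  ext x
  rw [h x]
  simp only [Set.mem_iUnion, mem_configBox hℓ, exists_prop]
  exact ⟨fun hx => ⟨_, hx, rfl⟩, fun ⟨σ, hσ, e⟩ => e ▸ hσ⟩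

lemma groupErr_mono {R ℓ : ℝ} (hR : 0 ≤ R) (hℓ : 0 < ℓ) {n m : ℕ} (h : n ≤ m) :
    groupErr R ℓ n ≤ groupErr R ℓ m := by
  unfold groupErr
  have : (n : ℝ) ≤ m := by exact_mod_cast h
  gcongr

/-- The soft energy in a product of boxes. -/
lemma softEnergy_ge_of_configBox {N : ℕ} {S : Layout N} (hS : S.IsValid) {ε η k : ℝ}
    (hε0 : 0 ≤ ε) (hε : ε ≤ 1 / 8) (hη0 : 0 < η) (hη : η ≤ 1 / 2) (herr : groupErr S.R S.ℓ S.m ≤ 1)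
    (hkin : (3 * S.m / (S.R ^ 3 - S.R₀ ^ 3) + 4 * Real.pi / S.ℓ ^ 3 * S.m ^ 2) / η *
      (24 * S.ℓ ^ 2) ≤ ε)
    (hk : k * S.M ^ 3 = N) (hk0 : 0 ≤ k) (hm : 16 * k + 2 ≤ S.m)
    {ψ : Config N → ℂ} {G : Fin N → Fin 3 → Config N → ℂ} (hψm : Measurable ψ)
    (hGm : ∀ i k, Measurable (G i k))
    (hG : ∀ i k, HasWeakDirDeriv ψ (G i k) (particleUnitVec i k)) {σ : Fin N → Fin 3 → ℤ}
    (hσ : ∀ i, σ i ∈ boxIndices S.M)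
    (h2 : IntegrableOn (fun x => ‖ψ x‖ ^ 2) (configBox S.ℓ σ))
    (hG2 : ∀ i k, IntegrableOn (fun x => ‖G i k x‖ ^ 2) (configBox S.ℓ σ)) :
    (1 - 2 * η) * (4 * Real.pi / S.ℓ ^ 3 * (1 - groupErr S.R S.ℓ S.m)) *
      ((1 - 2 * ε) * ((k - 1) * N)) * ∫ x in configBox S.ℓ σ, ‖ψ x‖ ^ 2 ≤
    ∫ x in configBox S.ℓ σ, (ε * (∑ i, ∑ k, ‖G i k x‖ ^ 2) +
      S.softPot (1 - 2 * ε) x * ‖ψ x‖ ^ 2) := by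
  classical
  have hℓ := hS.ℓ_pos
  have hR := hS.R_pos
  have hR₀ := hS.R₀_pos
  have hRR : S.R₀ < S.R := by linarith [hS.two_mul_R₀_le]
  have hg := hS.isGrouping σ
  set grp := S.grp σ with hgrp
  set Q := configBox S.ℓ σ with hQ
  have hbox := isBox_cube (fun i => corner S.ℓ (σ i)) hℓ
  set θ := 1 - 2 * ε with hθ
  set w : Fin N → ℝ := S.weight θ σ with hw
  have hw0 : ∀ i, 0 ≤ w i := fun i => by
    simp only [hw, Layout.weight]; split_ifs <;> [linarith; norm_num]
  have hw1 : ∀ i, w i ≤ 1 := fun i => by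
    simp only [hw, Layout.weight]; split_ifs <;> [linarith; norm_num]
  have hwc : ∀ i, ∀ j ∈ grp i, w j = w i := fun i j hj => by
    simp only [hw, Layout.weight, hg.box_eq i j hj]
  have hcub := cube_sub_pos hR₀.le hRR
  have hpi := Real.pi_pos
  set E := 4 * Real.pi / S.ℓ ^ 3 * (1 - groupErr S.R S.ℓ S.m) with hE
  set I := ∫ x in Q, ‖ψ x‖ ^ 2 with hI
  have hI0 : 0 ≤ I := integral_nonneg fun x => by positivity
  have hkinI : ∀ i, 0 ≤ ∫ x in Q, ∑ k, ‖G i k x‖ ^ 2 := fun i =>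
    integral_nonneg fun x => by positivity
  -- the bound for one group
  have hgroup : ∀ i₀, (1 - 2 * η) * E * (w i₀ * ((grp i₀).card * ((grp i₀).card - 1))) * I ≤
      w i₀ * (∫ x in Q, groupPot (grp i₀) (corner S.ℓ (σ i₀)) S.ℓ S.R₀ S.R x * ‖ψ x‖ ^ 2) +
      ε * ∑ i ∈ grp i₀, ∫ x in Q, ∑ k, ‖G i k x‖ ^ 2 := by
    intro i₀
    have hcm := hg.card_le i₀
    have hcm' : ((grp i₀).card : ℝ) ≤ S.m := by exact_mod_cast hcm
    have hc1 : (1 : ℝ) ≤ (grp i₀).card := by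
      exact_mod_cast Finset.card_pos.2 ⟨i₀, hg.self_mem i₀⟩
    have hmono := groupErr_mono hR.le hℓ hcm
    have hb := groupPot_bound (s := grp i₀) (c := fun i => corner S.ℓ (σ i)) hR₀.le hRR
      hS.four_mul_R_le (fun i hi => by rw [hg.box_eq i₀ i hi]) hη0 (by linarith)
      (hmono.trans herr) hψm hGm hG (hbox.integrable_iff.2 h2)
      (fun i k => hbox.integrable_iff.2 (hG2 i k))
    have hV := hbox.boxVol_pos
    have e : ∀ F : Config N → ℝ, ∫ x in Q, F x =
        boxVol (fun i => cube (corner S.ℓ (σ i)) S.ℓ) *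
          ∫ x, F x ∂boxProb fun i => cube (corner S.ℓ (σ i)) S.ℓ := fun F => hbox.setIntegral_eq F
    simp only [e, hI]
    rw [← Finset.mul_sum]
    set V := boxVol (fun i => cube (corner S.ℓ (σ i)) S.ℓ)
    set μ := boxProb fun i => cube (corner S.ℓ (σ i)) S.ℓ
    have hI0' : 0 ≤ ∫ x, ‖ψ x‖ ^ 2 ∂μ := integral_nonneg fun x => by positivity
    have hn0 : (0 : ℝ) ≤ (grp i₀).card * ((grp i₀).card - 1) :=
      mul_nonneg (by linarith) (by linarith)
    have l1 : (1 - 2 * η) * E * (((grp i₀).card * ((grp i₀).card - 1))) * (∫ x, ‖ψ x‖ ^ 2 ∂μ) ≤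
        (1 - 2 * η) * (4 * Real.pi / S.ℓ ^ 3 * (((grp i₀).card * ((grp i₀).card - 1))) *
          (1 - groupErr S.R S.ℓ (grp i₀).card)) * ∫ x, ‖ψ x‖ ^ 2 ∂μ := by
      refine mul_le_mul_of_nonneg_right ?_ hI0'
      rw [mul_assoc]
      refine mul_le_mul_of_nonneg_left ?_ (by linarith)
      rw [hE, mul_right_comm]
      exact mul_le_mul_of_nonneg_left (by linarith) (mul_nonneg (by positivity) hn0)
    have l2 : (3 * ((grp i₀).card : ℝ) / (S.R ^ 3 - S.R₀ ^ 3) + 4 * Real.pi / S.ℓ ^ 3 *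
        ((grp i₀).card * ((grp i₀).card - 1))) / η * (24 * S.ℓ ^ 2) ≤ ε := by
      refine le_trans ?_ hkin
      have : ((grp i₀).card : ℝ) * ((grp i₀).card - 1) ≤ (S.m : ℝ) ^ 2 := by nlinarith
      gcongr
    have hs0 : 0 ≤ ∑ i ∈ grp i₀, ∫ x, ∑ k, ‖G i k x‖ ^ 2 ∂μ :=
      Finset.sum_nonneg fun i _ => integral_nonneg fun x => by positivity
    have l3 := mul_le_mul_of_nonneg_right l2 hs0
    have l4 := mul_le_mul_of_nonneg_left (l1.trans (hb.trans (add_le_add_right l3 _)))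
      (mul_nonneg hV.le (hw0 i₀))
    have l5 := mul_le_mul_of_nonneg_left
      (mul_le_of_le_one_left (mul_nonneg hε0 hs0) (hw1 i₀)) hV.le
    linarith
  rcases isEmpty_or_nonempty (Fin N) with hNe | hNe
  · have hN0 : (N : ℝ) = 0 := by
      have := Fintype.card_eq_zero (α := Fin N)
      rw [Fintype.card_fin] at this
      exact_mod_cast this
    rw [hN0, mul_zero, mul_zero, mul_zero, zero_mul]
    exact integral_nonneg fun x => by simp [Layout.softPot]
  -- one representative for each group
  choose! rep hrep using fun (s : Finset (Fin N)) (hs : s ∈ Finset.univ.image grp) =>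
    Finset.mem_image.1 hs
  have hrep' : ∀ s ∈ Finset.univ.image grp, grp (rep s) = s := fun s hs => (hrep s hs).2
  have hsum := Finset.sum_le_sum fun s (hs : s ∈ Finset.univ.image grp) => hgroup (rep s)
  rw [Finset.sum_add_distrib, ← Finset.sum_mul, ← Finset.mul_sum, ← Finset.mul_sum] at hsum
  have s1 : ∑ s ∈ Finset.univ.image grp,
      w (rep s) * ((grp (rep s)).card * (((grp (rep s)).card : ℝ) - 1)) =
      ∑ i, w i * (((grp i).card : ℝ) - 1) := by
    rw [hg.sum_groups fun i s => w i * ((s.card : ℝ) - 1)]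
    refine Finset.sum_congr rfl fun s hs => ?_
    rw [hrep' s hs]
    rw [Finset.sum_congr rfl (g := fun _ => w (rep s) * ((s.card : ℝ) - 1)), Finset.sum_const,
      nsmul_eq_mul]
    · ring
    · intro i hi
      rw [hwc (rep s) i (by rw [hrep' s hs]; exact hi)]
  have s2 : ∑ s ∈ Finset.univ.image grp, ∑ i ∈ grp (rep s), ∫ x in Q, ∑ k, ‖G i k x‖ ^ 2 =
      ∑ i, ∫ x in Q, ∑ k, ‖G i k x‖ ^ 2 := by
    rw [hg.sum_groups fun i _ => ∫ x in Q, ∑ k, ‖G i k x‖ ^ 2]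
    exact Finset.sum_congr rfl fun s hs => by rw [hrep' s hs]
  have hpi2 : ∀ s, IntegrableOn (fun x => groupPot (grp (rep s)) (corner S.ℓ (σ (rep s))) S.ℓ
      S.R₀ S.R x * ‖ψ x‖ ^ 2) Q := fun s =>
    integrable_bdd_mul measurable_groupPot (groupPot_nonneg hR₀.le hRR) (groupPot_le hR₀.le hRR) h2
  have hθ0 : 0 ≤ θ := by linarith
  obtain ⟨hW0, b, hWb⟩ := Layout.softPot_bounded hS hθ0
  have hWi : IntegrableOn (fun x => S.softPot θ x * ‖ψ x‖ ^ 2) Q :=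
    integrable_bdd_mul (S.measurable_softPot θ) hW0 hWb h2
  have s3 : ∑ s ∈ Finset.univ.image grp, w (rep s) * (∫ x in Q, groupPot (grp (rep s))
      (corner S.ℓ (σ (rep s))) S.ℓ S.R₀ S.R x * ‖ψ x‖ ^ 2) ≤
      ∫ x in Q, S.softPot θ x * ‖ψ x‖ ^ 2 := by
    simp only [← integral_const_mul]
    rw [← integral_finsetSum _ fun s _ => (hpi2 s).const_mul _]
    refine setIntegral_mono_on (integrable_finsetSum _ fun s _ => (hpi2 s).const_mul _) hWi
      (measurableSet_configBox _ _) fun x hx => ?_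
    have hxσ : S.boxes x = σ := (mem_configBox hℓ).1 hx
    simp only [← mul_assoc]
    rw [← Finset.sum_mul]
    refine mul_le_mul_of_nonneg_right ?_ (by positivity)
    have e1 : ∑ s ∈ Finset.univ.image grp, w (rep s) * groupPot (grp (rep s))
        (corner S.ℓ (σ (rep s))) S.ℓ S.R₀ S.R x = ∑ i, ∑ j ∈ (grp i).erase i,
        w i * pairTerm (grp i) (corner S.ℓ (σ i)) S.ℓ S.R₀ S.R i j x := by
      rw [hg.sum_groups fun i s => ∑ j ∈ s.erase i,
        w i * pairTerm s (corner S.ℓ (σ i)) S.ℓ S.R₀ S.R i j x]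
      refine Finset.sum_congr rfl fun s hs => ?_
      rw [groupPot, Finset.mul_sum, hrep' s hs]
      refine Finset.sum_congr rfl fun i hi => ?_
      have hi' : i ∈ grp (rep s) := by rw [hrep' s hs]; exact hi
      rw [Finset.mul_sum, hwc _ i hi', hg.box_eq _ i hi']
    rw [e1]
    refine Finset.sum_le_sum fun i _ => ?_
    have hnn : ∀ j, 0 ≤ (θ * S.chiSparse i j x + 1 / 4 * S.chiDense i j x) *
        shellPot S.R₀ S.R (torusDiff S.L (x i) (x j)) := fun j =>
      mul_nonneg (add_nonneg (mul_nonneg hθ0 (Layout.chiSparse_mem_Icc i j x).1)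
        (mul_nonneg (by norm_num) (Layout.chiDense_mem_Icc i j x).1))
        (shellPot_nonneg hR₀.le hRR _)
    refine (Finset.sum_le_sum fun j hj => ?_).trans (Finset.sum_le_sum_of_subset_of_nonneg
      (Finset.erase_subset_erase i (Finset.subset_univ (grp i))) fun j _ _ => hnn j)
    have hj' := Finset.mem_of_mem_erase hj
    exact Layout.weight_mul_pairTerm_le hS hθ0 hxσ hj'
  have hcount := hg.sum_weight_ge (B := boxIndices S.M) hσ (k := k) (θ := θ)
    (by rw [card_boxIndices]; exact_mod_cast hk) hk0 hm hθ0 (by linarith)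
  have hwe : ∀ i, (if Finset.card {j | σ j = σ i} ≤ S.m then θ else 1 / 4) = w i := fun i => by
    simp only [hw, Layout.weight]
  simp only [hwe] at hcount
  have hgi : ∀ i, IntegrableOn (fun x => ∑ k, ‖G i k x‖ ^ 2) Q := fun i =>
    integrable_finsetSum _ fun k _ => hG2 i k
  have hgsi : IntegrableOn (fun x => ∑ i, ∑ k, ‖G i k x‖ ^ 2) Q :=
    integrable_finsetSum _ fun i _ => hgi i
  rw [integral_add (hgsi.const_mul ε) hWi, integral_const_mul,
    integral_finsetSum _ fun i _ => hgi i]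
  rw [s1, s2] at hsum
  have hEE : 0 ≤ (1 - 2 * η) * E := mul_nonneg (by linarith)
    (mul_nonneg (by positivity) (by linarith))
  have := mul_le_mul_of_nonneg_right (mul_le_mul_of_nonneg_left hcount hEE) hI0
  linarith

/-- The lower bound for the energy of a wave function on the torus. -/
theorem IsTorusState.energy_ge {N : ℕ} {S : Layout N} {vp vm : R3 → ℝ} {t c lamM ε η k : ℝ}
    (hSv : S.Suits vp vm t c lamM ε) {ψ : Config N → ℂ} {G : Fin N → Fin 3 → Config N → ℂ}
    (hs : IsTorusState (fun x => vp x + vm x) N S.L ψ G)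
    (hη0 : 0 < η) (hη : η ≤ 1 / 2) (herr : groupErr S.R S.ℓ S.m ≤ 1)
    (hkin : (3 * S.m / (S.R ^ 3 - S.R₀ ^ 3) + 4 * Real.pi / S.ℓ ^ 3 * S.m ^ 2) / η *
      (24 * S.ℓ ^ 2) ≤ ε)
    (hk : k * S.M ^ 3 = N) (hk0 : 0 ≤ k) (hm : 16 * k + 2 ≤ S.m) :
    (1 - 2 * η) * (4 * Real.pi / S.ℓ ^ 3 * (1 - groupErr S.R S.ℓ S.m)) *
      ((1 - 2 * ε) * ((k - 1) * N)) * ∫ x in torusBox N S.L, ‖ψ x‖ ^ 2 ≤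
    ∫ x in torusBox N S.L, ((∑ i, ∑ k, ‖G i k x‖ ^ 2) + ∑ i, ∑ j ∈ Finset.univ.erase i,
      1 / 2 * ((vp (torusDiff S.L (x i) (x j)) + vm (torusDiff S.L (x i) (x j))) * ‖ψ x‖ ^ 2)) := by
  refine le_trans ?_ (hs.softEnergy_le hSv)
  have hS := hSv.valid
  have hU := torusBox_eq_biUnion (N := N) hS.ℓ_pos hS.L_eq
  have hsub : ∀ σ ∈ Fintype.piFinset fun _ : Fin N => boxIndices S.M,
      configBox S.ℓ σ ⊆ torusBox N S.L := fun σ hσ => by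
    rw [hU]; exact Set.subset_biUnion_of_mem (u := fun σ => configBox S.ℓ σ) hσ
  have hdisj : Set.PairwiseDisjoint (↑(Fintype.piFinset fun _ : Fin N => boxIndices S.M))
      (configBox (N := N) S.ℓ) := by
    intro σ _ τ _ hne
    refine Set.disjoint_left.2 fun x h1 h2 => hne ?_
    rw [mem_configBox hS.ℓ_pos] at h1 h2
    exact h1.symm.trans h2
  have hθ0 : 0 ≤ 1 - 2 * ε := by linarith [hSv.le_eighth]
  obtain ⟨hW0, b, hWb⟩ := Layout.softPot_bounded hS hθ0
  have hgi : IntegrableOn (fun x => ∑ i, ∑ k, ‖G i k x‖ ^ 2) (torusBox N S.L) :=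
    integrable_finsetSum _ fun i _ => integrable_finsetSum _ fun k _ => hs.integrable_gradient i k
  have hWi : IntegrableOn (fun x => S.softPot (1 - 2 * ε) x * ‖ψ x‖ ^ 2) (torusBox N S.L) :=
    integrable_bdd_mul (S.measurable_softPot _) hW0 hWb hs.integrable_sq
  have hlow : IntegrableOn (fun x => ε * (∑ i, ∑ k, ‖G i k x‖ ^ 2) +
      S.softPot (1 - 2 * ε) x * ‖ψ x‖ ^ 2) (torusBox N S.L) := (hgi.const_mul ε).add hWi
  rw [hU, integral_biUnion_finset _ (fun σ _ => measurableSet_configBox _ _) hdisj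
      (fun σ hσ => hs.integrable_sq.mono_set (hsub σ hσ)),
    integral_biUnion_finset _ (fun σ _ => measurableSet_configBox _ _) hdisj
      (fun σ hσ => hlow.mono_set (hsub σ hσ)), Finset.mul_sum]
  refine Finset.sum_le_sum fun σ hσ => ?_
  exact softEnergy_ge_of_configBox hS hSv.nonneg hSv.le_eighth hη0 hη herr hkin hk hk0 hm
    hs.measurable hs.measurable_deriv hs.weakGradient (fun i => Fintype.mem_piFinset.1 hσ i)
    (hs.integrable_sq.mono_set (hsub σ hσ))
    (fun i k => (hs.integrable_gradient i k).mono_set (hsub σ hσ))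

/-! ### Trial functions as torus states, and scaling -/

section Dilation
variable {X : Type*} [NormedAddCommGroup X] [NormedSpace ℝ X] [MeasureSpace X] [BorelSpace X]
  [FiniteDimensional ℝ X] [(volume : Measure X).IsAddHaarMeasure] {E : Type*}
  [NormedAddCommGroup E] {a : ℝ}

lemma integrableOn_comp_smul (ha : a ≠ 0) {F : X → E} {s : Set X} (hs : MeasurableSet s) :
    IntegrableOn (fun x => F (a • x)) ((fun x => a • x) ⁻¹' s) ↔ IntegrableOn F s := by
  rw [← integrable_indicator_iff hs, ← integrable_indicator_iff (measurable_const_smul a hs),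
    ← integrable_comp_smul_iff volume (s.indicator F) ha]
  rfl

lemma setIntegral_comp_smul_preimage [NormedSpace ℝ E] (F : X → E) {s : Set X} (hs : MeasurableSet s) :
    ∫ x in (fun x => a • x) ⁻¹' s, F (a • x) = |(a ^ Module.finrank ℝ X)⁻¹| • ∫ x in s, F x := by
  rw [← integral_indicator hs, ← integral_indicator (measurable_const_smul a hs),
    ← Measure.integral_comp_smul]
  rfl

lemma locallyIntegrable_comp_smul (ha : a ≠ 0) {F : X → E} (hF : LocallyIntegrable F) :
    LocallyIntegrable fun x => F (a • x) := by
  rw [locallyIntegrable_iff] at hF ⊢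
  intro K hK
  have h1 : K = (fun x => a • x) ⁻¹' ((fun x => a • x) '' K) :=
    (Set.preimage_image_eq _ (smul_right_injective X ha)).symm
  have h2 : IsCompact ((fun x : X => a • x) '' K) := hK.image (continuous_const_smul a)
  rw [h1, integrableOn_comp_smul ha h2.measurableSet]
  exact hF _ h2

lemma HasWeakDirDeriv.comp_smul {f g : X → ℂ} {e : X} (h : HasWeakDirDeriv f g e) (ha : a ≠ 0) :
    HasWeakDirDeriv (fun x => f (a • x)) (fun x => a • g (a • x)) e := by
  refine ⟨locallyIntegrable_comp_smul ha h.locallyIntegrable,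
    (locallyIntegrable_comp_smul ha h.locallyIntegrable_deriv).smul a, fun η hη hc => ?_⟩
  set ζ : X → ℝ := fun y => η (a⁻¹ • y) with hζ
  have hζd : ∀ x, fderiv ℝ ζ (a • x) e = a⁻¹ * fderiv ℝ η x e := by
    intro x
    have h1 : HasFDerivAt η (fderiv ℝ η x) (a⁻¹ • a • x) := by
      rw [inv_smul_smul₀ ha]
      exact (hη.differentiable (by simp) x).hasFDerivAt
    have h2 : HasFDerivAt (fun y : X => a⁻¹ • y) (a⁻¹ • ContinuousLinearMap.id ℝ X) (a • x) :=
      (hasFDerivAt_id _).const_smul a⁻¹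
    have h3 := (h1.comp (a • x) h2).fderiv
    change fderiv ℝ (η ∘ fun y => a⁻¹ • y) (a • x) e = _
    rw [h3]
    simp
  have key := h.integral_eq ζ (hη.comp (contDiff_const_smul a⁻¹))
    (hc.comp_homeomorph (Homeomorph.smulOfNeZero a⁻¹ (inv_ne_zero ha)))
  have k1 := Measure.integral_comp_smul (volume : Measure X) (fun y => fderiv ℝ ζ y e • f y) a
  have k2 := Measure.integral_comp_smul (volume : Measure X) (fun y => ζ y • g y) a
  rw [key, smul_neg, ← k2] at k1
  have hζs : ∀ x, ζ (a • x) = η x := fun x => by simp only [hζ, inv_smul_smul₀ ha]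
  simp only [hζd, hζs] at k1
  calc ∫ x, (fderiv ℝ η x e) • f (a • x) = a • ∫ x, (a⁻¹ * fderiv ℝ η x e) • f (a • x) := by
        rw [← integral_smul]
        refine integral_congr_ae (Eventually.of_forall fun x => ?_)
        simp only [smul_smul]
        rw [mul_inv_cancel_left₀ ha]
    _ = _ := by
        rw [k1, smul_neg, ← integral_smul]
        congr 1
        refine integral_congr_ae (Eventually.of_forall fun x => ?_)
        simp only [smul_comm (η x) a]
end Dilation

section Trial
variable {N : ℕ} {w : R3 → ℝ} {L : ℝ}

lemma sum_Ioi_eq_half (f : Fin N → Fin N → ℝ) (hf : ∀ i j, f i j = f j i) :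
    ∑ i, ∑ j ∈ Finset.Ioi i, f i j = ∑ i, ∑ j ∈ Finset.univ.erase i, 1 / 2 * f i j := by
  have h1 : ∀ i : Fin N, ∑ j ∈ Finset.univ.erase i, 1 / 2 * f i j =
      ∑ j ∈ Finset.Ioi i, 1 / 2 * f i j + ∑ j ∈ Finset.Iio i, 1 / 2 * f i j := by
    intro i
    rw [← Finset.sum_union (Finset.disjoint_left.2 fun j h1 h2 =>
      lt_asymm (Finset.mem_Ioi.1 h1) (Finset.mem_Iio.1 h2))]
    refine Finset.sum_congr ?_ fun _ _ => rfl
    ext j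
    simp only [Finset.mem_erase, Finset.mem_univ, and_true, Finset.mem_union, Finset.mem_Ioi,
      Finset.mem_Iio]
    exact ⟨fun h => (lt_or_gt_of_ne h).symm, fun h => h.elim ne_of_gt ne_of_lt⟩
  have h2 : ∑ i : Fin N, ∑ j ∈ Finset.Iio i, 1 / 2 * f i j =
      ∑ i : Fin N, ∑ j ∈ Finset.Ioi i, 1 / 2 * f i j := by
    rw [Finset.sum_comm' (t' := Finset.univ) (s' := fun j => Finset.Ioi j) (by simp)]
    exact Finset.sum_congr rfl fun i _ => Finset.sum_congr rfl fun j _ => by rw [hf]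
  simp only [h1, Finset.sum_add_distrib, h2]
  rw [← Finset.sum_add_distrib]
  refine Finset.sum_congr rfl fun i _ => ?_
  rw [← Finset.sum_add_distrib]
  exact Finset.sum_congr rfl fun j _ => by ring

lemma totalInteraction_eq (hr : IsRadial w) (hL : 0 < L) (x : Config N) :
    totalInteraction w N L x =
      ∑ i, ∑ j ∈ Finset.univ.erase i, 1 / 2 * w (torusDiff L (x i) (x j)) :=
  sum_Ioi_eq_half (fun i j => w (torusDiff L (x i) (x j))) fun _ _ =>
    hr _ _ (norm_torusDiff_comm hL _ _)

/-- If the interaction is bounded below, the total interaction dominates each pair. -/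
lemma integrable_pair_of_total (hw : Measurable w) (hr : IsRadial w) (hL : 0 < L) {lam : ℝ}
    (hlam : ∀ x, -lam ≤ w x) {ψ : Config N → ℂ} (hψ : Measurable ψ)
    (h2 : IntegrableOn (fun x => ‖ψ x‖ ^ 2) (torusBox N L))
    (ht : IntegrableOn (fun x => totalInteraction w N L x * ‖ψ x‖ ^ 2) (torusBox N L))
    {i j : Fin N} (hij : i ≠ j) :
    IntegrableOn (fun x => w (torusDiff L (x i) (x j)) * ‖ψ x‖ ^ 2) (torusBox N L) := by
  have hδ : Measurable fun x : Config N => torusDiff L (x i) (x j) :=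
    (measurable_torusDiff L).comp (by fun_prop : Measurable fun x : Config N => (x i, x j))
  set K : ℝ := ∑ a : Fin N, ∑ _b ∈ Finset.univ.erase a, 1 / 2 * |lam| with hK
  have hb : IntegrableOn (fun x => 2 * (totalInteraction w N L x * ‖ψ x‖ ^ 2) +
      (2 * K + 2 * |lam|) * ‖ψ x‖ ^ 2) (torusBox N L) := (ht.const_mul 2).add (h2.const_mul _)
  refine Integrable.mono' hb (by fun_prop) (Eventually.of_forall fun x => ?_)
  rw [Real.norm_eq_abs, abs_mul, abs_of_nonneg (by positivity : 0 ≤ ‖ψ x‖ ^ 2), ← mul_assoc,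
    ← add_mul]
  refine mul_le_mul_of_nonneg_right ?_ (by positivity)
  have hl : ∀ y, 0 ≤ w y + |lam| := fun y => by linarith [hlam y, le_abs_self lam]
  have h1 : 1 / 2 * (w (torusDiff L (x i) (x j)) + |lam|) ≤ totalInteraction w N L x + K := by
    rw [totalInteraction_eq hr hL, hK, ← Finset.sum_add_distrib]
    simp only [← Finset.sum_add_distrib, ← mul_add]
    have hn : ∀ a : Fin N, ∀ b ∈ Finset.univ.erase a,
        0 ≤ 1 / 2 * (w (torusDiff L (x a) (x b)) + |lam|) :=
      fun a b _ => mul_nonneg (by norm_num) (hl _)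
    exact (Finset.single_le_sum (hn i) (Finset.mem_erase.2 ⟨hij.symm, Finset.mem_univ j⟩)).trans
      (Finset.single_le_sum (f := fun a => ∑ b ∈ Finset.univ.erase a,
        1 / 2 * (w (torusDiff L (x a) (x b)) + |lam|))
        (fun a _ => Finset.sum_nonneg (hn a)) (Finset.mem_univ i))
  have h2 := hl (torusDiff L (x i) (x j))
  rw [abs_le]
  constructor <;> linarith [abs_nonneg lam]

lemma measurableSet_torusBox (N : ℕ) (L : ℝ) : MeasurableSet (torusBox N L) := by
  rw [torusBox_eq_pi]
  exact MeasurableSet.univ_pi fun _ => measurableSet_cube _ _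

/-- A trial function has a measurable, exactly periodic version with the same energy. -/
lemma IsBoseTrial.exists_torusState (hw : Measurable w) (hr : IsRadial w) (hL : 0 < L) {lam : ℝ}
    (hlam : ∀ x, -lam ≤ w x) {ψ : Config N → ℂ} {G : Fin N → Fin 3 → Config N → ℂ}
    (h : IsBoseTrial w N L ψ G) :
    ∃ φ Γ, IsTorusState w N L φ Γ ∧ ∫ x in torusBox N L, ‖φ x‖ ^ 2 = 1 ∧
      boseEnergy w N L φ Γ = boseEnergy w N L ψ G := by
  rcases isEmpty_or_nonempty (Fin N) with hN | ⟨⟨i₀⟩⟩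
  · have hψ : Measurable ψ := measurable_of_finite ψ
    exact ⟨ψ, G, ⟨hψ, fun i => hN.elim i, h.periodic, fun i => hN.elim i, h.weakGradient,
      h.integrable_sq, h.integrable_gradient, fun i => hN.elim i⟩, h.normalized, rfl⟩
  have hψ := (h.weakGradient i₀ 0).locallyIntegrable.aestronglyMeasurable
  obtain ⟨φ, hφm, hφp, hφ⟩ := exists_periodic_version hψ hL
    fun i k => Eventually.of_forall (h.periodic i k)
  choose Γ hΓm hΓp hΓ using fun i k => exists_periodic_version
    (h.weakGradient i k).locallyIntegrable_deriv.aestronglyMeasurable hL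
    fun j m => (h.weakGradient i k).ae_periodic (h.periodic j m)
  have e1 : (fun x => ‖ψ x‖ ^ 2) =ᵐ[volume.restrict (torusBox N L)] fun x => ‖φ x‖ ^ 2 := by
    filter_upwards [ae_restrict_of_ae hφ] with x hx; rw [hx]
  have e2 : ∀ i k, (fun x => ‖G i k x‖ ^ 2) =ᵐ[volume.restrict (torusBox N L)]
      fun x => ‖Γ i k x‖ ^ 2 := fun i k => by
    filter_upwards [ae_restrict_of_ae (hΓ i k)] with x hx; rw [hx]
  have e3 : (fun x => totalInteraction w N L x * ‖ψ x‖ ^ 2) =ᵐ[volume.restrict (torusBox N L)]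
      fun x => totalInteraction w N L x * ‖φ x‖ ^ 2 := by
    filter_upwards [e1] with x hx; rw [hx]
  have h2 : IntegrableOn (fun x => ‖φ x‖ ^ 2) (torusBox N L) := h.integrable_sq.congr e1
  refine ⟨φ, Γ, ⟨hφm, hΓm, hφp, hΓp, fun i k => (h.weakGradient i k).congr_ae hφ (hΓ i k),
    h2, fun i k => (h.integrable_gradient i k).congr (e2 i k), fun i j hij =>
    integrable_pair_of_total hw hr hL hlam hφm h2 (h.integrable_potential.congr e3) hij⟩, ?_, ?_⟩
  · rw [← h.normalized]
    exact integral_congr_ae e1.symm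
  · refine integral_congr_ae ?_
    filter_upwards [e3, ae_all_iff.2 fun i => ae_all_iff.2 fun k => e2 i k] with x h3 h4
    simp only [h3, h4]

lemma torusDiff_smul {a : ℝ} (ha : 0 < a) (x y : R3) :
    torusDiff L (a • x) (a • y) = a • torusDiff (a⁻¹ * L) x y := by
  ext k
  have : (a * x k - a * y k) / L = (x k - y k) / (a⁻¹ * L) := by
    rw [← mul_sub]; field_simp
  simp only [torusDiff, PiLp.smul_apply, smul_eq_mul, this]
  field_simp

/-- Dilating a torus state by `a` scales the box, the interaction and the energy. -/
lemma IsTorusState.comp_smul {a : ℝ} (ha : 0 < a) {ψ : Config N → ℂ}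
    {G : Fin N → Fin 3 → Config N → ℂ} (h : IsTorusState (scaledPotential a w) N L ψ G) :
    IsTorusState w N (a⁻¹ * L) (fun x => ψ (a • x)) (fun i k x => a • G i k (a • x)) ∧
    ∃ J, 0 < J ∧ ∫ x in torusBox N (a⁻¹ * L), ‖ψ (a • x)‖ ^ 2 =
      J * ∫ x in torusBox N L, ‖ψ x‖ ^ 2 ∧
      boseEnergy w N (a⁻¹ * L) (fun x => ψ (a • x)) (fun i k x => a • G i k (a • x)) =
        J * (a ^ 2 * boseEnergy (scaledPotential a w) N L ψ G) := by
  have ha0 := ha.ne'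
  have hT : torusBox N (a⁻¹ * L) = (fun x : Config N => a • x) ⁻¹' torusBox N L := by
    ext x
    refine forall_congr' fun i => forall_congr' fun k => ?_
    simp only [Set.mem_Ico, Pi.smul_apply, PiLp.smul_apply, smul_eq_mul]
    rw [lt_inv_mul_iff₀ ha, mul_nonneg_iff_of_pos_left ha]
  have hTm := measurableSet_torusBox N L
  have hw : ∀ (x : Config N) i j, w (torusDiff (a⁻¹ * L) (x i) (x j)) =
      a ^ 2 * scaledPotential a w (torusDiff L ((a • x) i) ((a • x) j)) := by
    intro x i j
    rw [scaledPotential, Pi.smul_apply, Pi.smul_apply, torusDiff_smul ha, inv_smul_smul₀ ha0,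
      mul_inv_cancel_left₀ (by positivity)]
  have hper : ∀ (x : Config N) i k, a • (x + (a⁻¹ * L) • particleUnitVec i k) =
      a • x + L • particleUnitVec i k := by
    intro x i k
    rw [smul_add, smul_smul, mul_inv_cancel_left₀ ha0]
  have hsq : ∀ z : ℂ, ‖a • z‖ ^ 2 = a ^ 2 * ‖z‖ ^ 2 := fun z => by
    rw [norm_smul, mul_pow, Real.norm_eq_abs, sq_abs]
  refine ⟨⟨h.measurable.comp (measurable_const_smul a), fun i k =>
    ((h.measurable_deriv i k).comp (measurable_const_smul a)).const_smul a, fun i k x => ?_,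
    fun j m i k x => ?_, fun i k => (h.weakGradient i k).comp_smul ha0, ?_, fun i k => ?_,
    fun i j hij => ?_⟩, |(a ^ Module.finrank ℝ (Config N))⁻¹|, by positivity, ?_, ?_⟩
  · simp only [hper, h.periodic]
  · simp only [hper, h.periodic_deriv]
  · rw [hT]
    exact (integrableOn_comp_smul ha0 hTm (F := fun x => ‖ψ x‖ ^ 2)).2 h.integrable_sq
  · rw [hT]
    simp only [hsq]
    exact Integrable.const_mul ((integrableOn_comp_smul ha0 hTm (F := fun x => ‖G i k x‖ ^ 2)).2
      (h.integrable_gradient i k)) _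
  · rw [hT]
    simp only [hw, mul_assoc]
    exact Integrable.const_mul ((integrableOn_comp_smul ha0 hTm (F := fun x =>
      scaledPotential a w (torusDiff L (x i) (x j)) * ‖ψ x‖ ^ 2)).2
      (h.integrable_potential i j hij)) _
  · rw [hT]
    exact setIntegral_comp_smul_preimage (fun x => ‖ψ x‖ ^ 2) hTm
  · unfold boseEnergy
    rw [← integral_const_mul, ← smul_eq_mul (a := |_|), ← setIntegral_comp_smul_preimage _ hTm, hT]
    refine integral_congr_ae (Eventually.of_forall fun x => ?_)
    simp only [hsq, totalInteraction, hw, ← Finset.mul_sum]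
    ring
end Trial

/-! ### Choice of the length scales -/

/-- The hypotheses on the potential, for any radius `R₀` beyond which `vp + vm` vanishes. -/
lemma isAdmissible_of_bounds {vp vm : R3 → ℝ} {R₀ t c lamM : ℝ} (hvp : Measurable vp)
    (hvm : Measurable vm) (hrp : IsRadial vp) (hrm : IsRadial vm) (hsupp : HasCompactSupport vm)
    (hvp0 : ∀ x, 0 ≤ vp x) (hSL : 1 ≤ scatteringLength (fun x => vp x + vm x)) (hR₀ : 0 < R₀)
    (hlam : 0 < lamM) (ht : 0 < t) (hc : 1 ≤ c) (hv : ∀ x, R₀ < ‖x‖ → vp x + vm x = 0)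
    (hvml : ∀ x, -lamM ≤ vm x)
    (hSt : 0 ≤ scatteringLength (fun x => c * ((vp x + vm x) + t * vm x))) :
    IsAdmissible vp vm R₀ t c lamM := by
  have hset : MeasurableSet {x : R3 | R₀ < ‖x‖} := measurableSet_lt measurable_const measurable_norm
  have hneg : ∀ x, R₀ < ‖x‖ → vm x ≤ 0 := fun x hx => by linarith [hv x hx, hvp0 x]
  have hvmi : IntegrableOn vm {x | R₀ < ‖x‖} := by
    have h1 : IntegrableOn (fun _ : R3 => lamM) (tsupport vm) :=
      integrableOn_const hsupp.measure_lt_top.ne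
    have h2 : Integrable ((tsupport vm).indicator fun _ : R3 => lamM) :=
      (integrable_indicator_iff (isClosed_tsupport vm).measurableSet).2 h1
    refine Integrable.mono' (h2.integrableOn (s := {x | R₀ < ‖x‖})) hvm.aestronglyMeasurable
      ((ae_restrict_iff' hset).2 (Eventually.of_forall fun x hx => ?_))
    by_cases hs : x ∈ tsupport vm
    · rw [Set.indicator_of_mem hs, Real.norm_of_nonpos (hneg x hx)]
      linarith [hvml x]
    · rw [Set.indicator_of_notMem hs, image_eq_zero_of_notMem_tsupport hs, norm_zero]
  refine ⟨⟨fun x y h => by simp only [hrp x y h, hrm x y h], hvp.add hvm, hR₀,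
      fun x hx => (hv x hx).le, ?_⟩,
    ⟨fun x y h => by simp only [hrp x y h, hrm x y h], by fun_prop, hR₀, fun x hx => ?_, ?_⟩,
    hvp, hvm, hSL, hSt, hv, hvp0, hvml, ht, hc, hlam⟩
  · exact (integrableOn_zero (s := {x : R3 | R₀ < ‖x‖})).congr_fun
      (fun x hx => (hv x hx).symm) hset
  · rw [hv x hx, zero_add]
    exact mul_nonpos_of_nonneg_of_nonpos (by linarith)
      (mul_nonpos_of_nonneg_of_nonpos ht.le (hneg x hx))
  · refine IntegrableOn.congr_fun (f := fun x => c * t * vm x) (hvmi.const_mul (c * t))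
      (fun x hx => ?_) hset
    simp only
    rw [hv x hx, zero_add, mul_assoc]

/-- Room for the number of particles near a given one, in terms of `s = R₀ / r₁`. -/
noncomputable def cellRange (s : ℝ) : ℕ := ⌈8 * s⌉₊ + 2

/-- A layout with prescribed scales suits the potential as soon as the constants that multiply
the potential and `lamM` are large. -/
lemma Layout.exists_suits {N : ℕ} {vp vm : R3 → ℝ} {R₀ t c lamM lamP r₁ s ε L ℓ R : ℝ} {M m : ℕ}
    (hv : IsAdmissible vp vm R₀ t c lamM) (hP : ∀ y, ‖y‖ ≤ r₁ → lamP ≤ vp y) (hr₁ : 0 < r₁)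
    (hr : r₁ ≤ R₀) (hs : R₀ / r₁ ≤ s) (hc : 16 * (2 * cellRange s + 1) ^ 3 ≤ c)
    (hlam : 8 * (2 * cellRange s + 1) ^ 3 * lamM ≤ t / (1 + t) * lamP) (hε0 : 0 ≤ ε)
    (hε : ε ≤ 1 / 8) (hℓ : 0 < ℓ) (hL : L = M * ℓ) (hM : 2 ≤ M) (h2R : 2 * R₀ ≤ R)
    (h4R : 4 * R ≤ ℓ) (hm : 0 < m) :
    ∃ S : Layout N, S.L = L ∧ S.ℓ = ℓ ∧ S.R = R ∧ S.R₀ = R₀ ∧ S.M = M ∧ S.m = m ∧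
      S.Suits vp vm t c lamM ε := by
  choose grp hgrp using fun σ : Fin N → Fin 3 → ℤ => exists_isGrouping hm σ
  have hR₀ := hv.core.pos
  have hM' : (2 : ℝ) ≤ M := by exact_mod_cast hM
  have hLℓ : ℓ ≤ L := by rw [hL]; nlinarith
  have hL0 : 0 < L := by linarith
  have hone : (1 : ℝ) ≤ (2 * cellRange s + 1) ^ 3 := one_le_pow₀ (by linarith [(cellRange s).cast_nonneg (α := ℝ)])
  refine ⟨⟨L, ℓ, R, R₀, M, m, 4 * (2 * cellRange s + 1) ^ 3, grp⟩, rfl, rfl, rfl, rfl, rfl, rfl,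
    ⟨hℓ, hL, hM, hR₀, h2R, h4R, hgrp⟩, hv, hε0, hε, by linarith, ?_,
    lamP, r₁, ⌈2 * L / r₁⌉₊, cellRange s, hP, hr, Nat.ceil_pos.2 (by positivity), ?_, ?_, le_rfl,
    hlam⟩
  · push_cast
    linarith
  · simp only
    rw [← div_le_iff₀' hr₁]
    exact Nat.le_ceil _
  · simp only
    have h1 : (⌈2 * L / r₁⌉₊ : ℝ) ≤ 2 * L / r₁ + 1 := (Nat.ceil_lt_add_one (by positivity)).le
    have h2 : 4 * R₀ * ⌈2 * L / r₁⌉₊ / L ≤ 8 * (R₀ / r₁) + 1 := by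
      rw [div_le_iff₀ hL0]
      calc 4 * R₀ * ⌈2 * L / r₁⌉₊ ≤ 4 * R₀ * (2 * L / r₁ + 1) := by gcongr
        _ = 8 * (R₀ / r₁) * L + 4 * R₀ := by ring
        _ ≤ _ := by linarith
    have h3 : (8 * s : ℝ) ≤ ⌈8 * s⌉₊ := Nat.le_ceil _
    simp only [cellRange]
    push_cast
    linarith

/-- With soft range `e ^ (-5)`, boxes of side about `e ^ (-6)` and groups of about `e ^ (-1)`
particles, all relative errors are of order `e`. -/
lemma errors_le {e ℓ R₀ : ℝ} {m : ℕ} (he : 0 < e) (he1 : e ≤ 1 / 3200) (hℓ1 : 1 ≤ ℓ * e ^ 6)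
    (hℓ2 : ℓ * e ^ 6 ≤ 2) (hm : m * e ≤ 259) (h0 : 0 < R₀) (hR : 2 * R₀ ≤ (e ^ 5)⁻¹) :
    groupErr (e ^ 5)⁻¹ ℓ m ≤ 15 * e ∧
    (3 * m / ((e ^ 5)⁻¹ ^ 3 - R₀ ^ 3) + 4 * Real.pi / ℓ ^ 3 * m ^ 2) / (400 * e) *
      (24 * ℓ ^ 2) ≤ 400 * e := by
  have hpi := Real.pi_lt_d2
  have hpi0 := Real.pi_pos
  obtain ⟨y, hy⟩ : ∃ y, y = ℓ * e ^ 6 := ⟨_, rfl⟩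
  obtain ⟨z, hz⟩ : ∃ z, z = m * e := ⟨_, rfl⟩
  rw [← hy] at hℓ1 hℓ2
  rw [← hz] at hm
  have hz0 : 0 ≤ z := hz ▸ by positivity
  have hℓ : ℓ = y / e ^ 6 := by rw [hy]; field_simp
  have hm' : (m : ℝ) = z / e := by rw [hz]; field_simp
  have hy0 : 0 < y := by linarith
  have hy3 : 1 ≤ y ^ 3 := one_le_pow₀ hℓ1
  constructor
  · have e1 : groupErr (e ^ 5)⁻¹ ℓ m = 12 * e / y + z * (32 * Real.pi / 3) * e ^ 2 / y ^ 3 := by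
      rw [groupErr, hℓ, hm']; field_simp
    have h1 : 12 * e / y ≤ 12 * e := div_le_self (by positivity) hℓ1
    have h2 : z * (32 * Real.pi / 3) * e ^ 2 / y ^ 3 ≤ z * (32 * Real.pi / 3) * e ^ 2 :=
      div_le_self (by positivity) hy3
    have h3 : z * (32 * Real.pi / 3) * e ^ 2 ≤ 259 * (32 * 3.15 / 3) * e ^ 2 := by gcongr
    rw [e1]
    nlinarith
  · have hR3 : 7 / 8 * (e ^ 5)⁻¹ ^ 3 ≤ (e ^ 5)⁻¹ ^ 3 - R₀ ^ 3 := by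
      have : (2 * R₀) ^ 3 ≤ (e ^ 5)⁻¹ ^ 3 := by gcongr
      linarith
    have h1 : 3 * m / ((e ^ 5)⁻¹ ^ 3 - R₀ ^ 3) ≤ 888 * e ^ 14 := by
      calc 3 * m / ((e ^ 5)⁻¹ ^ 3 - R₀ ^ 3) ≤ 3 * m / (7 / 8 * (e ^ 5)⁻¹ ^ 3) := by gcongr
        _ = 24 / 7 * z * e ^ 14 := by rw [hm']; field_simp; ring
        _ ≤ 24 / 7 * 259 * e ^ 14 := by gcongr
        _ = _ := by norm_num
    have h2 : 4 * Real.pi / ℓ ^ 3 * m ^ 2 ≤ 850000 * e ^ 16 / y ^ 3 := by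
      calc 4 * Real.pi / ℓ ^ 3 * m ^ 2 = 4 * Real.pi * z ^ 2 * e ^ 16 / y ^ 3 := by
            rw [hm', hℓ]; field_simp
        _ ≤ 4 * 3.15 * 259 ^ 2 * e ^ 16 / y ^ 3 := by gcongr
        _ ≤ _ := by gcongr; norm_num
    calc _ ≤ (888 * e ^ 14 + 850000 * e ^ 16 / y ^ 3) / (400 * e) * (24 * ℓ ^ 2) := by gcongr
      _ = (888 * y ^ 2 + 850000 * e ^ 2 / y) * 24 / 400 * e := by rw [hℓ]; field_simp
      _ ≤ (888 * 2 ^ 2 + 850000 * (1 / 3200) ^ 2 / 1) * 24 / 400 * e := by gcongr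
      _ ≤ 400 * e := by gcongr; norm_num

lemma one_sub_le_mul {x y : ℝ} (hx0 : 0 ≤ x) (hy0 : 0 ≤ y) : 1 - (x + y) ≤ (1 - x) * (1 - y) := by
  nlinarith

lemma density_scaling {a L : ℝ} (p n : ℝ) (ha : a ≠ 0) (hL : L ≠ 0) :
    4 * p * (n / (a⁻¹ * L) ^ 3) * n = a ^ 2 * (4 * p * a * (n / L ^ 3) * n) := by
  field_simp

set_option maxHeartbeats 800000 in
/-- The energy of `N` particles in a large box. -/
theorem boseEnergy_ge {N : ℕ} {vp vm : R3 → ℝ} {R₀ t c lamM lamP r₁ s e L a : ℝ}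
    (hrp : IsRadial vp) (hrm : IsRadial vm)
    (hv : IsAdmissible vp vm R₀ t c lamM) (hP : ∀ y, ‖y‖ ≤ r₁ → lamP ≤ vp y) (hr₁ : 0 < r₁)
    (hr : r₁ ≤ R₀) (hs : R₀ / r₁ ≤ s) (hc : 16 * (2 * cellRange s + 1) ^ 3 ≤ c)
    (hlam : 8 * (2 * cellRange s + 1) ^ 3 * lamM ≤ t / (1 + t) * lamP)
    (he : 0 < e) (he1 : e ≤ 1 / 3200) (heR : 2 * R₀ * e ≤ 1) (ha : 0 < a) (hL : 0 < L)
    (hL2 : 2 ≤ a⁻¹ * L * e ^ 6) (hρ1 : e ^ 17 / 2 ≤ N / (a⁻¹ * L) ^ 3)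
    (hρ2 : N / (a⁻¹ * L) ^ 3 ≤ 2 * e ^ 17)
    {ψ : Config N → ℂ} {G : Fin N → Fin 3 → Config N → ℂ}
    (h : IsBoseTrial (scaledPotential a fun x => vp x + vm x) N L ψ G) :
    (1 - 1700 * e) * (4 * Real.pi * a * (N / L ^ 3) * N) ≤
      boseEnergy (scaledPotential a fun x => vp x + vm x) N L ψ G := by
  have hR₀ := hv.core.pos
  have hw : Measurable fun x => vp x + vm x := hv.measurable_pos.add hv.measurable_neg
  have hrw : IsRadial fun x => vp x + vm x := fun x y h => by simp only [hrp x y h, hrm x y h]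
  obtain ⟨φ, Γ, hφ, hn, hE⟩ := h.exists_torusState
    (w := scaledPotential a fun x => vp x + vm x) (lam := (a ^ 2)⁻¹ * lamM)
    ((hw.comp (measurable_const_smul a⁻¹)).const_mul _)
    (fun x y hxy => by
      simp only [scaledPotential]
      exact congrArg _ (hrw (a⁻¹ • x) (a⁻¹ • y) (by rw [norm_smul, norm_smul, hxy]))) hL
    (fun x => by
      rw [scaledPotential, ← mul_neg]
      exact mul_le_mul_of_nonneg_left (by linarith [hv.lower (a⁻¹ • x), hv.nonneg (a⁻¹ • x)])
        (by positivity))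
  obtain ⟨hs1, J, hJ, hJn, hJE⟩ := hφ.comp_smul ha
  rw [hn, mul_one] at hJn
  rw [← hE]
  set L' := a⁻¹ * L with hL'
  have hL'0 : 0 < L' := by positivity
  -- the number of boxes in each direction
  set M := ⌊L' * e ^ 6⌋₊ with hM
  have hM2 : 2 ≤ M := Nat.le_floor (by exact_mod_cast hL2)
  have hM2' : (2 : ℝ) ≤ M := by exact_mod_cast hM2
  have hM0 : (0 : ℝ) < M := by linarith
  have hMle : (M : ℝ) ≤ L' * e ^ 6 := Nat.floor_le (by positivity)
  have hMlt : L' * e ^ 6 < M + 1 := Nat.lt_floor_add_one _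
  set ℓ := L' / M with hℓ
  have hLM : L' = M * ℓ := by rw [hℓ]; field_simp
  have hℓ0 : 0 < ℓ := by positivity
  have hℓe : ℓ * e ^ 6 = L' * e ^ 6 / M := by rw [hℓ]; ring
  have hℓ1 : 1 ≤ ℓ * e ^ 6 := by rw [hℓe, le_div_iff₀ hM0]; linarith
  have hℓ2 : ℓ * e ^ 6 ≤ 2 := by rw [hℓe, div_le_iff₀ hM0]; linarith
  -- the mean number of particles in a box
  set k := (N : ℝ) / M ^ 3 with hk
  have hkM : k * M ^ 3 = N := by rw [hk]; field_simp
  have hkd : k = N / L' ^ 3 * ℓ ^ 3 := by rw [hk, hℓ]; field_simp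
  set y := ℓ * e ^ 6 with hy
  have hk1 : 1 ≤ 2 * (k * e) := by
    calc (1 : ℝ) ≤ y ^ 3 := one_le_pow₀ hℓ1
      _ = 2 * (e ^ 17 / 2 * ℓ ^ 3 * e) := by rw [hy]; ring
      _ ≤ 2 * (N / L' ^ 3 * ℓ ^ 3 * e) := by gcongr
      _ = _ := by rw [hkd]
  have hk2 : k * e ≤ 16 := by
    calc k * e = N / L' ^ 3 * ℓ ^ 3 * e := by rw [hkd]
      _ ≤ 2 * e ^ 17 * ℓ ^ 3 * e := by gcongr
      _ = 2 * y ^ 3 := by rw [hy]; ring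
      _ ≤ 2 * 2 ^ 3 := by gcongr
      _ = 16 := by norm_num
  have hk0 : 0 < k := by
    by_contra hneg
    have := mul_nonpos_of_nonpos_of_nonneg (not_lt.1 hneg) he.le
    linarith
  set m := ⌈258 / e⌉₊ with hm
  have hm1 : 258 / e ≤ m := Nat.le_ceil _
  have hm2 : (m : ℝ) < 258 / e + 1 := Nat.ceil_lt_add_one (by positivity)
  have hm0 : 0 < m := Nat.ceil_pos.2 (by positivity)
  have hme : m * e ≤ 259 := by
    have := mul_le_mul_of_nonneg_right hm2.le he.le
    rw [add_mul, div_mul_cancel₀ _ he.ne'] at this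
    linarith
  have hmk : 16 * k + 2 ≤ m := by
    refine le_trans ?_ hm1
    rw [le_div_iff₀ he]
    linarith
  have hR : 2 * R₀ ≤ (e ^ 5)⁻¹ := by
    rw [← one_div, le_div_iff₀ (by positivity)]
    calc 2 * R₀ * e ^ 5 = 2 * R₀ * e * e ^ 4 := by ring
      _ ≤ 1 * 1 := by gcongr; exact pow_le_one₀ he.le (by linarith)
      _ = 1 := by ring
  have h4R : 4 * (e ^ 5)⁻¹ ≤ ℓ := by
    rw [← div_eq_mul_inv, div_le_iff₀ (by positivity)]
    have : 1 ≤ ℓ * e ^ 5 * e := by linarith [show ℓ * e ^ 5 * e = y by rw [hy]; ring]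
    have h5 : 0 ≤ ℓ * e ^ 5 := by positivity
    nlinarith
  obtain ⟨herr, hkin⟩ := errors_le he he1 hℓ1 hℓ2 hme hR₀ hR
  obtain ⟨S, s1, s2, s3, s4, s5, s6, hSv⟩ := Layout.exists_suits (N := N) (ε := 400 * e) hv hP hr₁ hr
    hs hc hlam (by positivity) (by linarith) hℓ0 hLM hM2 hR h4R hm0
  have hs1' : IsTorusState (fun x => vp x + vm x) N S.L (fun x => φ (a • x))
      (fun i k x => a • Γ i k (a • x)) := by rw [s1]; exact hs1
  have key := hs1'.energy_ge hSv (η := 400 * e) (k := k) (by positivity) (by linarith)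
    (by rw [s2, s3, s6]; linarith) (by rw [s2, s3, s4, s6]; exact hkin) (by rw [s5]; exact hkM)
    hk0.le (by rw [s6]; exact hmk)
  have hEe : ∫ x in torusBox N S.L, ((∑ i, ∑ k, ‖a • Γ i k (a • x)‖ ^ 2) +
      ∑ i, ∑ j ∈ Finset.univ.erase i, 1 / 2 * ((vp (torusDiff S.L (x i) (x j)) +
        vm (torusDiff S.L (x i) (x j))) * ‖φ (a • x)‖ ^ 2)) =
      boseEnergy (fun x => vp x + vm x) N L' (fun x => φ (a • x))
        (fun i k x => a • Γ i k (a • x)) := by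
    unfold boseEnergy
    rw [s1]
    refine integral_congr_ae (Eventually.of_forall fun x => ?_)
    simp only [totalInteraction_eq hrw hL'0, Finset.sum_mul, mul_assoc]
  rw [hEe, hJE, s1, hJn, s2, s3, s6] at key
  set E := boseEnergy (scaledPotential a fun x => vp x + vm x) N L φ Γ
  -- cancel the normalization and collect the errors
  have hd0 : 0 ≤ 4 * Real.pi * (N / L' ^ 3) * N := by positivity
  have hkk : 4 * Real.pi / ℓ ^ 3 * (k * N) = 4 * Real.pi * (N / L' ^ 3) * N := by
    rw [hkd]; field_simp
  have hk1' : (1 - 2 * e) * k ≤ k - 1 := by linarith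
  have hkey : (1 - 1700 * e) * (4 * Real.pi * (N / L' ^ 3) * N) * J ≤ a ^ 2 * E * J := by
    calc (1 - 1700 * e) * (4 * Real.pi * (N / L' ^ 3) * N) * J
        ≤ ((1 - 800 * e) * (1 - 15 * e) * ((1 - 800 * e) * (1 - 2 * e))) *
          (4 * Real.pi * (N / L' ^ 3) * N) * J := by
          refine mul_le_mul_of_nonneg_right (mul_le_mul_of_nonneg_right ?_ hd0) hJ.le
          have h1 := one_sub_le_mul (x := 800 * e) (y := 15 * e) (by positivity) (by positivity)
          have h2 := one_sub_le_mul (x := 800 * e) (y := 2 * e) (by positivity) (by positivity)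
          have h3 := one_sub_le_mul (x := 815 * e) (y := 802 * e) (by positivity) (by positivity)
          calc 1 - 1700 * e ≤ (1 - 815 * e) * (1 - 802 * e) := by linarith
            _ ≤ _ := mul_le_mul (by linarith) (by linarith) (by linarith)
              (mul_nonneg (by linarith) (by linarith))
      _ = (1 - 800 * e) * (4 * Real.pi / ℓ ^ 3 * (1 - 15 * e)) *
          ((1 - 800 * e) * ((1 - 2 * e) * k * N)) * J := by rw [← hkk]; ring
      _ ≤ (1 - 2 * (400 * e)) * (4 * Real.pi / ℓ ^ 3 * (1 - groupErr (e ^ 5)⁻¹ ℓ m)) *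
          ((1 - 2 * (400 * e)) * ((k - 1) * N)) * J := by
          have e800 : 1 - 2 * (400 * e) = 1 - 800 * e := by ring
          rw [e800]
          have n1 : 0 ≤ 1 - 800 * e := by linarith
          have n2 : 0 ≤ 1 - groupErr (e ^ 5)⁻¹ ℓ m := by linarith
          have n3 : 0 ≤ 1 - 2 * e := by linarith
          gcongr
      _ ≤ J * (a ^ 2 * E) := key
      _ = _ := by ring
  have hkey' := le_of_mul_le_mul_right hkey hJ
  have hfin : 4 * Real.pi * (N / L' ^ 3) * N = a ^ 2 * (4 * Real.pi * a * (N / L ^ 3) * N) :=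
    density_scaling _ _ ha.ne' hL.ne'
  rw [hfin, mul_left_comm] at hkey'
  exact le_of_mul_le_mul_left hkey' (by positivity)

/-! ### The thermodynamic limit -/

/-- In the thermodynamic limit the side length tends to infinity; eventually all requirements on
the size of the box and on the density hold. -/
lemma eventually_large_box {L : ℕ → ℝ} {ρ a e : ℝ} (ha : 0 < a) (he : 0 < e)
    (hρ : e ^ 17 = a ^ 3 * ρ)
    (hL : Tendsto (fun N : ℕ => (N : ℝ) / (L N) ^ 3) atTop (𝓝 ρ)) :
    ∀ᶠ N : ℕ in atTop, 0 < N ∧ 0 < L N ∧ 2 ≤ a⁻¹ * L N * e ^ 6 ∧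
      e ^ 17 / 2 ≤ N / (a⁻¹ * L N) ^ 3 ∧ N / (a⁻¹ * L N) ^ 3 ≤ 2 * e ^ 17 := by
  have he17 : 0 < e ^ 17 := by positivity
  have hd : Tendsto (fun N : ℕ => (N : ℝ) / (a⁻¹ * L N) ^ 3) atTop (𝓝 (e ^ 17)) := by
    rw [hρ]
    refine (hL.const_mul (a ^ 3)).congr fun N => ?_
    rw [mul_pow, inv_pow, div_mul_eq_div_div_swap, div_inv_eq_mul, mul_comm]
  filter_upwards [hd.eventually (eventually_ge_nhds (half_lt_self he17)),
    hd.eventually (eventually_le_nhds (by linarith : e ^ 17 < 2 * e ^ 17)),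
    eventually_gt_atTop 0, (tendsto_natCast_atTop_atTop (R := ℝ)).eventually_ge_atTop
      (2 * e ^ 17 * (2 / e ^ 6) ^ 3)] with N h1 h2 h3 h4
  have hN : (0 : ℝ) < N := by exact_mod_cast h3
  have hq : 0 < (N : ℝ) / (a⁻¹ * L N) ^ 3 := by linarith
  have hL3 : 0 < (a⁻¹ * L N) ^ 3 := by
    by_contra hneg
    exact absurd (div_nonpos_of_nonneg_of_nonpos hN.le (not_lt.1 hneg)) (not_le.2 hq)
  have hL1 : 0 < a⁻¹ * L N := by
    by_contra hneg
    exact absurd hL3 (not_lt.2 (Odd.pow_nonpos (by decide) (not_lt.1 hneg)))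
  refine ⟨h3, pos_of_mul_pos_right hL1 (inv_pos.2 ha).le, ?_, h1, h2⟩
  rw [div_le_iff₀ hL3] at h2
  have h5 : (2 / e ^ 6) ^ 3 ≤ (a⁻¹ * L N) ^ 3 :=
    le_of_mul_le_mul_left (h4.trans h2) (by positivity)
  have h6 := le_of_pow_le_pow_left₀ (by norm_num) hL1.le h5
  rwa [div_le_iff₀ (by positivity)] at h6

theorem theorem2 :
    ∃ c₁ c₂ : ℝ → ℝ, (∀ s, 0 < s → 1 < c₁ s ∧ 1 < c₂ s) ∧
    ∀ (vp vm : R3 → ℝ),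
      Measurable vp → Measurable vm → IsRadial vp → IsRadial vm → HasCompactSupport vm →
      (∀ x, 0 ≤ vp x) →
      scatteringLength (fun x => vp x + vm x) = 1 →
    ∃ (C : ℝ) (δ : ℝ → ℝ), (∀ t, 0 < t → 0 < δ t) ∧
    ∀ (R₀ r₁ lamP lamM t : ℝ),
      0 < R₀ → 0 < r₁ → 0 < lamP → 0 < lamM → 0 < t →
      (∀ x, R₀ < ‖x‖ → vp x + vm x = 0) →
      (∀ x, -lamM ≤ vm x) →
      (∀ x, ‖x‖ ≤ r₁ → lamP ≤ vp x) →
      0 ≤ scatteringLength (fun x => c₁ (R₀ / r₁) * ((vp x + vm x) + t * vm x)) →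
      (1 + t⁻¹) * c₂ (R₀ / r₁) * lamM ≤ lamP →
    ∀ (a ρ : ℝ), 0 < a → 0 < ρ → 4 * Real.pi / 3 * (a ^ 3 * ρ) < δ t →
    ∀ L : ℕ → ℝ, Tendsto (fun N : ℕ => (N : ℝ) / (L N) ^ 3) atTop (𝓝 ρ) →
      ((1 - C * (a ^ 3 * ρ) ^ ((1 : ℝ) / 17) : ℝ) : EReal) ≤
        liminf (fun N : ℕ =>
          groundStateEnergy (scaledPotential a (fun x => vp x + vm x)) N (L N) /
            ((4 * Real.pi * a * ρ * (N : ℝ) : ℝ) : EReal)) atTop := by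
  have hone : ∀ s, (1 : ℝ) ≤ (2 * cellRange s + 1) ^ 3 := fun s =>
    one_le_pow₀ (by linarith [(cellRange s).cast_nonneg (α := ℝ)])
  refine ⟨fun s => 16 * (2 * cellRange s + 1) ^ 3, fun s => 8 * (2 * cellRange s + 1) ^ 3,
    fun s _ => ⟨by linarith [hone s], by linarith [hone s]⟩,
    fun vp vm hvp hvm hrp hrm hsupp hvp0 hSL => ?_⟩
  by_cases hex : ∃ Rv : ℝ, 0 < Rv ∧ ∀ x, Rv < ‖x‖ → vp x + vm x = 0
  swap
  · exact ⟨0, fun _ => 1, fun _ _ => one_pos, fun R₀ r₁ lamP lamM t hR₀ _ _ _ _ hv =>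
      absurd ⟨R₀, hR₀, hv⟩ hex⟩
  -- `R₀` may be arbitrarily large, so the smallness of the density refers to a fixed radius
  obtain ⟨Rv, hRv, hvv⟩ := hex
  refine ⟨1700, fun _ => (min (1 / 3200) (1 / (2 * Rv))) ^ 17, fun _ _ => by positivity, ?_⟩
  intro R₀ r₁ lamP lamM t hR₀ hr₁ hlP hlM ht hv hvml hP hSt hlam a ρ ha hρ hδ L hL
  set D : ℝ := (2 * cellRange (R₀ / r₁) + 1) ^ 3 with hD
  have hD1 : 1 ≤ D := hone _
  have hR : 0 < min R₀ Rv := lt_min hR₀ hRv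
  have hadm : IsAdmissible vp vm (min R₀ Rv) t (16 * D) lamM :=
    isAdmissible_of_bounds hvp hvm hrp hrm hsupp hvp0 hSL.ge hR hlM ht (by linarith)
      (fun x hx => (min_lt_iff.1 hx).elim (hv x) (hvv x)) hvml hSt
  have hlam' : 8 * D * lamM ≤ t / (1 + t) * lamP := by
    have := mul_le_mul_of_nonneg_left hlam (by positivity : 0 ≤ t / (1 + t))
    refine le_trans (le_of_eq ?_) this
    simp only [← hD]
    field_simp
    ring
  -- the repulsive core lies inside the range
  have hr : r₁ ≤ min R₀ Rv := by
    by_contra hlt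
    rw [not_le] at hlt
    have hx : ‖EuclideanSpace.single (0 : Fin 3) r₁‖ = r₁ := by
      simp [abs_of_pos hr₁]
    have h1 := hadm.eq_zero (EuclideanSpace.single (0 : Fin 3) r₁) (by rw [hx]; exact hlt)
    have h2 := hP _ hx.le
    have h3 := hvml (EuclideanSpace.single (0 : Fin 3) r₁)
    have h4 : t / (1 + t) * lamP ≤ lamP :=
      mul_le_of_le_one_left hlP.le ((div_le_one (by positivity)).2 (by linarith))
    have h5 : 8 * lamM ≤ 8 * D * lamM := mul_le_mul_of_nonneg_right (by linarith) hlM.le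
    linarith
  have hρ' : 0 < a ^ 3 * ρ := by positivity
  set e := (a ^ 3 * ρ) ^ ((1 : ℝ) / 17) with he
  have he0 : 0 < e := Real.rpow_pos_of_pos hρ' _
  have he17 : e ^ 17 = a ^ 3 * ρ := by
    rw [he, ← Real.rpow_natCast, ← Real.rpow_mul hρ'.le]
    norm_num
  have hesmall : e < min (1 / 3200) (1 / (2 * Rv)) := by
    refine lt_of_pow_lt_pow_left₀ 17 (by positivity) (lt_of_le_of_lt ?_ hδ)
    rw [he17]
    exact le_mul_of_one_le_left hρ'.le (by linarith [Real.pi_gt_three])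
  have he1 := (hesmall.trans_le (min_le_left _ _)).le
  have he2 : 2 * min R₀ Rv * e ≤ 1 := by
    have h1 := (hesmall.trans_le (min_le_right _ _)).le
    rw [le_div_iff₀ (by positivity)] at h1
    have h2 := mul_le_mul_of_nonneg_right (min_le_right R₀ Rv) he0.le
    linarith
  have hlim : Tendsto (fun N : ℕ => (((1 - 1700 * e) * ((N / (L N) ^ 3) / ρ) : ℝ) : EReal)) atTop
      (𝓝 ((1 - 1700 * e : ℝ) : EReal)) := by
    refine continuous_coe_real_ereal.continuousAt.tendsto.comp ?_
    have := (hL.div_const ρ).const_mul (1 - 1700 * e)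
    rwa [div_self hρ.ne', mul_one] at this
  rw [← hlim.liminf_eq]
  refine liminf_le_liminf ?_
  filter_upwards [eventually_large_box ha he0 he17 hL] with N hN
  obtain ⟨hN0, hLN, h1, h2, h3⟩ := hN
  have hN0' : (0 : ℝ) < N := by exact_mod_cast hN0
  rw [EReal.le_div_iff_mul_le (by exact_mod_cast (by positivity : 0 < 4 * Real.pi * a * ρ * N))
    (EReal.coe_ne_top _), ← EReal.coe_mul]
  refine le_iInf fun ψ => le_iInf fun G => le_iInf fun h => EReal.coe_le_coe_iff.2 ?_
  have hmin : min R₀ Rv / r₁ ≤ R₀ / r₁ := div_le_div_of_nonneg_right (min_le_left _ _) hr₁.le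
  have := boseEnergy_ge hrp hrm hadm hP hr₁ hr hmin le_rfl hlam' he0 he1 he2 ha hLN h1 h2 h3 h
  refine le_trans (le_of_eq ?_) this
  field_simp
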